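/- Let $n\ge 0$ and $m\ge 1$ be integers, let $q\in\mathbb C^\times$ be not a root of unity, fix a value of $\log q$ and put $q^a=e^{a\log q}$, $[a]=q^a-q^{-a}$. Let $x,z\in\mathbb C^{n+1}$, $(x,z)=\sum_i x_iz_i$, let $e_1,\dots,e_{n+1}$ be the standard basis and $(T^vF)(z)=F(z+v)$. Put $$R_+=\{e_i-e_j\mid 1\le i<j\le n\}\cup\{e_i-\sqrt m\,e_{n+1}\mid 1\le i\le n\},$$ with multiplicities $m_\alpha=m$ for $\alpha=e_i-e_j$ and $m_\alpha=1$ for $\alpha=e_i-\sqrt m\,e_{n+1}$. Let $P=\mathbb Ze_1\oplus\dots\oplus\mathbb Ze_n\oplus\sqrt m\,\mathbb Ze_{n+1}$, $\rho=\frac12\sum_{\alpha\in R_+}m_\alpha\alpha$ and $\mathcal N=\{-\rho+\sum_{\alpha\in R_+}l_\alpha\alpha\mid 0\le l_\alpha\le m_\alpha\}$ (with real $l_\alpha$). A *polynomial* is a finite sum $f(z)=\sum_{\nu\in P}f_\nu q^{2(\nu,z)}$. A function of $z$ is *quasi-invariant* if * $f(z+se_i)=f(z+se_j)$ whenever $q^{2z_i}=q^{2z_j}$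 $\;(1\le s\le m,\ 1\le i<j\le n)$, and * $f(z+e_i)=f(z+\sqrt m\,e_{n+1})$ whenever $q^{1-m+2z_i}=q^{2\sqrt m z_{n+1}}$ $\;(1\le i\le n)$. Let $\widetilde{\mathfrak R}$ be the ring of quasi-invariant polynomials. Let $\widetilde D=\sum_{i=1}^n\widetilde a_i(z)T^{e_i}+\widetilde a_{n+1}(z)T^{\sqrt m e_{n+1}}$ with $$\widetilde a_i(z)=\frac{[z_i-\sqrt mz_{n+1}-\frac{m+1}2]}{[z_i-\sqrt mz_{n+1}-\frac{m-1}2]}\prod_{1\le j\le n,\,j\ne i}\frac{[z_i-z_j-m]}{[z_i-z_j]},\qquad \widetilde a_{n+1}(z)=\frac{[1]}{[m]}\prod_{j=1}^n\frac{[\sqrt mz_{n+1}-z_j-\frac{m+1}2]}{[\sqrt mz_{n+1}-z_j+\frac{m-1}2]},$$ and let $$\mathfrak m(x)=\sum_{i=1}^nq^{2x_i}+\frac{[1]}{[m]}q^{2\sqrt mx_{n+1}},\qquad Q(z)=q^{2(\rho,z)}\prod_{\alpha\in R_+}\prod_{j=1}^{m_\alpha}[(\alpha,z+\tfrac12j\alpha)]\,[(\alpha,z-\tfrac12j\alpha)].$$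 A *Baker–Akhiezer (BA) function* is a function $\psi(x,z)=q^{2(x,z)}\sum_{\nu\in\mathcal N\cap(\rho+P)}\psi_\nu(x)q^{2(\nu,z)}$ that is quasi-invariant in $z$ for every $x$; it is *normalized* if $\psi_\rho(x)=\prod_{\alpha\in R_+}\prod_{j=1}^{m_\alpha}[(\alpha,\frac12j\alpha-x)]$. "For generic $x$" means: off the zero set of some nonzero polynomial in $x$. A difference operator in $x$ on $P$ is a finite sum $\sum_{\nu\in P}d_\nu(x)T^\nu$ whose coefficients are quotients of polynomials; equalities between such operators, and their action on functions, are understood for generic $x$. 1. $\widetilde D(\widetilde{\mathfrak R})\subseteq\widetilde{\mathfrak R}$: for every $f\in\widetilde{\mathfrak R}$ the function $\widetilde Df$ agrees, off the poles of the coefficients of $\widetilde D$, with an element of $\widetilde{\mathfrak R}$. 2. Define $$\psi=\prod_\nu\bigl(\widetilde D-\mathfrak m(x+\nu)\bigr)\bigl[q^{2(x,z)}Q(z)\bigr],$$ where $\widetilde D$ acts in $z$ and the product is over all distinct $\nu\ne0$ of the form $\nu=\sum_{\alpha\in R_+}l_\alpha\alpha$ with $l_\alpha\in\{0,\dots,m_\alpha\}$.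 Then $\psi$ (extended from the points $z$ none of whose translates $z+\mu$, $\mu\in P$, is a pole of the coefficients of $\widetilde D$) is a BA function; its coefficient $\psi_{-\rho}(x)$ equals $\prod_\nu(\mathfrak m(x)-\mathfrak m(x+\nu))$ and is not identically zero; and $\widetilde D\psi=\mathfrak m(x)\psi$, with $\widetilde D$ acting in $z$, off the poles of the coefficients of $\widetilde D$. 3. There is a normalized BA function $\Psi$, obtained by renormalizing $\psi$: $\psi_\rho(x)\Psi(x,z)=\Psi_\rho(x)\psi(x,z)$ for all $x,z$. Every normalized BA function coincides with $\Psi$ for generic $x$ and all $z$. Moreover $\Psi(x,z)=\Psi(z,x)$ for all $x,z$. 4. For each $f\in\widetilde{\mathfrak R}$ there is a difference operator $D_f$ in $x$ on $P$, unique for given $f$, such that $D_f\Psi=f(z)\Psi$. All these operators commute. Finally $\mathfrak m\in\widetilde{\mathfrak R}$, and $D_{\mathfrak m}=\widetilde D$, acting in $x$. -/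

import Mathlib

noncomputable section

namespace DeformedMR

/-! ### q-powers, vectors, exponential sums

`q ∈ ℂ^×` is given through a fixed value `h` of `log q`, so that `q ^ a = exp (h * a)` for `a ∈ ℂ`.
The variables `x, z` range over `ℂ^{n+1}`; roots, weights and shifts are vectors of `ℝ^{n+1}`.
The coordinate `Fin.last n` is the `(n+1)`-st one, and `Fin.castSucc i`, `i : Fin n`, are the first
`n` coordinates. -/

/-- `q ^ a = exp (a log q)`, with `h = log q`. -/
def qpow (h a : ℂ) : ℂ := Complex.exp (h * a)

/-- The `q`-number `[a] = q ^ a - q ^ (-a)`. -/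
def qnum (h a : ℂ) : ℂ := qpow h a - qpow h (-a)

/-- A real vector viewed as a complex one. -/
def cvec {n : ℕ} (ν : Fin (n + 1) → ℝ) : Fin (n + 1) → ℂ := fun i => (ν i : ℂ)

/-- The (complexified) standard scalar product `(x, z) = ∑ xᵢ zᵢ`, without conjugation. -/
def pair {n : ℕ} (x z : Fin (n + 1) → ℂ) : ℂ := ∑ i, x i * z i

/-- The finite exponential sum `∑_ν c_ν q^{2(ν, z)}`. -/
def expSum {n : ℕ} (h : ℂ) (c : (Fin (n + 1) → ℝ) →₀ ℂ) (z : Fin (n + 1) → ℂ) : ℂ :=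
  c.sum fun ν a => a * qpow h (2 * pair (cvec ν) z)

/-! ### The deformed root system `A_n(m)` -/

/-- `e_i` for the first `n` coordinates, and `√m e_{n+1}` for the last one. -/
def basisVec {n : ℕ} (m : ℕ) (i : Fin (n + 1)) : Fin (n + 1) → ℝ :=
  Pi.single i (if i = Fin.last n then Real.sqrt m else 1)

/-- Labels of the positive roots: pairs `i < j` in `{1, …, n+1}`. -/
abbrev PosRoot (n : ℕ) : Type := {p : Fin (n + 1) × Fin (n + 1) // p.1 < p.2}

/-- The positive root with label `i < j`: `e_i - e_j` if `j ≤ n`, and `e_i - √m e_{n+1}` if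
`j = n + 1`. -/
def root {n : ℕ} (m : ℕ) (α : PosRoot n) : Fin (n + 1) → ℝ :=
  basisVec m α.1.1 - basisVec m α.1.2

/-- Multiplicities: `m` on the roots `e_i - e_j`, and `1` on the roots `e_i - √m e_{n+1}`. -/
def mult {n : ℕ} (m : ℕ) (α : PosRoot n) : ℕ :=
  if α.1.2 = Fin.last n then 1 else m

/-- `P = ℤ e_1 ⊕ ⋯ ⊕ ℤ e_n ⊕ √m ℤ e_{n+1}`. -/
def weightLattice (n m : ℕ) : AddSubgroup (Fin (n + 1) → ℝ) :=
  AddSubgroup.closure (Set.range (basisVec m))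

/-- `ρ = ½ ∑_{α > 0} m_α α`. -/
def rho (n m : ℕ) : Fin (n + 1) → ℝ :=
  (1 / 2 : ℝ) • ∑ α : PosRoot n, (mult m α : ℝ) • root m α

/-- The polytope `𝒩 = {-ρ + ∑_{α > 0} l_α α ∣ 0 ≤ l_α ≤ m_α}` (real `l_α`). -/
def polytope (n m : ℕ) : Set (Fin (n + 1) → ℝ) :=
  {ν | ∃ l : PosRoot n → ℝ, (∀ α, 0 ≤ l α ∧ l α ≤ mult m α) ∧
    ν = -rho n m + ∑ α, l α • root m α}

/-- The set of all distinct `ν ≠ 0` of the form `ν = ∑_{α > 0} l_α α` with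
`l_α ∈ {0, 1, …, m_α}`. -/
def shiftSet (n m : ℕ) : Finset (Fin (n + 1) → ℝ) :=
  open Classical in
  ((Fintype.piFinset fun α : PosRoot n => Finset.range (mult m α + 1)).image
    fun l => ∑ α, (l α : ℝ) • root m α).erase 0

/-! ### Polynomials and the ring of quasi-invariants -/

lemma qpow_add (h a b : ℂ) : qpow h (a + b) = qpow h a * qpow h b := by
  simp [qpow, mul_add, Complex.exp_add]

lemma pair_add {n : ℕ} (x y z : Fin (n + 1) → ℂ) : pair (x + y) z = pair x z + pair y z := by
  simp [pair, add_mul, Finset.sum_add_distrib]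

lemma cvec_add {n : ℕ} (μ ν : Fin (n + 1) → ℝ) : cvec (μ + ν) = cvec μ + cvec ν := by
  funext i; simp [cvec]

lemma expSum_add {n : ℕ} (h : ℂ) (c d : (Fin (n + 1) → ℝ) →₀ ℂ) :
    expSum h (c + d) = expSum h c + expSum h d := by
  funext z
  exact Finsupp.sum_add_index' (by simp) (by intros; ring)

lemma expSum_single {n : ℕ} (h : ℂ) (ν : Fin (n + 1) → ℝ) (a : ℂ) (z : Fin (n + 1) → ℂ) :
    expSum h (Finsupp.single ν a) z = a * qpow h (2 * pair (cvec ν) z) := by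
  simp [expSum]

/-- `f` is a polynomial: a finite sum `f(z) = ∑_{ν ∈ P} f_ν q^{2(ν, z)}`. -/
def IsPoly {n : ℕ} (h : ℂ) (m : ℕ) (f : (Fin (n + 1) → ℂ) → ℂ) : Prop :=
  ∃ c : (Fin (n + 1) → ℝ) →₀ ℂ, (∀ ν ∈ c.support, ν ∈ weightLattice n m) ∧ f = expSum h c

lemma IsPoly.add {n : ℕ} {h : ℂ} {m : ℕ} {f g : (Fin (n + 1) → ℂ) → ℂ}
    (hf : IsPoly h m f) (hg : IsPoly h m g) : IsPoly h m (f + g) := by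
  classical
  obtain ⟨c, hc, rfl⟩ := hf
  obtain ⟨d, hd, rfl⟩ := hg
  refine ⟨c + d, fun ν hν => ?_, (expSum_add h c d).symm⟩
  rcases Finset.mem_union.1 (Finsupp.support_add hν) with h1 | h1
  · exact hc ν h1
  · exact hd ν h1

lemma isPoly_single {n : ℕ} (h : ℂ) (m : ℕ) {ν : Fin (n + 1) → ℝ} (hν : ν ∈ weightLattice n m)
    (a : ℂ) : IsPoly h m fun z => a * qpow h (2 * pair (cvec ν) z) := by
  refine ⟨Finsupp.single ν a, fun μ hμ => ?_, ?_⟩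
  · have := Finsupp.support_single_subset hμ
    rw [Finset.mem_singleton] at this
    exact this ▸ hν
  · funext z; rw [expSum_single]

lemma isPoly_const {n : ℕ} (h : ℂ) (m : ℕ) (a : ℂ) :
    IsPoly h m fun _ : Fin (n + 1) → ℂ => a := by
  simpa [pair, cvec, qpow] using isPoly_single (n := n) h m (zero_mem _) a

lemma isPoly_sum {n : ℕ} {h : ℂ} {m : ℕ} {ι : Type} (s : Finset ι)
    (f : ι → (Fin (n + 1) → ℂ) → ℂ) (hf : ∀ i ∈ s, IsPoly h m (f i)) :
    IsPoly h m (∑ i ∈ s, f i) :=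
  Finset.sum_induction f (IsPoly h m) (fun _ _ => IsPoly.add) (isPoly_const h m 0) hf

lemma IsPoly.mul {n : ℕ} {h : ℂ} {m : ℕ} {f g : (Fin (n + 1) → ℂ) → ℂ}
    (hf : IsPoly h m f) (hg : IsPoly h m g) : IsPoly h m (f * g) := by
  obtain ⟨c, hc, rfl⟩ := hf
  obtain ⟨d, hd, rfl⟩ := hg
  have key : expSum h c * expSum h d = ∑ μ ∈ c.support, ∑ ν ∈ d.support,
      fun z => (c μ * d ν) * qpow h (2 * pair (cvec (μ + ν)) z) := by
    funext z
    simp only [Pi.mul_apply, expSum, Finsupp.sum, Finset.sum_apply, Finset.sum_mul_sum]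
    refine Finset.sum_congr rfl fun μ _ => Finset.sum_congr rfl fun ν _ => ?_
    rw [cvec_add, pair_add, mul_add, qpow_add]
    ring
  rw [key]
  exact isPoly_sum _ _ fun μ hμ => isPoly_sum _ _ fun ν hν =>
    isPoly_single h m (add_mem (hc μ hμ) (hd ν hν)) _

/-- The quasi-invariance conditions on a function of `z`:
`f(z + s e_i) = f(z + s e_j)` whenever `q^{2 z_i} = q^{2 z_j}` (`1 ≤ s ≤ m`, `1 ≤ i < j ≤ n`), and
`f(z + e_i) = f(z + √m e_{n+1})` whenever `q^{1 - m + 2 z_i} = q^{2 √m z_{n+1}}`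
(`1 ≤ i ≤ n`). -/
def QuasiInvariant {n : ℕ} (h : ℂ) (m : ℕ) (f : (Fin (n + 1) → ℂ) → ℂ) : Prop :=
  (∀ s : ℕ, 1 ≤ s → s ≤ m → ∀ i j : Fin n, i < j → ∀ z : Fin (n + 1) → ℂ,
    qpow h (2 * z i.castSucc) = qpow h (2 * z j.castSucc) →
      f (z + (s : ℂ) • cvec (basisVec m i.castSucc)) =
        f (z + (s : ℂ) • cvec (basisVec m j.castSucc))) ∧
  (∀ i : Fin n, ∀ z : Fin (n + 1) → ℂ,
    qpow h (1 - m + 2 * z i.castSucc) = qpow h (2 * (Real.sqrt m : ℂ) * z (Fin.last n)) →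
      f (z + cvec (basisVec m i.castSucc)) = f (z + cvec (basisVec m (Fin.last n))))

/-- The ring of quasi-invariant polynomials. -/
def quasiInvariants (n : ℕ) (h : ℂ) (m : ℕ) : Subalgebra ℂ ((Fin (n + 1) → ℂ) → ℂ) where
  carrier := {f | IsPoly h m f ∧ QuasiInvariant h m f}
  mul_mem' := by
    rintro f g ⟨hf, hf1, hf2⟩ ⟨hg, hg1, hg2⟩
    refine ⟨hf.mul hg, fun s h1 h2 i j hij z hz => ?_, fun i z hz => ?_⟩
    · simp only [Pi.mul_apply]
      rw [hf1 s h1 h2 i j hij z hz, hg1 s h1 h2 i j hij z hz]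
    · simp only [Pi.mul_apply]
      rw [hf2 i z hz, hg2 i z hz]
  add_mem' := by
    rintro f g ⟨hf, hf1, hf2⟩ ⟨hg, hg1, hg2⟩
    refine ⟨hf.add hg, fun s h1 h2 i j hij z hz => ?_, fun i z hz => ?_⟩
    · simp only [Pi.add_apply]
      rw [hf1 s h1 h2 i j hij z hz, hg1 s h1 h2 i j hij z hz]
    · simp only [Pi.add_apply]
      rw [hf2 i z hz, hg2 i z hz]
  algebraMap_mem' := fun a =>
    ⟨isPoly_const h m a, fun _ _ _ _ _ _ _ _ => rfl, fun _ _ _ => rfl⟩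

/-! ### The deformed Macdonald–Ruijsenaars operator -/

/-- The coefficient `ã_i(z)`, `1 ≤ i ≤ n`. -/
def coeffA {n : ℕ} (h : ℂ) (m : ℕ) (i : Fin n) (z : Fin (n + 1) → ℂ) : ℂ :=
  qnum h (z i.castSucc - (Real.sqrt m : ℂ) * z (Fin.last n) - (m + 1) / 2) /
      qnum h (z i.castSucc - (Real.sqrt m : ℂ) * z (Fin.last n) - (m - 1) / 2) *
    ∏ j ∈ Finset.univ.erase i,
      qnum h (z i.castSucc - z j.castSucc - m) / qnum h (z i.castSucc - z j.castSucc)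

/-- The coefficient `ã_{n+1}(z)`. -/
def coeffLast {n : ℕ} (h : ℂ) (m : ℕ) (z : Fin (n + 1) → ℂ) : ℂ :=
  qnum h 1 / qnum h m * ∏ j : Fin n,
    qnum h ((Real.sqrt m : ℂ) * z (Fin.last n) - z j.castSucc - (m + 1) / 2) /
      qnum h ((Real.sqrt m : ℂ) * z (Fin.last n) - z j.castSucc + (m - 1) / 2)

/-- The operator
`D̃ = ã_1(z) T^{e_1} + ⋯ + ã_n(z) T^{e_n} + ã_{n+1}(z) T^{√m e_{n+1}}`, where
`(T^v F)(z) = F(z + v)`. Its values are meaningful off the poles of the coefficients. -/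
def opD (n : ℕ) (h : ℂ) (m : ℕ) : Module.End ℂ ((Fin (n + 1) → ℂ) → ℂ) where
  toFun F z := (∑ i : Fin n, coeffA h m i z * F (z + cvec (basisVec m i.castSucc))) +
    coeffLast h m z * F (z + cvec (basisVec m (Fin.last n)))
  map_add' F G := by
    funext z
    simp only [Pi.add_apply, mul_add, Finset.sum_add_distrib]
    ring
  map_smul' a F := by
    funext z
    simp only [Pi.smul_apply, smul_eq_mul, RingHom.id_apply, mul_add, Finset.mul_sum]
    congr 1
    · exact Finset.sum_congr rfl fun i _ => by ring
    · ring

/-- `z` is not a pole of the coefficients of `D̃`. -/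
def OffPoles {n : ℕ} (h : ℂ) (m : ℕ) (z : Fin (n + 1) → ℂ) : Prop :=
  (∀ i j : Fin n, i ≠ j → qnum h (z i.castSucc - z j.castSucc) ≠ 0) ∧
  (∀ i : Fin n,
    qnum h (z i.castSucc - (Real.sqrt m : ℂ) * z (Fin.last n) - (m - 1) / 2) ≠ 0)

/-- The deformed orbit sum
`𝔪(x) = q^{2 x_1} + ⋯ + q^{2 x_n} + (q - q⁻¹)/(q^m - q^{-m}) q^{2 √m x_{n+1}}`. -/
def orbitSum {n : ℕ} (h : ℂ) (m : ℕ) (x : Fin (n + 1) → ℂ) : ℂ :=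
  (∑ i : Fin n, qpow h (2 * x i.castSucc)) +
    qnum h 1 / qnum h m * qpow h (2 * (Real.sqrt m : ℂ) * x (Fin.last n))

/-! ### Baker–Akhiezer functions -/

/-- `ψ(x, z) = q^{2(x,z)} ∑_ν ψ_ν(x) q^{2(ν, z)}` is a Baker–Akhiezer function with coefficients
`ψ_ν(x) = c x ν`: the sum is over `ν ∈ 𝒩 ∩ (ρ + P)`, and for each `x` the function `ψ(x, ·)`
satisfies the quasi-invariance conditions. -/
structure IsBA {n : ℕ} (h : ℂ) (m : ℕ) (c : (Fin (n + 1) → ℂ) → (Fin (n + 1) → ℝ) →₀ ℂ)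
    (ψ : (Fin (n + 1) → ℂ) → (Fin (n + 1) → ℂ) → ℂ) : Prop where
  expansion : ∀ x z, ψ x z = qpow h (2 * pair x z) * expSum h (c x) z
  support_subset : ∀ x, ∀ ν ∈ (c x).support, ν ∈ polytope n m ∧ ν - rho n m ∈ weightLattice n m
  quasiInvariant : ∀ x, QuasiInvariant h m (ψ x)

/-- The normalizing factor `∏_{α > 0} ∏_{j=1}^{m_α} [(α, ½ j α - x)]`. -/
def normFactor {n : ℕ} (h : ℂ) (m : ℕ) (x : Fin (n + 1) → ℂ) : ℂ :=
  ∏ α : PosRoot n, ∏ j ∈ Finset.Icc 1 (mult m α),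
    qnum h (pair (cvec (root m α)) (((j : ℂ) / 2) • cvec (root m α) - x))

/-- A normalized Baker–Akhiezer function: `ψ_ρ(x)` is the normalizing factor. -/
def IsNormalizedBA {n : ℕ} (h : ℂ) (m : ℕ) (c : (Fin (n + 1) → ℂ) → (Fin (n + 1) → ℝ) →₀ ℂ)
    (ψ : (Fin (n + 1) → ℂ) → (Fin (n + 1) → ℂ) → ℂ) : Prop :=
  IsBA h m c ψ ∧ ∀ x, c x (rho n m) = normFactor h m x

/-- `Q(z) = q^{2(ρ,z)} ∏_{α > 0} ∏_{j=1}^{m_α} [(α, z + ½ j α)] [(α, z - ½ j α)]`. -/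
def polyQ {n : ℕ} (h : ℂ) (m : ℕ) (z : Fin (n + 1) → ℂ) : ℂ :=
  qpow h (2 * pair (cvec (rho n m)) z) *
    ∏ α : PosRoot n, ∏ j ∈ Finset.Icc 1 (mult m α),
      (qnum h (pair (cvec (root m α)) (z + ((j : ℂ) / 2) • cvec (root m α))) *
        qnum h (pair (cvec (root m α)) (z - ((j : ℂ) / 2) • cvec (root m α))))

/-- The product formula `∏_ν (D̃ - 𝔪(x + ν)) [q^{2(x,z)} Q(z)]`, with `D̃` acting in `z`. The
factors commute; their product is the value at `D̃` of the polynomial `∏_ν (X - 𝔪(x + ν))`. -/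
def berestProduct (n : ℕ) (h : ℂ) (m : ℕ) (x z : Fin (n + 1) → ℂ) : ℂ :=
  (Polynomial.aeval (opD n h m)
    (∏ ν ∈ shiftSet n m, (Polynomial.X - Polynomial.C (orbitSum h m (x + cvec ν)))))
    (fun w => qpow h (2 * pair x w) * polyQ h m w) z

/-! ### Difference operators on the lattice `P` -/

/-- `d` is a rational function of the exponentials: `d = a / b` off the zeros of `b`, with
polynomials `a` and `b ≠ 0`. -/
def IsRationalFun {n : ℕ} (h : ℂ) (m : ℕ) (d : (Fin (n + 1) → ℂ) → ℂ) : Prop :=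
  ∃ a b : (Fin (n + 1) → ℂ) → ℂ, IsPoly h m a ∧ IsPoly h m b ∧ b ≠ 0 ∧
    ∀ x, b x ≠ 0 → d x = a x / b x

/-- A difference operator `∑_ν d_ν(x) T^ν` on the lattice `P`: a finite sum over `ν ∈ P`, with
coefficients that are rational functions of the exponentials. -/
structure DiffOp (n : ℕ) (h : ℂ) (m : ℕ) where
  coeff : (Fin (n + 1) → ℝ) →₀ ((Fin (n + 1) → ℂ) → ℂ)
  mem_lattice : ∀ ν ∈ coeff.support, ν ∈ weightLattice n m
  rational : ∀ ν ∈ coeff.support, IsRationalFun h m (coeff ν)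

/-- The action `F ↦ (x ↦ ∑_ν d_ν(x) F(x + ν))`. -/
def DiffOp.act {n : ℕ} {h : ℂ} {m : ℕ} (D : DiffOp n h m) (F : (Fin (n + 1) → ℂ) → ℂ)
    (x : Fin (n + 1) → ℂ) : ℂ :=
  D.coeff.sum fun ν d => d x * F (x + cvec ν)

/-- A property holds for generic `x`: off the zero set of some nonzero polynomial. -/
def Generically {n : ℕ} (h : ℂ) (m : ℕ) (p : (Fin (n + 1) → ℂ) → Prop) : Prop :=
  ∃ b : (Fin (n + 1) → ℂ) → ℂ, IsPoly h m b ∧ b ≠ 0 ∧ ∀ x, b x ≠ 0 → p x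

/-- Equality of operators whose coefficients are rational functions: for generic `x`, the two
results agree at `x` for every function `F`. -/
def OpEq {n : ℕ} (h : ℂ) (m : ℕ)
    (A B : ((Fin (n + 1) → ℂ) → ℂ) → (Fin (n + 1) → ℂ) → ℂ) : Prop :=
  Generically h m fun x => ∀ F, A F x = B F x

/-- `D Ψ = f(z) Ψ`, with `D` acting in `x`. -/
def IsEigen {n : ℕ} {h : ℂ} {m : ℕ} (D : DiffOp n h m)
    (Ψ : (Fin (n + 1) → ℂ) → (Fin (n + 1) → ℂ) → ℂ) (f : (Fin (n + 1) → ℂ) → ℂ) : Prop :=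
  Generically h m fun x => ∀ z, D.act (fun y => Ψ y z) x = f z * Ψ x z

end DeformedMR

end

open DeformedMR

/-! The operator is controlled by its leading terms, and everything is done on coefficient vectors
of functions `q^{2(x-ρ,z)} ∑ c_p q^{2(lat p,z)}` that are quasi-invariant in `z`. The basis vectors
are treated uniformly: the singular hyperplanes are `ζ_i = ζ_j + off i j`, with the last index
differing only through lengths and multiplicities.

Invariance. On each singular hyperplane exactly two coefficients have a pole. Their residues are
opposite, and the condition with `s = 1` equates the two values that they multiply, so the poles
cancel (`lin_mul_tD_aux`, `exists_isPoly_tD`). For the quasi-invariance of the result the terms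
match in pairs (`tD_hyp_eq`, `TQ_of_tD`). The twist `q^{2(x-ρ,z)}` is carried along, so the same
argument serves quasi-invariant polynomials and BA functions.

Spectrum. In a direction `ℓ` separating exponents, the operator multiplies the extreme coefficient,
at `p`, by `𝔪(x + p - kv ℓ)`, where `kv ℓ` is the vertex of the zonotope `∑ [0, m_α] α` in that
direction (`tD_top`). Hence supports do not grow, and for generic `x` an eigenvector has the
vertices `y + kv ℓ` for one fixed `y`, with eigenvalue `𝔪(x + y)` (`eigen_top`). No Jordan blocks
occur (`orbPoly_kill`). The function `Q` satisfies all quasi-invariance conditions because both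
sides vanish, and after multiplication by `q^{2(ρ,z)}` its exponents lie in the doubled zonotope.
The only possible `y` there are the integral points of the zonotope itself, an integrality statement
about flows (`mem_zon_of_cut`). So the product over `ν ≠ 0` leaves the component with `y = 0`, an
eigenfunction with exponents in the zonotope. Polynomial dependence on `x` removes the word generic.

Extreme coefficients. The leading part of quasi-invariance along a wall gives linear equations for
the coefficients on an edge of the zonotope, which fix the ratio of its end coefficients (`edge`).
Passing from chamber to chamber, one vertex coefficient determines all the others (`chamber`).

Bispectrality. For a quasi-invariant `f`, the decomposition of `f Ψ(x, ·)` into eigenvectors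
consists of multiples of the translates `Ψ(x + y, ·)`, because eigenvalues are generically simple.
This is a difference equation in `x` (`expansion`). For `f = 𝔪` the translates are by basis vectors,
and the vertex coefficients identify the multipliers with the coefficients of the operator
(`dual_equation`). Thus `Ψ(x, z)` and `Ψ(z, x)` satisfy the same equation in `x`. Uniqueness of
solutions with a given leading term makes them proportional, and a diagonal entry of the kernel
fixes the factor (`exists_proportional`, `exists_kernel`). A difference operator is determined by
its action on `Ψ` (`latOp_eq_zero`), which gives uniqueness and commutativity of the `D_f` and
identifies `D_𝔪`. -/

open Filter Topology

noncomputable section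

namespace DeformedMR

variable {n m : ℕ} {h : ℂ}

/-! ### Lattice coordinates -/

/-- Length of the basis vector `basisVec m i`. -/
def kap (m : ℕ) (i : Fin (n + 1)) : ℝ := if i = Fin.last n then Real.sqrt m else 1

/-- Squared length of the basis vector `basisVec m i`. -/
def nsq (m : ℕ) (i : Fin (n + 1)) : ℕ := if i = Fin.last n then m else 1

/-- The complex basis vector of the lattice. -/
def eps (m : ℕ) (i : Fin (n + 1)) : Fin (n + 1) → ℂ := cvec (basisVec m i)

/-- The coordinate `(basisVec m i, z)`. -/
def zeta (m : ℕ) (i : Fin (n + 1)) (z : Fin (n + 1) → ℂ) : ℂ := (kap m i : ℂ) * z i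

/-- The point with given coordinates `zeta`. -/
def pt (m : ℕ) (w : Fin (n + 1) → ℂ) : Fin (n + 1) → ℂ := fun i => w i / (kap m i : ℂ)

/-- The lattice vector with integral coordinates `p`. -/
def lat (m : ℕ) (p : Fin (n + 1) → ℤ) : Fin (n + 1) → ℝ := fun i => p i * kap m i

lemma kap_ne_zero (hm : 1 ≤ m) (i : Fin (n + 1)) : kap m i ≠ 0 := by
  unfold kap
  split_ifs
  · have : (0 : ℝ) < m := by exact_mod_cast hm
    exact (Real.sqrt_pos.2 this).ne'
  · exact one_ne_zero

lemma kap_sq (i : Fin (n + 1)) : kap m i * kap m i = nsq m i := by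
  unfold kap nsq
  split_ifs <;> simp

lemma nsq_pos (hm : 1 ≤ m) (i : Fin (n + 1)) : 0 < nsq m i := by
  unfold nsq
  split_ifs <;> omega

lemma basisVec_eq (i : Fin (n + 1)) : basisVec m i = Pi.single i (kap m i) := rfl

lemma eps_apply (i j : Fin (n + 1)) : eps m i j = if j = i then (kap m i : ℂ) else 0 := by
  simp only [eps, cvec, basisVec_eq, Pi.single_apply]
  split_ifs <;> simp

lemma zeta_add (i : Fin (n + 1)) (z w : Fin (n + 1) → ℂ) :
    zeta m i (z + w) = zeta m i z + zeta m i w := by simp [zeta, mul_add]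

lemma zeta_sub (i : Fin (n + 1)) (z w : Fin (n + 1) → ℂ) :
    zeta m i (z - w) = zeta m i z - zeta m i w := by simp [zeta, mul_sub]

lemma zeta_smul (i : Fin (n + 1)) (a : ℂ) (z : Fin (n + 1) → ℂ) :
    zeta m i (a • z) = a * zeta m i z := by simp [zeta]; ring

lemma kap_sq' (i : Fin (n + 1)) : (kap m i : ℂ) * kap m i = nsq m i := by
  exact_mod_cast congrArg (fun r : ℝ => (r : ℂ)) (kap_sq (m := m) i)

lemma zeta_eps (i j : Fin (n + 1)) : zeta m i (eps m j) = if i = j then (nsq m i : ℂ) else 0 := by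
  rw [zeta, eps_apply]
  split_ifs with hij
  · subst hij; exact kap_sq' i
  · simp

lemma zeta_lat (i : Fin (n + 1)) (p : Fin (n + 1) → ℤ) :
    zeta m i (cvec (lat m p)) = p i * nsq m i := by
  simp only [zeta, cvec, lat, ← kap_sq' i]
  push_cast
  ring

lemma zeta_pt (hm : 1 ≤ m) (i : Fin (n + 1)) (w : Fin (n + 1) → ℂ) : zeta m i (pt m w) = w i := by
  have : (kap m i : ℂ) ≠ 0 := by exact_mod_cast kap_ne_zero hm i
  simp only [zeta, pt]
  field_simp

lemma pt_zeta (hm : 1 ≤ m) (z : Fin (n + 1) → ℂ) : pt m (fun i => zeta m i z) = z := by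
  funext i
  have : (kap m i : ℂ) ≠ 0 := by exact_mod_cast kap_ne_zero hm i
  simp only [zeta, pt]
  field_simp

lemma pair_comm (x z : Fin (n + 1) → ℂ) : pair x z = pair z x := by
  simp [pair, mul_comm]

lemma pair_add_right (x z w : Fin (n + 1) → ℂ) : pair x (z + w) = pair x z + pair x w := by
  rw [pair_comm, pair_add, pair_comm z, pair_comm w]

lemma pair_lat (p : Fin (n + 1) → ℤ) (z : Fin (n + 1) → ℂ) :
    pair (cvec (lat m p)) z = ∑ i, (p i : ℂ) * zeta m i z := by
  simp only [pair, cvec, lat, zeta]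
  refine Finset.sum_congr rfl fun i _ => ?_
  push_cast
  ring

lemma pair_eps (x : Fin (n + 1) → ℂ) (i : Fin (n + 1)) : pair x (eps m i) = zeta m i x := by
  simp [pair, eps_apply, zeta, mul_comm]

lemma cvec_basisVec (i : Fin (n + 1)) : cvec (basisVec m i) = eps m i := rfl

lemma lat_add (p p' : Fin (n + 1) → ℤ) : lat m (p + p') = lat m p + lat m p' := by
  funext i; simp [lat, add_mul]

lemma lat_sub (p p' : Fin (n + 1) → ℤ) : lat m (p - p') = lat m p - lat m p' := by
  funext i; simp [lat, sub_mul]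

lemma lat_single (i : Fin (n + 1)) : lat m (Pi.single i 1) = basisVec m i := by
  funext j
  simp only [lat, basisVec_eq, Pi.single_apply]
  split_ifs with hj <;> simp [hj]

lemma lat_zero : lat m (0 : Fin (n + 1) → ℤ) = 0 := by funext i; simp [lat]

lemma lat_injective (hm : 1 ≤ m) : Function.Injective (lat m : (Fin (n + 1) → ℤ) → _) := by
  intro p p' hp
  funext i
  have := congrFun hp i
  simp only [lat] at this
  exact_mod_cast mul_right_cancel₀ (kap_ne_zero hm i) this

lemma mem_weightLattice (ν : Fin (n + 1) → ℝ) :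
    ν ∈ weightLattice n m ↔ ∃ p : Fin (n + 1) → ℤ, ν = lat m p := by
  constructor
  · intro hν
    induction hν using AddSubgroup.closure_induction with
    | mem x hx =>
      obtain ⟨i, rfl⟩ := hx
      exact ⟨_, (lat_single i).symm⟩
    | zero => exact ⟨0, lat_zero.symm⟩
    | add x y _ _ hx hy =>
      obtain ⟨p, rfl⟩ := hx
      obtain ⟨p', rfl⟩ := hy
      exact ⟨_, (lat_add _ _).symm⟩
    | neg x _ hx =>
      obtain ⟨p, rfl⟩ := hx
      exact ⟨-p, by funext i; simp [lat]⟩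
  · rintro ⟨p, rfl⟩
    have : lat m p = ∑ i, p i • basisVec m i := by
      funext j
      simp [lat, basisVec_eq, Finset.sum_apply, Pi.single_apply]
    rw [this]
    exact sum_mem fun i _ => zsmul_mem (AddSubgroup.subset_closure (Set.mem_range_self i)) _

/-! ### `q`-powers -/

lemma qpow_zero : qpow h 0 = 1 := by simp [qpow]

lemma qpow_ne_zero (a : ℂ) : qpow h a ≠ 0 := Complex.exp_ne_zero _

lemma qpow_neg (a : ℂ) : qpow h (-a) = (qpow h a)⁻¹ := by simp [qpow, Complex.exp_neg]

lemma qpow_sub (a b : ℂ) : qpow h (a - b) = qpow h a / qpow h b := by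
  simp [qpow, mul_sub, Complex.exp_sub]

lemma qpow_nat_mul (k : ℕ) (a : ℂ) : qpow h (k * a) = qpow h a ^ k := by
  rw [qpow, qpow, ← Complex.exp_nat_mul]; congr 1; ring

lemma qpow_int_mul (k : ℤ) (a : ℂ) : qpow h (k * a) = qpow h a ^ k := by
  rw [qpow, qpow, ← Complex.exp_int_mul]; congr 1; ring

lemma qpow_sum {ι : Type*} (s : Finset ι) (f : ι → ℂ) :
    qpow h (∑ i ∈ s, f i) = ∏ i ∈ s, qpow h (f i) := by
  simp [qpow, Finset.mul_sum, Complex.exp_sum]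

lemma qnum_neg (a : ℂ) : qnum h (-a) = -qnum h a := by simp [qnum]

lemma qnum_eq (a : ℂ) : qnum h a = qpow h (-a) * (qpow h (2 * a) - 1) := by
  rw [qnum, mul_sub, mul_one, ← qpow_add]; congr 2; ring

lemma qnum_eq_zero_iff (a : ℂ) : qnum h a = 0 ↔ qpow h (2 * a) = 1 := by
  rw [qnum_eq, mul_eq_zero, sub_eq_zero]
  simp [qpow_ne_zero]

/-- `q = exp h` is not a root of unity. -/
def NotRoot (h : ℂ) : Prop := ∀ k : ℕ, 1 ≤ k → Complex.exp h ^ k ≠ 1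

lemma NotRoot.ne_zero (hq : NotRoot h) : h ≠ 0 := by
  rintro rfl
  exact hq 1 le_rfl (by simp)

lemma NotRoot.qpow_nat (hq : NotRoot h) {k : ℕ} (hk : k ≠ 0) : qpow h k ≠ 1 := by
  have := hq k (Nat.one_le_iff_ne_zero.2 hk)
  rwa [← Complex.exp_nat_mul, mul_comm] at this

lemma NotRoot.qpow_int (hq : NotRoot h) {k : ℤ} (hk : k ≠ 0) : qpow h k ≠ 1 := by
  obtain ⟨k, rfl | rfl⟩ := k.eq_nat_or_neg
  · exact_mod_cast hq.qpow_nat (k := k) (by simpa using hk)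
  · have := hq.qpow_nat (k := k) (by simpa using hk)
    push_cast
    rwa [qpow_neg, ne_eq, inv_eq_one]

lemma NotRoot.qnum_int (hq : NotRoot h) {k : ℤ} (hk : k ≠ 0) : qnum h k ≠ 0 := by
  rw [ne_eq, qnum_eq_zero_iff]
  have := hq.qpow_int (k := 2 * k) (by omega)
  exact_mod_cast this

lemma NotRoot.qnum_nat (hq : NotRoot h) {k : ℕ} (hk : k ≠ 0) : qnum h k ≠ 0 := by
  exact_mod_cast hq.qnum_int (k := k) (by exact_mod_cast hk)

/-! ### Monomials and Laurent polynomials -/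

/-- The monomial `q^{2 (lat p, z)}`. -/
def mono (h : ℂ) (m : ℕ) (p : Fin (n + 1) → ℤ) (z : Fin (n + 1) → ℂ) : ℂ :=
  qpow h (2 * ∑ i, (p i : ℂ) * zeta m i z)

/-- The Laurent polynomial with coefficients `c`, as a function of `z`. -/
def ev (h : ℂ) (m : ℕ) : ((Fin (n + 1) → ℤ) →₀ ℂ) →ₗ[ℂ] ((Fin (n + 1) → ℂ) → ℂ) :=
  Finsupp.linearCombination ℂ (mono h m)

lemma ev_apply (c : (Fin (n + 1) → ℤ) →₀ ℂ) (z : Fin (n + 1) → ℂ) :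
    ev h m c z = ∑ p ∈ c.support, c p * mono h m p z := by
  simp [ev, Finsupp.linearCombination_apply, Finsupp.sum, Finset.sum_apply]

lemma ev_apply_of_subset {c : (Fin (n + 1) → ℤ) →₀ ℂ} {S : Finset (Fin (n + 1) → ℤ)}
    (hS : c.support ⊆ S) (z : Fin (n + 1) → ℂ) :
    ev h m c z = ∑ p ∈ S, c p * mono h m p z := by
  rw [ev_apply]
  exact Finset.sum_subset hS fun p _ hp => by simp [Finsupp.notMem_support_iff.1 hp]

lemma ev_single (p : Fin (n + 1) → ℤ) (a : ℂ) (z : Fin (n + 1) → ℂ) :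
    ev h m (Finsupp.single p a) z = a * mono h m p z := by
  simp [ev, Finsupp.linearCombination_single]

lemma mono_eq (p : Fin (n + 1) → ℤ) (z : Fin (n + 1) → ℂ) :
    mono h m p z = qpow h (2 * pair (cvec (lat m p)) z) := by rw [pair_lat]; rfl

lemma mono_ne_zero (p : Fin (n + 1) → ℤ) (z : Fin (n + 1) → ℂ) : mono h m p z ≠ 0 :=
  qpow_ne_zero _

lemma mono_add (p p' : Fin (n + 1) → ℤ) (z : Fin (n + 1) → ℂ) :
    mono h m (p + p') z = mono h m p z * mono h m p' z := by
  rw [mono_eq, lat_add, cvec_add, pair_add, mul_add, qpow_add, ← mono_eq, ← mono_eq]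

lemma mono_zero (z : Fin (n + 1) → ℂ) : mono h m 0 z = 1 := by simp [mono, qpow_zero]

lemma mono_single (i : Fin (n + 1)) (z : Fin (n + 1) → ℂ) :
    mono h m (Pi.single i 1) z = qpow h (2 * zeta m i z) := by
  simp [mono, Pi.single_apply]

lemma mono_single_int (i : Fin (n + 1)) (k : ℤ) (z : Fin (n + 1) → ℂ) :
    mono h m (Pi.single i k) z = qpow h (2 * zeta m i z) ^ k := by
  rw [← qpow_int_mul]
  simp [mono, Pi.single_apply]
  ring_nf

lemma mono_shift (p : Fin (n + 1) → ℤ) (z w : Fin (n + 1) → ℂ) :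
    mono h m p (z + w) = mono h m p z * mono h m p w := by
  simp only [mono, zeta_add, mul_add, Finset.sum_add_distrib, qpow_add]

/-- Replacing lattice exponents by their integral coordinates turns polynomials into finitely
supported functions on `ℤ^{n+1}`, the form used from here on. -/
lemma isPoly_iff (f : (Fin (n + 1) → ℂ) → ℂ) : IsPoly h m f ↔ ∃ c, f = ev h m c := by
  constructor
  · rintro ⟨c, hc, rfl⟩
    choose! p hp using fun ν (hν : ν ∈ c.support) => (mem_weightLattice ν).1 (hc ν hν)
    refine ⟨∑ ν ∈ c.support, Finsupp.single (p ν) (c ν), ?_⟩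
    funext z
    rw [map_sum, Finset.sum_apply, expSum, Finsupp.sum]
    refine Finset.sum_congr rfl fun ν hν => ?_
    rw [ev_single, mono_eq, ← hp ν hν]
  · rintro ⟨c, rfl⟩
    have : ev h m c = ∑ p ∈ c.support, fun z => c p * qpow h (2 * pair (cvec (lat m p)) z) := by
      funext z
      rw [ev_apply, Finset.sum_apply]
      exact Finset.sum_congr rfl fun p _ => by rw [mono_eq]
    rw [this]
    exact isPoly_sum _ _ fun p _ => isPoly_single h m ((mem_weightLattice _).2 ⟨p, rfl⟩) _

lemma isPoly_ev (c : (Fin (n + 1) → ℤ) →₀ ℂ) : IsPoly h m (ev h m c) := (isPoly_iff _).2 ⟨c, rfl⟩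

lemma isPoly_mono (p : Fin (n + 1) → ℤ) : IsPoly h m (mono h m p) :=
  (isPoly_iff _).2 ⟨Finsupp.single p 1, by funext z; simp [ev_single]⟩

lemma IsPoly.const_mul {f : (Fin (n + 1) → ℂ) → ℂ} (a : ℂ) (hf : IsPoly h m f) :
    IsPoly h m fun z => a * f z := (isPoly_const h m a).mul hf

lemma IsPoly.sub {f g : (Fin (n + 1) → ℂ) → ℂ} (hf : IsPoly h m f) (hg : IsPoly h m g) :
    IsPoly h m (f - g) := by
  have := hf.add (hg.const_mul (-1))
  convert this using 1
  funext z
  simp [sub_eq_add_neg]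

lemma isPoly_prod {ι : Type*} (s : Finset ι) (f : ι → (Fin (n + 1) → ℂ) → ℂ)
    (hf : ∀ i ∈ s, IsPoly h m (f i)) : IsPoly h m (∏ i ∈ s, f i) :=
  Finset.prod_induction f (IsPoly h m) (fun _ _ => IsPoly.mul) (isPoly_const h m 1) hf

lemma isPoly_sum' {ι : Type*} (s : Finset ι) (f : ι → (Fin (n + 1) → ℂ) → ℂ)
    (hf : ∀ i ∈ s, IsPoly h m (f i)) : IsPoly h m (∑ i ∈ s, f i) :=
  Finset.sum_induction f (IsPoly h m) (fun _ _ => IsPoly.add) (isPoly_const h m 0) hf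

lemma IsPoly.shift {f : (Fin (n + 1) → ℂ) → ℂ} (hf : IsPoly h m f) (w : Fin (n + 1) → ℂ) :
    IsPoly h m fun z => f (z + w) := by
  obtain ⟨c, rfl⟩ := (isPoly_iff f).1 hf
  have : (fun z => ev h m c (z + w)) =
      ∑ p ∈ c.support, fun z => (c p * mono h m p w) * mono h m p z := by
    funext z
    rw [ev_apply, Finset.sum_apply]
    exact Finset.sum_congr rfl fun p _ => by rw [mono_shift]; ring
  rw [this]
  exact isPoly_sum' _ _ fun p _ => (isPoly_mono p).const_mul _

/-- Laurent polynomials depend on the exponentials only. -/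
lemma mono_congr {z w : Fin (n + 1) → ℂ}
    (hzw : ∀ i, qpow h (2 * zeta m i z) = qpow h (2 * zeta m i w)) (p : Fin (n + 1) → ℤ) :
    mono h m p z = mono h m p w := by
  have key : ∀ z, mono h m p z = ∏ i, qpow h (2 * zeta m i z) ^ (p i) := by
    intro z
    rw [mono, Finset.mul_sum, qpow_sum]
    refine Finset.prod_congr rfl fun i _ => ?_
    rw [← qpow_int_mul]; congr 1; ring
  simp only [key, hzw]

lemma IsPoly.congr {f : (Fin (n + 1) → ℂ) → ℂ} (hf : IsPoly h m f) {z w : Fin (n + 1) → ℂ}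
    (hzw : ∀ i, qpow h (2 * zeta m i z) = qpow h (2 * zeta m i w)) : f z = f w := by
  obtain ⟨c, rfl⟩ := (isPoly_iff f).1 hf
  rw [ev_apply, ev_apply]
  exact Finset.sum_congr rfl fun p _ => by rw [mono_congr hzw]

/-! ### Analyticity and density -/

lemma analytic_apply (i : Fin (n + 1)) :
    AnalyticOnNhd ℂ (fun z : Fin (n + 1) → ℂ => z i) Set.univ := fun _ _ =>
  (ContinuousLinearMap.proj (R := ℂ) (φ := fun _ : Fin (n + 1) => ℂ) i).analyticAt _

lemma analytic_zeta (i : Fin (n + 1)) :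
    AnalyticOnNhd ℂ (fun z : Fin (n + 1) → ℂ => zeta m i z) Set.univ :=
  analyticOnNhd_const.mul (analytic_apply i)

lemma AnalyticOnNhd.qpow {f : (Fin (n + 1) → ℂ) → ℂ} (hf : AnalyticOnNhd ℂ f Set.univ) :
    AnalyticOnNhd ℂ (fun z => qpow h (f z)) Set.univ :=
  (analyticOnNhd_const.mul hf).cexp

lemma AnalyticOnNhd.qnum {f : (Fin (n + 1) → ℂ) → ℂ} (hf : AnalyticOnNhd ℂ f Set.univ) :
    AnalyticOnNhd ℂ (fun z => qnum h (f z)) Set.univ :=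
  (AnalyticOnNhd.qpow hf).sub (AnalyticOnNhd.qpow hf.neg)

lemma analytic_pair (x : Fin (n + 1) → ℂ) :
    AnalyticOnNhd ℂ (fun z : Fin (n + 1) → ℂ => pair x z) Set.univ := by
  unfold pair
  exact Finset.analyticOnNhd_fun_sum _ fun i _ => analyticOnNhd_const.mul (analytic_apply i)

lemma analytic_mono (p : Fin (n + 1) → ℤ) :
    AnalyticOnNhd ℂ (mono h m p : (Fin (n + 1) → ℂ) → ℂ) Set.univ := by
  have : (mono h m p : (Fin (n + 1) → ℂ) → ℂ) = fun z => qpow h (2 * pair (cvec (lat m p)) z) := by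
    funext z; rw [mono_eq]
  rw [this]
  exact AnalyticOnNhd.qpow (analyticOnNhd_const.mul (analytic_pair _))

lemma IsPoly.analytic {f : (Fin (n + 1) → ℂ) → ℂ} (hf : IsPoly h m f) :
    AnalyticOnNhd ℂ f Set.univ := by
  obtain ⟨c, rfl⟩ := (isPoly_iff f).1 hf
  have : ev h m c = fun z => ∑ p ∈ c.support, c p * mono h m p z := by funext z; rw [ev_apply]
  rw [this]
  exact Finset.analyticOnNhd_fun_sum _ fun i _ => analyticOnNhd_const.mul (analytic_mono i)

lemma AnalyticOnNhd.cont {f : (Fin (n + 1) → ℂ) → ℂ} (hf : AnalyticOnNhd ℂ f Set.univ) :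
    Continuous f := continuousOn_univ.1 hf.continuousOn

lemma IsPoly.continuous {f : (Fin (n + 1) → ℂ) → ℂ} (hf : IsPoly h m f) : Continuous f :=
  AnalyticOnNhd.cont hf.analytic

/-- The identity theorem: an analytic function vanishing near one point vanishes everywhere. This
density is what extends identities proved off poles, or for generic `x`, by continuity. -/
lemma dense_ne_zero {f : (Fin (n + 1) → ℂ) → ℂ} (hf : AnalyticOnNhd ℂ f Set.univ) (h0 : f ≠ 0) :
    Dense {z | f z ≠ 0} := by
  rw [← Set.compl_ofPred, ← interior_eq_empty_iff_dense_compl, Set.eq_empty_iff_forall_notMem]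
  intro z hz
  apply h0
  refine AnalyticOnNhd.eq_of_eventuallyEq (z₀ := z) hf analyticOnNhd_const ?_
  exact mem_interior_iff_mem_nhds.1 hz

lemma isOpen_ne_zero {f : (Fin (n + 1) → ℂ) → ℂ} (hf : AnalyticOnNhd ℂ f Set.univ) :
    IsOpen {z | f z ≠ 0} := isOpen_ne_fun (AnalyticOnNhd.cont hf) continuous_const

lemma analytic_mul_ne_zero {f g : (Fin (n + 1) → ℂ) → ℂ} (hf : AnalyticOnNhd ℂ f Set.univ)
    (hg : AnalyticOnNhd ℂ g Set.univ) (hf0 : f ≠ 0) (hg0 : g ≠ 0) : f * g ≠ 0 := by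
  obtain ⟨z, hz, hz'⟩ := ((dense_ne_zero hf hf0).inter_of_isOpen_left (dense_ne_zero hg hg0)
    (isOpen_ne_zero hf)).nonempty
  exact fun h0 => mul_ne_zero hz hz' (congrFun h0 z)

lemma analytic_prod {ι : Type*} (s : Finset ι) (f : ι → (Fin (n + 1) → ℂ) → ℂ)
    (hf : ∀ i ∈ s, AnalyticOnNhd ℂ (f i) Set.univ) : AnalyticOnNhd ℂ (∏ i ∈ s, f i) Set.univ :=
  Finset.analyticOnNhd_prod _ hf

lemma analytic_prod_ne_zero {ι : Type*} (s : Finset ι) (f : ι → (Fin (n + 1) → ℂ) → ℂ)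
    (hf : ∀ i ∈ s, AnalyticOnNhd ℂ (f i) Set.univ) (h0 : ∀ i ∈ s, f i ≠ 0) :
    ∏ i ∈ s, f i ≠ 0 := by
  classical
  induction s using Finset.induction_on with
  | empty => exact fun h => one_ne_zero (congrFun h 0)
  | insert a s ha ih =>
    rw [Finset.prod_insert ha]
    refine analytic_mul_ne_zero (hf a (by simp)) (analytic_prod _ _ fun i hi => hf i (by simp [hi]))
      (h0 a (by simp)) (ih (fun i hi => hf i (by simp [hi])) fun i hi => h0 i (by simp [hi]))

lemma eq_of_mul_eq_zero {f g : (Fin (n + 1) → ℂ) → ℂ} (hf : AnalyticOnNhd ℂ f Set.univ)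
    (hf0 : f ≠ 0) (hg : Continuous g) (hfg : ∀ z, f z ≠ 0 → g z = 0) : g = 0 :=
  Continuous.ext_on (dense_ne_zero hf hf0) hg continuous_const fun z hz => hfg z hz

/-! ### Generic points -/

lemma Generically.mono {p p' : (Fin (n + 1) → ℂ) → Prop} (hp : Generically h m p)
    (hpp : ∀ x, p x → p' x) : Generically h m p' := by
  obtain ⟨b, hb, hb0, hx⟩ := hp
  exact ⟨b, hb, hb0, fun x hbx => hpp x (hx x hbx)⟩

lemma Generically.and {p p' : (Fin (n + 1) → ℂ) → Prop} (hp : Generically h m p)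
    (hp' : Generically h m p') : Generically h m fun x => p x ∧ p' x := by
  obtain ⟨b, hb, hb0, hx⟩ := hp
  obtain ⟨b', hb', hb0', hx'⟩ := hp'
  refine ⟨b * b', hb.mul hb', analytic_mul_ne_zero hb.analytic hb'.analytic hb0 hb0', fun x hbx => ?_⟩
  exact ⟨hx x (left_ne_zero_of_mul hbx), hx' x (right_ne_zero_of_mul hbx)⟩

lemma generically_true : Generically h m fun _ : Fin (n + 1) → ℂ => True :=
  ⟨fun _ => 1, isPoly_const h m 1, fun h0 => one_ne_zero (congrFun h0 0), fun _ _ => trivial⟩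

lemma generically_ball {ι : Type*} (s : Finset ι) (p : ι → (Fin (n + 1) → ℂ) → Prop)
    (hp : ∀ i ∈ s, Generically h m (p i)) : Generically h m fun x => ∀ i ∈ s, p i x := by
  classical
  induction s using Finset.induction_on with
  | empty => exact generically_true.mono fun x _ => by simp
  | insert a s ha ih =>
    refine ((hp a (by simp)).and (ih fun i hi => hp i (by simp [hi]))).mono fun x hx i hi => ?_
    rcases Finset.mem_insert.1 hi with rfl | hi
    · exact hx.1
    · exact hx.2 i hi

lemma Generically.shift {p : (Fin (n + 1) → ℂ) → Prop} (hp : Generically h m p)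
    (w : Fin (n + 1) → ℂ) : Generically h m fun x => p (x + w) := by
  obtain ⟨b, hb, hb0, hx⟩ := hp
  refine ⟨_, hb.shift w, fun h0 => hb0 ?_, fun x hbx => hx _ hbx⟩
  funext x
  simpa using congrFun h0 (x - w)

lemma Generically.dense {p : (Fin (n + 1) → ℂ) → Prop} (hp : Generically h m p) :
    Dense {x | p x} := by
  obtain ⟨b, hb, hb0, hx⟩ := hp
  exact (dense_ne_zero hb.analytic hb0).mono hx

lemma Generically.exists {p : (Fin (n + 1) → ℂ) → Prop} (hp : Generically h m p) : ∃ x, p x :=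
  hp.dense.nonempty

lemma Generically.ext {p : (Fin (n + 1) → ℂ) → Prop} (hp : Generically h m p)
    {f g : (Fin (n + 1) → ℂ) → ℂ} (hf : Continuous f) (hg : Continuous g)
    (hfg : ∀ x, p x → f x = g x) : f = g :=
  Continuous.ext_on hp.dense hf hg hfg

/-- Variant of `Generically` with a nonvanishing function that is a Laurent polynomial up to a
nowhere vanishing factor. -/
lemma generically_of_ne_zero {f u : (Fin (n + 1) → ℂ) → ℂ} (hfu : IsPoly h m fun x => u x * f x)
    (hu : ∀ x, u x ≠ 0) (hf : f ≠ 0) : Generically h m fun x => f x ≠ 0 := by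
  refine ⟨_, hfu, fun h0 => hf ?_, fun x hx => right_ne_zero_of_mul hx⟩
  funext x
  exact (mul_eq_zero.1 (congrFun h0 x)).resolve_left (hu x)

/-! ### Directions and asymptotics along rays -/

/-- The value of the functional `ℓ` on the exponent `p`. -/
def dot (p : Fin (n + 1) → ℤ) (ℓ : Fin (n + 1) → ℝ) : ℝ := ∑ i, (p i : ℝ) * ℓ i

lemma dot_add (p p' : Fin (n + 1) → ℤ) (ℓ : Fin (n + 1) → ℝ) :
    dot (p + p') ℓ = dot p ℓ + dot p' ℓ := by
  simp [dot, add_mul, Finset.sum_add_distrib]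

lemma dot_sub (p p' : Fin (n + 1) → ℤ) (ℓ : Fin (n + 1) → ℝ) :
    dot (p - p') ℓ = dot p ℓ - dot p' ℓ := by
  simp [dot, sub_mul, Finset.sum_sub_distrib]

lemma continuous_dot (p : Fin (n + 1) → ℤ) : Continuous (dot p) := by
  unfold dot; fun_prop

/-- Directions that separate all exponents. -/
def GenDir (ℓ : Fin (n + 1) → ℝ) : Prop := ∀ p : Fin (n + 1) → ℤ, dot p ℓ = 0 → p = 0

lemma GenDir.inj {ℓ : Fin (n + 1) → ℝ} (hℓ : GenDir ℓ) {p p' : Fin (n + 1) → ℤ}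
    (hp : dot p ℓ = dot p' ℓ) : p = p' :=
  sub_eq_zero.1 (hℓ _ (by rw [dot_sub, hp, sub_self]))

/-- The excluded directions form countably many hyperplanes, each of measure zero, so the remaining
ones have full measure. -/
lemma dense_genDir : Dense {ℓ : Fin (n + 1) → ℝ | GenDir ℓ} := by
  refine MeasureTheory.Measure.dense_of_ae (μ := MeasureTheory.volume) ?_
  have key : ∀ p : Fin (n + 1) → ℤ, ∀ᵐ ℓ : Fin (n + 1) → ℝ, dot p ℓ = 0 → p = 0 := by
    intro p
    by_cases hp : p = 0
    · exact Eventually.of_forall fun _ _ => hp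
    let f : (Fin (n + 1) → ℝ) →ₗ[ℝ] ℝ := ∑ i, (p i : ℝ) • LinearMap.proj i
    have hf : ∀ ℓ, f ℓ = dot p ℓ := fun ℓ => by simp [f, dot]
    have hker : LinearMap.ker f ≠ ⊤ := by
      intro htop
      apply hp
      funext i
      have : f (Pi.single i 1) = 0 := LinearMap.mem_ker.1 (htop ▸ Submodule.mem_top)
      rw [hf] at this
      simpa [dot, Pi.single_apply] using this
    have h0 := MeasureTheory.Measure.addHaar_submodule MeasureTheory.volume _ hker
    have : (↑(LinearMap.ker f) : Set (Fin (n + 1) → ℝ))ᶜ ∈ MeasureTheory.ae MeasureTheory.volume :=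
      MeasureTheory.compl_mem_ae_iff.2 h0
    filter_upwards [this] with ℓ hℓ h1
    exact absurd (by rw [SetLike.mem_coe, LinearMap.mem_ker, hf, h1]) hℓ
  filter_upwards [MeasureTheory.ae_all_iff.2 key] with ℓ hℓ using hℓ

/-- The point with coordinates `w + t ℓ / h`. -/
def ray (h : ℂ) (m : ℕ) (w : Fin (n + 1) → ℂ) (ℓ : Fin (n + 1) → ℝ) (t : ℝ) : Fin (n + 1) → ℂ :=
  pt m fun i => w i + (t * ℓ i : ℝ) / h

lemma zeta_ray (hm : 1 ≤ m) (w : Fin (n + 1) → ℂ) (ℓ : Fin (n + 1) → ℝ) (t : ℝ)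
    (i : Fin (n + 1)) : zeta m i (ray h m w ℓ t) = w i + (t * ℓ i : ℝ) / h := zeta_pt hm _ _

/-- The division by `h` in `ray` makes the growth factor a real exponential with rate `dot p ℓ`,
whatever the complex number `h ≠ 0`. -/
lemma mono_ray (hm : 1 ≤ m) (h0 : h ≠ 0) (p : Fin (n + 1) → ℤ) (w : Fin (n + 1) → ℂ)
    (ℓ : Fin (n + 1) → ℝ) (t : ℝ) :
    mono h m p (ray h m w ℓ t) = mono h m p (pt m w) * (Real.exp (2 * t * dot p ℓ) : ℝ) := by
  simp only [mono, zeta_ray hm, zeta_pt hm, mul_add, Finset.sum_add_distrib, qpow_add]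
  congr 1
  rw [qpow, Complex.ofReal_exp]
  congr 1
  simp only [dot]
  push_cast
  simp only [Finset.mul_sum]
  refine Finset.sum_congr rfl fun i _ => ?_
  field_simp

lemma tendsto_exp_neg {b : ℝ} (hb : b < 0) :
    Tendsto (fun t : ℝ => ((Real.exp (2 * t * b) : ℝ) : ℂ)) atTop (𝓝 0) := by
  have : Tendsto (fun t : ℝ => Real.exp (2 * t * b)) atTop (𝓝 0) := by
    refine Real.tendsto_exp_atBot.comp ?_
    have := (tendsto_id (α := ℝ) (x := atTop)).const_mul_atTop_of_neg (r := 2 * b) (by linarith)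
    refine this.congr fun t => ?_
    simp only [id]; ring
  exact_mod_cast (Complex.continuous_ofReal.tendsto 0).comp this

/-- Leading asymptotics of a Laurent polynomial along a ray. -/
lemma tendsto_ev (hm : 1 ≤ m) (h0 : h ≠ 0) (c : (Fin (n + 1) → ℤ) →₀ ℂ) (w : Fin (n + 1) → ℂ)
    (ℓ : Fin (n + 1) → ℝ) (b : ℝ) (hb : ∀ p ∈ c.support, dot p ℓ ≤ b) :
    Tendsto (fun t : ℝ => ev h m c (ray h m w ℓ t) * (Real.exp (2 * t * (-b)) : ℝ)) atTop
      (𝓝 (∑ p ∈ c.support with dot p ℓ = b, c p * mono h m p (pt m w))) := by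
  have key : ∀ t : ℝ, ev h m c (ray h m w ℓ t) * (Real.exp (2 * t * (-b)) : ℝ) =
      ∑ p ∈ c.support, c p * mono h m p (pt m w) * (Real.exp (2 * t * (dot p ℓ - b)) : ℝ) := by
    intro t
    rw [ev_apply, Finset.sum_mul]
    refine Finset.sum_congr rfl fun p _ => ?_
    rw [mono_ray hm h0]
    have : Real.exp (2 * t * (dot p ℓ - b)) =
        Real.exp (2 * t * dot p ℓ) * Real.exp (2 * t * (-b)) := by
      rw [← Real.exp_add]; congr 1; ring
    rw [this]; push_cast; ring
  simp only [key]
  rw [Finset.sum_filter]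
  refine tendsto_finsetSum _ fun p hp => ?_
  split_ifs with hpb
  · simp [hpb]
  · have := (tendsto_exp_neg (b := dot p ℓ - b)
      (sub_neg.2 (lt_of_le_of_ne (hb p hp) hpb))).const_mul (c p * mono h m p (pt m w))
    simpa using this

/-- Leading asymptotics along a separating direction. -/
lemma tendsto_ev_gen (hm : 1 ≤ m) (h0 : h ≠ 0) (c : (Fin (n + 1) → ℤ) →₀ ℂ) (w : Fin (n + 1) → ℂ)
    {ℓ : Fin (n + 1) → ℝ} (hℓ : GenDir ℓ) (p0 : Fin (n + 1) → ℤ)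
    (hb : ∀ p ∈ c.support, dot p ℓ ≤ dot p0 ℓ) :
    Tendsto (fun t : ℝ => ev h m c (ray h m w ℓ t) * (Real.exp (2 * t * (-dot p0 ℓ)) : ℝ)) atTop
      (𝓝 (c p0 * mono h m p0 (pt m w))) := by
  convert tendsto_ev hm h0 c w ℓ _ hb using 2
  by_cases hp0 : p0 ∈ c.support
  · rw [Finset.sum_eq_single p0]
    · intro p hp hne
      exact absurd (hℓ.inj (Finset.mem_filter.1 hp).2) hne
    · intro hp
      exact (hp (Finset.mem_filter.2 ⟨hp0, rfl⟩)).elim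
  · rw [Finsupp.notMem_support_iff.1 hp0, zero_mul, Finset.sum_eq_zero]
    intro p hp
    exact absurd (hℓ.inj (Finset.mem_filter.1 hp).2 ▸ (Finset.mem_filter.1 hp).1) hp0

/-- The exponent of a nonzero Laurent polynomial that is maximal in a given direction. -/
lemma exists_top {c : (Fin (n + 1) → ℤ) →₀ ℂ} (hc : c ≠ 0) (ℓ : Fin (n + 1) → ℝ) :
    ∃ p ∈ c.support, ∀ p' ∈ c.support, dot p' ℓ ≤ dot p ℓ :=
  Finset.exists_max_image _ _ (Finsupp.support_nonempty_iff.2 hc)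

lemma exists_genDir : ∃ ℓ : Fin (n + 1) → ℝ, GenDir ℓ := dense_genDir.nonempty

/-- Along a separating ray the term of the maximal exponent dominates all others, so a nonzero
combination of monomials is a nonzero function. -/
lemma ev_injective (hm : 1 ≤ m) (h0 : h ≠ 0) :
    Function.Injective (ev h m : ((Fin (n + 1) → ℤ) →₀ ℂ) →ₗ[ℂ] _) := by
  rw [← LinearMap.ker_eq_bot, LinearMap.ker_eq_bot']
  intro c hc
  by_contra hne
  obtain ⟨ℓ, hℓ⟩ := exists_genDir (n := n)
  obtain ⟨p, hp, hmax⟩ := exists_top hne ℓ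
  have := tendsto_ev_gen hm h0 c 0 hℓ p hmax
  simp only [hc, Pi.zero_apply, zero_mul] at this
  have h1 := tendsto_nhds_unique this tendsto_const_nhds
  exact (mul_ne_zero (Finsupp.mem_support_iff.1 hp) (mono_ne_zero _ _)) h1

/-- Eventual nonvanishing of Laurent polynomials along separating rays. -/
lemma eventually_ne_zero (hm : 1 ≤ m) (h0 : h ≠ 0) {f : (Fin (n + 1) → ℂ) → ℂ}
    (hf : IsPoly h m f) (hf0 : f ≠ 0) (w : Fin (n + 1) → ℂ) {ℓ : Fin (n + 1) → ℝ}
    (hℓ : GenDir ℓ) : ∀ᶠ t in atTop, f (ray h m w ℓ t) ≠ 0 := by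
  obtain ⟨c, rfl⟩ := (isPoly_iff f).1 hf
  have hc : c ≠ 0 := by rintro rfl; exact hf0 (map_zero _)
  obtain ⟨p, hp, hmax⟩ := exists_top hc ℓ
  have := tendsto_ev_gen hm h0 c w hℓ p hmax
  have h1 := this.eventually_ne
    (mul_ne_zero (Finsupp.mem_support_iff.1 hp) (mono_ne_zero (h := h) (m := m) p (pt m w)))
  filter_upwards [h1] with t ht
  exact left_ne_zero_of_mul ht

/-! ### Coefficients as combinations of values -/

/-- On Laurent polynomials with support in a finite set, each coefficient is a finite combination
of values at points of a dense set. -/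
lemma exists_coeff_functional (hm : 1 ≤ m) (h0 : h ≠ 0) (S : Finset (Fin (n + 1) → ℤ))
    {Z : Set (Fin (n + 1) → ℂ)} (hZ : Dense Z) (p : Fin (n + 1) → ℤ) :
    ∃ w : (Fin (n + 1) → ℂ) →₀ ℂ, (∀ z ∈ w.support, z ∈ Z) ∧
      ∀ c : (Fin (n + 1) → ℤ) →₀ ℂ, c.support ⊆ S → ∑ z ∈ w.support, w z * ev h m c z = c p := by
  let V : Submodule ℂ ((Fin (n + 1) → ℤ) →₀ ℂ) :=
    Finsupp.supported ℂ ℂ (S : Set (Fin (n + 1) → ℤ))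
  have : FiniteDimensional ℂ V := Module.Finite.equiv
    (Finsupp.supportedEquivFinsupp (R := ℂ) (M := ℂ) (S : Set (Fin (n + 1) → ℤ))).symm
  let e : Z → Module.Dual ℂ V := fun z =>
    (LinearMap.proj (z : Fin (n + 1) → ℂ) ∘ₗ ev h m) ∘ₗ V.subtype
  let W : Submodule ℂ (Module.Dual ℂ V) := Submodule.span ℂ (Set.range e)
  -- Evaluations at points of `Z` span the dual of the finite-dimensional space `V`: a vector killed
  -- by all of them is a Laurent polynomial vanishing on a dense set, hence zero.
  have htop : W = ⊤ := by
    have hbot : W.dualCoannihilator = ⊥ := by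
      rw [eq_bot_iff]
      intro v hv
      rw [Submodule.mem_dualCoannihilator] at hv
      have hv' : ∀ z ∈ Z, ev h m (v : (Fin (n + 1) → ℤ) →₀ ℂ) z = 0 := fun z hz =>
        hv (e ⟨z, hz⟩) (Submodule.subset_span ⟨⟨z, hz⟩, rfl⟩)
      have h1 : ev h m (v : (Fin (n + 1) → ℤ) →₀ ℂ) = 0 :=
        Continuous.ext_on hZ (isPoly_ev _).continuous continuous_const hv'
      have h2 : (v : (Fin (n + 1) → ℤ) →₀ ℂ) = 0 := ev_injective hm h0 (by rw [h1, map_zero])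
      exact (Submodule.mem_bot ℂ).2 (Subtype.ext h2)
    have : FiniteDimensional ℂ (Module.Dual ℂ V) := 
      Subspace.instModuleDualFiniteDimensional (K := ℂ) (V := V)
    have : FiniteDimensional ℂ W := FiniteDimensional.finiteDimensional_submodule W
    have h6 := Subspace.dualCoannihilator_dualAnnihilator_eq (K := ℂ) (V := V) (W := W)
    rw [← h6, hbot, Submodule.dualAnnihilator_bot]
  let φ : Module.Dual ℂ V := Finsupp.lapply p ∘ₗ V.subtype
  have hφ : φ ∈ W := htop ▸ Submodule.mem_top
  obtain ⟨a, ha⟩ := Finsupp.mem_span_range_iff_exists_finsupp.1 hφ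
  classical
  refine ⟨a.mapDomain (Subtype.val), fun z hz => ?_, fun c hc => ?_⟩
  · have := Finsupp.mapDomain_support hz
    obtain ⟨y, _, rfl⟩ := Finset.mem_image.1 this
    exact y.2
  · have hcV : c ∈ V := (Finsupp.mem_supported ℂ c).2 (by exact_mod_cast hc)
    have h3 := LinearMap.congr_fun ha ⟨c, hcV⟩
    have h4 : (a.mapDomain Subtype.val).sum (fun z b => b * ev h m c z) =
        a.sum fun z b => b * ev h m c z := by
      rw [Finsupp.sum_mapDomain_index] <;> intros <;> ring
    rw [Finsupp.sum] at h4
    rw [h4]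
    have h5 : φ ⟨c, hcV⟩ = c p := rfl
    have h6 := map_finsuppSum (LinearMap.applyₗ (R := ℂ) (⟨c, hcV⟩ : V)) a fun i b => b • e i
    rw [← h5, ← h3]
    exact h6.symm

/-- Families of coefficients that are recovered from values depend polynomially on parameters. -/
lemma isPoly_coeff (hm : 1 ≤ m) (h0 : h ≠ 0) (S : Finset (Fin (n + 1) → ℤ))
    {Z : Set (Fin (n + 1) → ℂ)} (hZ : Dense Z)
    (c : (Fin (n + 1) → ℂ) → (Fin (n + 1) → ℤ) →₀ ℂ) (hc : ∀ x, (c x).support ⊆ S)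
    (hpoly : ∀ z ∈ Z, IsPoly h m fun x => ev h m (c x) z) (p : Fin (n + 1) → ℤ) :
    IsPoly h m fun x => c x p := by
  obtain ⟨w, hw, hwc⟩ := exists_coeff_functional hm h0 S hZ p
  have : (fun x => c x p) = ∑ z ∈ w.support, fun x => w z * ev h m (c x) z := by
    funext x
    rw [← hwc (c x) (hc x), Finset.sum_apply]
  rw [this]
  exact isPoly_sum' _ _ fun z hz => (hpoly z (hw z hz)).const_mul _

/-! ### The operator in uniform notation -/

/-- The multiplicity of the root labelled by `i ≠ j`. -/
def mlt (m : ℕ) (i j : Fin (n + 1)) : ℕ := if i = Fin.last n ∨ j = Fin.last n then 1 else m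

/-- Offset of the singular hyperplane labelled by `i ≠ j`. -/
def off (m : ℕ) (i j : Fin (n + 1)) : ℂ := ((nsq m j : ℂ) - nsq m i) / 2

/-- Weights of the deformed orbit sum. -/
def wt (h : ℂ) (m : ℕ) (i : Fin (n + 1)) : ℂ := if i = Fin.last n then qnum h 1 / qnum h m else 1

/-- The elementary factor of a coefficient of the operator. -/
def phi (h : ℂ) (m : ℕ) (i j : Fin (n + 1)) (z : Fin (n + 1) → ℂ) : ℂ :=
  qnum h (zeta m i z - zeta m j z - off m i j - mlt m i j * nsq m i) /
    qnum h (zeta m i z - zeta m j z - off m i j)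

/-- The coefficients of the operator. -/
def aco (h : ℂ) (m : ℕ) (i : Fin (n + 1)) (z : Fin (n + 1) → ℂ) : ℂ :=
  wt h m i * ∏ j ∈ Finset.univ.erase i, phi h m i j z

lemma mlt_comm (i j : Fin (n + 1)) : mlt m i j = mlt m j i := by simp [mlt, or_comm]

lemma off_swap (i j : Fin (n + 1)) : off m j i = -off m i j := by simp [off]; ring

lemma prod_erase_eq_ite {ι : Type*} [Fintype ι] [DecidableEq ι] (i : ι) (f : ι → ℂ) :
    ∏ j ∈ Finset.univ.erase i, f j = ∏ j, if j = i then 1 else f j := by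
  rw [← Finset.mul_prod_erase Finset.univ (fun j => if j = i then 1 else f j) (Finset.mem_univ i)]
  simp only [if_true, one_mul]
  exact Finset.prod_congr rfl fun j hj => by rw [if_neg (Finset.ne_of_mem_erase hj)]

lemma kap_last : kap m (Fin.last n) = Real.sqrt m := by simp [kap]

lemma kap_castSucc (i : Fin n) : kap m i.castSucc = 1 := by simp [kap, Fin.castSucc_ne_last]

lemma nsq_last : nsq m (Fin.last n) = m := by simp [nsq]

lemma nsq_of_ne {i : Fin (n + 1)} (hi : i ≠ Fin.last n) : nsq m i = 1 := by simp [nsq, hi]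

lemma mlt_last (i : Fin (n + 1)) : mlt m i (Fin.last n) = 1 := by simp [mlt]

lemma mlt_of_ne {i j : Fin (n + 1)} (hi : i ≠ Fin.last n) (hj : j ≠ Fin.last n) :
    mlt m i j = m := by simp [mlt, hi, hj]

lemma zeta_castSucc (i : Fin n) (z : Fin (n + 1) → ℂ) : zeta m i.castSucc z = z i.castSucc := by
  simp [zeta, kap_castSucc]

lemma zeta_last (z : Fin (n + 1) → ℂ) :
    zeta m (Fin.last n) z = (Real.sqrt m : ℂ) * z (Fin.last n) := by
  simp [zeta, kap_last]

lemma coeffA_eq (i : Fin n) (z : Fin (n + 1) → ℂ) : coeffA h m i z = aco h m i.castSucc z := by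
  have h1 : ∀ j : Fin n, (j.castSucc = i.castSucc) ↔ j = i := fun j =>
    (Fin.castSucc_injective n).eq_iff
  rw [aco, prod_erase_eq_ite, Fin.prod_univ_castSucc, coeffA, prod_erase_eq_ite, wt,
    if_neg (Fin.castSucc_ne_last i), one_mul, mul_comm, if_neg (Fin.castSucc_ne_last i).symm]
  congr 1
  · refine Finset.prod_congr rfl fun j _ => ?_
    simp only [h1]
    split_ifs with hj
    · rfl
    · simp only [phi, zeta_castSucc, off, nsq_of_ne (Fin.castSucc_ne_last _),
        mlt_of_ne (Fin.castSucc_ne_last _) (Fin.castSucc_ne_last _)]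
      congr 2 <;> (push_cast; ring)
  · simp only [phi, zeta_castSucc, zeta_last, off, nsq_of_ne (Fin.castSucc_ne_last _), nsq_last,
        mlt_last]
    congr 2 <;> (push_cast; ring)

lemma coeffLast_eq (z : Fin (n + 1) → ℂ) : coeffLast h m z = aco h m (Fin.last n) z := by
  rw [aco, prod_erase_eq_ite, Fin.prod_univ_castSucc, coeffLast, wt, if_pos rfl, if_pos rfl,
    mul_one]
  congr 1
  refine Finset.prod_congr rfl fun j _ => ?_
  rw [if_neg (Fin.castSucc_ne_last j)]
  simp only [phi, zeta_castSucc, zeta_last, off, nsq_of_ne (Fin.castSucc_ne_last _), nsq_last,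
        mlt_comm (Fin.last n), mlt_last]
  congr 2 <;> (push_cast; ring)

lemma opD_apply (F : (Fin (n + 1) → ℂ) → ℂ) (z : Fin (n + 1) → ℂ) :
    opD n h m F z = ∑ i, aco h m i z * F (z + eps m i) := by
  rw [Fin.sum_univ_castSucc, ← coeffLast_eq]
  simp only [← coeffA_eq]
  rfl

lemma orbitSum_eq (x : Fin (n + 1) → ℂ) :
    orbitSum h m x = ∑ i, wt h m i * qpow h (2 * zeta m i x) := by
  rw [Fin.sum_univ_castSucc, orbitSum, zeta_last]
  simp only [zeta_castSucc, wt, Fin.castSucc_ne_last, if_false, if_true, one_mul]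
  congr 3
  ring

lemma offPoles_iff (z : Fin (n + 1) → ℂ) : OffPoles h m z ↔
    ∀ i j, i ≠ j → qnum h (zeta m i z - zeta m j z - off m i j) ≠ 0 := by
  constructor
  · rintro ⟨h1, h2⟩ i j hij
    induction i using Fin.lastCases with
    | last =>
      induction j using Fin.lastCases with
      | last => exact absurd rfl hij
      | cast j =>
        have := h2 j
        rw [← neg_ne_zero, ← qnum_neg] at this
        convert this using 2
        simp only [zeta_castSucc, zeta_last, off, nsq_of_ne (Fin.castSucc_ne_last _), nsq_last]
        push_cast; ring
    | cast i =>
      induction j using Fin.lastCases with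
      | last =>
        convert h2 i using 2
        simp only [zeta_castSucc, zeta_last, off, nsq_of_ne (Fin.castSucc_ne_last _), nsq_last]
        push_cast; ring
      | cast j =>
        convert h1 i j (fun hh => hij (by rw [hh])) using 2
        simp only [zeta_castSucc, off, nsq_of_ne (Fin.castSucc_ne_last _)]
        push_cast; ring
  · intro H
    refine ⟨fun i j hij => ?_, fun i => ?_⟩
    · convert H i.castSucc j.castSucc (fun hh => hij (Fin.castSucc_injective n hh)) using 2
      simp only [zeta_castSucc, off, nsq_of_ne (Fin.castSucc_ne_last _)]
      push_cast; ring
    · convert H i.castSucc (Fin.last n) (Fin.castSucc_ne_last i) using 2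
      simp only [zeta_castSucc, zeta_last, off, nsq_of_ne (Fin.castSucc_ne_last _), nsq_last]
      push_cast; ring

lemma qnum_swap (i j : Fin (n + 1)) (z : Fin (n + 1) → ℂ) :
    qnum h (zeta m j z - zeta m i z - off m j i) = -qnum h (zeta m i z - zeta m j z - off m i j) := by
  rw [← qnum_neg, off_swap]; congr 1; ring

lemma offPoles_iff_lt (z : Fin (n + 1) → ℂ) : OffPoles h m z ↔
    ∀ e : PosRoot n, qnum h (zeta m e.1.1 z - zeta m e.1.2 z - off m e.1.1 e.1.2) ≠ 0 := by
  rw [offPoles_iff]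
  refine ⟨fun H e => H _ _ e.2.ne, fun H i j hij => ?_⟩
  rcases lt_or_gt_of_ne hij with hlt | hlt
  · exact H ⟨(i, j), hlt⟩
  · rw [qnum_swap, neg_ne_zero]
    exact H ⟨(j, i), hlt⟩

/-- The operator conjugated by `q^{2(y,z)}`. -/
def tD (h : ℂ) (m : ℕ) (y : Fin (n + 1) → ℂ) (F : (Fin (n + 1) → ℂ) → ℂ) (z : Fin (n + 1) → ℂ) :
    ℂ := ∑ i, aco h m i z * (qpow h (2 * zeta m i y) * F (z + eps m i))

/-- Multiplication by `q^{2(y,z)}`. -/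
def tw (h : ℂ) (y : Fin (n + 1) → ℂ) (F : (Fin (n + 1) → ℂ) → ℂ) (z : Fin (n + 1) → ℂ) : ℂ :=
  qpow h (2 * pair y z) * F z

lemma qpow_pair_eps (y z : Fin (n + 1) → ℂ) (i : Fin (n + 1)) :
    qpow h (2 * pair y (z + eps m i)) = qpow h (2 * pair y z) * qpow h (2 * zeta m i y) := by
  rw [pair_add_right, pair_eps, mul_add, qpow_add]

lemma opD_tw (y : Fin (n + 1) → ℂ) (F : (Fin (n + 1) → ℂ) → ℂ) (z : Fin (n + 1) → ℂ) :
    opD n h m (tw h y F) z = tw h y (tD h m y F) z := by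
  rw [opD_apply, tw, tD, Finset.mul_sum]
  refine Finset.sum_congr rfl fun i _ => ?_
  rw [tw, qpow_pair_eps]
  ring

/-- Quasi-invariance of `q^{2(y,z)} F(z)`, on the main hyperplanes. -/
def TQ (h : ℂ) (m : ℕ) (y : Fin (n + 1) → ℂ) (F : (Fin (n + 1) → ℂ) → ℂ) : Prop :=
  ∀ i j, i < j → ∀ s : ℕ, 1 ≤ s → s ≤ mlt m i j → ∀ z, zeta m i z = zeta m j z + off m i j →
    qpow h (2 * zeta m i y) ^ s * F (z + (s : ℂ) • eps m i) =
      qpow h (2 * zeta m j y) ^ s * F (z + (s : ℂ) • eps m j)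

lemma qpow_pair_smul_eps (y z : Fin (n + 1) → ℂ) (s : ℕ) (i : Fin (n + 1)) :
    qpow h (2 * pair y (z + (s : ℂ) • eps m i)) =
      qpow h (2 * pair y z) * qpow h (2 * zeta m i y) ^ s := by
  rw [← qpow_nat_mul, ← qpow_add]
  congr 1
  have : pair y ((s : ℂ) • eps m i) = s * zeta m i y := by
    rw [← pair_eps]
    simp only [pair, Pi.smul_apply, smul_eq_mul, Finset.mul_sum]
    exact Finset.sum_congr rfl fun _ _ => by ring
  rw [pair_add_right, this]
  ring

/-- The condition is imposed modulo the period of `q^{2 ·}`, while `TQ` only concerns the main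
hyperplane. The factor `q^{2(y,z)}`, which is not periodic, is common to both sides and is cancelled
before `z` is moved to the main hyperplane; `F` depends only on the exponentials. -/
lemma mem_quasiInv_aux (hm : 1 ≤ m) {F : (Fin (n + 1) → ℂ) → ℂ} (hF : IsPoly h m F)
    {y : Fin (n + 1) → ℂ} {i j : Fin (n + 1)} {s : ℕ} (hij : i < j)
    (H : ∀ z, zeta m i z = zeta m j z + off m i j →
      qpow h (2 * zeta m i y) ^ s * F (z + (s : ℂ) • eps m i) =
      qpow h (2 * zeta m j y) ^ s * F (z + (s : ℂ) • eps m j)) (z : Fin (n + 1) → ℂ)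
    (hz : qpow h (2 * (zeta m i z - zeta m j z - off m i j)) = 1) :
    tw h y F (z + (s : ℂ) • eps m i) = tw h y F (z + (s : ℂ) • eps m j) := by
  simp only [tw, qpow_pair_smul_eps, mul_assoc]
  congr 1
  set z' : Fin (n + 1) → ℂ := pt m (Function.update (fun k => zeta m k z) i
    (zeta m j z + off m i j)) with hz'
  have hzi : zeta m i z' = zeta m j z + off m i j := by rw [hz', zeta_pt hm]; simp
  have hzk : ∀ k, k ≠ i → zeta m k z' = zeta m k z := fun k hk => by
    rw [hz', zeta_pt hm]; simp [hk]
  have hc : ∀ v : Fin (n + 1) → ℂ, F (z + v) = F (z' + v) := by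
    intro v
    refine hF.congr fun k => ?_
    rw [zeta_add, zeta_add, mul_add, mul_add, qpow_add, qpow_add]
    congr 1
    by_cases hk : k = i
    · subst hk
      rw [hzi]
      have : 2 * zeta m k z = 2 * (zeta m k z - zeta m j z - off m k j) +
        2 * (zeta m j z + off m k j) := by ring
      rw [this, qpow_add, hz, one_mul]
    · rw [hzk k hk]
  rw [hc, hc]
  exact H z' (by rw [hzi, hzk j hij.ne'])

lemma quasiInvariant_tw_iff (hm : 1 ≤ m) {F : (Fin (n + 1) → ℂ) → ℂ}
    (hF : IsPoly h m F) (y : Fin (n + 1) → ℂ) : QuasiInvariant h m (tw h y F) ↔ TQ h m y F := by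
  constructor
  · rintro ⟨h1, h2⟩ i j hij s hs1 hs2 z hz
    have key : tw h y F (z + (s : ℂ) • eps m i) = tw h y F (z + (s : ℂ) • eps m j) := by
      induction i using Fin.lastCases with
      | last => exact absurd hij (not_lt.2 (Fin.le_last j))
      | cast i =>
        induction j using Fin.lastCases with
        | last =>
          rw [mlt_last] at hs2
          obtain rfl : s = 1 := le_antisymm hs2 hs1
          have := h2 i z ?_
          · simpa [cvec_basisVec] using this
          · simp only [zeta_castSucc, zeta_last, off, nsq_of_ne (Fin.castSucc_ne_last _),
              nsq_last] at hz
            rw [hz]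
            congr 1
            push_cast; ring
        | cast j =>
          rw [mlt_of_ne (Fin.castSucc_ne_last _) (Fin.castSucc_ne_last _)] at hs2
          refine h1 s hs1 hs2 i j (by simpa using hij) z ?_
          simp only [zeta_castSucc, off, nsq_of_ne (Fin.castSucc_ne_last _)] at hz
          rw [hz]
          congr 1
          push_cast; ring
    simp only [tw, qpow_pair_smul_eps, mul_assoc] at key
    exact mul_left_cancel₀ (qpow_ne_zero _) key
  · intro H
    constructor
    · intro s hs1 hs2 i j hij z hz
      refine mem_quasiInv_aux hm hF (i := i.castSucc) (j := j.castSucc) (by simpa using hij)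
        (H _ _ (by simpa using hij) s hs1
          (by rwa [mlt_of_ne (Fin.castSucc_ne_last _) (Fin.castSucc_ne_last _)])) z ?_
      simp only [zeta_castSucc, off, nsq_of_ne (Fin.castSucc_ne_last _)]
      rw [sub_self, zero_div, sub_zero, mul_sub, qpow_sub, hz, div_self (qpow_ne_zero _)]
    · intro i z hz
      have := mem_quasiInv_aux hm hF (i := i.castSucc) (j := Fin.last n) (s := 1)
        (Fin.castSucc_lt_last i)
        (H _ _ (Fin.castSucc_lt_last i) 1 le_rfl (by rw [mlt_last])) z ?_
      · simpa [cvec_basisVec] using this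
      · simp only [zeta_castSucc, zeta_last, off, nsq_of_ne (Fin.castSucc_ne_last _), nsq_last]
        have : 2 * (z i.castSucc - (Real.sqrt m : ℂ) * z (Fin.last n) - ((m : ℂ) - (1 : ℕ)) / 2) =
          (1 - m + 2 * z i.castSucc) - 2 * (Real.sqrt m : ℂ) * z (Fin.last n) := by
          push_cast; ring
        rw [this, qpow_sub, hz, div_self (qpow_ne_zero _)]

lemma tw_zero (F : (Fin (n + 1) → ℂ) → ℂ) : tw h 0 F = F := by
  funext z; simp [tw, pair, qpow_zero]

/-! ### Singular hyperplanes and division -/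

/-- The defining equation of a singular hyperplane. -/
def lin (h : ℂ) (m : ℕ) (i j : Fin (n + 1)) (z : Fin (n + 1) → ℂ) : ℂ :=
  qpow h (2 * zeta m i z) - qpow h (2 * off m i j) * qpow h (2 * zeta m j z)

/-- The numerator of `phi`. -/
def plin (h : ℂ) (m : ℕ) (i j : Fin (n + 1)) (z : Fin (n + 1) → ℂ) : ℂ :=
  qpow h (-(mlt m i j * nsq m i)) * qpow h (2 * zeta m i z) -
    qpow h (mlt m i j * nsq m i + 2 * off m i j) * qpow h (2 * zeta m j z)

lemma isPoly_qpow_zeta (i : Fin (n + 1)) :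
    IsPoly h m fun z : Fin (n + 1) → ℂ => qpow h (2 * zeta m i z) := by
  have : (fun z : Fin (n + 1) → ℂ => qpow h (2 * zeta m i z)) = mono h m (Pi.single i 1) := by
    funext z; rw [mono_single]
  rw [this]
  exact isPoly_mono _

lemma isPoly_lin (i j : Fin (n + 1)) : IsPoly h m (lin h m i j) :=
  (isPoly_qpow_zeta i).sub ((isPoly_qpow_zeta j).const_mul _)

lemma isPoly_plin (i j : Fin (n + 1)) : IsPoly h m (plin h m i j) :=
  ((isPoly_qpow_zeta i).const_mul _).sub ((isPoly_qpow_zeta j).const_mul _)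

lemma lin_eq (i j : Fin (n + 1)) (z : Fin (n + 1) → ℂ) : lin h m i j z =
    qpow h (zeta m i z + zeta m j z + off m i j) *
      qnum h (zeta m i z - zeta m j z - off m i j) := by
  rw [qnum, lin, mul_sub, ← qpow_add, ← qpow_add, ← qpow_add]
  congr 2 <;> ring

lemma lin_ne_zero_iff (i j : Fin (n + 1)) (z : Fin (n + 1) → ℂ) : lin h m i j z ≠ 0 ↔
    qnum h (zeta m i z - zeta m j z - off m i j) ≠ 0 := by
  rw [lin_eq, mul_ne_zero_iff]
  simp [qpow_ne_zero]

lemma lin_of_eq {i j : Fin (n + 1)} {z : Fin (n + 1) → ℂ}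
    (hz : zeta m i z = zeta m j z + off m i j) : lin h m i j z = 0 := by
  rw [lin, hz, ← qpow_add]
  simp only [mul_add, add_comm, sub_self]

lemma lin_swap (i j : Fin (n + 1)) (z : Fin (n + 1) → ℂ) :
    lin h m i j z = -qpow h (2 * off m i j) * lin h m j i z := by
  simp only [lin, off_swap i j, mul_sub]
  have : qpow h (2 * off m i j) * qpow h (2 * -off m i j) = 1 := by
    rw [← qpow_add, ← qpow_zero (h := h)]; congr 1; ring
  linear_combination (-qpow h (2 * zeta m i z)) * this

lemma phi_mul_lin (i j : Fin (n + 1)) (z : Fin (n + 1) → ℂ)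
    (hz : qnum h (zeta m i z - zeta m j z - off m i j) ≠ 0) :
    phi h m i j z * lin h m i j z = plin h m i j z := by
  rw [phi, lin_eq, div_mul_eq_mul_div, mul_comm (qpow h _), ← mul_assoc, mul_right_comm,
    mul_div_assoc, div_self hz, mul_one, qnum, sub_mul, ← qpow_add, ← qpow_add, plin,
    ← qpow_add, ← qpow_add]
  congr 2 <;> ring

/-- Projection to the main hyperplane labelled by `i ≠ j`. -/
def toHyp (m : ℕ) (i j : Fin (n + 1)) (z : Fin (n + 1) → ℂ) : Fin (n + 1) → ℂ :=
  Function.update z i ((zeta m j z + off m i j) / kap m i)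

lemma zeta_toHyp_self (hm : 1 ≤ m) (i j : Fin (n + 1)) (z : Fin (n + 1) → ℂ) :
    zeta m i (toHyp m i j z) = zeta m j z + off m i j := by
  have : (kap m i : ℂ) ≠ 0 := by exact_mod_cast kap_ne_zero hm i
  simp only [toHyp, zeta, Function.update_self]
  field_simp

lemma zeta_toHyp_of_ne {i j k : Fin (n + 1)} (hk : k ≠ i) (z : Fin (n + 1) → ℂ) :
    zeta m k (toHyp m i j z) = zeta m k z := by
  simp [toHyp, zeta, hk]

lemma toHyp_of_eq (hm : 1 ≤ m) {i j : Fin (n + 1)} {z : Fin (n + 1) → ℂ}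
    (hz : zeta m i z = zeta m j z + off m i j) : toHyp m i j z = z := by
  have : (kap m i : ℂ) ≠ 0 := by exact_mod_cast kap_ne_zero hm i
  rw [toHyp, ← hz, zeta, mul_div_cancel_left₀ _ this, Function.update_eq_self]

lemma continuous_zeta (i : Fin (n + 1)) : Continuous (zeta m i : (Fin (n + 1) → ℂ) → ℂ) :=
  AnalyticOnNhd.cont (analytic_zeta i)

lemma continuous_toHyp (i j : Fin (n + 1)) :
    Continuous (toHyp m i j : (Fin (n + 1) → ℂ) → _) := by
  unfold toHyp
  exact continuous_id.update i (((continuous_zeta j).add continuous_const).div_const _)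

/-- The geometric sum handles `k ≥ 0`; for negative exponents `f^{-k} - g^{-k} = -(f^k - g^k) f^{-k}
g^{-k}`, which is where the inverses have to be polynomials. -/
lemma pow_sub_zpow_dvd (f g : (Fin (n + 1) → ℂ) → ℂ) (hf : IsPoly h m f) (hg : IsPoly h m g)
    (hf' : IsPoly h m fun z => (f z)⁻¹) (hg' : IsPoly h m fun z => (g z)⁻¹)
    (hf0 : ∀ z, f z ≠ 0) (hg0 : ∀ z, g z ≠ 0) (k : ℤ) :
    ∃ r, IsPoly h m r ∧ ∀ z, f z ^ k - g z ^ k = (f z - g z) * r z := by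
  have hpow : ∀ {u : (Fin (n + 1) → ℂ) → ℂ}, IsPoly h m u → ∀ k : ℕ, IsPoly h m (u ^ k) := by
    intro u hu k
    induction k with
    | zero => rw [pow_zero]; exact isPoly_const h m 1
    | succ k ih => rw [pow_succ]; exact ih.mul hu
  have hnat : ∀ k : ℕ, ∃ r, IsPoly h m r ∧ ∀ z, f z ^ k - g z ^ k = (f z - g z) * r z := by
    intro k
    refine ⟨∑ i ∈ Finset.range k, f ^ i * g ^ (k - 1 - i),
      isPoly_sum' _ _ fun i _ => (hpow hf _).mul (hpow hg _), fun z => ?_⟩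
    rw [Finset.sum_apply]
    exact ((Commute.all (f z) (g z)).mul_geom_sum₂ k).symm
  obtain ⟨k, rfl | rfl⟩ := k.eq_nat_or_neg
  · simpa using hnat k
  · obtain ⟨r, hr, hrz⟩ := hnat k
    refine ⟨fun z => -1 * (r * ((fun z => (f z)⁻¹) ^ k * (fun z => (g z)⁻¹) ^ k)) z,
      (hr.mul ((hpow hf' k).mul (hpow hg' k))).const_mul (-1), fun z => ?_⟩
    have h1 := hrz z
    have h2 := pow_ne_zero k (hf0 z)
    have h3 := pow_ne_zero k (hg0 z)
    simp only [zpow_neg, zpow_natCast, Pi.mul_apply, Pi.pow_apply, inv_pow]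
    field_simp
    linear_combination -h1

lemma isPoly_zpow_zeta (i : Fin (n + 1)) (k : ℤ) :
    IsPoly h m fun z : Fin (n + 1) → ℂ => qpow h (2 * zeta m i z) ^ k := by
  have : (fun z : Fin (n + 1) → ℂ => qpow h (2 * zeta m i z) ^ k) = mono h m (Pi.single i k) := by
    funext z; rw [mono_single_int]
  rw [this]
  exact isPoly_mono _

/-- A Laurent polynomial vanishing on the main hyperplane is divisible by its equation. -/
lemma exists_div_lin (hm : 1 ≤ m) {i j : Fin (n + 1)} (hij : i ≠ j) {f : (Fin (n + 1) → ℂ) → ℂ}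
    (hf : IsPoly h m f) (hv : ∀ z, zeta m i z = zeta m j z + off m i j → f z = 0) :
    ∃ g, IsPoly h m g ∧ f = lin h m i j * g := by
  obtain ⟨c, rfl⟩ := (isPoly_iff f).1 hf
  -- Moving a monomial to the hyperplane replaces `u = q^{2ζ_i}` by `v = q^{2 off} q^{2ζ_j}` in the
  -- power with exponent `p i` and changes nothing else, so the difference is divisible by `u - v`,
  -- which is `lin`.
  have key : ∀ p : Fin (n + 1) → ℤ, ∃ r, IsPoly h m r ∧
      ∀ z, mono h m p z - mono h m p (toHyp m i j z) = lin h m i j z * r z := by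
    intro p
    obtain ⟨r, hr, hrz⟩ := pow_sub_zpow_dvd (h := h) (m := m)
      (fun z : Fin (n + 1) → ℂ => qpow h (2 * zeta m i z))
      (fun z => qpow h (2 * off m i j) * qpow h (2 * zeta m j z)) (isPoly_qpow_zeta i)
      ((isPoly_qpow_zeta j).const_mul _) (by simpa using isPoly_zpow_zeta (h := h) (m := m) i (-1))
      (by
        have := (isPoly_zpow_zeta (h := h) (m := m) j (-1)).const_mul (qpow h (2 * off m i j))⁻¹
        simpa [mul_comm] using this)
      (fun z => qpow_ne_zero _) (fun z => mul_ne_zero (qpow_ne_zero _) (qpow_ne_zero _)) (p i)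
    refine ⟨mono h m (Function.update p i 0) * r, (isPoly_mono _).mul hr, fun z => ?_⟩
    have hsplit : ∀ z, mono h m p z =
        qpow h (2 * zeta m i z) ^ (p i) * mono h m (Function.update p i 0) z := by
      intro z
      rw [← mono_single_int, ← mono_add]
      congr 1
      funext k
      by_cases hk : k = i
      · subst hk; simp
      · simp [hk]
    have hrest : mono h m (Function.update p i 0) (toHyp m i j z) =
        mono h m (Function.update p i 0) z := by
      simp only [mono]
      congr 2
      refine Finset.sum_congr rfl fun k _ => ?_
      by_cases hk : k = i
      · subst hk; simp
      · rw [zeta_toHyp_of_ne hk]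
    rw [hsplit z, hsplit (toHyp m i j z), hrest, zeta_toHyp_self hm, mul_add, qpow_add,
      mul_comm (qpow h (2 * zeta m j z)), ← sub_mul, hrz, lin, Pi.mul_apply]
    ring
  choose r hr hrz using key
  refine ⟨∑ p ∈ c.support, fun z => c p * r p z,
    isPoly_sum' _ _ fun p _ => (hr p).const_mul _, ?_⟩
  funext z
  have h1 : ev h m c (toHyp m i j z) = 0 := by
    refine hv _ ?_
    rw [zeta_toHyp_self hm, zeta_toHyp_of_ne hij.symm]
  rw [← sub_zero (ev h m c z), ← h1, ev_apply, ev_apply, ← Finset.sum_sub_distrib, Pi.mul_apply,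
    Finset.sum_apply, Finset.mul_sum]
  refine Finset.sum_congr rfl fun p _ => ?_
  rw [← mul_sub, hrz]
  ring

/-! ### Genericity of points off the singular hyperplanes. -/

lemma qnum_analytic (k l : Fin (n + 1)) (v : Fin (n + 1) → ℂ) : AnalyticOnNhd ℂ
    (fun z : Fin (n + 1) → ℂ => qnum h (zeta m k (z + v) - zeta m l (z + v) - off m k l))
    Set.univ := by
  refine AnalyticOnNhd.qnum ?_
  simp only [zeta_add]
  exact ((((analytic_zeta k).add analyticOnNhd_const)).sub
    ((analytic_zeta l).add analyticOnNhd_const)).sub analyticOnNhd_const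

lemma toHyp_analytic (i j k : Fin (n + 1)) :
    AnalyticOnNhd ℂ (fun z : Fin (n + 1) → ℂ => zeta m k (toHyp m i j z)) Set.univ := by
  by_cases hk : k = i
  · subst hk
    have : (fun z : Fin (n + 1) → ℂ => zeta m k (toHyp m k j z)) =
        fun z => kap m k * ((zeta m j z + off m k j) / kap m k) := by
      funext z; simp [toHyp, zeta]
    rw [this]
    simp only [div_eq_mul_inv]
    exact analyticOnNhd_const.mul (((analytic_zeta j).add analyticOnNhd_const).mul
      analyticOnNhd_const)
  · simp only [zeta_toHyp_of_ne hk]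
    exact analytic_zeta k

lemma qnum_toHyp_analytic (i j k l : Fin (n + 1)) (v : Fin (n + 1) → ℂ) : AnalyticOnNhd ℂ
    (fun z : Fin (n + 1) → ℂ =>
      qnum h (zeta m k (toHyp m i j z + v) - zeta m l (toHyp m i j z + v) - off m k l))
    Set.univ := by
  refine AnalyticOnNhd.qnum ?_
  simp only [zeta_add]
  exact ((((toHyp_analytic i j k).add analyticOnNhd_const)).sub
    ((toHyp_analytic i j l).add analyticOnNhd_const)).sub analyticOnNhd_const

/-- At this argument `q^{2a}` equals the real number `e`; it provides an explicit nonzero value for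
every `h ≠ 0`. -/
lemma qnum_half (h0 : h ≠ 0) : qnum h (1 / (2 * h)) ≠ 0 := by
  rw [ne_eq, qnum_eq_zero_iff, qpow]
  have : h * (2 * (1 / (2 * h))) = ((1 : ℝ) : ℂ) := by field_simp; simp
  rw [this, ← Complex.ofReal_exp]
  have h1 : Real.exp 1 ≠ 1 := by simp
  exact_mod_cast h1

/-- Distinct singular hyperplanes do not contain each other. -/
lemma qnum_toHyp_ne_zero (hm : 1 ≤ m) (h0 : h ≠ 0) {i j k l : Fin (n + 1)} (hij : i < j)
    (hkl : k < l) (hne : ¬(k = i ∧ l = j)) (v : Fin (n + 1) → ℂ) :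
    (fun z : Fin (n + 1) → ℂ =>
      qnum h (zeta m k (toHyp m i j z + v) - zeta m l (toHyp m i j z + v) - off m k l)) ≠ 0 := by
  -- It suffices to find a point of the hyperplane of `(i, j)` at which the argument of the q-number
  -- is `1 / (2h)`. A coordinate that stays free on that hyperplane is adjusted, according to which
  -- indices coincide.
  suffices H : ∃ w : Fin (n + 1) → ℂ, zeta m k (toHyp m i j (pt m w)) -
      zeta m l (toHyp m i j (pt m w)) =
      1 / (2 * h) + off m k l - zeta m k v + zeta m l v by
    obtain ⟨w, hw⟩ := H
    intro hzero
    have h1 := congrFun hzero (pt m w)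
    simp only [zeta_add, Pi.zero_apply] at h1
    refine qnum_half h0 ?_
    rw [← h1]
    congr 1
    linear_combination -hw
  generalize 1 / (2 * h) + off m k l - zeta m k v + zeta m l v = a
  by_cases hk : k = i
  · subst hk
    have hlj : l ≠ j := fun hl => hne ⟨rfl, hl⟩
    refine ⟨Pi.single j (a - off m k j), ?_⟩
    rw [zeta_toHyp_self hm, zeta_toHyp_of_ne hkl.ne', zeta_pt hm, zeta_pt hm]
    simp [hlj]
  by_cases hl : l = i
  · subst hl
    have hkj : k ≠ j := (hkl.trans hij).ne
    refine ⟨Pi.single k (a + off m l j), ?_⟩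
    rw [zeta_toHyp_self hm, zeta_toHyp_of_ne hk, zeta_pt hm, zeta_pt hm]
    simp [hkj.symm]
  · refine ⟨Pi.single k a, ?_⟩
    rw [zeta_toHyp_of_ne hk, zeta_toHyp_of_ne hl, zeta_pt hm, zeta_pt hm]
    simp [hkl.ne']

lemma qnum_ne_zero_fun (hm : 1 ≤ m) (h0 : h ≠ 0) {k l : Fin (n + 1)} (hkl : k ≠ l)
    (v : Fin (n + 1) → ℂ) :
    (fun z : Fin (n + 1) → ℂ => qnum h (zeta m k (z + v) - zeta m l (z + v) - off m k l)) ≠ 0 := by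
  intro hzero
  have h1 := congrFun hzero
    (pt m (Pi.single k (1 / (2 * h) + off m k l - zeta m k v + zeta m l v)))
  simp only [zeta_add, zeta_pt hm, Pi.zero_apply, Pi.single_eq_same, Pi.single_eq_of_ne hkl.symm]
    at h1
  refine qnum_half h0 ?_
  rw [← h1]
  congr 1
  ring

lemma dense_forall_ne_zero {ι : Type*} [Fintype ι] (f : ι → (Fin (n + 1) → ℂ) → ℂ)
    (hf : ∀ i, AnalyticOnNhd ℂ (f i) Set.univ) (h0 : ∀ i, f i ≠ 0) :
    Dense {z | ∀ i, f i z ≠ 0} := by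
  refine (dense_ne_zero (analytic_prod Finset.univ f fun i _ => hf i)
    (analytic_prod_ne_zero Finset.univ f (fun i _ => hf i) fun i _ => h0 i)).mono fun z hz i => ?_
  rw [Set.mem_ofPred_eq, Finset.prod_apply] at hz
  exact Finset.prod_ne_zero_iff.1 hz i (Finset.mem_univ i)

lemma dense_offPoles (hm : 1 ≤ m) (h0 : h ≠ 0) (v : Fin (n + 1) → ℂ) :
    Dense {z : Fin (n + 1) → ℂ | OffPoles h m (z + v)} := by
  refine (dense_forall_ne_zero (fun (e : PosRoot n) (z : Fin (n + 1) → ℂ) =>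
    qnum h (zeta m e.1.1 (z + v) - zeta m e.1.2 (z + v) - off m e.1.1 e.1.2))
    (fun e => qnum_analytic _ _ v) fun e => qnum_ne_zero_fun hm h0 e.2.ne v).mono fun z hz => ?_
  exact (offPoles_iff_lt _).2 hz

lemma dense_offPoles' (hm : 1 ≤ m) (h0 : h ≠ 0) :
    Dense {z : Fin (n + 1) → ℂ | OffPoles h m z} := by
  simpa using dense_offPoles (n := n) hm h0 0

/-- On the main hyperplane of `a`, points off the other singular hyperplanes are dense. -/
lemma dense_toHyp (hm : 1 ≤ m) (h0 : h ≠ 0) (a : PosRoot n) (v : Fin (n + 1) → ℂ) :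
    Dense {z : Fin (n + 1) → ℂ | ∀ e : PosRoot n, e ≠ a →
      qnum h (zeta m e.1.1 (toHyp m a.1.1 a.1.2 z + v) - zeta m e.1.2 (toHyp m a.1.1 a.1.2 z + v) -
        off m e.1.1 e.1.2) ≠ 0} := by
  refine (dense_forall_ne_zero (ι := {e : PosRoot n // e ≠ a}) (fun e (z : Fin (n + 1) → ℂ) =>
    qnum h (zeta m e.1.1.1 (toHyp m a.1.1 a.1.2 z + v) -
      zeta m e.1.1.2 (toHyp m a.1.1 a.1.2 z + v) - off m e.1.1.1 e.1.1.2))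
    (fun e => qnum_toHyp_analytic _ _ _ _ v) fun e =>
      qnum_toHyp_ne_zero hm h0 a.2 e.1.2 (fun hh => e.2 (Subtype.ext (Prod.ext hh.1 hh.2))) v).mono
      fun z hz e he => ?_
  exact hz ⟨e, he⟩

/-- Division by the product of the equations of all singular hyperplanes. -/
lemma exists_div_prod_lin (hm : 1 ≤ m) (h0 : h ≠ 0) {f : (Fin (n + 1) → ℂ) → ℂ}
    (hf : IsPoly h m f)
    (hv : ∀ a : PosRoot n, ∀ z, zeta m a.1.1 z = zeta m a.1.2 z + off m a.1.1 a.1.2 →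
      (∀ e : PosRoot n, e ≠ a → lin h m e.1.1 e.1.2 z ≠ 0) → f z = 0) :
    ∃ g, IsPoly h m g ∧ f = (∏ e : PosRoot n, lin h m e.1.1 e.1.2) * g := by
  classical
  suffices H : ∀ T : Finset (PosRoot n), ∃ g, IsPoly h m g ∧
      f = (∏ e ∈ T, lin h m e.1.1 e.1.2) * g from H Finset.univ
  intro T
  induction T using Finset.induction_on with
  | empty => exact ⟨f, hf, by simp⟩
  | insert a T ha ih =>
    obtain ⟨g, hg, hfg⟩ := ih
    -- At a point of the hyperplane of `a` lying on no other singular hyperplane the factors already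
    -- split off are nonzero, so `g` vanishes with `f`. Such points are dense in the hyperplane.
    have hvan : ∀ z, zeta m a.1.1 z = zeta m a.1.2 z + off m a.1.1 a.1.2 → g z = 0 := by
      have h1 : (fun z => g (toHyp m a.1.1 a.1.2 z)) = 0 := by
        refine Continuous.ext_on (dense_toHyp hm h0 a 0)
          (hg.continuous.comp (continuous_toHyp _ _)) continuous_const fun z hz => ?_
        simp only [Set.mem_ofPred_eq, add_zero] at hz
        have h2 := hv a (toHyp m a.1.1 a.1.2 z)
          (by rw [zeta_toHyp_self hm, zeta_toHyp_of_ne a.2.ne'])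
          fun e he => (lin_ne_zero_iff _ _ _).2 (hz e he)
        rw [hfg, Pi.mul_apply, Finset.prod_apply] at h2
        refine (mul_eq_zero.1 h2).resolve_left (Finset.prod_ne_zero_iff.2 fun e he => ?_)
        exact (lin_ne_zero_iff _ _ _).2 (hz e (fun hea => ha (hea ▸ he)))
      intro z hz
      have := congrFun h1 z
      simpa only [toHyp_of_eq hm hz, Pi.zero_apply] using this
    obtain ⟨g', hg', hgg'⟩ := exists_div_lin hm a.2.ne hg hvan
    refine ⟨g', hg', ?_⟩
    rw [Finset.prod_insert ha, hfg, hgg']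
    ring

/-! ### Identities between the coefficients on a singular hyperplane -/

lemma zeta_shift (k i : Fin (n + 1)) (z : Fin (n + 1) → ℂ) (s : ℂ) :
    zeta m k (z + s • eps m i) = zeta m k z + if k = i then s * nsq m k else 0 := by
  rw [zeta_add, zeta_smul, zeta_eps]
  split_ifs <;> simp

lemma zeta_shift_self (i : Fin (n + 1)) (z : Fin (n + 1) → ℂ) (s : ℂ) :
    zeta m i (z + s • eps m i) = zeta m i z + s * nsq m i := by
  rw [zeta_shift, if_pos rfl]

lemma zeta_shift_of_ne {k i : Fin (n + 1)} (hk : k ≠ i) (z : Fin (n + 1) → ℂ) (s : ℂ) :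
    zeta m k (z + s • eps m i) = zeta m k z := by
  rw [zeta_shift, if_neg hk, add_zero]

/-- The offsets satisfy `off i l = off i j + off j l`, and `mlt i l * nsq i = mlt j l * nsq j`.
Hence numerator and denominator have equal arguments on the hyperplane of `(i, j)`. -/
lemma phi_eq_of_hyp {i j l : Fin (n + 1)} (hij : i < j) (hli : l ≠ i) (hlj : l ≠ j)
    {z : Fin (n + 1) → ℂ} (hz : zeta m i z = zeta m j z + off m i j) :
    phi h m i l z = phi h m j l z := by
  have hi : i ≠ Fin.last n := (hij.trans_le (Fin.le_last j)).ne
  by_cases hj : j = Fin.last n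
  · subst hj
    simp only [phi, hz, off, nsq_of_ne hi, nsq_of_ne hlj, mlt_of_ne hi hlj, mlt_comm _ l,
      mlt_last, nsq_last]
    congr 2 <;> (push_cast; ring)
  · by_cases hl : l = Fin.last n
    · subst hl
      simp only [phi, hz, off, nsq_of_ne hi, nsq_of_ne hj, mlt_last, nsq_last]
      congr 2 <;> (push_cast; ring)
    · simp only [phi, hz, off, nsq_of_ne hi, nsq_of_ne hj, nsq_of_ne hl, mlt_of_ne hi hl,
        mlt_of_ne hj hl]
      congr 2 <;> (push_cast; ring)

lemma phi_shift_of_ne {i l k : Fin (n + 1)} (hik : i ≠ k) (hlk : l ≠ k) (z : Fin (n + 1) → ℂ)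
    (s : ℂ) : phi h m i l (z + s • eps m k) = phi h m i l z := by
  rw [phi, phi, zeta_shift_of_ne hik, zeta_shift_of_ne hlk]

/-- When `j` is not last, the two shifts exchange the two factors. When `j` is last, `s = 1` and
each product telescopes, the numerator of one factor being the denominator of the other; the
assumptions on poles allow this cancellation. -/
lemma phi_mul_phi_shift {i j l : Fin (n + 1)} (hij : i < j) (hli : l ≠ i) (hlj : l ≠ j)
    {z : Fin (n + 1) → ℂ} (hz : zeta m i z = zeta m j z + off m i j) {s : ℕ} (hs1 : 1 ≤ s)
    (hs : s ≤ mlt m i j) (hp : OffPoles h m (z + (s : ℂ) • eps m i))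
    (hp' : OffPoles h m (z + (s : ℂ) • eps m j)) :
    phi h m l i (z + (s : ℂ) • eps m i) * phi h m l j (z + (s : ℂ) • eps m i) =
      phi h m l i (z + (s : ℂ) • eps m j) * phi h m l j (z + (s : ℂ) • eps m j) := by
  have hi : i ≠ Fin.last n := (hij.trans_le (Fin.le_last j)).ne
  have h1 := (offPoles_iff _).1 hp l i hli
  have h2 := (offPoles_iff _).1 hp' l j hlj
  simp only [phi, zeta_shift_of_ne hli, zeta_shift_of_ne hlj, zeta_shift_self,
    zeta_shift_of_ne hij.ne, zeta_shift_of_ne hij.ne'] at h1 h2 ⊢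
  by_cases hj : j = Fin.last n
  · subst hj
    rw [mlt_last] at hs
    obtain rfl : s = 1 := le_antisymm hs hs1
    simp only [hz, off, nsq_of_ne hi, nsq_of_ne hlj, mlt_of_ne hlj hi, mlt_last, nsq_last]
      at h1 h2 ⊢
    generalize zeta m (Fin.last n) z = a at *
    generalize zeta m l z = b at *
    have e1 : b - a - ((m : ℂ) - (1 : ℕ)) / 2 - (1 : ℕ) * (1 : ℕ) =
      b - (a + ((m : ℂ) - (1 : ℕ)) / 2 + (1 : ℕ) * (1 : ℕ)) - (((1 : ℕ) : ℂ) - (1 : ℕ)) / 2 := by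
      push_cast; ring
    have e2 : b - (a + ((m : ℂ) - (1 : ℕ)) / 2) - (((1 : ℕ) : ℂ) - (1 : ℕ)) / 2 - m * (1 : ℕ) =
      b - (a + (1 : ℕ) * m) - ((m : ℂ) - (1 : ℕ)) / 2 := by
      push_cast; ring
    have e3 : b - (a + ((m : ℂ) - (1 : ℕ)) / 2 + (1 : ℕ) * (1 : ℕ)) - (((1 : ℕ) : ℂ) - (1 : ℕ)) / 2 -
        m * (1 : ℕ) =
      b - (a + (1 : ℕ) * m) - ((m : ℂ) - (1 : ℕ)) / 2 - (1 : ℕ) * (1 : ℕ) := by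
      push_cast; ring
    have e4 : b - (a + ((m : ℂ) - (1 : ℕ)) / 2) - (((1 : ℕ) : ℂ) - (1 : ℕ)) / 2 =
      b - a - ((m : ℂ) - (1 : ℕ)) / 2 := by
      push_cast; ring
    rw [e1, e2, e3, e4]
    rw [div_mul_div_cancel₀ h1, mul_comm (_ / _), div_mul_div_cancel₀ h2]
  · rw [mul_comm]
    have hn : nsq m i = nsq m j := by rw [nsq_of_ne hi, nsq_of_ne hj]
    have ho : off m l i = off m l j := by rw [off, off, hn]
    have ho' : off m i j = 0 := by rw [off, hn]; simp
    have hm' : mlt m l i = mlt m l j := by simp [mlt, hi, hj]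
    rw [hz, ho, ho', hm', hn, add_zero]

/-- This relation dictates the weight `[1]/[m]` of the last coordinate. It makes the residues on a
singular hyperplane opposite, and it also gives the quasi-invariance of `𝔪`. -/
lemma wt_mul_qnum (hm : 1 ≤ m) (hq : NotRoot h) {i j : Fin (n + 1)} (hij : i < j) :
    wt h m i * qnum h (mlt m i j * nsq m i) = wt h m j * qnum h (mlt m i j * nsq m j) := by
  have hi : i ≠ Fin.last n := (hij.trans_le (Fin.le_last j)).ne
  by_cases hj : j = Fin.last n
  · subst hj
    have := hq.qnum_nat (k := m) (by omega)
    simp only [wt, if_neg hi, if_true, mlt_last, nsq_of_ne hi, nsq_last, Nat.cast_one, one_mul]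
    rw [div_mul_cancel₀ _ this]
  · simp [wt, hi, hj, nsq_of_ne]

lemma prod_erase_split {ι : Type*} [DecidableEq ι] [Fintype ι] {i j : ι} (hij : i ≠ j)
    (f : ι → ℂ) : ∏ k ∈ Finset.univ.erase i, f k =
      f j * ∏ k ∈ (Finset.univ.erase i).erase j, f k :=
  (Finset.mul_prod_erase _ _ (by simp [hij.symm])).symm

lemma prod_phi_eq_of_hyp {i j : Fin (n + 1)} (hij : i < j) {z : Fin (n + 1) → ℂ}
    (hz : zeta m i z = zeta m j z + off m i j) :
    ∏ k ∈ (Finset.univ.erase i).erase j, phi h m i k z =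
      ∏ k ∈ (Finset.univ.erase j).erase i, phi h m j k z := by
  rw [Finset.erase_right_comm]
  refine Finset.prod_congr rfl fun k hk => ?_
  simp only [Finset.mem_erase] at hk
  exact phi_eq_of_hyp hij hk.1 hk.2.1 hz

/-- Among the factors of the coefficient with index `l`, only those involving `i` or `j` see the
shifts, and their product is controlled by `phi_mul_phi_shift`. -/
lemma aco_third {i j l : Fin (n + 1)} (hij : i < j) (hli : l ≠ i) (hlj : l ≠ j)
    {z : Fin (n + 1) → ℂ} (hz : zeta m i z = zeta m j z + off m i j) {s : ℕ} (hs1 : 1 ≤ s)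
    (hs : s ≤ mlt m i j) (hp : OffPoles h m (z + (s : ℂ) • eps m i))
    (hp' : OffPoles h m (z + (s : ℂ) • eps m j)) :
    aco h m l (z + (s : ℂ) • eps m i) = aco h m l (z + (s : ℂ) • eps m j) := by
  have hj : j ∈ (Finset.univ.erase l).erase i := by simp [hij.ne', hlj.symm]
  rw [aco, aco, prod_erase_split hli, prod_erase_split hli,
    ← Finset.mul_prod_erase _ _ hj, ← Finset.mul_prod_erase _ _ hj, ← mul_assoc (phi h m l i _),
    ← mul_assoc (phi h m l i _), phi_mul_phi_shift hij hli hlj hz hs1 hs hp hp']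
  congr 2
  refine Finset.prod_congr rfl fun k hk => ?_
  simp only [Finset.mem_erase] at hk
  rw [phi_shift_of_ne hli hk.2.1, phi_shift_of_ne hlj hk.1]

/-- At the last admissible shift the numerator of `phi i j` is `[0]`, so no value beyond the range
of the quasi-invariance conditions is ever needed. -/
lemma aco_self_top {i j : Fin (n + 1)} (hij : i ≠ j) {z : Fin (n + 1) → ℂ}
    (hz : zeta m i z = zeta m j z + off m i j) :
    aco h m i (z + (mlt m i j : ℂ) • eps m i) = 0 := by
  have : phi h m i j (z + (mlt m i j : ℂ) • eps m i) = 0 := by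
    rw [phi, zeta_shift_self, zeta_shift_of_ne hij.symm, hz]
    have : zeta m j z + off m i j + mlt m i j * nsq m i - zeta m j z - off m i j -
      mlt m i j * nsq m i = 0 := by ring
    rw [this]
    simp [qnum]
  rw [aco, prod_erase_split hij, this]
  ring

lemma aco_self_eq {i j : Fin (n + 1)} (hij : i < j) {z : Fin (n + 1) → ℂ}
    (hz : zeta m i z = zeta m j z + off m i j) (hj : j ≠ Fin.last n) (s : ℂ) :
    aco h m i (z + s • eps m i) = aco h m j (z + s • eps m j) := by
  have hi : i ≠ Fin.last n := (hij.trans_le (Fin.le_last j)).ne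
  have hn : nsq m i = nsq m j := by rw [nsq_of_ne hi, nsq_of_ne hj]
  have ho' : off m i j = 0 := by rw [off, hn]; simp
  have hz' : zeta m i z = zeta m j z := by rw [hz, ho', add_zero]
  have hw : wt h m i = wt h m j := by simp [wt, hi, hj]
  rw [aco, aco, prod_erase_split hij.ne, prod_erase_split hij.ne', hw,
    Finset.erase_right_comm]
  congr 2
  · rw [phi, phi, zeta_shift_self, zeta_shift_self, zeta_shift_of_ne hij.ne',
      zeta_shift_of_ne hij.ne, hz', mlt_comm j i, off_swap i j, ho', hn]
    simp
  · refine Finset.prod_congr rfl fun k hk => ?_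
    simp only [Finset.mem_erase] at hk
    have ho : off m i k = off m j k := by rw [off, off, hn]
    have hm' : mlt m i k = mlt m j k := by simp [mlt, hi, hj]
    rw [phi, phi, zeta_shift_self, zeta_shift_self, zeta_shift_of_ne hk.1,
      zeta_shift_of_ne hk.2.1, hz', ho, hm', hn]

/-- The factors not involving the pair agree on the hyperplane, and the remaining one depends on `s`
only. If `j` is last, then `s = 1` and both sides contain `[m+1]/[m]`, thanks to the weight. -/
lemma aco_cross (hm : 1 ≤ m) (hq : NotRoot h) {i j : Fin (n + 1)} (hij : i < j)
    {z : Fin (n + 1) → ℂ} (hz : zeta m i z = zeta m j z + off m i j) {s : ℕ} (hs1 : 1 ≤ s)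
    (hs : s ≤ mlt m i j) :
    aco h m j (z + (s : ℂ) • eps m i) = aco h m i (z + (s : ℂ) • eps m j) := by
  have hi : i ≠ Fin.last n := (hij.trans_le (Fin.le_last j)).ne
  have hrest : ∏ k ∈ (Finset.univ.erase j).erase i, phi h m j k (z + (s : ℂ) • eps m i) =
      ∏ k ∈ (Finset.univ.erase i).erase j, phi h m i k (z + (s : ℂ) • eps m j) := by
    have h1 : ∏ k ∈ (Finset.univ.erase j).erase i, phi h m j k (z + (s : ℂ) • eps m i) =
        ∏ k ∈ (Finset.univ.erase j).erase i, phi h m j k z :=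
      Finset.prod_congr rfl fun k hk => phi_shift_of_ne hij.ne' (Finset.ne_of_mem_erase hk) _ _
    have h2 : ∏ k ∈ (Finset.univ.erase i).erase j, phi h m i k (z + (s : ℂ) • eps m j) =
        ∏ k ∈ (Finset.univ.erase i).erase j, phi h m i k z :=
      Finset.prod_congr rfl fun k hk => phi_shift_of_ne hij.ne (Finset.ne_of_mem_erase hk) _ _
    rw [h1, h2, prod_phi_eq_of_hyp hij hz]
  rw [aco, aco, prod_erase_split hij.ne, prod_erase_split hij.ne', hrest, ← mul_assoc,
    ← mul_assoc]
  congr 1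
  have e1 : phi h m j i (z + (s : ℂ) • eps m i) =
      qnum h (-(s * nsq m i) - mlt m i j * nsq m j) / qnum h (-(s * nsq m i)) := by
    rw [phi, zeta_shift_self, zeta_shift_of_ne hij.ne', hz, off_swap i j, mlt_comm j i]
    congr 2 <;> ring
  have e2 : phi h m i j (z + (s : ℂ) • eps m j) =
      qnum h (-(s * nsq m j) - mlt m i j * nsq m i) / qnum h (-(s * nsq m j)) := by
    rw [phi, zeta_shift_self, zeta_shift_of_ne hij.ne, hz]
    congr 2 <;> ring
  rw [e1, e2]
  by_cases hj : j = Fin.last n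
  · subst hj
    rw [mlt_last] at hs
    obtain rfl : s = 1 := le_antisymm hs hs1
    have h1 := hq.qnum_nat (k := m) (by omega)
    have h2 := hq.qnum_nat (k := 1) (by omega)
    simp only [wt, if_neg hi, if_true, mlt_last, nsq_of_ne hi, nsq_last, Nat.cast_one, one_mul,
      qnum_neg] at h2 ⊢
    have : -(m : ℂ) - 1 = -1 - m := by ring
    rw [this]
    field_simp
  · have hn : nsq m i = nsq m j := by rw [nsq_of_ne hi, nsq_of_ne hj]
    have hw : wt h m i = wt h m j := by simp [wt, hi, hj]
    rw [hn, hw]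

/-! ### The operator preserves quasi-invariants -/

lemma continuousAt_phi {i l : Fin (n + 1)} {z : Fin (n + 1) → ℂ}
    (hz : qnum h (zeta m i z - zeta m l z - off m i l) ≠ 0) : ContinuousAt (phi h m i l) z := by
  have hc : ∀ a : ℂ, Continuous fun z : Fin (n + 1) → ℂ =>
      qnum h (zeta m i z - zeta m l z - off m i l - a) := fun a =>
    AnalyticOnNhd.cont (AnalyticOnNhd.qnum ((((analytic_zeta i).sub (analytic_zeta l)).sub
      analyticOnNhd_const).sub analyticOnNhd_const))
  have h1 := (hc (mlt m i l * nsq m i)).continuousAt (x := z)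
  have h2 := (hc 0).continuousAt (x := z)
  simp only [sub_zero] at h2
  exact h1.div h2 hz

lemma prod_lin_mul_aco_isPoly (i : Fin (n + 1)) : ∃ r, IsPoly h m r ∧
    ∀ z : Fin (n + 1) → ℂ, OffPoles h m z →
      (∏ e : PosRoot n, lin h m e.1.1 e.1.2 z) * aco h m i z = r z := by
  classical
  -- Each factor `phi i j` with `j ∈ U` is matched with the equation, in `T`, of the root joining
  -- `i` and `j`, which clears its denominator. Unmatched equations remain as polynomial factors.
  have key : ∀ T : Finset (PosRoot n), ∀ U : Finset (Fin (n + 1)), i ∉ U →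
      (∀ j ∈ U, ∃ e ∈ T, (e.1.1 = i ∧ e.1.2 = j) ∨ (e.1.1 = j ∧ e.1.2 = i)) →
      ∃ r, IsPoly h m r ∧ ∀ z : Fin (n + 1) → ℂ, OffPoles h m z →
      (∏ e ∈ T, lin h m e.1.1 e.1.2 z) * ∏ j ∈ U, phi h m i j z = r z := by
    intro T
    induction T using Finset.induction_on with
    | empty =>
      intro U hiU hU
      have : U = ∅ := by
        rw [Finset.eq_empty_iff_forall_notMem]
        intro j hj
        obtain ⟨e, he, _⟩ := hU j hj
        simp at he
      subst this
      exact ⟨_, isPoly_const h m 1, fun z _ => by simp⟩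
    | insert a T ha ih =>
      intro U hiU hU
      by_cases hex : ∃ j ∈ U, (a.1.1 = i ∧ a.1.2 = j) ∨ (a.1.1 = j ∧ a.1.2 = i)
      · obtain ⟨j, hj, haj⟩ := hex
        obtain ⟨r, hr, hrz⟩ := ih (U.erase j) (fun hh => hiU (Finset.mem_of_mem_erase hh)) (by
          intro k hk
          obtain ⟨e, he, hek⟩ := hU k (Finset.mem_of_mem_erase hk)
          rcases Finset.mem_insert.1 he with rfl | he
          · exfalso
            have hki := Finset.ne_of_mem_erase hk
            have hne : j ≠ i := fun hh => hiU (hh ▸ hj)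
            have hne' : k ≠ i := fun hh => hiU (hh ▸ Finset.mem_of_mem_erase hk)
            rcases haj with ⟨h1, h2⟩ | ⟨h1, h2⟩ <;> rcases hek with ⟨h3, h4⟩ | ⟨h3, h4⟩
            · exact hki (h4.symm.trans h2)
            · exact hne' (h3.symm.trans h1)
            · exact hne (h1.symm.trans h3)
            · exact hki (h3.symm.trans h1)
          · exact ⟨e, he, hek⟩)
        have hij : i ≠ j := fun hh => hiU (hh ▸ hj)
        have hloc : ∃ r', IsPoly h m r' ∧ ∀ z : Fin (n + 1) → ℂ, OffPoles h m z →
            lin h m a.1.1 a.1.2 z * phi h m i j z = r' z := by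
          rcases haj with ⟨h1, h2⟩ | ⟨h1, h2⟩
          · refine ⟨plin h m i j, isPoly_plin i j, fun z hz => ?_⟩
            rw [h1, h2, mul_comm, phi_mul_lin _ _ _ ((offPoles_iff z).1 hz i j hij)]
          · refine ⟨_, (isPoly_plin i j).const_mul (-qpow h (2 * off m j i)), fun z hz => ?_⟩
            rw [h1, h2, lin_swap, mul_assoc, mul_comm (lin h m i j z),
              phi_mul_lin _ _ _ ((offPoles_iff z).1 hz i j hij)]
        obtain ⟨r', hr', hrz'⟩ := hloc
        refine ⟨r' * r, hr'.mul hr, fun z hz => ?_⟩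
        rw [Finset.prod_insert ha, ← Finset.mul_prod_erase U _ hj, Pi.mul_apply, ← hrz z hz,
          ← hrz' z hz]
        ring
      · obtain ⟨r, hr, hrz⟩ := ih U hiU (by
          intro k hk
          obtain ⟨e, he, hek⟩ := hU k hk
          rcases Finset.mem_insert.1 he with rfl | he
          · exact absurd ⟨k, hk, hek⟩ hex
          · exact ⟨e, he, hek⟩)
        refine ⟨_, (isPoly_lin a.1.1 a.1.2).mul hr, fun z hz => ?_⟩
        rw [Finset.prod_insert ha, Pi.mul_apply, ← hrz z hz, mul_assoc]
  obtain ⟨r, hr, hrz⟩ := key Finset.univ (Finset.univ.erase i) (by simp) (by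
    intro j hj
    have hji := Finset.ne_of_mem_erase hj
    rcases lt_or_gt_of_ne hji with hlt | hlt
    · exact ⟨⟨(j, i), hlt⟩, Finset.mem_univ _, Or.inr ⟨rfl, rfl⟩⟩
    · exact ⟨⟨(i, j), hlt⟩, Finset.mem_univ _, Or.inl ⟨rfl, rfl⟩⟩)
  refine ⟨_, hr.const_mul (wt h m i), fun z hz => ?_⟩
  rw [aco, ← hrz z hz]
  ring

lemma eq_of_dense_of_continuousAt {Z : Set (Fin (n + 1) → ℂ)} (hZ : Dense Z)
    {f g : (Fin (n + 1) → ℂ) → ℂ} {z : Fin (n + 1) → ℂ} (hf : ContinuousAt f z)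
    (hg : ContinuousAt g z) (hfg : ∀ w ∈ Z, f w = g w) : f z = g z := by
  have : (𝓝[Z] z).NeBot := mem_closure_iff_nhdsWithin_neBot.1 (hZ z)
  have h1 : Tendsto f (𝓝[Z] z) (𝓝 (f z)) := hf.mono_left nhdsWithin_le_nhds
  have h2 : Tendsto g (𝓝[Z] z) (𝓝 (g z)) := hg.mono_left nhdsWithin_le_nhds
  refine tendsto_nhds_unique (h1.congr' ?_) h2
  filter_upwards [self_mem_nhdsWithin] with w hw using hfg w hw

/-- The poles of the operator cancel on quasi-invariants. -/
lemma lin_mul_tD_aux (hm : 1 ≤ m) (hq : NotRoot h) {y : Fin (n + 1) → ℂ}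
    {F : (Fin (n + 1) → ℂ) → ℂ} (hF : Continuous F) (hTQ : TQ h m y F) (a : PosRoot n)
    {z : Fin (n + 1) → ℂ} (hz : zeta m a.1.1 z = zeta m a.1.2 z + off m a.1.1 a.1.2)
    (hother : ∀ e : PosRoot n, e ≠ a → lin h m e.1.1 e.1.2 z ≠ 0) :
    ∃ K : (Fin (n + 1) → ℂ) → ℂ, ContinuousAt K z ∧ K z = 0 ∧
      ∀ w, OffPoles h m w → K w = lin h m a.1.1 a.1.2 w * tD h m y F w := by
  obtain ⟨⟨i, j⟩, hij⟩ := a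
  simp only at hij hz hother ⊢
  have hnz : ∀ k l, k ≠ l → ¬(k = i ∧ l = j) → ¬(k = j ∧ l = i) →
      qnum h (zeta m k z - zeta m l z - off m k l) ≠ 0 := by
    intro k l hkl h1 h2
    rcases lt_or_gt_of_ne hkl with hlt | hlt
    · refine (lin_ne_zero_iff _ _ _).1 (hother ⟨(k, l), hlt⟩ fun hh => ?_)
      have := congrArg Subtype.val hh
      exact h1 (Prod.mk.injEq _ _ _ _ ▸ this)
    · rw [qnum_swap, neg_ne_zero]
      refine (lin_ne_zero_iff _ _ _).1 (hother ⟨(l, k), hlt⟩ fun hh => ?_)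
      have := congrArg Subtype.val hh
      have h3 : l = i ∧ k = j := Prod.mk.injEq _ _ _ _ ▸ this
      exact h2 ⟨h3.2, h3.1⟩
  -- `b l` extends `lin · a_l` continuously across the hyperplane: for `l = i, j` the equation is
  -- absorbed into the numerator of the singular factor.
  let b : Fin (n + 1) → (Fin (n + 1) → ℂ) → ℂ := fun l w =>
    if l = i then wt h m i * (plin h m i j w *
      ∏ k ∈ (Finset.univ.erase i).erase j, phi h m i k w)
    else if l = j then wt h m j * ((-qpow h (2 * off m i j) * plin h m j i w) *
      ∏ k ∈ (Finset.univ.erase j).erase i, phi h m j k w)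
    else lin h m i j w * aco h m l w
  have hbi : b i = fun w => wt h m i * (plin h m i j w *
      ∏ k ∈ (Finset.univ.erase i).erase j, phi h m i k w) := by
    funext w; simp [b]
  have hbj : b j = fun w => wt h m j * ((-qpow h (2 * off m i j) * plin h m j i w) *
      ∏ k ∈ (Finset.univ.erase j).erase i, phi h m j k w) := by
    funext w; simp [b, hij.ne']
  have hbl : ∀ l, l ≠ i → l ≠ j → b l = fun w => lin h m i j w * aco h m l w := by
    intro l h1 h2
    funext w; simp [b, h1, h2]
  have hbc : ∀ l, ContinuousAt (b l) z := by
    intro l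
    by_cases h1 : l = i
    · subst h1
      rw [hbi]
      refine continuousAt_const.mul ((isPoly_plin _ _).continuous.continuousAt.mul ?_)
      refine tendsto_finsetProd _ fun k hk => ?_
      simp only [Finset.mem_erase] at hk
      exact continuousAt_phi (hnz l k hk.2.1.symm (fun hh => hk.1 hh.2) fun hh => hij.ne hh.1)
    by_cases h2 : l = j
    · subst h2
      rw [hbj]
      refine continuousAt_const.mul
        ((continuousAt_const.mul (isPoly_plin _ _).continuous.continuousAt).mul ?_)
      refine tendsto_finsetProd _ fun k hk => ?_
      simp only [Finset.mem_erase] at hk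
      exact continuousAt_phi (hnz l k hk.2.1.symm (fun hh => hij.ne' hh.1) fun hh => hk.1 hh.2)
    · rw [hbl l h1 h2]
      refine (isPoly_lin _ _).continuous.continuousAt.mul (continuousAt_const.mul ?_)
      refine tendsto_finsetProd _ fun k hk => ?_
      exact continuousAt_phi (hnz l k (Finset.ne_of_mem_erase hk).symm (fun hh => h1 hh.1)
        fun hh => h2 hh.1)
  have hbv : ∀ l w, OffPoles h m w → b l w = lin h m i j w * aco h m l w := by
    intro l w hw
    have hw' := (offPoles_iff w).1 hw
    by_cases h1 : l = i
    · subst h1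
      rw [hbi, aco, prod_erase_split hij.ne]
      simp only
      rw [← phi_mul_lin _ _ _ (hw' l j hij.ne)]
      ring
    by_cases h2 : l = j
    · subst h2
      rw [hbj, aco, prod_erase_split hij.ne', lin_swap]
      simp only
      rw [← phi_mul_lin _ _ _ (hw' l i hij.ne')]
      ring
    · rw [hbl l h1 h2]
  refine ⟨fun w => ∑ l, b l w * (qpow h (2 * zeta m l y) * F (w + eps m l)), ?_, ?_, ?_⟩
  · refine tendsto_finsetSum _ fun l _ => ?_
    exact (hbc l).mul (continuous_const.mul (hF.comp (continuous_id.add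
      continuous_const))).continuousAt
  · have hl0 : lin h m i j z = 0 := lin_of_eq hz
    have hz' : ∀ l ∈ (Finset.univ.erase i).erase j,
        b l z * (qpow h (2 * zeta m l y) * F (z + eps m l)) = 0 := by
      intro l hl
      simp only [Finset.mem_erase] at hl
      rw [hbl l hl.2.1 hl.1]
      simp [hl0]
    simp only
    rw [← Finset.add_sum_erase _ _ (Finset.mem_univ i),
      ← Finset.add_sum_erase (Finset.univ.erase i) _ (a := j) (by simp [hij.ne']),
      Finset.sum_eq_zero hz', add_zero]
    have h1 := hTQ i j hij 1 le_rfl (by simp only [mlt]; split_ifs <;> omega) z hz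
    simp only [pow_one, Nat.cast_one, one_smul] at h1
    rw [h1, ← add_mul, hbi, hbj]
    simp only
    rw [← prod_phi_eq_of_hyp hij hz]
    -- The residues of the two singular coefficients are opposite: on the hyperplane both numerators
    -- reduce to multiples of `q^{2ζ_j}`, with the q-numbers compared in `wt_mul_qnum`.
    have h2 : wt h m i * plin h m i j z + wt h m j * (-qpow h (2 * off m i j) * plin h m j i z)
        = 0 := by
      have hw := wt_mul_qnum hm hq hij
      have e1 : plin h m i j z = -(qpow h (2 * off m i j) * qpow h (2 * zeta m j z)) *
          qnum h (mlt m i j * nsq m i) := by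
        rw [plin, hz, qnum, mul_add, qpow_add, qpow_add]; ring
      have e2 : plin h m j i z = -qpow h (2 * zeta m i z) * qnum h (mlt m i j * nsq m j) *
          qpow h (-(2 * off m i j)) := by
        have : zeta m j z = zeta m i z - off m i j := by rw [hz]; ring
        have h3 : 2 * -off m i j = -(2 * off m i j) := by ring
        have h4 : 2 * (zeta m i z - off m i j) = 2 * zeta m i z + -(2 * off m i j) := by ring
        rw [plin, this, qnum, off_swap i j, h3, h4, qpow_add, qpow_add, mlt_comm j i]
        ring
      have e3 : qpow h (-(2 * off m i j)) * qpow h (2 * zeta m i z) = qpow h (2 * zeta m j z) := by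
        rw [← qpow_add, hz]; congr 1; ring
      rw [e1, e2]
      linear_combination (-(qpow h (2 * off m i j) * qpow h (2 * zeta m j z))) * hw +
        wt h m j * qpow h (2 * off m i j) * qnum h (mlt m i j * nsq m j) * e3
    linear_combination ((∏ k ∈ (Finset.univ.erase i).erase j, phi h m i k z) *
      (qpow h (2 * zeta m j y) * F (z + eps m j))) * h2
  · intro w hw
    rw [tD, Finset.mul_sum]
    refine Finset.sum_congr rfl fun l _ => ?_
    rw [hbv l w hw, mul_assoc]

/-- The operator sends quasi-invariant Laurent polynomials to Laurent polynomials. -/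
theorem exists_isPoly_tD (hm : 1 ≤ m) (hq : NotRoot h) {y : Fin (n + 1) → ℂ}
    {F : (Fin (n + 1) → ℂ) → ℂ} (hF : IsPoly h m F) (hTQ : TQ h m y F) :
    ∃ g, IsPoly h m g ∧ ∀ z, OffPoles h m z → tD h m y F z = g z := by
  classical
  have h0 := hq.ne_zero
  choose r hr hrz using prod_lin_mul_aco_isPoly (n := n) (h := h) (m := m)
  let N : (Fin (n + 1) → ℂ) → ℂ := ∑ l, fun z => qpow h (2 * zeta m l y) *
    (r l * fun z => F (z + eps m l)) z
  have hN : IsPoly h m N := isPoly_sum' _ _ fun l _ => ((hr l).mul (hF.shift _)).const_mul _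
  have hNz : ∀ z, OffPoles h m z →
      N z = (∏ e : PosRoot n, lin h m e.1.1 e.1.2 z) * tD h m y F z := by
    intro z hz
    simp only [N, Finset.sum_apply, tD, Finset.mul_sum, Pi.mul_apply]
    refine Finset.sum_congr rfl fun l _ => ?_
    rw [← hrz l z hz]
    ring
  obtain ⟨g, hg, hNg⟩ := exists_div_prod_lin hm h0 hN (by
    intro a z hz hother
    obtain ⟨K, hKc, hK0, hK⟩ := lin_mul_tD_aux hm hq hF.continuous hTQ a hz hother
    -- Off the poles `N` is the product of the other equations and `K`; both sides are continuous at
    -- `z`, so the equality persists there and `K z = 0` makes `N` vanish.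
    have h1 : N z = (∏ e ∈ Finset.univ.erase a, lin h m e.1.1 e.1.2 z) * K z := by
      refine eq_of_dense_of_continuousAt (dense_offPoles' hm h0) hN.continuous.continuousAt
        (g := fun z => (∏ e ∈ Finset.univ.erase a, lin h m e.1.1 e.1.2 z) * K z)
        (ContinuousAt.mul ?_ hKc) fun w hw => ?_
      · exact tendsto_finsetProd _ fun e _ => (isPoly_lin _ _).continuous.continuousAt
      · rw [hNz w hw, hK w hw, ← Finset.mul_prod_erase _ _ (Finset.mem_univ a)]
        ring
    rw [h1, hK0, mul_zero])
  refine ⟨g, hg, fun z hz => ?_⟩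
  have h1 := hNz z hz
  rw [hNg, Pi.mul_apply, Finset.prod_apply] at h1
  refine (mul_left_cancel₀ (Finset.prod_ne_zero_iff.2 fun e _ => ?_) h1).symm
  exact (lin_ne_zero_iff _ _ _).2 ((offPoles_iff_lt z).1 hz e)

lemma tD_hyp_eq (hm : 1 ≤ m) (hq : NotRoot h) {y : Fin (n + 1) → ℂ}
    {F : (Fin (n + 1) → ℂ) → ℂ} (hTQ : TQ h m y F) {i j : Fin (n + 1)} (hij : i < j) {s : ℕ}
    (hs1 : 1 ≤ s) (hs : s ≤ mlt m i j) {z : Fin (n + 1) → ℂ}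
    (hz : zeta m i z = zeta m j z + off m i j) (hp : OffPoles h m (z + (s : ℂ) • eps m i))
    (hp' : OffPoles h m (z + (s : ℂ) • eps m j)) :
    qpow h (2 * zeta m i y) ^ s * tD h m y F (z + (s : ℂ) • eps m i) =
      qpow h (2 * zeta m j y) ^ s * tD h m y F (z + (s : ℂ) • eps m j) := by
  have hi : i ≠ Fin.last n := (hij.trans_le (Fin.le_last j)).ne
  have hji : j ∈ Finset.univ.erase i := by simp [hij.ne']
  rw [tD, tD, ← Finset.add_sum_erase _ _ (Finset.mem_univ i), ← Finset.add_sum_erase _ _ hji,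
    ← Finset.add_sum_erase Finset.univ (fun l => aco h m l (z + (s : ℂ) • eps m j) * _)
      (Finset.mem_univ i), ← Finset.add_sum_erase (Finset.univ.erase i)
      (fun l => aco h m l (z + (s : ℂ) • eps m j) * _) hji]
  simp only [mul_add]
  have hrest : qpow h (2 * zeta m i y) ^ s * ∑ l ∈ (Finset.univ.erase i).erase j,
        aco h m l (z + (s : ℂ) • eps m i) *
          (qpow h (2 * zeta m l y) * F (z + (s : ℂ) • eps m i + eps m l)) =
      qpow h (2 * zeta m j y) ^ s * ∑ l ∈ (Finset.univ.erase i).erase j,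
        aco h m l (z + (s : ℂ) • eps m j) *
          (qpow h (2 * zeta m l y) * F (z + (s : ℂ) • eps m j + eps m l)) := by
    rw [Finset.mul_sum, Finset.mul_sum]
    refine Finset.sum_congr rfl fun l hl => ?_
    simp only [Finset.mem_erase] at hl
    rw [aco_third hij hl.2.1 hl.1 hz hs1 hs hp hp']
    have h1 := hTQ i j hij s hs1 hs (z + eps m l) (by
      rw [zeta_add, zeta_add, zeta_eps, zeta_eps, if_neg (Ne.symm hl.2.1), if_neg (Ne.symm hl.1),
        hz]; ring)
    rw [add_right_comm z _ (eps m l), add_right_comm z _ (eps m l)]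
    linear_combination (aco h m l (z + (s : ℂ) • eps m j) * qpow h (2 * zeta m l y)) * h1
  -- The `i`-term on one side is matched with the `j`-term on the other. The shift becomes `s + 1`,
  -- still admissible unless `s` is maximal, and in that case both coefficients vanish.
  have hii : qpow h (2 * zeta m i y) ^ s * (aco h m i (z + (s : ℂ) • eps m i) *
          (qpow h (2 * zeta m i y) * F (z + (s : ℂ) • eps m i + eps m i))) =
      qpow h (2 * zeta m j y) ^ s * (aco h m j (z + (s : ℂ) • eps m j) *
          (qpow h (2 * zeta m j y) * F (z + (s : ℂ) • eps m j + eps m j))) := by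
    rcases hs.eq_or_lt with rfl | hlt
    · have hz' : zeta m j z = zeta m i z + off m j i := by rw [hz, off_swap i j]; ring
      have h2 := aco_self_top (h := h) hij.ne' hz'
      rw [mlt_comm] at h2
      rw [aco_self_top hij.ne hz, h2]
      ring
    · have hj : j ≠ Fin.last n := by
        rintro rfl
        rw [mlt_last] at hlt
        omega
      have h1 := hTQ i j hij (s + 1) (by omega) hlt z hz
      rw [aco_self_eq hij hz hj]
      have e : ∀ k : Fin (n + 1), z + (s : ℂ) • eps m k + eps m k =
          z + ((s + 1 : ℕ) : ℂ) • eps m k := by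
        intro k; push_cast; rw [add_smul, one_smul, add_assoc]
      rw [e, e]
      linear_combination (aco h m j (z + (s : ℂ) • eps m j)) * h1
  -- In the mixed terms the arguments coincide if `s = 1`. Otherwise `j` is not last, `z + ε_i +
  -- ε_j` is again on the hyperplane, and the condition with `s - 1` is applied at that point.
  have hjj : qpow h (2 * zeta m i y) ^ s * (aco h m j (z + (s : ℂ) • eps m i) *
          (qpow h (2 * zeta m j y) * F (z + (s : ℂ) • eps m i + eps m j))) =
      qpow h (2 * zeta m j y) ^ s * (aco h m i (z + (s : ℂ) • eps m j) *
          (qpow h (2 * zeta m i y) * F (z + (s : ℂ) • eps m j + eps m i))) := by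
    rw [aco_cross hm hq hij hz hs1 hs]
    have key : qpow h (2 * zeta m i y) ^ s * (qpow h (2 * zeta m j y) *
          F (z + (s : ℂ) • eps m i + eps m j)) =
        qpow h (2 * zeta m j y) ^ s * (qpow h (2 * zeta m i y) *
          F (z + (s : ℂ) • eps m j + eps m i)) := by
      obtain ⟨t, rfl⟩ : ∃ t, s = t + 1 := ⟨s - 1, by omega⟩
      have e : ∀ k l : Fin (n + 1), z + ((t + 1 : ℕ) : ℂ) • eps m k + eps m l =
          (z + eps m k + eps m l) + (t : ℂ) • eps m k := by
        intro k l; push_cast; rw [add_smul, one_smul]; abel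
      rcases Nat.eq_zero_or_pos t with rfl | ht
      · have : z + ((0 + 1 : ℕ) : ℂ) • eps m i + eps m j =
            z + ((0 + 1 : ℕ) : ℂ) • eps m j + eps m i := by
          push_cast; rw [one_smul, one_smul, add_right_comm]
        rw [this]; ring
      · have hj : j ≠ Fin.last n := by
          rintro rfl
          rw [mlt_last] at hs
          omega
        have h1 := hTQ i j hij t ht (by omega) (z + eps m i + eps m j) (by
          simp only [zeta_add, zeta_eps, if_true, if_neg hij.ne, if_neg hij.ne', hz,
            nsq_of_ne hi, nsq_of_ne hj]
          ring)
        rw [e, e, add_right_comm z (eps m j)]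
        linear_combination (qpow h (2 * zeta m i y) * qpow h (2 * zeta m j y)) * h1
    linear_combination (aco h m i (z + (s : ℂ) • eps m j)) * key
  linear_combination hrest + hii + hjj

/-- The operator preserves quasi-invariance. -/
theorem TQ_of_tD (hm : 1 ≤ m) (hq : NotRoot h) {y : Fin (n + 1) → ℂ}
    {F g : (Fin (n + 1) → ℂ) → ℂ} (hTQ : TQ h m y F) (hg : IsPoly h m g)
    (hFg : ∀ z, OffPoles h m z → tD h m y F z = g z) : TQ h m y g := by
  have h0 := hq.ne_zero
  intro i j hij s hs1 hs z hz
  let a : PosRoot n := ⟨(i, j), hij⟩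
  have hcont : ∀ v : Fin (n + 1) → ℂ, Continuous fun z : Fin (n + 1) → ℂ =>
      g (toHyp m i j z + v) := fun v =>
    hg.continuous.comp ((continuous_toHyp i j).add continuous_const)
  -- After a shift by `s ε_k` the hyperplane's own q-number becomes `± [s · nsq k]`, nonzero because
  -- `q` is not a root of unity. The other singular hyperplanes are avoided on a dense set.
  have hdense : Dense {z : Fin (n + 1) → ℂ | OffPoles h m (toHyp m i j z + (s : ℂ) • eps m i) ∧
      OffPoles h m (toHyp m i j z + (s : ℂ) • eps m j)} := by
    have hop : ∀ k, k = i ∨ k = j → ∀ z : Fin (n + 1) → ℂ,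
        (∀ e : PosRoot n, e ≠ a → qnum h (zeta m e.1.1 (toHyp m i j z + (s : ℂ) • eps m k) -
          zeta m e.1.2 (toHyp m i j z + (s : ℂ) • eps m k) - off m e.1.1 e.1.2) ≠ 0) →
        OffPoles h m (toHyp m i j z + (s : ℂ) • eps m k) := by
      intro k hk z hz
      rw [offPoles_iff_lt]
      intro e
      by_cases he : e = a
      · subst he
        simp only [a]
        have hnq : ∀ k : Fin (n + 1), qnum h (s * nsq m k) ≠ 0 := fun k => by
          have := hq.qnum_nat (k := s * nsq m k) (mul_ne_zero (by omega) (nsq_pos hm k).ne')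
          exact_mod_cast this
        rcases hk with rfl | rfl
        · rw [zeta_shift_self, zeta_shift_of_ne hij.ne', zeta_toHyp_self hm,
            zeta_toHyp_of_ne hij.ne']
          convert hnq k using 2
          ring
        · rw [zeta_shift_self, zeta_shift_of_ne hij.ne, zeta_toHyp_self hm,
            zeta_toHyp_of_ne hij.ne', ← neg_ne_zero, ← qnum_neg]
          convert hnq k using 2
          ring
      · exact hz e he
    let ι := {e : PosRoot n // e ≠ a} × Bool
    let v : Bool → Fin (n + 1) → ℂ := fun b => (s : ℂ) • eps m (if b then i else j)
    refine (dense_forall_ne_zero (ι := ι) (fun e (z : Fin (n + 1) → ℂ) =>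
      qnum h (zeta m e.1.1.1.1 (toHyp m i j z + v e.2) - zeta m e.1.1.1.2 (toHyp m i j z + v e.2) -
        off m e.1.1.1.1 e.1.1.1.2)) (fun e => qnum_toHyp_analytic _ _ _ _ _) fun e =>
      qnum_toHyp_ne_zero hm h0 hij e.1.1.2
        (fun hh => e.1.2 (Subtype.ext (Prod.ext hh.1 hh.2))) _).mono fun z hz => ⟨?_, ?_⟩
    · exact hop i (Or.inl rfl) z fun e he => hz (⟨e, he⟩, true)
    · exact hop j (Or.inr rfl) z fun e he => hz (⟨e, he⟩, false)
  have key := Continuous.ext_on hdense (continuous_const.mul (hcont ((s : ℂ) • eps m i)))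
    (continuous_const.mul (hcont ((s : ℂ) • eps m j)))
    (f := fun z => qpow h (2 * zeta m i y) ^ s * g (toHyp m i j z + (s : ℂ) • eps m i))
    (g := fun z => qpow h (2 * zeta m j y) ^ s * g (toHyp m i j z + (s : ℂ) • eps m j))
    fun z hz => by
      have h1 := tD_hyp_eq hm hq hTQ hij hs1 hs (z := toHyp m i j z)
        (by rw [zeta_toHyp_self hm, zeta_toHyp_of_ne hij.ne']) hz.1 hz.2
      rw [hFg _ hz.1, hFg _ hz.2] at h1
      exact h1
  have := congrFun key z
  simpa only [toHyp_of_eq hm hz] using this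

/-! ### Asymptotics of the operator -/

lemma tendsto_qnum_ratio_pos (h0 : h ≠ 0) (a c : ℂ) {δ : ℝ} (hδ : 0 < δ) :
    Tendsto (fun t : ℝ => qnum h (a - c + (t * δ : ℝ) / h) / qnum h (a + (t * δ : ℝ) / h)) atTop
      (𝓝 (qpow h (-c))) := by
  have key : ∀ (b : ℂ) (t : ℝ), qnum h (b + (t * δ : ℝ) / h) =
      qpow h ((t * δ : ℝ) / h) *
        (qpow h b - qpow h (-b) * (Real.exp (2 * t * (-δ)) : ℝ)) := by
    intro b t
    have e : ((Real.exp (2 * t * (-δ)) : ℝ) : ℂ) = qpow h (-(2 * ((t * δ : ℝ) / h))) := by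
      rw [qpow, Complex.ofReal_exp]
      congr 1
      field_simp
      push_cast
      ring
    rw [e, qnum, mul_sub, ← qpow_add, ← qpow_add, ← qpow_add]
    congr 2 <;> ring
  simp only [key, mul_div_mul_left _ _ (qpow_ne_zero _)]
  have hlim : ∀ b : ℂ, Tendsto (fun t : ℝ =>
      qpow h b - qpow h (-b) * (Real.exp (2 * t * (-δ)) : ℝ)) atTop (𝓝 (qpow h b)) := by
    intro b
    have := (tendsto_const_nhds (x := qpow h b)).sub
      ((tendsto_exp_neg (b := -δ) (by linarith)).const_mul (qpow h (-b)))
    simpa using this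
  have := (hlim (a - c)).div (hlim a) (qpow_ne_zero _)
  rwa [← qpow_sub, sub_sub_cancel_left] at this

/-- The sign of a root in a given direction. -/
def sg (ℓ : Fin (n + 1) → ℝ) (i j : Fin (n + 1)) : ℤ := if ℓ j < ℓ i then 1 else -1

lemma tendsto_phi_ray (hm : 1 ≤ m) (h0 : h ≠ 0) (w : Fin (n + 1) → ℂ) {ℓ : Fin (n + 1) → ℝ}
    {i j : Fin (n + 1)} (hij : ℓ i ≠ ℓ j) :
    Tendsto (fun t : ℝ => phi h m i j (ray h m w ℓ t)) atTop
      (𝓝 (qpow h (-(sg ℓ i j * mlt m i j * nsq m i)))) := by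
  rcases lt_or_gt_of_ne hij with hlt | hlt
  · have := tendsto_qnum_ratio_pos h0 (-(w i - w j - off m i j)) (-(mlt m i j * nsq m i))
      (sub_pos.2 hlt)
    rw [sg, if_neg hlt.not_gt]
    refine (this.congr fun t => ?_).trans (le_of_eq ?_)
    · rw [phi, zeta_ray hm, zeta_ray hm, ← neg_div_neg_eq, ← qnum_neg, ← qnum_neg]
      congr 2 <;> (push_cast; ring)
    · congr 2; push_cast; ring
  · have := tendsto_qnum_ratio_pos h0 (w i - w j - off m i j) (mlt m i j * nsq m i)
      (sub_pos.2 hlt)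
    rw [sg, if_pos hlt]
    refine (this.congr fun t => ?_).trans (le_of_eq ?_)
    · rw [phi, zeta_ray hm, zeta_ray hm]
      congr 2 <;> (push_cast; ring)
    · congr 2; push_cast; ring

lemma tendsto_aco_ray (hm : 1 ≤ m) (h0 : h ≠ 0) (w : Fin (n + 1) → ℂ) {ℓ : Fin (n + 1) → ℝ}
    (hℓ : Function.Injective ℓ) (i : Fin (n + 1)) :
    Tendsto (fun t : ℝ => aco h m i (ray h m w ℓ t)) atTop
      (𝓝 (wt h m i * ∏ j ∈ Finset.univ.erase i,
        qpow h (-(sg ℓ i j * mlt m i j * nsq m i)))) := by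
  refine tendsto_const_nhds.mul (tendsto_finsetProd _ fun j hj => ?_)
  exact tendsto_phi_ray hm h0 w fun hh => (Finset.ne_of_mem_erase hj) (hℓ hh).symm

lemma GenDir.injective {ℓ : Fin (n + 1) → ℝ} (hℓ : GenDir ℓ) : Function.Injective ℓ := by
  intro i j hij
  by_contra hne
  have h1 : dot (Pi.single i 1) ℓ = dot (Pi.single j 1) ℓ := by
    simp [dot, Pi.single_apply, hij]
  have h2 := congrFun (hℓ.inj h1) i
  simp [hne] at h2

/-! ### Root sums in lattice coordinates -/

/-- Lattice coordinates of a positive root. -/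
def sroot (α : PosRoot n) : Fin (n + 1) → ℤ := Pi.single α.1.1 1 - Pi.single α.1.2 1

lemma lat_sroot (α : PosRoot n) : lat m (sroot α) = root m α := by
  rw [sroot, lat_sub, lat_single, lat_single, root]

/-- Lattice coordinates of the extreme point of the integral polytope in the direction `ℓ`. -/
def kv (m : ℕ) (ℓ : Fin (n + 1) → ℝ) : Fin (n + 1) → ℤ :=
  ∑ α : PosRoot n, (if ℓ α.1.2 < ℓ α.1.1 then (mlt m α.1.1 α.1.2 : ℤ) else 0) • sroot α

/-- Lattice coordinates of `2ρ`. -/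
def kfull (n m : ℕ) : Fin (n + 1) → ℤ :=
  ∑ α : PosRoot n, (mlt m α.1.1 α.1.2 : ℤ) • sroot α

lemma mult_eq (α : PosRoot n) : mult m α = mlt m α.1.1 α.1.2 := by
  have h1 : α.1.1 ≠ Fin.last n := (α.2.trans_le (Fin.le_last _)).ne
  simp [mult, mlt, h1]

lemma lat_zsmul (k : ℤ) (p : Fin (n + 1) → ℤ) : lat m (k • p) = (k : ℝ) • lat m p := by
  funext i; simp [lat, mul_assoc]

lemma lat_sum {ι : Type*} (s : Finset ι) (p : ι → Fin (n + 1) → ℤ) :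
    lat m (∑ a ∈ s, p a) = ∑ a ∈ s, lat m (p a) := by
  funext i
  simp [lat, Finset.sum_apply, Finset.sum_mul]

lemma lat_kfull : lat m (kfull n m) = (2 : ℝ) • rho n m := by
  have h2 : (2 : ℝ) * (1 / 2) = 1 := by norm_num
  rw [kfull, lat_sum, rho, smul_smul, h2, one_smul]
  exact Finset.sum_congr rfl fun α _ => by
    rw [lat_zsmul, lat_sroot, mult_eq]; simp

lemma sum_posRoot {A : Type*} [AddCommMonoid A] (F : Fin (n + 1) → Fin (n + 1) → A) :
    ∑ α : PosRoot n, F α.1.1 α.1.2 = ∑ a, ∑ b, if a < b then F a b else 0 := by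
  rw [← Finset.sum_product', Finset.univ_product_univ, ← Finset.sum_filter]
  exact (Finset.sum_subtype _ (by simp) fun x : Fin (n + 1) × Fin (n + 1) => F x.1 x.2).symm

lemma sum_sroot_apply (g : Fin (n + 1) → Fin (n + 1) → ℤ) (i : Fin (n + 1)) :
    (∑ α : PosRoot n, g α.1.1 α.1.2 • sroot α) i =
      ∑ j, if i < j then g i j else if j < i then -g j i else 0 := by
  rw [Finset.sum_apply]
  have h1 := sum_posRoot (n := n) fun a b =>
    g a b * ((Pi.single a 1 : Fin (n + 1) → ℤ) i - (Pi.single b 1 : Fin (n + 1) → ℤ) i)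
  simp only [Pi.smul_apply, sroot, Pi.sub_apply, smul_eq_mul]
  rw [h1]
  have h2 : ∀ a b : Fin (n + 1), (if a < b then
      g a b * ((Pi.single a 1 : Fin (n + 1) → ℤ) i - (Pi.single b 1 : Fin (n + 1) → ℤ) i) else 0) =
      (if a = i then (if i < b then g i b else 0) else 0) -
        (if b = i then (if a < i then g a i else 0) else 0) := by
    intro a b
    simp only [Pi.single_apply, eq_comm (a := i)]
    by_cases ha : a = i <;> by_cases hb : b = i
    · subst ha; subst hb; simp
    · subst ha; simp [hb]
    · subst hb; simp only [ha, if_false, if_true]; split_ifs <;> ring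
    · simp [ha, hb]
  simp only [h2, Finset.sum_sub_distrib, Finset.sum_ite_eq', Finset.mem_univ, if_true]
  rw [Finset.sum_comm]
  simp only [Finset.sum_ite_eq', Finset.mem_univ, if_true]
  rw [← Finset.sum_sub_distrib]
  refine Finset.sum_congr rfl fun j _ => ?_
  rcases lt_trichotomy i j with hij | hij | hij
  · simp [hij, hij.not_gt]
  · simp [hij]
  · simp [hij, hij.not_gt]

/-- The left side is, up to length and sign, the exponent in the limit of the coefficient `aco i`
along `ℓ`. Since `kfull` represents `2ρ`, this limit can be absorbed into a translation of `x`. -/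
lemma two_mul_kv (ℓ : Fin (n + 1) → ℝ) (hℓ : Function.Injective ℓ) (i : Fin (n + 1)) :
    ∑ j ∈ Finset.univ.erase i, sg ℓ i j * (mlt m i j : ℤ) = 2 * kv m ℓ i - kfull n m i := by
  rw [kv, kfull, sum_sroot_apply (fun a b => if ℓ b < ℓ a then (mlt m a b : ℤ) else 0),
    sum_sroot_apply (fun a b => (mlt m a b : ℤ)), Finset.mul_sum, ← Finset.sum_sub_distrib,
    ← Finset.add_sum_erase Finset.univ _ (Finset.mem_univ i)]
  simp only [lt_self_iff_false, if_false, mul_zero, sub_zero, zero_add]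
  refine Finset.sum_congr rfl fun j hj => ?_
  have hji := Finset.ne_of_mem_erase hj
  have hne : ℓ i ≠ ℓ j := fun hh => hji (hℓ hh).symm
  rw [sg, mlt_comm j i]
  rcases lt_or_gt_of_ne hji with h1 | h1 <;> rcases lt_or_gt_of_ne hne with h2 | h2 <;>
    simp [h1, h1.not_gt, h2, h2.not_gt] <;> ring

/-! ### Leading terms -/

lemma ray_add_eps (hm : 1 ≤ m) (w : Fin (n + 1) → ℂ) (ℓ : Fin (n + 1) → ℝ) (t : ℝ)
    (i : Fin (n + 1)) :
    ray h m w ℓ t + eps m i = ray h m (w + Pi.single i (nsq m i : ℂ)) ℓ t := by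
  rw [← pt_zeta hm (ray h m w ℓ t + eps m i), ← pt_zeta hm (ray h m (w + _) ℓ t)]
  congr 1
  funext k
  rw [zeta_add, zeta_ray hm, zeta_ray hm, zeta_eps, Pi.add_apply]
  by_cases hk : k = i
  · subst hk; simp; ring
  · simp [hk]

lemma lin_ne_zero_fun (hm : 1 ≤ m) (h0 : h ≠ 0) {i j : Fin (n + 1)} (hij : i ≠ j) :
    (lin h m i j : (Fin (n + 1) → ℂ) → ℂ) ≠ 0 := by
  intro hzero
  apply qnum_ne_zero_fun hm h0 hij 0
  funext z
  have := congrFun hzero z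
  rw [Pi.zero_apply, lin_eq, mul_eq_zero] at this
  simpa [qpow_ne_zero] using this

lemma eventually_offPoles (hm : 1 ≤ m) (h0 : h ≠ 0) (w : Fin (n + 1) → ℂ)
    {ℓ : Fin (n + 1) → ℝ} (hℓ : GenDir ℓ) : ∀ᶠ t in atTop, OffPoles h m (ray h m w ℓ t) := by
  have : ∀ e : PosRoot n, ∀ᶠ t in atTop, lin h m e.1.1 e.1.2 (ray h m w ℓ t) ≠ 0 := fun e =>
    eventually_ne_zero hm h0 (isPoly_lin _ _) (lin_ne_zero_fun hm h0 e.2.ne) w hℓ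
  filter_upwards [eventually_all.2 this] with t ht
  exact (offPoles_iff_lt _).2 fun e => (lin_ne_zero_iff _ _ _).1 (ht e)

lemma mono_pt_single (hm : 1 ≤ m) (p : Fin (n + 1) → ℤ) (i : Fin (n + 1)) (a : ℂ) :
    mono h m p (pt m (Pi.single i a)) = qpow h (2 * (p i * a)) := by
  simp [mono, zeta_pt hm, Pi.single_apply]

lemma rho_coord (i : Fin (n + 1)) :
    2 * zeta m i (cvec (rho n m)) = kfull n m i * nsq m i := by
  have : (2 : ℂ) * zeta m i (cvec (rho n m)) = zeta m i (cvec ((2 : ℝ) • rho n m)) := by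
    simp only [zeta, cvec, Pi.smul_apply, smul_eq_mul]; push_cast; ring
  rw [this, ← lat_kfull, zeta_lat]

/-- Leading asymptotics of the operator along a separating ray. -/
lemma tendsto_tD (hm : 1 ≤ m) (h0 : h ≠ 0) (x : Fin (n + 1) → ℂ)
    (c : (Fin (n + 1) → ℤ) →₀ ℂ) {ℓ : Fin (n + 1) → ℝ} (hℓ : GenDir ℓ) (p0 : Fin (n + 1) → ℤ)
    (hb : ∀ p ∈ c.support, dot p ℓ ≤ dot p0 ℓ) :
    Tendsto (fun t : ℝ => tD h m (x - cvec (rho n m)) (ev h m c) (ray h m 0 ℓ t) *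
      (Real.exp (2 * t * (-dot p0 ℓ)) : ℝ)) atTop
      (𝓝 (orbitSum h m (x + cvec (lat m (p0 - kv m ℓ))) * c p0)) := by
  have hterm : ∀ i : Fin (n + 1), Tendsto (fun t : ℝ => aco h m i (ray h m 0 ℓ t) *
      (qpow h (2 * zeta m i (x - cvec (rho n m))) * (ev h m c (ray h m 0 ℓ t + eps m i) *
        (Real.exp (2 * t * (-dot p0 ℓ)) : ℝ)))) atTop
      (𝓝 (wt h m i * qpow h (2 * zeta m i (x + cvec (lat m (p0 - kv m ℓ)))) * c p0)) := by
    intro i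
    have h1 := tendsto_aco_ray (h := h) hm h0 0 hℓ.injective i
    have h2 := tendsto_ev_gen hm h0 c (0 + Pi.single i (nsq m i : ℂ)) hℓ p0 hb
    simp only [← ray_add_eps hm] at h2
    refine (h1.mul (h2.const_mul (qpow h (2 * zeta m i (x - cvec (rho n m)))))).trans
      (le_of_eq ?_)
    congr 1
    rw [zero_add, mono_pt_single hm, ← qpow_sum]
    -- The limit of `aco i` contributes `-(2 kv - kfull)_i`, the twist by `-ρ` contributes
    -- `-kfull_i` and the monomial `2 p0_i`, each times `nsq i`. The total is the exponent of
    -- `q^{2ζ_i}` at `x + lat (p0 - kv ℓ)`.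
    have e1 : ∑ j ∈ Finset.univ.erase i, -((sg ℓ i j : ℂ) * mlt m i j * nsq m i) =
        -(2 * kv m ℓ i - kfull n m i) * nsq m i := by
      have := congrArg (fun k : ℤ => (k : ℂ)) (two_mul_kv (m := m) ℓ hℓ.injective i)
      push_cast at this
      rw [← this, Finset.sum_neg_distrib, ← Finset.sum_mul]
      ring
    rw [e1, zeta_sub, mul_sub, rho_coord, zeta_add, zeta_lat]
    have e2 : (2 : ℂ) * (zeta m i x + ((p0 - kv m ℓ) i : ℤ) * nsq m i) =
        -(2 * kv m ℓ i - kfull n m i) * nsq m i + (2 * zeta m i x - kfull n m i * nsq m i) +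
          2 * (p0 i * nsq m i) := by
      simp only [Pi.sub_apply]; push_cast; ring
    rw [e2, qpow_add, qpow_add]
    ring
  have := tendsto_finsetSum Finset.univ fun i _ => hterm i
  rw [orbitSum_eq, Finset.sum_mul]
  refine this.congr fun t => ?_
  rw [tD, Finset.sum_mul]
  exact Finset.sum_congr rfl fun i _ => by ring

/-- Leading terms of the result of the operator. -/
lemma tD_top (hm : 1 ≤ m) (h0 : h ≠ 0) {x : Fin (n + 1) → ℂ}
    {c c' : (Fin (n + 1) → ℤ) →₀ ℂ}
    (hD : ∀ z, OffPoles h m z → tD h m (x - cvec (rho n m)) (ev h m c) z = ev h m c' z)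
    {ℓ : Fin (n + 1) → ℝ} (hℓ : GenDir ℓ) {p0 : Fin (n + 1) → ℤ}
    (hb : ∀ p ∈ c.support, dot p ℓ ≤ dot p0 ℓ) :
    (∀ p ∈ c'.support, dot p ℓ ≤ dot p0 ℓ) ∧
      c' p0 = orbitSum h m (x + cvec (lat m (p0 - kv m ℓ))) * c p0 := by
  have key : ∀ p1 : Fin (n + 1) → ℤ, (∀ p ∈ c.support, dot p ℓ ≤ dot p1 ℓ) →
      (∀ p ∈ c'.support, dot p ℓ ≤ dot p1 ℓ) →
      c' p1 = orbitSum h m (x + cvec (lat m (p1 - kv m ℓ))) * c p1 := by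
    intro p1 hc hc'
    have h1 := tendsto_tD (h := h) hm h0 x c hℓ p1 hc
    have h2 := tendsto_ev_gen hm h0 c' 0 hℓ p1 hc'
    have h3 : mono h m p1 (pt m (0 : Fin (n + 1) → ℂ)) = 1 := by
      simp [mono, zeta_pt hm, qpow_zero]
    rw [h3, mul_one] at h2
    refine tendsto_nhds_unique (h2.congr' ?_) h1
    filter_upwards [eventually_offPoles hm h0 0 hℓ] with t ht
    rw [hD _ ht]
  -- If the result had exponents beyond `p0`, its top coefficient would be a multiple of a
  -- coefficient of `c` outside the support.
  have hle : ∀ p ∈ c'.support, dot p ℓ ≤ dot p0 ℓ := by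
    intro p hp
    by_contra hlt
    push Not at hlt
    obtain ⟨p1, hp1, hmax⟩ := exists_top (c := c') (by rintro rfl; simp at hp) ℓ
    have hlt1 : dot p0 ℓ < dot p1 ℓ := hlt.trans_le (hmax p hp)
    have h1 := key p1 (fun p hp => (hb p hp).trans hlt1.le) hmax
    have h2 : c p1 = 0 := by
      rw [← Finsupp.notMem_support_iff]
      intro hmem
      exact absurd (hb p1 hmem) (not_le.2 hlt1)
    rw [h2, mul_zero] at h1
    exact (Finsupp.mem_support_iff.1 hp1) h1
  exact ⟨hle, key p0 hb hle⟩

/-- The operator does not enlarge supports in any direction. -/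
lemma tD_bound (hm : 1 ≤ m) (h0 : h ≠ 0) {x : Fin (n + 1) → ℂ}
    {c c' : (Fin (n + 1) → ℤ) →₀ ℂ}
    (hD : ∀ z, OffPoles h m z → tD h m (x - cvec (rho n m)) (ev h m c) z = ev h m c' z)
    {θ : Fin (n + 1) → ℝ} {b : ℝ} (hb : ∀ p ∈ c.support, dot p θ ≤ b) :
    ∀ p ∈ c'.support, dot p θ ≤ b := by
  intro p' hp'
  by_contra hlt
  push Not at hlt
  have hopen : IsOpen {ℓ : Fin (n + 1) → ℝ | ∀ p ∈ c.support, dot p ℓ < dot p' ℓ} := by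
    have : {ℓ : Fin (n + 1) → ℝ | ∀ p ∈ c.support, dot p ℓ < dot p' ℓ} =
        ⋂ p ∈ c.support, {ℓ | dot p ℓ < dot p' ℓ} := by ext; simp
    rw [this]
    exact isOpen_biInter_finset fun p _ => isOpen_lt (continuous_dot p) (continuous_dot p')
  -- The direction `θ` need not separate exponents; the finitely many strict inequalities survive a
  -- small perturbation to a separating direction.
  obtain ⟨ℓ, hℓ, hgen⟩ := dense_genDir.inter_open_nonempty _ hopen
    ⟨θ, fun p hp => (hb p hp).trans_lt hlt⟩
  obtain ⟨_, h2⟩ := tD_top hm h0 hD hgen (p0 := p') fun p hp => (hℓ p hp).le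
  have h3 : c p' = 0 := by
    rw [← Finsupp.notMem_support_iff]
    intro hmem
    exact lt_irrefl _ (hℓ p' hmem)
  rw [h3, mul_zero] at h2
  exact (Finsupp.mem_support_iff.1 hp') h2

/-! ### The operator on quasi-invariant coefficient vectors -/

/-- Coefficients `c` such that `q^{2(x-ρ,z)} ∑ c_p q^{2(lat p,z)}` is quasi-invariant. -/
def QIs (h : ℂ) (m : ℕ) (x : Fin (n + 1) → ℂ) : Submodule ℂ ((Fin (n + 1) → ℤ) →₀ ℂ) where
  carrier := {c | TQ h m (x - cvec (rho n m)) (ev h m c)}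
  zero_mem' := by
    intro i j _ s _ _ z _
    simp
  add_mem' := by
    intro c c' hc hc' i j hij s hs1 hs z hz
    simp only [map_add, Pi.add_apply, mul_add]
    rw [hc i j hij s hs1 hs z hz, hc' i j hij s hs1 hs z hz]
  smul_mem' := by
    intro a c hc i j hij s hs1 hs z hz
    have := hc i j hij s hs1 hs z hz
    simp only [map_smul, Pi.smul_apply, smul_eq_mul]
    linear_combination a * this

lemma mem_QIs {x : Fin (n + 1) → ℂ} {c : (Fin (n + 1) → ℤ) →₀ ℂ} :
    c ∈ QIs h m x ↔ TQ h m (x - cvec (rho n m)) (ev h m c) := Iff.rfl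

lemma exists_opE (hm : 1 ≤ m) (hq : NotRoot h) (x : Fin (n + 1) → ℂ) (c : QIs h m x) :
    ∃ c' : QIs h m x, ∀ z, OffPoles h m z →
      tD h m (x - cvec (rho n m)) (ev h m (c : (Fin (n + 1) → ℤ) →₀ ℂ)) z =
        ev h m (c' : (Fin (n + 1) → ℤ) →₀ ℂ) z := by
  obtain ⟨g, hg, hgz⟩ := exists_isPoly_tD hm hq (isPoly_ev _) c.2
  have hT := TQ_of_tD hm hq c.2 hg hgz
  obtain ⟨c', rfl⟩ := (isPoly_iff g).1 hg
  exact ⟨⟨c', hT⟩, hgz⟩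

lemma ev_ext (hm : 1 ≤ m) (h0 : h ≠ 0) {c c' : (Fin (n + 1) → ℤ) →₀ ℂ}
    (H : ∀ z, OffPoles h m z → ev h m c z = ev h m c' z) : c = c' :=
  ev_injective hm h0 (Continuous.ext_on (dense_offPoles' hm h0) (isPoly_ev c).continuous
    (isPoly_ev c').continuous H)

/-- The operator, acting on coefficient vectors. -/
def opE (hm : 1 ≤ m) (hq : NotRoot h) (x : Fin (n + 1) → ℂ) : Module.End ℂ (QIs h m x) where
  toFun c := Classical.choose (exists_opE hm hq x c)
  map_add' c c' := by
    refine Subtype.ext (ev_ext hm hq.ne_zero fun z hz => ?_)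
    rw [← Classical.choose_spec (exists_opE hm hq x (c + c')) z hz, Submodule.coe_add, map_add,
      Submodule.coe_add, map_add, Pi.add_apply,
      ← Classical.choose_spec (exists_opE hm hq x c) z hz,
      ← Classical.choose_spec (exists_opE hm hq x c') z hz, tD, tD, tD, ← Finset.sum_add_distrib]
    exact Finset.sum_congr rfl fun i _ => by rw [Pi.add_apply]; ring
  map_smul' a c := by
    refine Subtype.ext (ev_ext hm hq.ne_zero fun z hz => ?_)
    rw [← Classical.choose_spec (exists_opE hm hq x (a • c)) z hz, Submodule.coe_smul, map_smul,
      RingHom.id_apply, Submodule.coe_smul, map_smul, Pi.smul_apply,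
      ← Classical.choose_spec (exists_opE hm hq x c) z hz, tD, tD, Finset.smul_sum]
    exact Finset.sum_congr rfl fun i _ => by rw [Pi.smul_apply, smul_eq_mul, smul_eq_mul]; ring

lemma opE_spec (hm : 1 ≤ m) (hq : NotRoot h) (x : Fin (n + 1) → ℂ) (c : QIs h m x)
    (z : Fin (n + 1) → ℂ) (hz : OffPoles h m z) :
    tD h m (x - cvec (rho n m)) (ev h m (c : (Fin (n + 1) → ℤ) →₀ ℂ)) z =
      ev h m (opE hm hq x c : (Fin (n + 1) → ℤ) →₀ ℂ) z :=
  Classical.choose_spec (exists_opE hm hq x c) z hz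

/-! ### Eigenvectors -/

/-- A finite set of exponents cut out by linear inequalities. -/
def Sep (S : Finset (Fin (n + 1) → ℤ)) : Prop :=
  ∀ p ∉ S, ∃ (θ : Fin (n + 1) → ℝ) (b : ℝ), (∀ p' ∈ S, dot p' θ ≤ b) ∧ b < dot p θ

lemma opE_supp (hm : 1 ≤ m) (hq : NotRoot h) {x : Fin (n + 1) → ℂ} {S : Finset (Fin (n + 1) → ℤ)}
    (hS : Sep S) {c : QIs h m x} (hc : (c : (Fin (n + 1) → ℤ) →₀ ℂ).support ⊆ S) :
    (opE hm hq x c : (Fin (n + 1) → ℤ) →₀ ℂ).support ⊆ S := by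
  intro p hp
  by_contra hpS
  obtain ⟨θ, b, h1, h2⟩ := hS p hpS
  exact absurd (tD_bound hm hq.ne_zero (opE_spec hm hq x c) (fun p' hp' => h1 p' (hc hp')) p hp)
    (not_le.2 h2)

/-- All extreme points of the integral polytope. -/
def kvs (n m : ℕ) : Finset (Fin (n + 1) → ℤ) :=
  open Classical in
  (Finset.univ : Finset (Finset (PosRoot n))).image fun A =>
    ∑ α ∈ A, (mlt m α.1.1 α.1.2 : ℤ) • sroot α

lemma kv_mem_kvs (ℓ : Fin (n + 1) → ℝ) : kv m ℓ ∈ kvs n m := by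
  classical
  rw [kvs, Finset.mem_image]
  refine ⟨Finset.univ.filter fun α : PosRoot n => ℓ α.1.2 < ℓ α.1.1, Finset.mem_univ _, ?_⟩
  rw [kv, Finset.sum_filter]
  exact Finset.sum_congr rfl fun α _ => by split_ifs <;> simp

/-- Differences of exponents and extreme points. -/
def tset (m : ℕ) (S : Finset (Fin (n + 1) → ℤ)) : Finset (Fin (n + 1) → ℤ) :=
  Finset.image₂ (fun p k => p - k) S (kvs n m)

lemma sub_kv_mem_tset {S : Finset (Fin (n + 1) → ℤ)} {p : Fin (n + 1) → ℤ} (hp : p ∈ S)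
    (ℓ : Fin (n + 1) → ℝ) : p - kv m ℓ ∈ tset m S :=
  Finset.mem_image₂_of_mem hp (kv_mem_kvs ℓ)

/-- The values `𝔪(x + ν)` are distinct for `ν ∈ T`. -/
def Res (h : ℂ) (m : ℕ) (T : Finset (Fin (n + 1) → ℤ)) (x : Fin (n + 1) → ℂ) : Prop :=
  ∀ p ∈ T, ∀ p' ∈ T, orbitSum h m (x + cvec (lat m p)) = orbitSum h m (x + cvec (lat m p')) →
    p = p'

lemma wt_ne_zero (hm : 1 ≤ m) (hq : NotRoot h) (i : Fin (n + 1)) : wt h m i ≠ 0 := by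
  unfold wt
  have h1 := hq.qnum_nat (k := 1) one_ne_zero
  have h2 := hq.qnum_nat (k := m) (by omega)
  split_ifs
  · exact div_ne_zero (by exact_mod_cast h1) h2
  · exact one_ne_zero

/-- Coefficients of `x ↦ 𝔪(x + lat p)`. -/
def orbCoef (h : ℂ) (m : ℕ) (p : Fin (n + 1) → ℤ) : (Fin (n + 1) → ℤ) →₀ ℂ :=
  ∑ i, Finsupp.single (Pi.single i 1) (wt h m i * qpow h (2 * (p i * nsq m i)))

lemma ev_orbCoef (p : Fin (n + 1) → ℤ) (x : Fin (n + 1) → ℂ) :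
    ev h m (orbCoef h m p) x = orbitSum h m (x + cvec (lat m p)) := by
  rw [orbCoef, map_sum, Finset.sum_apply, orbitSum_eq]
  refine Finset.sum_congr rfl fun i _ => ?_
  rw [ev_single, mono_single, zeta_add, zeta_lat, mul_add, qpow_add]
  ring

lemma isPoly_orbitSum_shift (p : Fin (n + 1) → ℤ) :
    IsPoly h m fun x : Fin (n + 1) → ℂ => orbitSum h m (x + cvec (lat m p)) := by
  have : (fun x : Fin (n + 1) → ℂ => orbitSum h m (x + cvec (lat m p))) =
      ev h m (orbCoef h m p) := by funext x; rw [ev_orbCoef]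
  rw [this]
  exact isPoly_ev _

lemma isPoly_orbitSum : IsPoly h m (orbitSum h m : (Fin (n + 1) → ℂ) → ℂ) := by
  have := isPoly_orbitSum_shift (h := h) (m := m) (0 : Fin (n + 1) → ℤ)
  have h0 : cvec (0 : Fin (n + 1) → ℝ) = 0 := by funext i; simp [cvec]
  simpa only [lat_zero, h0, add_zero] using this

lemma orbCoef_apply (p : Fin (n + 1) → ℤ) (i : Fin (n + 1)) :
    orbCoef h m p (Pi.single i 1) = wt h m i * qpow h (2 * (p i * nsq m i)) := by
  rw [orbCoef, Finsupp.finsetSum_apply, Finset.sum_eq_single i]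
  · simp
  · intro j _ hj
    rw [Finsupp.single_apply, if_neg]
    intro hh
    have := congrFun hh j
    simp [hj] at this
  · simp

/-- The coefficient of `q^{2ζ_i(x)}` in `𝔪(x + lat p)` is `wt i · q^{2 p_i nsq i}`, which determines
`p_i` because `q` is not a root of unity. Hence different lattice shifts give generically different
eigenvalues. -/
lemma orbitSum_shift_sub_ne_zero (hm : 1 ≤ m) (hq : NotRoot h) {p p' : Fin (n + 1) → ℤ}
    (hp : p ≠ p') : (fun x : Fin (n + 1) → ℂ => orbitSum h m (x + cvec (lat m p)) -
      orbitSum h m (x + cvec (lat m p'))) ≠ 0 := by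
  intro h0
  have h1 : ev h m (orbCoef h m p) = ev h m (orbCoef h m p') := by
    funext x
    rw [ev_orbCoef, ev_orbCoef]
    exact sub_eq_zero.1 (congrFun h0 x)
  have h2 := ev_injective hm hq.ne_zero h1
  apply hp
  funext i
  by_contra hne
  have h3 := DFunLike.congr_fun h2 (Pi.single i 1)
  rw [orbCoef_apply, orbCoef_apply] at h3
  have h4 := mul_left_cancel₀ (wt_ne_zero hm hq i) h3
  have h5 := hq.qpow_int (k := 2 * (p i - p' i) * nsq m i) (by
    have := nsq_pos hm i
    have : p i - p' i ≠ 0 := sub_ne_zero.2 hne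
    positivity)
  apply h5
  have : ((2 * (p i - p' i) * nsq m i : ℤ) : ℂ) = 2 * (p i * nsq m i) - 2 * (p' i * nsq m i) := by
    push_cast; ring
  rw [this, qpow_sub, h4, div_self (qpow_ne_zero _)]

lemma generically_res (hm : 1 ≤ m) (hq : NotRoot h) (T : Finset (Fin (n + 1) → ℤ)) :
    Generically h m (Res h m T) := by
  refine (generically_ball T _ fun p _ => generically_ball T (fun p' x =>
    orbitSum h m (x + cvec (lat m p)) = orbitSum h m (x + cvec (lat m p')) → p = p')
      fun p' _ => ?_).mono fun x hx p hp p' hp' => hx p hp p' hp'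
  by_cases hpp : p = p'
  · exact generically_true.mono fun _ _ _ => hpp
  · exact ⟨_, (isPoly_orbitSum_shift p).sub (isPoly_orbitSum_shift p'),
      orbitSum_shift_sub_ne_zero hm hq hpp, fun x hx he => absurd (sub_eq_zero.2 he) hx⟩

/-- Extreme exponents of eigenvectors. -/
lemma eigen_top (hm : 1 ≤ m) (hq : NotRoot h) {x : Fin (n + 1) → ℂ}
    {S : Finset (Fin (n + 1) → ℤ)} (hx : Res h m (tset m S) x) {c : QIs h m x}
    (hc : (c : (Fin (n + 1) → ℤ) →₀ ℂ).support ⊆ S) (hc0 : c ≠ 0) {E : ℂ}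
    (hE : opE hm hq x c = E • c) :
    ∃ y, E = orbitSum h m (x + cvec (lat m y)) ∧ ∀ ℓ, GenDir ℓ →
      y + kv m ℓ ∈ (c : (Fin (n + 1) → ℤ) →₀ ℂ).support ∧
      ∀ p ∈ (c : (Fin (n + 1) → ℤ) →₀ ℂ).support, dot p ℓ ≤ dot (y + kv m ℓ) ℓ := by
  have hc0' : (c : (Fin (n + 1) → ℤ) →₀ ℂ) ≠ 0 := fun hh => hc0 (Subtype.ext hh)
  have key : ∀ ℓ, GenDir ℓ → ∃ p ∈ (c : (Fin (n + 1) → ℤ) →₀ ℂ).support,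
      (∀ p' ∈ (c : (Fin (n + 1) → ℤ) →₀ ℂ).support, dot p' ℓ ≤ dot p ℓ) ∧
      E = orbitSum h m (x + cvec (lat m (p - kv m ℓ))) := by
    intro ℓ hℓ
    obtain ⟨p, hp, hmax⟩ := exists_top hc0' ℓ
    refine ⟨p, hp, hmax, ?_⟩
    have h1 := (tD_top hm hq.ne_zero (opE_spec hm hq x c) hℓ hmax).2
    rw [hE, Submodule.coe_smul, Finsupp.smul_apply, smul_eq_mul] at h1
    exact mul_right_cancel₀ (Finsupp.mem_support_iff.1 hp) h1
  obtain ⟨ℓ0, hℓ0⟩ := exists_genDir (n := n)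
  obtain ⟨p0, hp0, _, hE0⟩ := key ℓ0 hℓ0
  refine ⟨p0 - kv m ℓ0, hE0, fun ℓ hℓ => ?_⟩
  obtain ⟨p, hp, hmax, hEp⟩ := key ℓ hℓ
  -- The eigenvalue read off in the directions `ℓ0` and `ℓ` is the same, so the distinctness of the
  -- values of `𝔪` makes `p - kv ℓ` independent of `ℓ`.
  have := hx _ (sub_kv_mem_tset (hc hp0) ℓ0) _ (sub_kv_mem_tset (hc hp) ℓ) (hE0 ▸ hEp)
  rw [this, sub_add_cancel]
  exact ⟨hp, hmax⟩

/-- The polynomial with roots `𝔪(x + lat y)`, `y ∈ Y`. -/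
def orbPoly (h : ℂ) (m : ℕ) (x : Fin (n + 1) → ℂ) (Y : Finset (Fin (n + 1) → ℤ)) :
    Polynomial ℂ :=
  ∏ y ∈ Y, (Polynomial.X - Polynomial.C (orbitSum h m (x + cvec (lat m y))))

/-- Quasi-invariant coefficient vectors with support in `S`. -/
def QIsupp (h : ℂ) (m : ℕ) (x : Fin (n + 1) → ℂ) (S : Finset (Fin (n + 1) → ℤ)) :
    Submodule ℂ (QIs h m x) :=
  (Finsupp.supported ℂ ℂ (S : Set (Fin (n + 1) → ℤ))).comap (QIs h m x).subtype

lemma mem_QIsupp {x : Fin (n + 1) → ℂ} {S : Finset (Fin (n + 1) → ℤ)} {c : QIs h m x} :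
    c ∈ QIsupp h m x S ↔ (c : (Fin (n + 1) → ℤ) →₀ ℂ).support ⊆ S := by
  rw [QIsupp, Submodule.mem_comap, Finsupp.mem_supported, Submodule.subtype_apply,
    Finset.coe_subset]

lemma finite_of_injective {V W : Type*} [AddCommMonoid V] [Module ℂ V] [AddCommMonoid W]
    [Module ℂ W] [Module.Finite ℂ W] (f : V →ₗ[ℂ] W) (hf : Function.Injective f) :
    Module.Finite ℂ V := by
  let _ : AddCommGroup V := Module.addCommMonoidToAddCommGroup ℂ
  let _ : AddCommGroup W := Module.addCommMonoidToAddCommGroup ℂ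
  exact Module.Finite.of_injective f hf

lemma finiteDimensional_QIsupp (x : Fin (n + 1) → ℂ) (S : Finset (Fin (n + 1) → ℤ)) :
    Module.Finite ℂ (QIsupp h m x S) := by
  let f : QIsupp h m x S →ₗ[ℂ] (S → ℂ) :=
    { toFun := fun c p => (c : QIs h m x).1 p.1
      map_add' := fun _ _ => rfl
      map_smul' := fun _ _ => rfl }
  refine finite_of_injective f fun a b hab => Subtype.ext (Subtype.ext (Finsupp.ext fun p => ?_))
  by_cases hp : p ∈ S
  · exact congrFun hab ⟨p, hp⟩
  · rw [Finsupp.notMem_support_iff.1 fun hh => hp (mem_QIsupp.1 a.2 hh),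
      Finsupp.notMem_support_iff.1 fun hh => hp (mem_QIsupp.1 b.2 hh)]

lemma exists_eigenvector_mem_of_group {V : Type*} [AddCommGroup V] [Module ℂ V]
    (T : Module.End ℂ V) (U W : Submodule ℂ V) (hfin : Module.Finite ℂ U) (hUW : W ≤ U)
    (hW : ∀ w ∈ W, T w ∈ W) (hne : W ≠ ⊥) : ∃ E : ℂ, ∃ v ∈ W, v ≠ 0 ∧ T v = E • v := by
  have : FiniteDimensional ℂ W := Submodule.finiteDimensional_of_le hUW
  have : Nontrivial W := Submodule.nontrivial_iff_ne_bot.2 hne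
  obtain ⟨E, hE⟩ := Module.End.exists_eigenvalue (T.restrict hW)
  obtain ⟨⟨g, hgW⟩, hg⟩ := hE.exists_hasEigenvector
  exact ⟨E, g, hgW, fun hh => hg.2 (Subtype.ext hh),
    congrArg Subtype.val (Module.End.mem_eigenspace_iff.1 hg.1)⟩

lemma exists_eigenvector_mem {V : Type*} [AddCommMonoid V] [Module ℂ V]
    (T : Module.End ℂ V) (U W : Submodule ℂ V) (hfin : Module.Finite ℂ U) (hUW : W ≤ U)
    (hW : ∀ w ∈ W, T w ∈ W) (hne : W ≠ ⊥) : ∃ E : ℂ, ∃ v ∈ W, v ≠ 0 ∧ T v = E • v := by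
  let _ : AddCommGroup V := Module.addCommMonoidToAddCommGroup ℂ
  exact exists_eigenvector_mem_of_group T U W hfin hUW hW hne

lemma aeval_mem_QIsupp (hm : 1 ≤ m) (hq : NotRoot h) {x : Fin (n + 1) → ℂ}
    {S : Finset (Fin (n + 1) → ℤ)} (hS : Sep S) (P : Polynomial ℂ) {c : QIs h m x}
    (hc : c ∈ QIsupp h m x S) : Polynomial.aeval (opE hm hq x) P c ∈ QIsupp h m x S := by
  induction P using Polynomial.induction_on' with
  | add P Q hP hQ => rw [map_add, LinearMap.add_apply]; exact add_mem hP hQ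
  | monomial k a =>
    rw [Polynomial.aeval_monomial, Module.End.mul_apply, Module.algebraMap_end_apply]
    refine Submodule.smul_mem _ _ ?_
    induction k with
    | zero => simpa using hc
    | succ k ih =>
      rw [pow_succ', Module.End.mul_apply]
      exact mem_QIsupp.2 (opE_supp hm hq hS (mem_QIsupp.1 ih))

/-- Written without subtraction, because `V` is only an additive monoid. -/
lemma aeval_X_sub_C_mul {V : Type*} [AddCommMonoid V] [Module ℂ V] (T : Module.End ℂ V) (a : ℂ)
    (P : Polynomial ℂ) (v : V) :
    Polynomial.aeval T ((Polynomial.X - Polynomial.C a) * P) v + a • Polynomial.aeval T P v =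
      T (Polynomial.aeval T P v) := by
  have h1 : (Polynomial.X - Polynomial.C a) * P + Polynomial.C a * P = Polynomial.X * P := by ring
  have h2 := congrArg (fun R => Polynomial.aeval T R v) h1
  simpa only [map_add, LinearMap.add_apply, map_mul, Module.End.mul_apply, Polynomial.aeval_X,
    Polynomial.aeval_C, Module.algebraMap_end_apply] using h2

/-- The operator is annihilated by the polynomial whose roots are the possible eigenvalues. -/
lemma orbPoly_kill (hm : 1 ≤ m) (hq : NotRoot h) {x : Fin (n + 1) → ℂ}
    {S Y : Finset (Fin (n + 1) → ℤ)} (hS : Sep S) (hx : Res h m (tset m S) x)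
    (hY : ∀ y, (∀ ℓ, GenDir ℓ → y + kv m ℓ ∈ S) → y ∈ Y) {c : QIs h m x}
    (hc : c ∈ QIsupp h m x S) : Polynomial.aeval (opE hm hq x) (orbPoly h m x Y) c = 0 := by
  classical
  set V := QIsupp h m x S with hV
  set A := Polynomial.aeval (opE hm hq x) (orbPoly h m x Y) with hA
  -- A nonzero image would be an invariant finite-dimensional space and contain an eigenvector `g =
  -- (T - E) g'`, with `g'` obtained by omitting one factor of the polynomial. Comparing leading
  -- terms of `g` and `g'` excludes such a Jordan block.
  let W : Submodule ℂ (QIs h m x) := V.map A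
  have hWV : W ≤ V := by
    rintro _ ⟨f, hf, rfl⟩
    exact aeval_mem_QIsupp hm hq hS _ hf
  suffices hbot : W = ⊥ by
    have : A c ∈ W := ⟨c, hc, rfl⟩
    rw [hbot] at this
    exact (Submodule.mem_bot ℂ).1 this
  by_contra hne
  have hWinv : ∀ g ∈ W, opE hm hq x g ∈ W := by
    rintro _ ⟨f, hf, rfl⟩
    refine ⟨opE hm hq x f, mem_QIsupp.2 (opE_supp hm hq hS (mem_QIsupp.1 hf)), ?_⟩
    have : A * opE hm hq x = opE hm hq x * A := by
      rw [hA]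
      nth_rewrite 2 [← Polynomial.aeval_X (R := ℂ) (opE hm hq x)]
      nth_rewrite 3 [← Polynomial.aeval_X (R := ℂ) (opE hm hq x)]
      rw [← map_mul, ← map_mul, mul_comm]
    exact LinearMap.congr_fun this f
  obtain ⟨E, g, hgW, hg0, hgE⟩ := exists_eigenvector_mem (opE hm hq x) V W
    (finiteDimensional_QIsupp x S) hWV hWinv hne
  have hgS := mem_QIsupp.1 (hWV hgW)
  obtain ⟨y, hEy, hy⟩ := eigen_top hm hq hx hgS hg0 hgE
  have hyY : y ∈ Y := hY y fun ℓ hℓ => hgS (hy ℓ hℓ).1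
  obtain ⟨f, hf, hfg⟩ := hgW
  set g' := Polynomial.aeval (opE hm hq x) (orbPoly h m x (Y.erase y)) f with hg'
  have hg'S := mem_QIsupp.1 (aeval_mem_QIsupp hm hq hS (orbPoly h m x (Y.erase y)) hf)
  have hgg' : g + E • g' = opE hm hq x g' := by
    rw [← hfg, hA, orbPoly, ← Finset.mul_prod_erase Y _ hyY, ← hEy]
    exact aeval_X_sub_C_mul _ _ _ _
  have hg'0 : (g' : (Fin (n + 1) → ℤ) →₀ ℂ) ≠ 0 := by
    intro hh
    apply hg0
    have : g' = 0 := Subtype.ext hh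
    rwa [this, map_zero, smul_zero, add_zero] at hgg'
  obtain ⟨ℓ, hℓ⟩ := exists_genDir (n := n)
  obtain ⟨p, hp, hmax⟩ := exists_top hg'0 ℓ
  obtain ⟨h1, h2⟩ := tD_top hm hq.ne_zero (opE_spec hm hq x g') hℓ hmax
  have hgp : ∀ p', (g : (Fin (n + 1) → ℤ) →₀ ℂ) p' =
      (opE hm hq x g' : (Fin (n + 1) → ℤ) →₀ ℂ) p' -
        E * (g' : (Fin (n + 1) → ℤ) →₀ ℂ) p' := by
    intro p'
    rw [← hgg']
    simp
  have hgtop : ∀ p' ∈ (g : (Fin (n + 1) → ℤ) →₀ ℂ).support, dot p' ℓ ≤ dot p ℓ := by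
    intro p' hp'
    by_contra hlt
    rw [Finsupp.mem_support_iff, hgp] at hp'
    apply hp'
    rw [Finsupp.notMem_support_iff.1 fun hh => hlt (h1 p' hh),
      Finsupp.notMem_support_iff.1 fun hh => hlt (hmax p' hh)]
    ring
  have h3 := (tD_top hm hq.ne_zero (opE_spec hm hq x g) hℓ hgtop).2
  have h4 : (opE hm hq x g : (Fin (n + 1) → ℤ) →₀ ℂ) p = E * (g : (Fin (n + 1) → ℤ) →₀ ℂ) p := by
    rw [hgE]; simp
  have h5 := hgp p
  rw [h2] at h5
  -- With `λ` the multiplier at the top exponent `p` of `g'`, one has `g_p = (λ - E) g'_p` and `(λ -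
  -- E) g_p = 0`, hence `(λ - E)² g'_p = 0` and `λ = E`.
  have h6 : orbitSum h m (x + cvec (lat m (p - kv m ℓ))) = E := by
    by_contra hne
    have hne' := sub_ne_zero.2 hne
    have h7 : (orbitSum h m (x + cvec (lat m (p - kv m ℓ))) - E) *
        (g : (Fin (n + 1) → ℤ) →₀ ℂ) p = 0 := by
      rw [sub_mul, ← h3, h4, sub_self]
    rw [h5, ← sub_mul] at h7
    exact (mul_ne_zero hne' (mul_ne_zero hne' (Finsupp.mem_support_iff.1 hp))) h7
  have h8 : (g : (Fin (n + 1) → ℤ) →₀ ℂ) p = 0 := by rw [h5, h6, sub_self]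
  -- So `g_p = 0`; but equality of eigenvalues identifies `p` with the vertex `y + kv ℓ`, which
  -- belongs to the support of the eigenvector `g`.
  have h9 : p = y + kv m ℓ := by
    have h10 : y ∈ tset m S := by
      have := sub_kv_mem_tset (m := m) (hgS (hy ℓ hℓ).1) ℓ
      rwa [add_sub_cancel_right] at this
    have := hx _ (sub_kv_mem_tset (hg'S hp) ℓ) _ h10 (h6.trans hEy)
    rw [← this, sub_add_cancel]
  exact (Finsupp.mem_support_iff.1 (hy ℓ hℓ).1) (h9 ▸ h8)

/-! ### Integral zonotopes -/

/-- The lattice points `∑ l_α α` with integral `0 ≤ l_α ≤ M_α`. -/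
def zon (M : PosRoot n → ℕ) : Finset (Fin (n + 1) → ℤ) :=
  open Classical in
  (Fintype.piFinset fun α : PosRoot n => Finset.range (M α + 1)).image
    fun l => ∑ α, (l α : ℤ) • sroot α

lemma mem_zon {M : PosRoot n → ℕ} {p : Fin (n + 1) → ℤ} :
    p ∈ zon M ↔ ∃ l : PosRoot n → ℕ, (∀ α, l α ≤ M α) ∧ p = ∑ α, (l α : ℤ) • sroot α := by
  classical
  simp only [zon, Finset.mem_image, Fintype.mem_piFinset, Finset.mem_range, Nat.lt_succ_iff]
  exact exists_congr fun l => and_congr_right fun _ => eq_comm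

/-- The value of the cut `A`. -/
def cut (M : PosRoot n → ℕ) (A : Finset (Fin (n + 1))) : ℤ :=
  ∑ α : PosRoot n, if α.1.1 ∈ A ∧ α.1.2 ∉ A then (M α : ℤ) else 0

lemma sum_sroot (α : PosRoot n) (B : Finset (Fin (n + 1))) :
    ∑ i ∈ B, sroot α i = (if α.1.1 ∈ B then 1 else 0) - if α.1.2 ∈ B then 1 else 0 := by
  simp only [sroot, Pi.sub_apply, Finset.sum_sub_distrib]
  congr 1 <;> simp [Pi.single_apply]

/-- Cut functions of a directed graph are submodular term by term. The edge `α`, from `A \ B` to `B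
\ A`, counts in the cut of `A` but in neither of the cuts on the left, so the inequality is strict.
-/
lemma cut_submodular (M : PosRoot n → ℕ) (A B : Finset (Fin (n + 1))) {α : PosRoot n}
    (hα : 1 ≤ M α) (h1 : α.1.1 ∈ A) (h2 : α.1.2 ∉ A) (h3 : α.1.1 ∉ B) (h4 : α.1.2 ∈ B) :
    cut M (A ∪ B) + cut M (A ∩ B) < cut M A + cut M B := by
  simp only [cut, ← Finset.sum_add_distrib]
  refine Finset.sum_lt_sum (fun β _ => ?_) ⟨α, Finset.mem_univ _, ?_⟩
  · have : (0 : ℤ) ≤ M β := Int.natCast_nonneg _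
    by_cases a1 : β.1.1 ∈ A <;> by_cases a2 : β.1.2 ∈ A <;> by_cases a3 : β.1.1 ∈ B <;>
      by_cases a4 : β.1.2 ∈ B <;> simp [a1, a2, a3, a4]
  · simp [h1, h2, h3, h4]
    omega

lemma cut_update (M : PosRoot n → ℕ) {α : PosRoot n} (hα : 1 ≤ M α) (A : Finset (Fin (n + 1))) :
    cut (Function.update M α (M α - 1)) A =
      cut M A - if α.1.1 ∈ A ∧ α.1.2 ∉ A then 1 else 0 := by
  rw [eq_sub_iff_add_eq, cut, cut, ← Finset.add_sum_erase _ _ (Finset.mem_univ α),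
    ← Finset.add_sum_erase (a := α) _ (fun β : PosRoot n => if β.1.1 ∈ A ∧ β.1.2 ∉ A then
      (M β : ℤ) else 0) (Finset.mem_univ α), Finset.sum_congr rfl fun β hβ => by
      rw [Function.update_of_ne (Finset.ne_of_mem_erase hβ)]]
  rw [Function.update_self]
  split_ifs <;> omega

lemma zon_update_subset (M : PosRoot n → ℕ) (α : PosRoot n) :
    zon (Function.update M α (M α - 1)) ⊆ zon M := by
  intro p hp
  obtain ⟨l, hl, rfl⟩ := mem_zon.1 hp
  refine mem_zon.2 ⟨l, fun β => (hl β).trans ?_, rfl⟩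
  by_cases hβ : β = α
  · subst hβ; simp
  · rw [Function.update_of_ne hβ]

lemma mem_zon_of_update {M : PosRoot n → ℕ} {α : PosRoot n} (hα : 1 ≤ M α)
    {p : Fin (n + 1) → ℤ} (hp : p - sroot α ∈ zon (Function.update M α (M α - 1))) :
    p ∈ zon M := by
  obtain ⟨l, hl, hpl⟩ := mem_zon.1 hp
  refine mem_zon.2 ⟨fun β => l β + if β = α then 1 else 0, fun β => ?_, ?_⟩
  · have := hl β
    by_cases hβ : β = α
    · subst hβ
      rw [Function.update_self] at this
      simp only [if_true]
      omega
    · rw [Function.update_of_ne hβ] at this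
      simpa [hβ] using this
  · rw [sub_eq_iff_eq_add] at hpl
    rw [hpl]
    simp [add_smul, Finset.sum_add_distrib]

/-- Integral points satisfying all cut conditions lie in the integral zonotope. -/
theorem mem_zon_of_cut (N : ℕ) : ∀ (M : PosRoot n → ℕ) (_ : ∑ α, M α = N)
    (p : Fin (n + 1) → ℤ) (_ : ∑ i, p i = 0) (_ : ∀ A : Finset (Fin (n + 1)),
    ∑ i ∈ A, p i ≤ cut M A), p ∈ zon M := by
  -- This is integrality of network flows. One unit of a positive `M α` is removed, and either `p`
  -- or `p - α` is shown to satisfy the cut conditions for the reduced multiplicities.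
  induction N with
  | zero =>
    intro M hM p hp hA
    have hM0 : ∀ α, M α = 0 := fun α => (Finset.sum_eq_zero_iff.1 hM) α (Finset.mem_univ _)
    have h1 : ∀ i, p i ≤ 0 := fun i => by simpa [cut, hM0] using hA {i}
    have h2 := (Finset.sum_eq_zero_iff_of_nonpos fun i _ => h1 i).1 hp
    exact mem_zon.2 ⟨0, fun _ => Nat.zero_le _, by funext i; simp [h2 i (Finset.mem_univ _)]⟩
  | succ N ih =>
    intro M hM p hp hA
    obtain ⟨α, -, hα⟩ : ∃ α ∈ Finset.univ, M α ≠ 0 := by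
      by_contra! hh
      rw [Finset.sum_eq_zero hh] at hM
      omega
    have hα1 : 1 ≤ M α := Nat.one_le_iff_ne_zero.2 hα
    have hne : α.1.1 ≠ α.1.2 := ne_of_lt α.2
    set M' := Function.update M α (M α - 1) with hM'
    have hsum : ∑ β, M' β = N := by
      have hM2 : M α + ∑ β ∈ Finset.univ.erase α, M β = N + 1 := by
        rw [Finset.add_sum_erase _ _ (Finset.mem_univ α), hM]
      rw [← Finset.add_sum_erase _ _ (Finset.mem_univ α)]
      rw [hM', Function.update_self, Finset.sum_congr rfl fun β hβ => by
        rw [Function.update_of_ne (Finset.ne_of_mem_erase hβ)]]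
      change M α - 1 + ∑ β ∈ Finset.univ.erase α, M β = N
      omega
    by_cases H1 : ∀ A : Finset (Fin (n + 1)), ∑ i ∈ A, p i ≤ cut M' A
    · exact zon_update_subset M α (ih M' hsum p hp H1)
    by_cases H2 : ∀ A : Finset (Fin (n + 1)), ∑ i ∈ A, (p - sroot α) i ≤ cut M' A
    · refine mem_zon_of_update hα1 (ih M' hsum _ ?_ H2)
      rw [Finset.sum_congr rfl fun i _ => Pi.sub_apply p (sroot α) i, Finset.sum_sub_distrib, hp,
        sum_sroot]
      simp
    exfalso
    -- If both fail, there are a tight cut `A` which `α` leaves and a tight cut `B` which `α`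
    -- enters. Strict submodularity contradicts the conditions for `A ∪ B` and `A ∩ B`.
    push Not at H1 H2
    obtain ⟨A, hA1⟩ := H1
    obtain ⟨B, hB1⟩ := H2
    rw [Finset.sum_congr rfl fun i _ => Pi.sub_apply p (sroot α) i, Finset.sum_sub_distrib,
      sum_sroot] at hB1
    rw [cut_update M hα1] at hA1 hB1
    have a0 := hA A
    have b0 := hA B
    have c1 : α.1.1 ∈ A ∧ α.1.2 ∉ A := by
      by_contra hh
      rw [if_neg hh] at hA1
      omega
    rw [if_pos c1] at hA1
    have c2 : α.1.1 ∉ B ∧ α.1.2 ∈ B := by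
      by_cases d1 : α.1.1 ∈ B <;> by_cases d2 : α.1.2 ∈ B <;> simp [d1, d2] at hB1 ⊢ <;> omega
    have e1 : cut M B ≤ ∑ i ∈ B, p i := by
      simp [c2.1, c2.2] at hB1
      omega
    have e2 := cut_submodular M A B hα1 c1.1 c1.2 c2.1 c2.2
    have e3 := hA (A ∪ B)
    have e4 := hA (A ∩ B)
    have e5 := Finset.sum_union_inter (s₁ := A) (s₂ := B) (f := p)
    omega

/-- The support function of the zonotope. -/
def zsupp (M : PosRoot n → ℕ) (ℓ : Fin (n + 1) → ℝ) : ℝ :=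
  ∑ α : PosRoot n, M α * max (ℓ α.1.1 - ℓ α.1.2) 0

lemma continuous_zsupp (M : PosRoot n → ℕ) : Continuous (zsupp M) := by
  unfold zsupp
  fun_prop

lemma dot_sroot (α : PosRoot n) (ℓ : Fin (n + 1) → ℝ) :
    dot (sroot α) ℓ = ℓ α.1.1 - ℓ α.1.2 := by
  have : ∀ i, ((sroot α i : ℤ) : ℝ) * ℓ i =
      (if i = α.1.1 then ℓ i else 0) - if i = α.1.2 then ℓ i else 0 := by
    intro i
    rw [sroot, Pi.sub_apply, Pi.single_apply, Pi.single_apply]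
    split_ifs <;> simp
  rw [dot, Finset.sum_congr rfl fun i _ => this i, Finset.sum_sub_distrib]
  simp

lemma dot_zsmul (k : ℤ) (p : Fin (n + 1) → ℤ) (ℓ : Fin (n + 1) → ℝ) :
    dot (k • p) ℓ = k * dot p ℓ := by
  simp [dot, Finset.mul_sum, mul_assoc]

lemma dot_sum {ι : Type*} (s : Finset ι) (p : ι → Fin (n + 1) → ℤ) (ℓ : Fin (n + 1) → ℝ) :
    dot (∑ a ∈ s, p a) ℓ = ∑ a ∈ s, dot (p a) ℓ := by
  simp only [dot, Finset.sum_apply, Int.cast_sum, Finset.sum_mul]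
  rw [Finset.sum_comm]

lemma dot_le_zsupp {M : PosRoot n → ℕ} {p : Fin (n + 1) → ℤ} (hp : p ∈ zon M)
    (ℓ : Fin (n + 1) → ℝ) : dot p ℓ ≤ zsupp M ℓ := by
  obtain ⟨l, hl, rfl⟩ := mem_zon.1 hp
  rw [dot_sum, zsupp]
  refine Finset.sum_le_sum fun α _ => ?_
  rw [dot_zsmul, dot_sroot]
  have h1 : (l α : ℝ) ≤ M α := by exact_mod_cast hl α
  calc (((l α : ℕ) : ℤ) : ℝ) * (ℓ α.1.1 - ℓ α.1.2)
      ≤ l α * max (ℓ α.1.1 - ℓ α.1.2) 0 := by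
        rw [Int.cast_natCast]
        exact mul_le_mul_of_nonneg_left (le_max_left _ _) (Nat.cast_nonneg _)
    _ ≤ _ := mul_le_mul_of_nonneg_right h1 (le_max_right _ _)

lemma dot_indicator (p : Fin (n + 1) → ℤ) (A : Finset (Fin (n + 1))) :
    dot p (fun i => if i ∈ A then 1 else 0) = ((∑ i ∈ A, p i : ℤ) : ℝ) := by
  simp [dot]

lemma zsupp_indicator (M : PosRoot n → ℕ) (A : Finset (Fin (n + 1))) :
    zsupp M (fun i => if i ∈ A then 1 else 0) = (cut M A : ℝ) := by
  rw [zsupp, cut, Int.cast_sum]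
  refine Finset.sum_congr rfl fun α _ => ?_
  by_cases h1 : α.1.1 ∈ A <;> by_cases h2 : α.1.2 ∈ A <;> simp [h1, h2]

lemma zsupp_const (M : PosRoot n → ℕ) (a : ℝ) : zsupp M (fun _ => a) = 0 := by simp [zsupp]

/-- Only the constant directions `1`, `-1` and the indicators of subsets are used; there the support
function takes the value `0` and the values of the cuts. -/
lemma mem_zon_of_dot {M : PosRoot n → ℕ} {p : Fin (n + 1) → ℤ}
    (hp : ∀ ℓ, dot p ℓ ≤ zsupp M ℓ) : p ∈ zon M := by
  refine mem_zon_of_cut _ M rfl p ?_ fun A => ?_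
  · have h1 := hp fun _ => 1
    have h2 := hp fun _ => -1
    rw [zsupp_const] at h1 h2
    simp only [dot, mul_one, mul_neg, Finset.sum_neg_distrib] at h1 h2
    have : (∑ i, (p i : ℝ)) = 0 := by linarith
    exact_mod_cast this
  · have := hp fun i => if i ∈ A then 1 else 0
    rw [dot_indicator, zsupp_indicator] at this
    exact_mod_cast this

lemma mem_zon_of_genDir {M : PosRoot n → ℕ} {p : Fin (n + 1) → ℤ}
    (hp : ∀ ℓ, GenDir ℓ → dot p ℓ ≤ zsupp M ℓ) : p ∈ zon M := by
  refine mem_zon_of_dot fun ℓ => ?_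
  have hc : IsClosed {ℓ : Fin (n + 1) → ℝ | dot p ℓ ≤ zsupp M ℓ} :=
    isClosed_le (continuous_dot p) (continuous_zsupp M)
  have : (Set.univ : Set (Fin (n + 1) → ℝ)) ⊆ {ℓ | dot p ℓ ≤ zsupp M ℓ} := by
    rw [← dense_genDir.closure_eq]
    exact closure_minimal hp hc
  exact this (Set.mem_univ ℓ)

lemma sep_zon (M : PosRoot n → ℕ) : Sep (zon M) := by
  intro p hp
  by_contra! hh
  exact hp (mem_zon_of_dot fun ℓ => hh ℓ _ fun p' hp' => dot_le_zsupp hp' ℓ)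

/-- A box of exponents. -/
def box (n : ℕ) (N : ℤ) : Finset (Fin (n + 1) → ℤ) :=
  Fintype.piFinset fun _ => Finset.Icc (-N) N

lemma mem_box {N : ℤ} {p : Fin (n + 1) → ℤ} : p ∈ box n N ↔ ∀ i, -N ≤ p i ∧ p i ≤ N := by
  simp [box]

lemma dot_single (p : Fin (n + 1) → ℤ) (i : Fin (n + 1)) (a : ℝ) :
    dot p (Pi.single i a) = p i * a := by
  simp [dot, Pi.single_apply]

lemma sep_box (N : ℤ) : Sep (box n N) := by
  intro p hp
  rw [mem_box] at hp
  push Not at hp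
  obtain ⟨i, hi⟩ := hp
  by_cases h1 : -N ≤ p i
  · refine ⟨Pi.single i 1, N, fun p' hp' => ?_, ?_⟩
    · rw [dot_single, mul_one]
      exact_mod_cast (mem_box.1 hp' i).2
    · rw [dot_single, mul_one]
      exact_mod_cast hi h1
  · refine ⟨Pi.single i (-1), N, fun p' hp' => ?_, ?_⟩
    · rw [dot_single, mul_neg_one]
      have := (mem_box.1 hp' i).1
      exact_mod_cast (by linarith : -p' i ≤ N)
    · rw [dot_single, mul_neg_one]
      exact_mod_cast (by linarith : N < -p i)

lemma exists_box (S : Finset (Fin (n + 1) → ℤ)) : ∃ N : ℤ, S ⊆ box n N := by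
  refine ⟨∑ p ∈ S, ∑ i, |p i|, fun p hp => mem_box.2 fun i => ?_⟩
  have h1 : |p i| ≤ ∑ i, |p i| :=
    Finset.single_le_sum (f := fun i => |p i|) (fun _ _ => abs_nonneg _) (Finset.mem_univ i)
  have h2 : ∑ i, |p i| ≤ ∑ p ∈ S, ∑ i, |p i| :=
    Finset.single_le_sum (f := fun p : Fin (n + 1) → ℤ => ∑ i, |p i|)
      (fun _ _ => Finset.sum_nonneg fun _ _ => abs_nonneg _) hp
  exact abs_le.1 (h1.trans h2)

/-- The multiplicities `k m_α`. -/
def kmul (n m k : ℕ) : PosRoot n → ℕ := fun α => k * mlt m α.1.1 α.1.2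

lemma kv_mem_zon (ℓ : Fin (n + 1) → ℝ) : kv m ℓ ∈ zon (kmul n m 1) := by
  refine mem_zon.2 ⟨fun α => if ℓ α.1.2 < ℓ α.1.1 then mlt m α.1.1 α.1.2 else 0, fun α => ?_, ?_⟩
  · rw [kmul, one_mul]
    dsimp only
    split_ifs <;> omega
  · rw [kv]
    refine Finset.sum_congr rfl fun α _ => ?_
    dsimp only
    rw [Nat.cast_ite, Nat.cast_zero]

lemma dot_kv (ℓ : Fin (n + 1) → ℝ) : dot (kv m ℓ) ℓ = zsupp (kmul n m 1) ℓ := by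
  rw [kv, dot_sum, zsupp]
  refine Finset.sum_congr rfl fun α _ => ?_
  rw [dot_zsmul, dot_sroot, kmul]
  split_ifs with hh
  · rw [max_eq_left (by linarith)]; push_cast; ring
  · rw [max_eq_right (by linarith)]; simp

lemma zsupp_kmul (k : ℕ) (ℓ : Fin (n + 1) → ℝ) :
    zsupp (kmul n m k) ℓ = k * zsupp (kmul n m 1) ℓ := by
  simp only [zsupp, kmul, Finset.mul_sum]
  exact Finset.sum_congr rfl fun α _ => by push_cast; ring

/-- The support function of the doubled zonotope is twice that of the zonotope, and `kv ℓ` attains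
the latter. Thus the eigenvalues possible on the support of `q^{2(ρ,z)} Q` are indexed by the
integral points entering the product formula. -/
lemma mem_zon_of_add_kv {y : Fin (n + 1) → ℤ}
    (hy : ∀ ℓ, GenDir ℓ → y + kv m ℓ ∈ zon (kmul n m 2)) : y ∈ zon (kmul n m 1) := by
  refine mem_zon_of_genDir fun ℓ hℓ => ?_
  have := dot_le_zsupp (hy ℓ hℓ) ℓ
  rw [dot_add, dot_kv, zsupp_kmul 2] at this
  push_cast at this
  linarith

/-- The same comparison of support functions leaves the zonotope with all multiplicities zero. It
shows that `𝔪(x)` is the only eigenvalue possible on the zonotope itself. -/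
lemma eq_zero_of_add_kv {y : Fin (n + 1) → ℤ}
    (hy : ∀ ℓ, GenDir ℓ → y + kv m ℓ ∈ zon (kmul n m 1)) : y = 0 := by
  have h1 : ∀ ℓ, GenDir ℓ → dot y ℓ ≤ zsupp (0 : PosRoot n → ℕ) ℓ := by
    intro ℓ hℓ
    have := dot_le_zsupp (hy ℓ hℓ) ℓ
    rw [dot_add, dot_kv] at this
    simp only [zsupp, Pi.zero_apply, Nat.cast_zero, zero_mul, Finset.sum_const_zero]
    linarith
  obtain ⟨l, hl, rfl⟩ := mem_zon.1 (mem_zon_of_genDir h1)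
  exact Finset.sum_eq_zero fun α _ => by simp [Nat.le_zero.1 (hl α)]

lemma zon_mono {M M' : PosRoot n → ℕ} (hM : ∀ α, M α ≤ M' α) : zon M ⊆ zon M' := by
  intro p hp
  obtain ⟨l, hl, rfl⟩ := mem_zon.1 hp
  exact mem_zon.2 ⟨l, fun α => (hl α).trans (hM α), rfl⟩

lemma zero_mem_zon (M : PosRoot n → ℕ) : (0 : Fin (n + 1) → ℤ) ∈ zon M :=
  mem_zon.2 ⟨0, fun _ => Nat.zero_le _, by simp⟩

/-! ### The polynomial `q^{2(ρ, z)} Q(z)` -/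

/-- `f` is a polynomial with exponents in `zon M` and constant term `1`. -/
def ZPoly (h : ℂ) (m : ℕ) (f : (Fin (n + 1) → ℂ) → ℂ) (M : PosRoot n → ℕ) : Prop :=
  ∃ c : (Fin (n + 1) → ℤ) →₀ ℂ, f = ev h m c ∧ c.support ⊆ zon M ∧ c 0 = 1

lemma add_mem_zon {M M' : PosRoot n → ℕ} {p p' : Fin (n + 1) → ℤ} (hp : p ∈ zon M)
    (hp' : p' ∈ zon M') : p + p' ∈ zon (M + M') := by
  obtain ⟨l, hl, rfl⟩ := mem_zon.1 hp
  obtain ⟨l', hl', rfl⟩ := mem_zon.1 hp'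
  refine mem_zon.2 ⟨l + l', fun α => add_le_add (hl α) (hl' α), ?_⟩
  simp [add_smul, Finset.sum_add_distrib]

/-- A linear functional positive on the positive roots. -/
def decr (n : ℕ) : Fin (n + 1) → ℝ := fun i => -((i : ℕ) : ℝ)

lemma dot_sroot_decr (α : PosRoot n) : 0 < dot (sroot α) (decr n) := by
  rw [dot_sroot, decr, decr]
  have : ((α.1.1 : ℕ) : ℝ) < (α.1.2 : ℕ) := by exact_mod_cast Fin.lt_def.1 α.2
  linarith

/-- The functional `decr` is positive on positive roots, so `0` is the lowest vertex of every
zonotope. Consequently constant terms multiply in `ZPoly.mul`. -/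
lemma eq_zero_of_add_eq_zero {M M' : PosRoot n → ℕ} {p p' : Fin (n + 1) → ℤ} (hp : p ∈ zon M)
    (hp' : p' ∈ zon M') (hpp : p + p' = 0) : p = 0 := by
  obtain ⟨l, hl, rfl⟩ := mem_zon.1 hp
  obtain ⟨l', hl', rfl⟩ := mem_zon.1 hp'
  have h1 := congrArg (fun p => dot p (decr n)) hpp
  simp only [dot_add, dot_sum, dot_zsmul, ← Finset.sum_add_distrib] at h1
  rw [show dot (0 : Fin (n + 1) → ℤ) (decr n) = 0 by simp [dot],
    Finset.sum_eq_zero_iff_of_nonneg fun α _ => ?_] at h1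
  · refine Finset.sum_eq_zero fun α _ => ?_
    have h2 := h1 α (Finset.mem_univ _)
    rw [← add_mul, mul_eq_zero, or_iff_left (dot_sroot_decr α).ne'] at h2
    have h3 : (l α : ℤ) + l' α = 0 := by exact_mod_cast h2
    have : (l α : ℤ) = 0 := by omega
    rw [this, zero_smul]
  · have := (dot_sroot_decr α).le
    positivity

lemma ZPoly.mul {f g : (Fin (n + 1) → ℂ) → ℂ} {M M' : PosRoot n → ℕ} (hf : ZPoly h m f M)
    (hg : ZPoly h m g M') : ZPoly h m (f * g) (M + M') := by
  obtain ⟨c, rfl, hc, hc1⟩ := hf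
  obtain ⟨d, rfl, hd, hd1⟩ := hg
  have h0c : (0 : Fin (n + 1) → ℤ) ∈ c.support := by rw [Finsupp.mem_support_iff, hc1]; simp
  have h0d : (0 : Fin (n + 1) → ℤ) ∈ d.support := by rw [Finsupp.mem_support_iff, hd1]; simp
  refine ⟨∑ p ∈ c.support, ∑ p' ∈ d.support, Finsupp.single (p + p') (c p * d p'), ?_, ?_, ?_⟩
  · funext z
    rw [Pi.mul_apply, ev_apply, ev_apply, Finset.sum_mul_sum]
    simp only [map_sum, Finset.sum_apply, ev_single, mono_add]
    exact Finset.sum_congr rfl fun p _ => Finset.sum_congr rfl fun p' _ => by ring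
  · have : (∑ p ∈ c.support, ∑ p' ∈ d.support, Finsupp.single (p + p') (c p * d p')) ∈
        Finsupp.supported ℂ ℂ (zon (M + M') : Set (Fin (n + 1) → ℤ)) :=
      Submodule.sum_mem _ fun p hp => Submodule.sum_mem _ fun p' hp' =>
        Finsupp.single_mem_supported _ _ (add_mem_zon (hc hp) (hd hp'))
    exact_mod_cast (Finsupp.mem_supported _ _).1 this
  · rw [Finsupp.finsetSum_apply, Finset.sum_eq_single 0]
    · rw [Finsupp.finsetSum_apply, Finset.sum_eq_single 0]
      · simp [hc1, hd1]
      · intro p' _ hp'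
        rw [zero_add, Finsupp.single_apply, if_neg hp']
      · exact fun hh => absurd h0d hh
    · intro p hp hp0
      rw [Finsupp.finsetSum_apply]
      refine Finset.sum_eq_zero fun p' hp' => ?_
      rw [Finsupp.single_apply, if_neg]
      exact fun hh => hp0 (eq_zero_of_add_eq_zero (hc hp) (hd hp') hh)
    · exact fun hh => absurd h0c hh

lemma zPoly_one : ZPoly h m (1 : (Fin (n + 1) → ℂ) → ℂ) 0 := by
  refine ⟨Finsupp.single 0 1, ?_, ?_, by simp⟩
  · funext z; rw [ev_single, mono_zero, mul_one, Pi.one_apply]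
  · exact Finsupp.support_single_subset.trans (Finset.singleton_subset_iff.2 (zero_mem_zon _))

lemma zPoly_prod {ι : Type*} (s : Finset ι) (f : ι → (Fin (n + 1) → ℂ) → ℂ)
    (M : ι → PosRoot n → ℕ) (hf : ∀ i ∈ s, ZPoly h m (f i) (M i)) :
    ZPoly h m (∏ i ∈ s, f i) (∑ i ∈ s, M i) := by
  classical
  induction s using Finset.induction_on with
  | empty => simpa using zPoly_one
  | insert a s ha ih =>
    rw [Finset.prod_insert ha, Finset.sum_insert ha]
    exact (hf a (Finset.mem_insert_self _ _)).mul
      (ih fun i hi => hf i (Finset.mem_insert_of_mem hi))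

lemma sroot_ne_zero (α : PosRoot n) : sroot α ≠ 0 := by
  intro hh
  have := dot_sroot_decr α
  rw [hh] at this
  simp [dot] at this

lemma zPoly_factor (α : PosRoot n) (κ : ℂ) : ZPoly h m (fun z => mono h m (sroot α) z ^ 2 + 1 -
    κ * mono h m (sroot α) z) (Pi.single α 2) := by
  have key : ∀ k : ℕ, k ≤ 2 → (k : ℤ) • sroot α ∈ zon (Pi.single α 2 : PosRoot n → ℕ) := by
    intro k hk
    refine mem_zon.2 ⟨Pi.single α k, fun β => ?_, ?_⟩
    · by_cases hβ : β = α
      · subst hβ; simpa using hk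
      · simp [hβ]
    · rw [Finset.sum_eq_single α]
      · simp
      · intro β _ hβ; simp [hβ]
      · simp
  refine ⟨Finsupp.single ((2 : ℤ) • sroot α) 1 + Finsupp.single 0 1 +
    Finsupp.single (sroot α) (-κ), ?_, ?_, ?_⟩
  · funext z
    rw [map_add, map_add, Pi.add_apply, Pi.add_apply, ev_single, ev_single, ev_single, mono_zero,
      two_smul, mono_add]
    ring
  · refine Finsupp.support_add.trans (Finset.union_subset (Finsupp.support_add.trans
      (Finset.union_subset ?_ ?_)) ?_) <;>
    refine Finsupp.support_single_subset.trans (Finset.singleton_subset_iff.2 ?_)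
    · exact_mod_cast key 2 le_rfl
    · exact zero_mem_zon _
    · simpa using key 1 (by norm_num)
  · have h2 : ¬ (2 : ℤ) • sroot α = 0 := by
      intro hh
      have h3 := congrArg (fun p => dot p (decr n)) hh
      simp only [dot_zsmul] at h3
      have := dot_sroot_decr α
      simp [dot] at h3 this
      linarith
    simp only [Finsupp.add_apply, Finsupp.single_apply, if_neg h2, if_neg (sroot_ne_zero α)]
    simp

lemma mono_sroot (α : PosRoot n) (z : Fin (n + 1) → ℂ) :
    mono h m (sroot α) z = qpow h (2 * (zeta m α.1.1 z - zeta m α.1.2 z)) := by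
  rw [mul_sub, qpow_sub, ← mono_single, ← mono_single, eq_div_iff (mono_ne_zero _ _), ← mono_add,
    sroot, sub_add_cancel]

lemma qnum_mul_qnum (a b : ℂ) : qpow h (2 * a) * (qnum h (a + b) * qnum h (a - b)) =
    qpow h (2 * a) ^ 2 + 1 - (qpow h (2 * b) + qpow h (-(2 * b))) * qpow h (2 * a) := by
  have h1 : qpow h (2 * a) = qpow h a ^ 2 := by
    rw [two_mul, qpow_add, sq]
  have h2 : qpow h (2 * b) = qpow h b ^ 2 := by
    rw [two_mul, qpow_add, sq]
  rw [qnum, qnum, qpow_neg (2 * b), h1, h2, qpow_neg, qpow_neg, qpow_sub, qpow_add]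
  have ha := qpow_ne_zero (h := h) a
  have hb := qpow_ne_zero (h := h) b
  field_simp
  ring

lemma pair_root (α : PosRoot n) (z : Fin (n + 1) → ℂ) :
    pair (cvec (root m α)) z = zeta m α.1.1 z - zeta m α.1.2 z := by
  have h1 : cvec (root m α) = eps m α.1.1 - eps m α.1.2 := by
    funext i; simp [cvec, root, eps]
  rw [h1, pair_comm, show pair z (eps m α.1.1 - eps m α.1.2) =
    pair z (eps m α.1.1) - pair z (eps m α.1.2) by
      simp [pair, mul_sub, Finset.sum_sub_distrib], pair_eps, pair_eps]

lemma zeta_root (α : PosRoot n) :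
    zeta m α.1.1 (cvec (root m α)) - zeta m α.1.2 (cvec (root m α)) =
      nsq m α.1.1 + nsq m α.1.2 := by
  have hne : α.1.1 ≠ α.1.2 := ne_of_lt α.2
  rw [← lat_sroot, zeta_lat, zeta_lat, sroot]
  simp [hne, hne.symm]

lemma two_mul_pair_rho (z : Fin (n + 1) → ℂ) : 2 * pair (cvec (rho n m)) z =
    ∑ α : PosRoot n, (mlt m α.1.1 α.1.2 : ℂ) * (zeta m α.1.1 z - zeta m α.1.2 z) := by
  have h2 : cvec (rho n m) = (1 / 2 : ℂ) • ∑ α : PosRoot n, (mult m α : ℂ) • cvec (root m α) := by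
    funext i; simp [cvec, rho]
  have h3 : pair (∑ α : PosRoot n, (mult m α : ℂ) • cvec (root m α)) z =
      ∑ α : PosRoot n, (mult m α : ℂ) * pair (cvec (root m α)) z := by
    simp only [pair, Finset.sum_apply, Pi.smul_apply, smul_eq_mul, Finset.sum_mul,
      Finset.mul_sum, mul_assoc]
    rw [Finset.sum_comm]
  have h4 : pair ((1 / 2 : ℂ) • ∑ α : PosRoot n, (mult m α : ℂ) • cvec (root m α)) z =
      1 / 2 * ∑ α : PosRoot n, (mult m α : ℂ) * pair (cvec (root m α)) z := by
    rw [← h3]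
    simp only [pair, Pi.smul_apply, smul_eq_mul, Finset.mul_sum (s := Finset.univ (α := Fin (n + 1))),
      mul_assoc]
  rw [h2, h4, ← mul_assoc]
  norm_num
  exact Finset.sum_congr rfl fun α _ => by rw [pair_root, mult_eq]

/-- Since `4(ρ,z)` is the sum of `2 m_α (α,z)`, the two factors `q^{2(ρ,z)}` supply one `q^{2(α,z)}`
for each of the `m_α` pairs of q-numbers, and each pair becomes a polynomial with constant term `1`.
-/
lemma qpow_rho_mul_polyQ (z : Fin (n + 1) → ℂ) :
    qpow h (2 * pair (cvec (rho n m)) z) * polyQ h m z =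
      ∏ α : PosRoot n, ∏ j ∈ Finset.Icc 1 (mult m α), (qpow h (2 * (zeta m α.1.1 z - zeta m α.1.2 z)) *
        (qnum h (zeta m α.1.1 z - zeta m α.1.2 z + j * ((nsq m α.1.1 + nsq m α.1.2) / 2 : ℂ)) *
          qnum h (zeta m α.1.1 z - zeta m α.1.2 z - j * ((nsq m α.1.1 + nsq m α.1.2) / 2 : ℂ)))) := by
  have h1 : qpow h (2 * pair (cvec (rho n m)) z) * qpow h (2 * pair (cvec (rho n m)) z) =
      ∏ α : PosRoot n, ∏ j ∈ Finset.Icc 1 (mult m α),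
        qpow h (2 * (zeta m α.1.1 z - zeta m α.1.2 z)) := by
    simp only [Finset.prod_const, Nat.card_Icc, Nat.add_sub_cancel]
    simp only [← qpow_nat_mul]
    rw [← qpow_sum, ← qpow_add]
    congr 1
    rw [← two_mul, two_mul_pair_rho, Finset.mul_sum]
    exact Finset.sum_congr rfl fun α _ => by rw [mult_eq]; ring
  rw [polyQ, ← mul_assoc, h1, ← Finset.prod_mul_distrib]
  refine Finset.prod_congr rfl fun α _ => ?_
  rw [← Finset.prod_mul_distrib]
  refine Finset.prod_congr rfl fun j _ => ?_
  have e1 : pair (cvec (root m α)) (z + ((j : ℂ) / 2) • cvec (root m α)) =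
      zeta m α.1.1 z - zeta m α.1.2 z + j * ((nsq m α.1.1 + nsq m α.1.2) / 2 : ℂ) := by
    rw [pair_root, zeta_add, zeta_add, zeta_smul, zeta_smul, ← zeta_root]
    ring
  have e2 : pair (cvec (root m α)) (z - ((j : ℂ) / 2) • cvec (root m α)) =
      zeta m α.1.1 z - zeta m α.1.2 z - j * ((nsq m α.1.1 + nsq m α.1.2) / 2 : ℂ) := by
    rw [pair_root, zeta_sub, zeta_sub, zeta_smul, zeta_smul, ← zeta_root]
    ring
  rw [e1, e2]

lemma exists_cQ : ZPoly h m
    (fun z : Fin (n + 1) → ℂ => qpow h (2 * pair (cvec (rho n m)) z) * polyQ h m z)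
    (kmul n m 2) := by
  have h1 := zPoly_prod (h := h) (m := m) Finset.univ
    (fun α : PosRoot n => ∏ j ∈ Finset.Icc 1 (mult m α), fun z => mono h m (sroot α) z ^ 2 + 1 -
      (qpow h (2 * (j * ((nsq m α.1.1 + nsq m α.1.2) / 2 : ℂ))) +
        qpow h (-(2 * (j * ((nsq m α.1.1 + nsq m α.1.2) / 2 : ℂ))))) * mono h m (sroot α) z)
    (fun α => ∑ j ∈ Finset.Icc 1 (mult m α), Pi.single α 2)
    fun α _ => zPoly_prod _ _ _ fun j _ => zPoly_factor α _
  have h2 : ∑ α : PosRoot n, ∑ j ∈ Finset.Icc 1 (mult m α), Pi.single α 2 = kmul n m 2 := by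
    funext β
    rw [Finset.sum_apply, Finset.sum_eq_single β]
    · rw [kmul, mult_eq]
      simp [mul_comm]
    · intro α _ hα
      simp [Ne.symm hα]
    · simp
  rw [h2] at h1
  convert h1 using 1
  funext z
  rw [qpow_rho_mul_polyQ, Finset.prod_apply]
  refine Finset.prod_congr rfl fun α _ => ?_
  rw [Finset.prod_apply]
  refine Finset.prod_congr rfl fun j _ => ?_
  rw [qnum_mul_qnum, mono_sroot]

/-- Coefficients of `q^{2(ρ, z)} Q(z)`. -/
def cQ (n : ℕ) (h : ℂ) (m : ℕ) : (Fin (n + 1) → ℤ) →₀ ℂ :=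
  Classical.choose (exists_cQ (n := n) (h := h) (m := m))

lemma ev_cQ (z : Fin (n + 1) → ℂ) :
    ev h m (cQ n h m) z = qpow h (2 * pair (cvec (rho n m)) z) * polyQ h m z :=
  (congrFun (Classical.choose_spec (exists_cQ (n := n) (h := h) (m := m))).1 z).symm

lemma cQ_support : (cQ n h m).support ⊆ zon (kmul n m 2) :=
  (Classical.choose_spec (exists_cQ (n := n) (h := h) (m := m))).2.1

lemma cQ_zero : cQ n h m 0 = 1 :=
  (Classical.choose_spec (exists_cQ (n := n) (h := h) (m := m))).2.2

/-- For `z` on the hyperplane of a root `α`, this locates the shifted points `z + s ε_i` and `z + s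
ε_j` on the hyperplanes `(α, ·) = ± s (α,α)/2`, where `Q` vanishes. An actual offset occurs only
when `s = 1`. -/
lemma off_add_eq {i j : Fin (n + 1)} (hij : i < j) {s : ℕ} (hs1 : 1 ≤ s) (hs : s ≤ mlt m i j) :
    off m i j + s * nsq m i = s * ((nsq m i + nsq m j) / 2 : ℂ) ∧
      off m i j - s * nsq m j = -(s * ((nsq m i + nsq m j) / 2 : ℂ)) := by
  have hi : i ≠ Fin.last n := (hij.trans_le (Fin.le_last _)).ne
  unfold off
  by_cases hj : j = Fin.last n
  · subst hj
    rw [mlt_last] at hs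
    obtain rfl : s = 1 := by omega
    constructor <;> push_cast <;> ring
  · rw [nsq_of_ne hi, nsq_of_ne hj]
    constructor <;> push_cast <;> ring

lemma ev_cQ_eq_zero {i j : Fin (n + 1)} (hij : i < j) {s : ℕ} (hs1 : 1 ≤ s)
    (hs : s ≤ mlt m i j) {z : Fin (n + 1) → ℂ}
    (hz : zeta m i z - zeta m j z = s * ((nsq m i + nsq m j) / 2 : ℂ) ∨
      zeta m i z - zeta m j z = -(s * ((nsq m i + nsq m j) / 2 : ℂ))) :
    ev h m (cQ n h m) z = 0 := by
  rw [ev_cQ, qpow_rho_mul_polyQ]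
  refine Finset.prod_eq_zero (Finset.mem_univ (⟨(i, j), hij⟩ : PosRoot n))
    (Finset.prod_eq_zero (i := s) ?_ ?_)
  · rw [Finset.mem_Icc, mult_eq]
    exact ⟨hs1, hs⟩
  · rcases hz with hz | hz
    · simp only [hz, sub_self]
      simp [qnum]
    · simp only [hz, neg_add_cancel]
      simp [qnum]

/-- Both sides of every quasi-invariance condition vanish, so the twist by `x` plays no role. -/
lemma cQ_mem (x : Fin (n + 1) → ℂ) : cQ n h m ∈ QIs h m x := by
  rw [mem_QIs]
  intro i j hij s hs1 hs z hz
  obtain ⟨e1, e2⟩ := off_add_eq hij hs1 hs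
  rw [ev_cQ_eq_zero hij hs1 hs (Or.inl ?_), ev_cQ_eq_zero hij hs1 hs (Or.inr ?_)]
  · simp
  · rw [zeta_shift_self, zeta_shift_of_ne hij.ne, hz, ← e2]
    ring
  · rw [zeta_shift_self, zeta_shift_of_ne hij.ne', hz, ← e1]
    ring

/-! ### The product formula -/

/-- Points none of whose lattice translates is a pole. -/
def Regular (h : ℂ) (m : ℕ) : Set (Fin (n + 1) → ℂ) :=
  {z | ∀ p : Fin (n + 1) → ℤ, OffPoles h m (z + cvec (lat m p))}

lemma isOpen_offPoles (v : Fin (n + 1) → ℂ) :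
    IsOpen {z : Fin (n + 1) → ℂ | OffPoles h m (z + v)} := by
  have : {z : Fin (n + 1) → ℂ | OffPoles h m (z + v)} = ⋂ e : PosRoot n,
      {z | qnum h (zeta m e.1.1 (z + v) - zeta m e.1.2 (z + v) - off m e.1.1 e.1.2) ≠ 0} := by
    ext z
    rw [Set.mem_iInter]
    exact offPoles_iff_lt _
  rw [this]
  exact isOpen_iInter_of_finite fun e => isOpen_ne_zero (qnum_analytic _ _ v)

/-- Baire's theorem for countably many open dense sets, one for each lattice translate. -/
lemma dense_regular (hm : 1 ≤ m) (h0 : h ≠ 0) : Dense (Regular h m : Set (Fin (n + 1) → ℂ)) := by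
  have : (Regular h m : Set (Fin (n + 1) → ℂ)) =
      ⋂ p : Fin (n + 1) → ℤ, {z | OffPoles h m (z + cvec (lat m p))} := by
    ext z
    rw [Set.mem_iInter]
    exact Iff.rfl
  rw [this]
  exact dense_iInter_of_isOpen (fun p => isOpen_offPoles _) fun p => dense_offPoles hm h0 _

lemma Regular.offPoles {z : Fin (n + 1) → ℂ} (hz : z ∈ Regular h m) : OffPoles h m z := by
  have := hz 0
  have h0 : cvec (0 : Fin (n + 1) → ℝ) = 0 := by funext i; simp [cvec]
  rwa [lat_zero, h0, add_zero] at this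

lemma Regular.add_eps {z : Fin (n + 1) → ℂ} (hz : z ∈ Regular h m) (i : Fin (n + 1)) :
    z + eps m i ∈ Regular h m := by
  intro p
  have := hz (Pi.single i 1 + p)
  rwa [lat_add, lat_single, cvec_add, ← add_assoc] at this

lemma regular_iff {z : Fin (n + 1) → ℂ} :
    z ∈ Regular h m ↔ ∀ μ ∈ weightLattice n m, OffPoles h m (z + cvec μ) :=
  ⟨fun hz μ hμ => by obtain ⟨p, rfl⟩ := (mem_weightLattice μ).1 hμ; exact hz p,
    fun hz p => hz _ ((mem_weightLattice _).2 ⟨p, rfl⟩)⟩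

/-- A family of quasi-invariant coefficient vectors, with values depending polynomially on the
parameter. -/
def PolyFam (h : ℂ) (m : ℕ) (c : ∀ x : Fin (n + 1) → ℂ, QIs h m x) : Prop :=
  ∀ z ∈ Regular h m, IsPoly h m fun x => ev h m (c x : (Fin (n + 1) → ℤ) →₀ ℂ) z

lemma isPoly_qpow_zeta_sub (i : Fin (n + 1)) (v : Fin (n + 1) → ℂ) :
    IsPoly h m fun x : Fin (n + 1) → ℂ => qpow h (2 * zeta m i (x - v)) := by
  simpa only [sub_eq_add_neg] using (isPoly_qpow_zeta (h := h) (m := m) i).shift (-v)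

lemma PolyFam.opE (hm : 1 ≤ m) (hq : NotRoot h) {c : ∀ x : Fin (n + 1) → ℂ, QIs h m x}
    (hc : PolyFam h m c) : PolyFam h m fun x => opE hm hq x (c x) := by
  intro z hz
  have : (fun x => ev h m (DeformedMR.opE hm hq x (c x) : (Fin (n + 1) → ℤ) →₀ ℂ) z) =
      ∑ i, fun x => aco h m i z * (qpow h (2 * zeta m i (x - cvec (rho n m))) *
        ev h m (c x : (Fin (n + 1) → ℤ) →₀ ℂ) (z + eps m i)) := by
    funext x
    rw [← opE_spec hm hq x (c x) z (Regular.offPoles hz), tD, Finset.sum_apply]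
  rw [this]
  exact isPoly_sum' _ _ fun i _ => ((isPoly_qpow_zeta_sub i _).mul
    (hc _ (Regular.add_eps hz i))).const_mul _

lemma PolyFam.smul {a : (Fin (n + 1) → ℂ) → ℂ} (ha : IsPoly h m a)
    {c : ∀ x : Fin (n + 1) → ℂ, QIs h m x} (hc : PolyFam h m c) :
    PolyFam h m fun x => a x • c x := by
  intro z hz
  have : (fun x => ev h m ((a x • c x : QIs h m x) : (Fin (n + 1) → ℤ) →₀ ℂ) z) =
      a * fun x => ev h m (c x : (Fin (n + 1) → ℤ) →₀ ℂ) z := by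
    funext x
    rw [Submodule.coe_smul, map_smul]
    rfl
  rw [this]
  exact ha.mul (hc z hz)

lemma PolyFam.of_add {a b c : ∀ x : Fin (n + 1) → ℂ, QIs h m x} (ha : PolyFam h m a)
    (hb : PolyFam h m b) (habc : ∀ x, c x + a x = b x) : PolyFam h m c := by
  intro z hz
  have : (fun x => ev h m (c x : (Fin (n + 1) → ℤ) →₀ ℂ) z) =
      (fun x => ev h m (b x : (Fin (n + 1) → ℤ) →₀ ℂ) z) -
        fun x => ev h m (a x : (Fin (n + 1) → ℤ) →₀ ℂ) z := by
    funext x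
    rw [Pi.sub_apply, ← habc, Submodule.coe_add, map_add, Pi.add_apply, add_sub_cancel_right]
  rw [this]
  exact (hb z hz).sub (ha z hz)

lemma orbPoly_insert (x : Fin (n + 1) → ℂ) {Y : Finset (Fin (n + 1) → ℤ)} {y : Fin (n + 1) → ℤ}
    (hy : y ∉ Y) : orbPoly h m x (insert y Y) =
      (Polynomial.X - Polynomial.C (orbitSum h m (x + cvec (lat m y)))) * orbPoly h m x Y :=
  Finset.prod_insert hy

lemma PolyFam.aeval (hm : 1 ≤ m) (hq : NotRoot h) {c : ∀ x : Fin (n + 1) → ℂ, QIs h m x}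
    (hc : PolyFam h m c) (Y : Finset (Fin (n + 1) → ℤ)) :
    PolyFam h m fun x => Polynomial.aeval (DeformedMR.opE hm hq x) (orbPoly h m x Y) (c x) := by
  classical
  induction Y using Finset.induction_on with
  | empty => simpa [orbPoly] using hc
  | insert y Y hy ih =>
    refine PolyFam.of_add (PolyFam.smul (isPoly_orbitSum_shift y) ih) (ih.opE hm hq) fun x => ?_
    rw [orbPoly_insert x hy]
    exact aeval_X_sub_C_mul _ _ _ _

lemma PolyFam.coeff (hm : 1 ≤ m) (h0 : h ≠ 0) {c : ∀ x : Fin (n + 1) → ℂ, QIs h m x}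
    (hc : PolyFam h m c) {S : Finset (Fin (n + 1) → ℤ)}
    (hS : ∀ x, (c x : (Fin (n + 1) → ℤ) →₀ ℂ).support ⊆ S) (p : Fin (n + 1) → ℤ) :
    IsPoly h m fun x => (c x : (Fin (n + 1) → ℤ) →₀ ℂ) p :=
  isPoly_coeff hm h0 S (dense_regular hm h0) _ hS hc p

/-- At each regular `z` both values are Laurent polynomials in `x`, so they agree for all `x` once
they agree generically; density of the regular points does the rest. -/
lemma PolyFam.ext (hm : 1 ≤ m) (h0 : h ≠ 0) {c d : ∀ x : Fin (n + 1) → ℂ, QIs h m x}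
    (hc : PolyFam h m c) (hd : PolyFam h m d) (hcd : Generically h m fun x => c x = d x)
    (x : Fin (n + 1) → ℂ) : c x = d x := by
  refine Subtype.ext (ev_injective hm h0 (Continuous.ext_on (dense_regular hm h0)
    (isPoly_ev _).continuous (isPoly_ev _).continuous fun z hz => ?_))
  exact congrFun (hcd.ext (hc z hz).continuous (hd z hz).continuous fun y hy => by rw [hy]) x

/-- Coefficients of the function given by the product formula. -/
def psiQ (hm : 1 ≤ m) (hq : NotRoot h) (x : Fin (n + 1) → ℂ) : QIs h m x :=
  Polynomial.aeval (opE hm hq x) (orbPoly h m x ((zon (kmul n m 1)).erase 0)) ⟨cQ n h m, cQ_mem x⟩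

lemma polyFam_psiQ (hm : 1 ≤ m) (hq : NotRoot h) : PolyFam h m (psiQ (n := n) hm hq) :=
  PolyFam.aeval hm hq (c := fun x => ⟨cQ n h m, cQ_mem x⟩) 
    (fun z _ => isPoly_const h m (ev h m (cQ n h m) z)) _

lemma psiQ_support_two (hm : 1 ≤ m) (hq : NotRoot h) (x : Fin (n + 1) → ℂ) :
    (psiQ hm hq x : (Fin (n + 1) → ℤ) →₀ ℂ).support ⊆ zon (kmul n m 2) :=
  mem_QIsupp.1 (aeval_mem_QIsupp hm hq (sep_zon _) _ (mem_QIsupp.2 cQ_support))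

lemma cvec_zero : cvec (0 : Fin (n + 1) → ℝ) = 0 := by funext i; simp [cvec]

/-- The polynomial with one root for each integral point of the zonotope annihilates the vector
`cQ`. Splitting off the factor of the point `0` leaves `(T - 𝔪(x)) ψ = 0`. -/
lemma opE_psiQ_generic (hm : 1 ≤ m) (hq : NotRoot h) {x : Fin (n + 1) → ℂ}
    (hx : Res h m (tset m (zon (kmul n m 2))) x) :
    opE hm hq x (psiQ hm hq x) = orbitSum h m x • psiQ hm hq x := by
  have h1 := orbPoly_kill hm hq (sep_zon _) hx (Y := zon (kmul n m 1))
    (fun y hy => mem_zon_of_add_kv hy) (c := ⟨cQ n h m, cQ_mem x⟩) (mem_QIsupp.2 cQ_support)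
  rw [orbPoly, ← Finset.mul_prod_erase _ _ (zero_mem_zon (kmul n m 1)), lat_zero, cvec_zero,
    add_zero] at h1
  have h2 := aeval_X_sub_C_mul (opE hm hq x) (orbitSum h m x)
    (orbPoly h m x ((zon (kmul n m 1)).erase 0)) ⟨cQ n h m, cQ_mem x⟩
  rw [orbPoly, h1, zero_add] at h2
  exact h2.symm

lemma zero_mem_tset {k : ℕ} (hk : 1 ≤ k) : (0 : Fin (n + 1) → ℤ) ∈ tset m (zon (kmul n m k)) := by
  have := sub_kv_mem_tset (m := m) (zon_mono (M' := kmul n m k) (fun α => Nat.mul_le_mul_right _ hk)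
    (kv_mem_zon (m := m) (0 : Fin (n + 1) → ℝ))) 0
  rwa [sub_self] at this

/-- The eigenvalue `𝔪(x)` forces `y = 0` in `eigen_top`, so the support is bounded in every
direction by the vertices of the zonotope. -/
lemma support_of_eigen (hm : 1 ≤ m) (hq : NotRoot h) {x : Fin (n + 1) → ℂ}
    (hx : Res h m (tset m (zon (kmul n m 2))) x) {c : QIs h m x}
    (hc : (c : (Fin (n + 1) → ℤ) →₀ ℂ).support ⊆ zon (kmul n m 2))
    (hE : opE hm hq x c = orbitSum h m x • c) :
    (c : (Fin (n + 1) → ℤ) →₀ ℂ).support ⊆ zon (kmul n m 1) := by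
  by_cases hc0 : c = 0
  · rw [hc0]; simp
  obtain ⟨y, hy1, hy2⟩ := eigen_top hm hq hx hc hc0 hE
  obtain ⟨ℓ0, hℓ0⟩ := exists_genDir (n := n)
  have hy : y ∈ tset m (zon (kmul n m 2)) := by
    have := sub_kv_mem_tset (m := m) (hc (hy2 ℓ0 hℓ0).1) ℓ0
    rwa [add_sub_cancel_right] at this
  have hy0 : 0 = y := hx _ (zero_mem_tset (by norm_num)) _ hy (by
    rw [lat_zero, cvec_zero, add_zero, hy1])
  intro p hp
  refine mem_zon_of_genDir fun ℓ hℓ => ?_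
  have := (hy2 ℓ hℓ).2 p hp
  rwa [← hy0, zero_add, dot_kv] at this

theorem opE_psiQ (hm : 1 ≤ m) (hq : NotRoot h) (x : Fin (n + 1) → ℂ) :
    opE hm hq x (psiQ hm hq x) = orbitSum h m x • psiQ hm hq x :=
  PolyFam.ext hm hq.ne_zero ((polyFam_psiQ hm hq).opE hm hq)
    (PolyFam.smul isPoly_orbitSum (polyFam_psiQ hm hq))
    ((generically_res hm hq _).mono fun _ hx => opE_psiQ_generic hm hq hx) x

/-- A coefficient outside the zonotope vanishes for generic `x` by `support_of_eigen`, and it is a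
Laurent polynomial in `x`. -/
theorem psiQ_support (hm : 1 ≤ m) (hq : NotRoot h) (x : Fin (n + 1) → ℂ) :
    (psiQ hm hq x : (Fin (n + 1) → ℤ) →₀ ℂ).support ⊆ zon (kmul n m 1) := by
  intro p hp
  by_contra hp1
  have h1 := (generically_res hm hq (tset m (zon (kmul n m 2)))).ext
    ((polyFam_psiQ hm hq).coeff hm hq.ne_zero (psiQ_support_two hm hq) p).continuous
    (continuous_const (y := (0 : ℂ))) fun y hy => Finsupp.notMem_support_iff.1 fun hh =>
      hp1 (support_of_eigen hm hq hy (psiQ_support_two hm hq y) (opE_psiQ hm hq y) hh)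
  exact (Finsupp.mem_support_iff.1 hp) (congrFun h1 x)

/-- Iterating the operator evaluates the function at lattice translates, hence the restriction to
points with no pole among their translates. -/
lemma aeval_opD_tw (hm : 1 ≤ m) (hq : NotRoot h) (x : Fin (n + 1) → ℂ) (c : QIs h m x)
    (Y : Finset (Fin (n + 1) → ℤ)) : ∀ z ∈ Regular h m,
    Polynomial.aeval (opD n h m) (orbPoly h m x Y)
      (tw h (x - cvec (rho n m)) (ev h m (c : (Fin (n + 1) → ℤ) →₀ ℂ))) z =
    tw h (x - cvec (rho n m)) (ev h m
      ((Polynomial.aeval (opE hm hq x) (orbPoly h m x Y) c : QIs h m x) : (Fin (n + 1) → ℤ) →₀ ℂ)) z := by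
  classical
  induction Y using Finset.induction_on with
  | empty => intro z _; simp [orbPoly]
  | insert y Y hy ih =>
    intro z hz
    have h1 := congrFun (aeval_X_sub_C_mul (opD n h m) (orbitSum h m (x + cvec (lat m y)))
      (orbPoly h m x Y) (tw h (x - cvec (rho n m)) (ev h m (c : (Fin (n + 1) → ℤ) →₀ ℂ)))) z
    have h2 := aeval_X_sub_C_mul (opE hm hq x) (orbitSum h m (x + cvec (lat m y)))
      (orbPoly h m x Y) c
    rw [← orbPoly_insert x hy] at h1 h2
    rw [opD_apply, Finset.sum_congr rfl fun i _ => by rw [ih _ (Regular.add_eps hz i)],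
      ← opD_apply, opD_tw] at h1
    have h3 : tw h (x - cvec (rho n m)) (tD h m (x - cvec (rho n m)) (ev h m
        (Polynomial.aeval (opE hm hq x) (orbPoly h m x Y) c).1)) z =
        tw h (x - cvec (rho n m)) (ev h m (opE hm hq x
        (Polynomial.aeval (opE hm hq x) (orbPoly h m x Y) c)).1) z := by
      rw [tw, opE_spec hm hq x _ z (Regular.offPoles hz), tw]
    rw [h3, ← h2] at h1
    rw [Pi.add_apply, Pi.smul_apply, ih z hz, Submodule.coe_add, map_add, Submodule.coe_smul,
      map_smul] at h1
    simp only [tw, Pi.add_apply, Pi.smul_apply, smul_eq_mul] at h1 ⊢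
    linear_combination h1

lemma tw_cQ (x : Fin (n + 1) → ℂ) : tw h (x - cvec (rho n m)) (ev h m (cQ n h m)) =
    fun w => qpow h (2 * pair x w) * polyQ h m w := by
  funext w
  rw [tw, ev_cQ, ← mul_assoc, ← qpow_add, ← mul_add, ← pair_add, sub_add_cancel]

lemma shiftSet_eq (hm : 1 ≤ m) : shiftSet n m = ((zon (kmul n m 1)).erase 0).image (lat m) := by
  classical
  rw [shiftSet, zon]
  ext ν
  simp only [Finset.mem_erase, Finset.mem_image, Fintype.mem_piFinset, Finset.mem_range, kmul,
    one_mul, mult_eq]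
  have h2 : ∀ l : PosRoot n → ℕ, lat m (∑ α, (l α : ℤ) • sroot α) =
      ∑ α : PosRoot n, (l α : ℝ) • root m α := by
    intro l
    rw [lat_sum]
    exact Finset.sum_congr rfl fun α _ => by rw [lat_zsmul, lat_sroot, Int.cast_natCast]
  constructor
  · rintro ⟨h1, l, hl, rfl⟩
    exact ⟨_, ⟨fun hh => h1 (by rw [← h2, hh, lat_zero]), l, hl, rfl⟩, h2 l⟩
  · rintro ⟨p, ⟨h1, l, hl, rfl⟩, rfl⟩
    exact ⟨fun hh => h1 (lat_injective hm (hh.trans lat_zero.symm)), l, hl, (h2 l).symm⟩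

lemma berestProduct_eq (hm : 1 ≤ m) (hq : NotRoot h) (x : Fin (n + 1) → ℂ)
    {z : Fin (n + 1) → ℂ} (hz : z ∈ Regular h m) : berestProduct n h m x z =
      tw h (x - cvec (rho n m)) (ev h m (psiQ hm hq x : (Fin (n + 1) → ℤ) →₀ ℂ)) z := by
  rw [psiQ, ← aeval_opD_tw hm hq x _ _ z hz, tw_cQ, berestProduct, shiftSet_eq hm,
    Finset.prod_image (lat_injective hm).injOn]
  rfl

/-! ### The constant coefficient of the product. -/

lemma genDir_decr : ∃ ℓ : Fin (n + 1) → ℝ, GenDir ℓ ∧ ∀ i j, i < j → ℓ j < ℓ i := by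
  have h1 : IsOpen {ℓ : Fin (n + 1) → ℝ | ∀ i j, i < j → ℓ j < ℓ i} := by
    simp only [Set.ofPred_forall]
    exact isOpen_iInter_of_finite fun i => isOpen_iInter_of_finite fun j =>
      isOpen_iInter_of_finite fun _ => isOpen_lt (continuous_apply _) (continuous_apply _)
  obtain ⟨ℓ, hℓ1, hℓ2⟩ := dense_genDir.inter_open_nonempty _ h1 ⟨decr n, fun i j hij => by
    simpa [decr] using Fin.lt_def.1 hij⟩
  exact ⟨ℓ, hℓ2, hℓ1⟩

lemma GenDir.neg {ℓ : Fin (n + 1) → ℝ} (hℓ : GenDir ℓ) : GenDir (-ℓ) := by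
  intro p hp
  apply hℓ p
  simpa [dot] using hp

lemma zon_dot_nonneg {M : PosRoot n → ℕ} {ℓ : Fin (n + 1) → ℝ} (hℓ : ∀ i j, i < j → ℓ j < ℓ i)
    {p : Fin (n + 1) → ℤ} (hp : p ∈ zon M) : 0 ≤ dot p ℓ := by
  obtain ⟨l, -, rfl⟩ := mem_zon.1 hp
  rw [dot_sum]
  refine Finset.sum_nonneg fun α _ => ?_
  rw [dot_zsmul, dot_sroot]
  have := hℓ _ _ α.2
  have h1 : 0 ≤ ℓ α.1.1 - ℓ α.1.2 := by linarith
  positivity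

lemma dot_neg_right (p : Fin (n + 1) → ℤ) (ℓ : Fin (n + 1) → ℝ) : dot p (-ℓ) = -dot p ℓ := by
  simp [dot]

/-- In the direction opposite to a decreasing one, `0` is the extreme exponent and the vertex `kv`
is `0`, so the leading-term rule multiplies this coefficient by `𝔪(x)`. -/
lemma opE_coeff_zero (hm : 1 ≤ m) (hq : NotRoot h) {x : Fin (n + 1) → ℂ} {M : PosRoot n → ℕ}
    {c : QIs h m x} (hc : (c : (Fin (n + 1) → ℤ) →₀ ℂ).support ⊆ zon M) :
    (opE hm hq x c : (Fin (n + 1) → ℤ) →₀ ℂ) 0 =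
      orbitSum h m x * (c : (Fin (n + 1) → ℤ) →₀ ℂ) 0 := by
  obtain ⟨ℓ, hℓ, hd⟩ := genDir_decr (n := n)
  have h1 := (tD_top hm hq.ne_zero (opE_spec hm hq x c) hℓ.neg (p0 := 0) fun p hp => by
    rw [dot_neg_right, dot_neg_right, show dot (0 : Fin (n + 1) → ℤ) ℓ = 0 by simp [dot]]
    linarith [zon_dot_nonneg hd (hc hp)]).2
  have h2 : kv m (-ℓ) = 0 := by
    rw [kv]
    refine Finset.sum_eq_zero fun α _ => ?_
    have := hd _ _ α.2
    rw [if_neg (by simp only [Pi.neg_apply]; linarith), zero_smul]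
  rwa [h2, sub_zero, lat_zero, cvec_zero, add_zero] at h1

lemma aeval_coeff_zero (hm : 1 ≤ m) (hq : NotRoot h) {x : Fin (n + 1) → ℂ} {M : PosRoot n → ℕ}
    {c : QIs h m x} (hc : (c : (Fin (n + 1) → ℤ) →₀ ℂ).support ⊆ zon M)
    (Y : Finset (Fin (n + 1) → ℤ)) :
    (Polynomial.aeval (opE hm hq x) (orbPoly h m x Y) c : QIs h m x).1 0 =
      (∏ y ∈ Y, (orbitSum h m x - orbitSum h m (x + cvec (lat m y)))) * c.1 0 := by
  classical
  induction Y using Finset.induction_on with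
  | empty => simp [orbPoly]
  | insert y Y hy ih =>
    have h2 := aeval_X_sub_C_mul (opE hm hq x) (orbitSum h m (x + cvec (lat m y)))
      (orbPoly h m x Y) c
    rw [← orbPoly_insert x hy] at h2
    have h3 := congrArg (fun c : QIs h m x => c.1 0) h2
    rw [opE_coeff_zero hm hq (mem_QIsupp.1 (aeval_mem_QIsupp hm hq (sep_zon M) (orbPoly h m x Y)
      (mem_QIsupp.2 hc))), Submodule.coe_add, Finsupp.add_apply, Submodule.coe_smul,
      Finsupp.smul_apply, ih, smul_eq_mul] at h3
    rw [Finset.prod_insert hy]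
    linear_combination h3

theorem psiQ_zero (hm : 1 ≤ m) (hq : NotRoot h) (x : Fin (n + 1) → ℂ) :
    (psiQ hm hq x : (Fin (n + 1) → ℤ) →₀ ℂ) 0 =
      ∏ ν ∈ shiftSet n m, (orbitSum h m x - orbitSum h m (x + cvec ν)) := by
  rw [psiQ, aeval_coeff_zero hm hq cQ_support, cQ_zero, mul_one, shiftSet_eq hm,
    Finset.prod_image (lat_injective hm).injOn]

/-! ### Coefficients along an edge of the polytope -/

/-- The normalizing factor attached to the chamber of `ℓ`, for one root. -/
def nrm1 (h : ℂ) (m : ℕ) (α : PosRoot n) (e : ℤ) (x : Fin (n + 1) → ℂ) : ℂ :=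
  ∏ s ∈ Finset.Icc 1 (mlt m α.1.1 α.1.2),
    qnum h (s * ((nsq m α.1.1 + nsq m α.1.2) / 2) - e * (zeta m α.1.1 x - zeta m α.1.2 x))

/-- The recurrence is `(X^{s+1} - Y^{s+1})(X + Y) = X^{s+2} - Y^{s+2} + XY (X^s - Y^s)`, where `XY`
is the constant `C`. Each factor `X + Y` costs one of the available equations. -/
lemma sum_mul_pow_eq_zero {ι : Type*} (I : Finset ι) (b X Y : ι → ℂ) (C : ℂ) (M : ℕ)
    (hXY : ∀ t ∈ I, X t * Y t = C)
    (H : ∀ s, 1 ≤ s → s ≤ M → ∑ t ∈ I, b t * (X t ^ s - Y t ^ s) = 0) (k : ℕ) :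
    ∀ s, 1 ≤ s → s + k ≤ M → ∑ t ∈ I, b t * (X t ^ s - Y t ^ s) * (X t + Y t) ^ k = 0 := by
  induction k with
  | zero =>
    intro s h1 h2
    simpa using H s h1 h2
  | succ k ih =>
    intro s h1 h2
    obtain ⟨s, rfl⟩ : ∃ s', s = s' + 1 := ⟨s - 1, by omega⟩
    have h3 := ih (s + 2) (by omega) (by omega)
    have h4 : ∑ t ∈ I, b t * (X t ^ s - Y t ^ s) * (X t + Y t) ^ k = 0 := by
      rcases Nat.eq_zero_or_pos s with rfl | hs
      · simp
      · exact ih s hs (by omega)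
    have h5 : ∑ t ∈ I, b t * (X t ^ (s + 1) - Y t ^ (s + 1)) * (X t + Y t) ^ (k + 1) =
        ∑ t ∈ I, b t * (X t ^ (s + 2) - Y t ^ (s + 2)) * (X t + Y t) ^ k +
          C * ∑ t ∈ I, b t * (X t ^ s - Y t ^ s) * (X t + Y t) ^ k := by
      rw [Finset.mul_sum, ← Finset.sum_add_distrib]
      refine Finset.sum_congr rfl fun t ht => ?_
      rw [← hXY t ht]
      ring
    rw [h5, h3, h4, mul_zero, add_zero]

lemma sum_mul_eval_eq_zero {ι : Type*} (I : Finset ι) (b X Y : ι → ℂ) (C : ℂ) (M : ℕ)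
    (hXY : ∀ t ∈ I, X t * Y t = C)
    (H : ∀ s, 1 ≤ s → s ≤ M → ∑ t ∈ I, b t * (X t ^ s - Y t ^ s) = 0) (P : Polynomial ℂ)
    (hP : P.natDegree < M) : ∑ t ∈ I, b t * (X t - Y t) * P.eval (X t + Y t) = 0 := by
  have h1 : ∑ t ∈ I, b t * (X t - Y t) * P.eval (X t + Y t) =
      ∑ k ∈ Finset.range M, P.coeff k *
        ∑ t ∈ I, b t * (X t ^ 1 - Y t ^ 1) * (X t + Y t) ^ k := by
    simp only [Finset.mul_sum]
    rw [Finset.sum_comm]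
    refine Finset.sum_congr rfl fun t _ => ?_
    rw [Polynomial.eval_eq_sum_range' hP, Finset.mul_sum]
    exact Finset.sum_congr rfl fun k _ => by ring
  rw [h1]
  refine Finset.sum_eq_zero fun k hk => ?_
  rw [sum_mul_pow_eq_zero I b X Y C M hXY H k 1 le_rfl
    (by have := Finset.mem_range.1 hk; omega), mul_zero]

/-- There are `M` equations for the `M + 1` unknowns `a t`. They are combined with a polynomial in
`X_t + Y_t` vanishing at all intermediate `t`, so only the two ends survive; the differences of the
nodes factor into q-numbers. -/
lemma string_ends (hq : NotRoot h) {M : ℕ} (hM : 1 ≤ M) (a : ℕ → ℂ) (A B : ℂ)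
    (H : ∀ s : ℕ, 1 ≤ s → s ≤ M → ∑ t ∈ Finset.range (M + 1),
      a t * (qpow h (2 * A - M + 2 * t) ^ s - qpow h (2 * B + M - 2 * t) ^ s) = 0) :
    a 0 * ∏ s ∈ Finset.Icc 1 M, qnum h (s - (A - B)) =
      a M * ∏ s ∈ Finset.Icc 1 M, qnum h (s + (A - B)) := by
  set T : ℕ → ℂ := fun t => qpow h (2 * A - M + 2 * t) + qpow h (2 * B + M - 2 * t) with hT
  set P : Polynomial ℂ := ∏ l ∈ Finset.Ico 1 M, (Polynomial.X - Polynomial.C (T l)) with hP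
  have hdeg : P.natDegree < M := by
    rw [hP, Polynomial.natDegree_finsetProd_X_sub_C_eq_card, Nat.card_Ico]
    omega
  have hev : ∀ v, P.eval v = ∏ l ∈ Finset.Ico 1 M, (v - T l) := by
    intro v
    simp [hP, Polynomial.eval_prod]
  have key := sum_mul_eval_eq_zero (Finset.range (M + 1)) a
    (fun t => qpow h (2 * A - M + 2 * t)) (fun t => qpow h (2 * B + M - 2 * t))
    (qpow h (2 * (A + B))) M (fun t _ => by rw [← qpow_add]; congr 1; ring) H P hdeg
  rw [Finset.sum_eq_add_of_mem 0 M (by simp) (by simp) (by omega) ?_] at key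
  swap
  · intro t ht ht0
    have ht' := Finset.mem_range.1 ht
    rw [hev, Finset.prod_eq_zero (i := t) (Finset.mem_Ico.2 ⟨by omega, by omega⟩) (by simp [hT]),
      mul_zero]
  set W := qpow h (A + B)
  have hW : W ≠ 0 := qpow_ne_zero _
  have hT0 : ∀ l ∈ Finset.Ico 1 M, qpow h (2 * A - M + 2 * (0 : ℕ)) +
      qpow h (2 * B + M - 2 * (0 : ℕ)) - T l =
      W * (qnum h (((M - l : ℕ) : ℂ) - (A - B)) * qnum h l) := by
    intro l hl
    rw [hT, Nat.cast_sub (Finset.mem_Ico.1 hl).2.le]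
    simp only [W, qnum, mul_sub, sub_mul, ← qpow_add]
    have e1 : A + B + (M - l - (A - B) + l) = 2 * B + M - 2 * (0 : ℕ) := by push_cast; ring
    have e2 : A + B + (M - l - (A - B) + -l) = 2 * B + M - 2 * l := by ring
    have e3 : A + B + (-(M - l - (A - B)) + l) = 2 * A - M + 2 * l := by ring
    have e4 : A + B + (-(M - l - (A - B)) + -l) = 2 * A - M + 2 * (0 : ℕ) := by push_cast; ring
    rw [e1, e2, e3, e4]
    ring
  have hTM : ∀ l ∈ Finset.Ico 1 M, qpow h (2 * A - M + 2 * (M : ℕ)) +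
      qpow h (2 * B + M - 2 * (M : ℕ)) - T l =
      W * (qnum h (l + (A - B)) * qnum h ((M - l : ℕ) : ℂ)) := by
    intro l hl
    rw [hT, Nat.cast_sub (Finset.mem_Ico.1 hl).2.le]
    simp only [W, qnum, mul_sub, sub_mul, ← qpow_add]
    have e1 : A + B + (l + (A - B) + (M - l)) = 2 * A - M + 2 * M := by ring
    have e2 : A + B + (l + (A - B) + -(M - l)) = 2 * A - M + 2 * l := by ring
    have e3 : A + B + (-(l + (A - B)) + (M - l)) = 2 * B + M - 2 * l := by ring
    have e4 : A + B + (-(l + (A - B)) + -(M - l)) = 2 * B + M - 2 * M := by ring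
    rw [e1, e2, e3, e4]
    ring
  have hrefl : ∀ f : ℕ → ℂ, ∏ l ∈ Finset.Ico 1 M, f (M - l) = ∏ l ∈ Finset.Ico 1 M, f l := by
    intro f
    refine Finset.prod_nbij' (fun l => M - l) (fun l => M - l) ?_ ?_ ?_ ?_ ?_ <;>
      simp only [Finset.mem_Ico] <;> intros <;> first | omega | trivial
  have hD0 : qpow h (2 * A - M + 2 * (0 : ℕ)) - qpow h (2 * B + M - 2 * (0 : ℕ)) =
      -(W * qnum h (M - (A - B))) := by
    simp only [W, qnum, mul_sub, ← qpow_add]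
    have e1 : A + B + (M - (A - B)) = 2 * B + M - 2 * (0 : ℕ) := by push_cast; ring
    have e2 : A + B + -(M - (A - B)) = 2 * A - M + 2 * (0 : ℕ) := by push_cast; ring
    rw [e1, e2]
    ring
  have hDM : qpow h (2 * A - M + 2 * (M : ℕ)) - qpow h (2 * B + M - 2 * (M : ℕ)) =
      W * qnum h (M + (A - B)) := by
    simp only [W, qnum, mul_sub, ← qpow_add]
    have e1 : A + B + (M + (A - B)) = 2 * A - M + 2 * M := by ring
    have e2 : A + B + -(M + (A - B)) = 2 * B + M - 2 * M := by ring
    rw [e1, e2]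
  rw [hev, hev, Finset.prod_congr rfl hT0, Finset.prod_congr rfl hTM, hD0, hDM,
    Finset.prod_mul_distrib, Finset.prod_mul_distrib, Finset.prod_mul_distrib,
    Finset.prod_mul_distrib, hrefl fun l => qnum h ((l : ℂ) - (A - B)),
    hrefl fun l => qnum h (l : ℂ)] at key
  have hN : ∏ l ∈ Finset.Ico 1 M, qnum h (l : ℂ) ≠ 0 := Finset.prod_ne_zero_iff.2 fun l hl =>
    hq.qnum_nat (by have := Finset.mem_Ico.1 hl; omega)
  have hWp : ∏ l ∈ Finset.Ico 1 M, W ≠ 0 := Finset.prod_ne_zero_iff.2 fun _ _ => hW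
  rw [← Finset.Ico_insert_right hM, Finset.prod_insert (by simp), Finset.prod_insert (by simp)]
  refine mul_left_cancel₀ (mul_ne_zero (mul_ne_zero hW hWp) hN) ?_
  linear_combination -key

/-- For a root ending at the last coordinate the string has two terms and a single equation, which
is brought to symmetric form by the factor `q^{A+B+(m-1)/2}`. -/
lemma string_ends_last (A B : ℂ) (a0 a1 : ℂ) (mm : ℂ)
    (H : a0 * (qpow h (2 * A - 1) - qpow h (2 * B + mm)) +
      a1 * qpow h (mm - 1) * (qpow h (2 * A + 1) - qpow h (2 * B - mm)) = 0) :
    a0 * qnum h ((1 + mm) / 2 - (A - B)) = a1 * qnum h ((1 + mm) / 2 + (A - B)) := by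
  refine mul_left_cancel₀ (qpow_ne_zero (h := h) (A + B + (mm - 1) / 2)) ?_
  have e1 : qpow h (A + B + (mm - 1) / 2) * qnum h ((1 + mm) / 2 - (A - B)) =
      qpow h (2 * B + mm) - qpow h (2 * A - 1) := by
    rw [qnum, mul_sub, ← qpow_add, ← qpow_add]
    congr 2 <;> ring
  have e2 : qpow h (A + B + (mm - 1) / 2) * qnum h ((1 + mm) / 2 + (A - B)) =
      qpow h (mm - 1) * (qpow h (2 * A + 1) - qpow h (2 * B - mm)) := by
    rw [qnum, mul_sub, mul_sub, ← qpow_add, ← qpow_add, ← qpow_add, ← qpow_add]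
    congr 2 <;> ring
  linear_combination a0 * e1 - a1 * e2 - H

lemma pt_add (w w' : Fin (n + 1) → ℂ) : pt m (w + w') = pt m w + pt m w' := by
  funext i; simp [pt, add_div]

lemma ray_add_smul_eps (hm : 1 ≤ m) (w : Fin (n + 1) → ℂ) (ℓ : Fin (n + 1) → ℝ) (t : ℝ)
    (s : ℂ) (i : Fin (n + 1)) :
    ray h m w ℓ t + s • eps m i = ray h m (w + Pi.single i (s * nsq m i)) ℓ t := by
  rw [← pt_zeta hm (ray h m w ℓ t + s • eps m i), ← pt_zeta hm (ray h m (w + _) ℓ t)]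
  congr 1
  funext k
  rw [zeta_shift, zeta_ray hm, zeta_ray hm, Pi.add_apply, Pi.single_apply]
  by_cases hk : k = i
  · subst hk; simp; ring
  · simp [hk]

/-- `ℓ₀` lies on the wall of `α` and on no other wall. -/
def OnWall (α : PosRoot n) (ℓ0 : Fin (n + 1) → ℝ) : Prop :=
  ℓ0 α.1.1 = ℓ0 α.1.2 ∧ ∀ β : PosRoot n, β ≠ α → ℓ0 β.1.1 ≠ ℓ0 β.1.2

/-- Equality with the support function forces `l β` to be extreme for every root not orthogonal to
`ℓ0`; only `l α` stays free, so the face is an edge parallel to `α`. -/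
lemma face_of_wall {α : PosRoot n} {ℓ0 : Fin (n + 1) → ℝ} (hw : OnWall α ℓ0)
    {p : Fin (n + 1) → ℤ} (hp : p ∈ zon (kmul n m 1))
    (hd : dot p ℓ0 = zsupp (kmul n m 1) ℓ0) :
    ∃ t : ℕ, t ≤ mlt m α.1.1 α.1.2 ∧ p = kv m ℓ0 + (t : ℤ) • sroot α := by
  obtain ⟨l, hl, rfl⟩ := mem_zon.1 hp
  rw [dot_sum, zsupp] at hd
  have hle : ∀ β ∈ Finset.univ, dot ((l β : ℤ) • sroot β) ℓ0 ≤
      (kmul n m 1 β : ℝ) * max (ℓ0 β.1.1 - ℓ0 β.1.2) 0 := by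
    intro β _
    rw [dot_zsmul, dot_sroot, Int.cast_natCast]
    have h1 : (l β : ℝ) ≤ kmul n m 1 β := by exact_mod_cast hl β
    exact (mul_le_mul_of_nonneg_left (le_max_left _ _) (Nat.cast_nonneg _)).trans
      (mul_le_mul_of_nonneg_right h1 (le_max_right _ _))
  have heq := (Finset.sum_eq_sum_iff_of_le hle).1 hd
  refine ⟨l α, by simpa [kmul] using hl α, ?_⟩
  rw [kv, ← Finset.add_sum_erase _ _ (Finset.mem_univ α),
    ← Finset.add_sum_erase (a := α) _ (fun β : PosRoot n =>
      (if ℓ0 β.1.2 < ℓ0 β.1.1 then (mlt m β.1.1 β.1.2 : ℤ) else 0) • sroot β) (Finset.mem_univ α),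
    if_neg (by rw [hw.1]; exact lt_irrefl _), zero_smul, zero_add]
  refine (add_comm _ _).trans ?_
  congr 1
  refine Finset.sum_congr rfl fun β hβ => ?_
  have h1 := heq β (Finset.mem_univ _)
  rw [dot_zsmul, dot_sroot, Int.cast_natCast] at h1
  rcases lt_or_gt_of_ne (hw.2 β (Finset.ne_of_mem_erase hβ)) with hlt | hgt
  · rw [max_eq_right (by linarith), mul_zero, mul_eq_zero,
      or_iff_left (by linarith [hlt] : ¬ ℓ0 β.1.1 - ℓ0 β.1.2 = 0)] at h1
    rw [if_neg hlt.not_gt]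
    have : l β = 0 := by exact_mod_cast h1
    rw [this, Nat.cast_zero]
  · rw [max_eq_left (by linarith)] at h1
    have h2 := mul_right_cancel₀ (by linarith [hgt] : ℓ0 β.1.1 - ℓ0 β.1.2 ≠ 0) h1
    rw [if_pos hgt]
    have : l β = mlt m β.1.1 β.1.2 := by
      have : l β = kmul n m 1 β := by exact_mod_cast h2
      simpa [kmul] using this
    rw [this]

lemma dot_wall {α : PosRoot n} {ℓ0 : Fin (n + 1) → ℝ} (hw : OnWall α ℓ0) (t : ℤ) :
    dot (kv m ℓ0 + t • sroot α) ℓ0 = zsupp (kmul n m 1) ℓ0 := by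
  rw [dot_add, dot_kv, dot_zsmul, dot_sroot, hw.1, sub_self, mul_zero, add_zero]

lemma tendsto_ev_wall (hm : 1 ≤ m) (h0 : h ≠ 0) {α : PosRoot n} {ℓ0 : Fin (n + 1) → ℝ}
    (hw : OnWall α ℓ0) {c : (Fin (n + 1) → ℤ) →₀ ℂ} (hc : c.support ⊆ zon (kmul n m 1))
    (w : Fin (n + 1) → ℂ) :
    Tendsto (fun t : ℝ => ev h m c (ray h m w ℓ0 t) *
      (Real.exp (2 * t * (-zsupp (kmul n m 1) ℓ0)) : ℝ)) atTop
      (𝓝 (∑ t ∈ Finset.range (mlt m α.1.1 α.1.2 + 1), c (kv m ℓ0 + (t : ℤ) • sroot α) *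
        mono h m (kv m ℓ0 + (t : ℤ) • sroot α) (pt m w))) := by
  classical
  have h1 := tendsto_ev hm h0 c w ℓ0 (zsupp (kmul n m 1) ℓ0) fun p hp => dot_le_zsupp (hc hp) ℓ0
  convert h1 using 2
  have hinj : Function.Injective fun t : ℕ => kv m ℓ0 + (t : ℤ) • sroot α := by
    intro t t' htt
    have h2 := congrArg (fun p => dot p (decr n)) htt
    simp only [dot_add, dot_zsmul, Int.cast_natCast, add_right_inj] at h2
    exact_mod_cast mul_right_cancel₀ (dot_sroot_decr α).ne' h2
  rw [← Finset.sum_image (s := Finset.range (mlt m α.1.1 α.1.2 + 1))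
    (f := fun p => c p * mono h m p (pt m w)) hinj.injOn]
  symm
  refine Finset.sum_subset (fun p hp => ?_) fun p hp hp' => ?_
  · rw [Finset.mem_filter] at hp
    obtain ⟨t, ht, rfl⟩ := face_of_wall hw (hc hp.1) hp.2
    exact Finset.mem_image.2 ⟨t, Finset.mem_range.2 (by omega), rfl⟩
  · obtain ⟨t, -, rfl⟩ := Finset.mem_image.1 hp
    rw [Finset.mem_filter, not_and_or, or_iff_left (not_not.2 (dot_wall hw t))] at hp'
    rw [Finsupp.notMem_support_iff.1 hp', zero_mul]

lemma nsq_mul_mlt {i j l : Fin (n + 1)} (hij : i < j) (hli : l ≠ i) (hlj : l ≠ j) :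
    mlt m i l * nsq m i = mlt m j l * nsq m j := by
  have hi : i ≠ Fin.last n := (hij.trans_le (Fin.le_last _)).ne
  by_cases hj : j = Fin.last n
  · subst hj
    rw [mlt_of_ne hi hlj, nsq_of_ne hi, mlt_comm, mlt_last, nsq_last]
    ring
  · rw [nsq_of_ne hi, nsq_of_ne hj]
    by_cases hl : l = Fin.last n
    · subst hl; rw [mlt_last, mlt_last]
    · rw [mlt_of_ne hi hl, mlt_of_ne hj hl]

/-- A ray in the wall direction `ℓ0` stays in the hyperplane of `α`, the offset being placed in the
coordinate `i`. In the leading part of the quasi-invariance condition along it only the exponents on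
an edge survive. The nearby injective `ℓ` serves to compute the coordinates of the vertex through
`two_mul_kv`. -/
lemma string_equation (hm : 1 ≤ m) (h0 : h ≠ 0) {α : PosRoot n} {ℓ0 ℓ : Fin (n + 1) → ℝ}
    (hw : OnWall α ℓ0) (hℓ : Function.Injective ℓ) (hα : ℓ α.1.1 < ℓ α.1.2)
    (hord : ∀ a b : Fin (n + 1), ℓ0 b < ℓ0 a → ℓ b < ℓ a)
    {x : Fin (n + 1) → ℂ} {c : (Fin (n + 1) → ℤ) →₀ ℂ} (hQ : c ∈ QIs h m x)
    (hc : c.support ⊆ zon (kmul n m 1)) {s : ℕ} (hs1 : 1 ≤ s) (hs : s ≤ mlt m α.1.1 α.1.2) :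
    ∑ t ∈ Finset.range (mlt m α.1.1 α.1.2 + 1), c (kv m ℓ0 + (t : ℤ) • sroot α) *
      qpow h (2 * off m α.1.1 α.1.2 * t) *
      (qpow h (2 * zeta m α.1.1 x - nsq m α.1.1 * mlt m α.1.1 α.1.2 + 2 * nsq m α.1.1 * t) ^ s -
        qpow h (2 * zeta m α.1.2 x + nsq m α.1.2 * mlt m α.1.1 α.1.2 -
          2 * nsq m α.1.2 * t) ^ s) = 0 := by
  obtain ⟨⟨i, j⟩, hij⟩ := α
  change i < j at hij
  simp only at hα hs ⊢
  have hk : kv m ℓ0 = kv m ℓ := by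
    rw [kv, kv]
    refine Finset.sum_congr rfl fun β _ => ?_
    congr 1
    by_cases hβ : β = ⟨(i, j), hij⟩
    · subst hβ
      rw [if_neg (by rw [hw.1]; exact lt_irrefl _), if_neg hα.not_gt]
    · rcases lt_or_gt_of_ne (hw.2 β hβ) with h1 | h1
      · rw [if_neg h1.not_gt, if_neg (hord _ _ h1).not_gt]
      · rw [if_pos h1, if_pos (hord _ _ h1)]
  have hsg : ∀ l, l ≠ i → l ≠ j → sg ℓ i l = sg ℓ j l := by
    intro l hli hlj
    have h3 : ℓ0 i ≠ ℓ0 l := by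
      rcases lt_or_gt_of_ne hli with hh | hh
      · exact (hw.2 ⟨(l, i), hh⟩ (fun e => hli (congrArg (fun a : PosRoot n => a.1.1) e))).symm
      · exact hw.2 ⟨(i, l), hh⟩ (fun e => hlj (congrArg (fun a : PosRoot n => a.1.2) e))
    have h4 : ℓ0 i = ℓ0 j := hw.1
    rw [sg, sg]
    rcases lt_or_gt_of_ne h3 with hh | hh
    · rw [if_neg (hord _ _ hh).not_gt, if_neg (hord _ _ (h4 ▸ hh)).not_gt]
    · rw [if_pos (hord _ _ hh), if_pos (hord _ _ (h4 ▸ hh))]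
  set k := kv m ℓ0 with hkd
  -- The roots other than `α` contribute the same amount `S` to the exponents at `i` and at `j`, so
  -- it becomes a common factor of the equation.
  set S : ℤ := ∑ l ∈ (Finset.univ.erase i).erase j, sg ℓ i l * (mlt m i l : ℤ) * nsq m i with hS
  have hi1 : (nsq m i : ℤ) * (2 * k i - kfull n m i) = -(nsq m i * mlt m i j) + S := by
    rw [hk, ← two_mul_kv ℓ hℓ i, ← Finset.add_sum_erase _ _ (Finset.mem_erase.2
      ⟨hij.ne', Finset.mem_univ j⟩), mul_add, hS, Finset.mul_sum]
    congr 1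
    · rw [sg, if_neg hα.not_gt]; ring
    · exact Finset.sum_congr rfl fun _ _ => by ring
  have hj1 : (nsq m j : ℤ) * (2 * k j - kfull n m j) = nsq m j * mlt m i j + S := by
    rw [hk, ← two_mul_kv ℓ hℓ j, ← Finset.add_sum_erase _ _ (Finset.mem_erase.2
      ⟨hij.ne, Finset.mem_univ i⟩), mul_add, hS, Finset.mul_sum, Finset.erase_right_comm]
    congr 1
    · rw [sg, if_pos hα, mlt_comm j i]; ring
    · refine Finset.sum_congr rfl fun l hl => ?_
      rw [Finset.mem_erase, Finset.mem_erase] at hl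
      have := nsq_mul_mlt (m := m) hij hl.2.1 hl.1
      have h5 : (mlt m i l : ℤ) * nsq m i = mlt m j l * nsq m j := by exact_mod_cast this
      rw [hsg l hl.2.1 hl.1, mul_assoc (sg ℓ j l), h5]
      ring
  have hi2 : (nsq m i : ℂ) * (2 * k i - kfull n m i) = -(nsq m i * mlt m i j) + S := by
    exact_mod_cast hi1
  have hj2 : (nsq m j : ℂ) * (2 * k j - kfull n m j) = nsq m j * mlt m i j + S := by
    exact_mod_cast hj1
  have hri := rho_coord (m := m) i
  have hrj := rho_coord (m := m) j
  have l1 := (tendsto_ev_wall hm h0 hw hc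
    (Pi.single i (off m i j) + Pi.single i (s * nsq m i : ℂ))).const_mul
    (qpow h (2 * zeta m i (x - cvec (rho n m))) ^ s)
  have l2 := (tendsto_ev_wall hm h0 hw hc
    (Pi.single i (off m i j) + Pi.single j (s * nsq m j : ℂ))).const_mul
    (qpow h (2 * zeta m j (x - cvec (rho n m))) ^ s)
  have heq := tendsto_nhds_unique (l1.congr fun t => by
    rw [← ray_add_smul_eps hm, ← mul_assoc, (mem_QIs.1 hQ) i j hij s hs1 hs, mul_assoc,
      ray_add_smul_eps hm]
    rw [zeta_ray hm, zeta_ray hm, show ℓ0 i = ℓ0 j from hw.1]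
    simp [hij.ne']
    ring) l2
  simp only [pt_add, mono_shift, mono_pt_single hm, ← hkd] at heq
  refine mul_left_cancel₀ (qpow_ne_zero (h := h) (2 * (k i * off m i j) + s * S)) ?_
  rw [mul_zero, ← sub_eq_zero.2 heq, Finset.mul_sum, Finset.mul_sum, Finset.mul_sum,
    ← Finset.sum_sub_distrib]
  refine Finset.sum_congr rfl fun t _ => ?_
  have sa : (sroot (⟨(i, j), hij⟩ : PosRoot n)) i = 1 := by simp [sroot, hij.ne]
  have sb : (sroot (⟨(i, j), hij⟩ : PosRoot n)) j = -1 := by simp [sroot, hij.ne']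
  have ki : (((k + (t : ℤ) • sroot (⟨(i, j), hij⟩ : PosRoot n)) i : ℤ) : ℂ) = k i + t := by
    rw [Pi.add_apply, Pi.smul_apply, sa]; push_cast; simp
  have kj : (((k + (t : ℤ) • sroot (⟨(i, j), hij⟩ : PosRoot n)) j : ℤ) : ℂ) = k j - t := by
    rw [Pi.add_apply, Pi.smul_apply, sb]; push_cast; simp; ring
  rw [ki, kj, ← qpow_nat_mul, ← qpow_nat_mul, ← qpow_nat_mul, ← qpow_nat_mul, zeta_sub, zeta_sub]
  have E1 : qpow h (2 * (k i * off m i j) + s * S) * (qpow h (2 * off m i j * t) *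
      qpow h (s * (2 * zeta m i x - nsq m i * mlt m i j + 2 * nsq m i * t))) =
      qpow h (s * (2 * (zeta m i x - zeta m i (cvec (rho n m))))) *
        (qpow h (2 * ((k i + t) * off m i j)) * qpow h (2 * ((k i + t) * (s * nsq m i)))) := by
    simp only [← qpow_add]
    congr 1
    linear_combination (-(s : ℂ)) * hi2 + s * hri
  have E2 : qpow h (2 * (k i * off m i j) + s * S) * (qpow h (2 * off m i j * t) *
      qpow h (s * (2 * zeta m j x + nsq m j * mlt m i j - 2 * nsq m j * t))) =
      qpow h (s * (2 * (zeta m j x - zeta m j (cvec (rho n m))))) *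
        (qpow h (2 * ((k i + t) * off m i j)) * qpow h (2 * ((k j - t) * (s * nsq m j)))) := by
    simp only [← qpow_add]
    congr 1
    linear_combination (-(s : ℂ)) * hj2 + s * hrj
  linear_combination c (k + (t : ℤ) • sroot (⟨(i, j), hij⟩ : PosRoot n)) * (E1 - E2)

theorem edge (hm : 1 ≤ m) (hq : NotRoot h) {α : PosRoot n} {ℓ0 ℓ : Fin (n + 1) → ℝ}
    (hw : OnWall α ℓ0) (hℓ : Function.Injective ℓ) (hα : ℓ α.1.1 < ℓ α.1.2)
    (hord : ∀ a b : Fin (n + 1), ℓ0 b < ℓ0 a → ℓ b < ℓ a)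
    {x : Fin (n + 1) → ℂ} {c : (Fin (n + 1) → ℤ) →₀ ℂ} (hQ : c ∈ QIs h m x)
    (hc : c.support ⊆ zon (kmul n m 1)) :
    c (kv m ℓ0) * nrm1 h m α 1 x =
      c (kv m ℓ0 + (mlt m α.1.1 α.1.2 : ℤ) • sroot α) * nrm1 h m α (-1) x := by
  have key := fun s hs1 hs => string_equation hm hq.ne_zero hw hℓ hα hord hQ hc (s := s) hs1 hs
  obtain ⟨⟨i, j⟩, hij⟩ := α
  change i < j at hij
  have hi : i ≠ Fin.last n := (hij.trans_le (Fin.le_last _)).ne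
  simp only [nrm1] at key ⊢
  by_cases hj : j = Fin.last n
  · subst hj
    have h1 := key 1 le_rfl (by rw [mlt_last])
    simp only [mlt_last, nsq_of_ne hi, nsq_last, off, Nat.reduceAdd, Finset.sum_range_succ, Finset.sum_range_zero,
      pow_one] at h1 ⊢
    have h2 := string_ends_last (h := h) (zeta m i x) (zeta m (Fin.last n) x)
      (c (kv m ℓ0)) (c (kv m ℓ0 + (1 : ℤ) • sroot (⟨(i, Fin.last n), hij⟩ : PosRoot n))) m (by
        rw [← h1]
        have e1 : (2 * (((m : ℂ) - (1 : ℕ)) / 2) * (1 : ℕ)) = m - 1 := by push_cast; ring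
        have e2 : 2 * zeta m i x - (1 : ℕ) * (1 : ℕ) + 2 * (1 : ℕ) * (1 : ℕ) =
          2 * zeta m i x + 1 := by push_cast; ring
        have e3 : 2 * zeta m (Fin.last n) x + (m : ℂ) * (1 : ℕ) - 2 * m * (1 : ℕ) =
          2 * zeta m (Fin.last n) x - m := by push_cast; ring
        rw [e1, e2, e3]
        simp [qpow_zero])
    simp only [Int.cast_one, one_mul, Int.cast_neg, neg_mul, sub_neg_eq_add]
    simpa using h2
  · have hM := mlt_of_ne (m := m) hi hj
    have h2 := string_ends hq hm
      (fun t => c (kv m ℓ0 + (t : ℤ) • sroot (⟨(i, j), hij⟩ : PosRoot n))) (zeta m i x) (zeta m j x)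
      fun s hs1 hs => by
        rw [← key s hs1 (hM.symm ▸ hs), hM]
        refine Finset.sum_congr rfl fun t _ => ?_
        simp [nsq_of_ne hi, nsq_of_ne hj, off, qpow_zero]
    rw [hM, nsq_of_ne hi, nsq_of_ne hj]
    simp only [Int.cast_one, one_mul, Int.cast_neg, neg_mul, sub_neg_eq_add]
    simpa using h2

/-! ### Coefficients at the extreme points -/

/-- The normalizing factor of the chamber of `ℓ`. -/
def nrm (h : ℂ) (m : ℕ) (ℓ : Fin (n + 1) → ℝ) (x : Fin (n + 1) → ℂ) : ℂ :=
  ∏ α : PosRoot n, nrm1 h m α (sg ℓ α.1.1 α.1.2) x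

/-- Crossing the wall of `α` changes the sign of `α` and of no other root: the two vertices are the
ends of one edge, and the normalizing factors differ in one factor. -/
lemma edge_nrm (hm : 1 ≤ m) (hq : NotRoot h) {α : PosRoot n} {ℓ0 ℓp ℓm : Fin (n + 1) → ℝ}
    (hw : OnWall α ℓ0) (hℓ : Function.Injective ℓm) (hα : ℓm α.1.1 < ℓm α.1.2)
    (hα' : ℓp α.1.2 < ℓp α.1.1)
    (hord : ∀ a b : Fin (n + 1), ℓ0 b < ℓ0 a → ℓm b < ℓm a)
    (hord' : ∀ a b : Fin (n + 1), ℓ0 b < ℓ0 a → ℓp b < ℓp a)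
    {x : Fin (n + 1) → ℂ} {c : (Fin (n + 1) → ℤ) →₀ ℂ} (hQ : c ∈ QIs h m x)
    (hc : c.support ⊆ zon (kmul n m 1)) :
    c (kv m ℓm) * nrm h m ℓp x = c (kv m ℓp) * nrm h m ℓm x := by
  have key := edge hm hq hw hℓ hα hord hQ hc
  have hm0 : kv m ℓm = kv m ℓ0 := by
    rw [kv, kv]
    refine Finset.sum_congr rfl fun β _ => ?_
    congr 1
    by_cases hβ : β = α
    · subst hβ
      rw [if_neg hα.not_gt, if_neg (by rw [hw.1]; exact lt_irrefl _)]
    · rcases lt_or_gt_of_ne (hw.2 β hβ) with h1 | h1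
      · rw [if_neg h1.not_gt, if_neg (hord _ _ h1).not_gt]
      · rw [if_pos h1, if_pos (hord _ _ h1)]
  have hp0 : kv m ℓp = kv m ℓ0 + (mlt m α.1.1 α.1.2 : ℤ) • sroot α := by
    rw [kv, kv, ← Finset.add_sum_erase _ _ (Finset.mem_univ α),
      ← Finset.add_sum_erase (a := α) _ (fun β : PosRoot n =>
        (if ℓ0 β.1.2 < ℓ0 β.1.1 then (mlt m β.1.1 β.1.2 : ℤ) else 0) • sroot β)
        (Finset.mem_univ α), if_pos hα', if_neg (by rw [hw.1]; exact lt_irrefl _), zero_smul,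
      zero_add]
    refine (add_comm _ _).trans ?_
    congr 1
    refine Finset.sum_congr rfl fun β hβ => ?_
    congr 1
    rcases lt_or_gt_of_ne (hw.2 β (Finset.ne_of_mem_erase hβ)) with h1 | h1
    · rw [if_neg h1.not_gt, if_neg (hord' _ _ h1).not_gt]
    · rw [if_pos h1, if_pos (hord' _ _ h1)]
  rw [hm0, hp0, nrm, nrm, ← Finset.mul_prod_erase _ _ (Finset.mem_univ α),
    ← Finset.mul_prod_erase (a := α) _ (fun β => nrm1 h m β (sg ℓm β.1.1 β.1.2) x)
      (Finset.mem_univ α)]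
  have hrest : ∏ β ∈ Finset.univ.erase α, nrm1 h m β (sg ℓp β.1.1 β.1.2) x =
      ∏ β ∈ Finset.univ.erase α, nrm1 h m β (sg ℓm β.1.1 β.1.2) x := by
    refine Finset.prod_congr rfl fun β hβ => ?_
    congr 1
    rw [sg, sg]
    rcases lt_or_gt_of_ne (hw.2 β (Finset.ne_of_mem_erase hβ)) with h1 | h1
    · rw [if_neg (hord _ _ h1).not_gt, if_neg (hord' _ _ h1).not_gt]
    · rw [if_pos (hord _ _ h1), if_pos (hord' _ _ h1)]
  rw [hrest, show sg ℓp α.1.1 α.1.2 = 1 from if_pos hα',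
    show sg ℓm α.1.1 α.1.2 = -1 from if_neg hα.not_gt]
  linear_combination (∏ β ∈ Finset.univ.erase α, nrm1 h m β (sg ℓm β.1.1 β.1.2) x) * key

/-- The direction attached to a permutation. -/
def lperm (σ : Equiv.Perm (Fin (n + 1))) : Fin (n + 1) → ℝ := fun i => -((σ i : ℕ) : ℝ)

lemma lperm_lt {σ : Equiv.Perm (Fin (n + 1))} {i j : Fin (n + 1)} :
    lperm σ j < lperm σ i ↔ σ i < σ j := by
  simp [lperm]

lemma lperm_injective (σ : Equiv.Perm (Fin (n + 1))) : Function.Injective (lperm σ) := by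
  intro i j hij
  simp only [lperm, neg_inj, Nat.cast_inj] at hij
  exact σ.injective (Fin.ext hij)

/-- The map merging `r` and `r + 1`. -/
def merge (r k : ℕ) : ℕ := if k ≤ r then k else k - 1

lemma swap_val (r : Fin n) (k : Fin (n + 1)) :
    ((Equiv.swap r.castSucc r.succ k : Fin (n + 1)) : ℕ) =
      if (k : ℕ) = r then (r : ℕ) + 1 else if (k : ℕ) = r + 1 then r else k := by
  rw [Equiv.swap_apply_def]
  simp only [Fin.ext_iff, Fin.val_castSucc, Fin.val_succ]
  split_ifs <;> simp

/-- The direction obtained by merging the values `r` and `r + 1` of the permutation lies on exactly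
one wall, which separates the two chambers. -/
lemma adjacent_nrm (hm : 1 ≤ m) (hq : NotRoot h) (σ : Equiv.Perm (Fin (n + 1))) (r : Fin n)
    {x : Fin (n + 1) → ℂ} {c : (Fin (n + 1) → ℤ) →₀ ℂ} (hQ : c ∈ QIs h m x)
    (hc : c.support ⊆ zon (kmul n m 1)) :
    c (kv m (lperm (Equiv.swap r.castSucc r.succ * σ))) * nrm h m (lperm σ) x =
      c (kv m (lperm σ)) * nrm h m (lperm (Equiv.swap r.castSucc r.succ * σ)) x := by
  set ℓ0 : Fin (n + 1) → ℝ := fun i => -(merge r (σ i) : ℝ) with hℓ0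
  set τ := Equiv.swap r.castSucc r.succ * σ with hτ
  have hτv : ∀ i, ((τ i : Fin (n + 1)) : ℕ) =
      if (σ i : ℕ) = r then (r : ℕ) + 1 else if (σ i : ℕ) = r + 1 then r else σ i :=
    fun i => swap_val r (σ i)
  have ho1 : ∀ a b : Fin (n + 1), ℓ0 b < ℓ0 a → lperm σ b < lperm σ a := by
    intro a b hab
    rw [lperm_lt, Fin.lt_def]
    simp only [hℓ0, neg_lt_neg_iff, Nat.cast_lt, merge] at hab
    split_ifs at hab <;> omega
  have ho2 : ∀ a b : Fin (n + 1), ℓ0 b < ℓ0 a → lperm τ b < lperm τ a := by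
    intro a b hab
    rw [lperm_lt, Fin.lt_def, hτv, hτv]
    simp only [hℓ0, neg_lt_neg_iff, Nat.cast_lt, merge] at hab
    split_ifs at hab ⊢ <;> omega
  have hwall : ∀ α : PosRoot n, (((σ α.1.1 : ℕ) = r ∧ (σ α.1.2 : ℕ) = r + 1) ∨
      ((σ α.1.1 : ℕ) = r + 1 ∧ (σ α.1.2 : ℕ) = r)) → OnWall α ℓ0 := by
    intro α hα
    refine ⟨?_, fun β hβ hh => hβ ?_⟩
    · simp only [hℓ0, neg_inj, Nat.cast_inj, merge]
      rcases hα with ⟨h1, h2⟩ | ⟨h1, h2⟩ <;> rw [h1, h2] <;> simp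
    · have hne : (σ β.1.1 : ℕ) ≠ σ β.1.2 := fun e => β.2.ne (σ.injective (Fin.ext e))
      simp only [hℓ0, neg_inj, Nat.cast_inj, merge] at hh
      have h3 : ((σ β.1.1 : ℕ) = r ∧ (σ β.1.2 : ℕ) = r + 1) ∨
          ((σ β.1.1 : ℕ) = r + 1 ∧ (σ β.1.2 : ℕ) = r) := by
        split_ifs at hh <;> omega
      have inj : ∀ a b : Fin (n + 1), (σ a : ℕ) = σ b → a = b :=
        fun a b e => σ.injective (Fin.ext e)
      have hα2 := α.2
      have hβ2 := β.2
      rcases hα with ⟨h1, h2⟩ | ⟨h1, h2⟩ <;> rcases h3 with ⟨h4, h5⟩ | ⟨h4, h5⟩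
      · exact Subtype.ext (Prod.ext (inj _ _ (by omega)) (inj _ _ (by omega)))
      · rw [inj β.1.1 α.1.2 (by omega), inj β.1.2 α.1.1 (by omega)] at hβ2
        exact absurd hα2 hβ2.not_gt
      · rw [inj β.1.1 α.1.2 (by omega), inj β.1.2 α.1.1 (by omega)] at hβ2
        exact absurd hα2 hβ2.not_gt
      · exact Subtype.ext (Prod.ext (inj _ _ (by omega)) (inj _ _ (by omega)))
  set a := σ.symm r.castSucc with ha
  set b := σ.symm r.succ with hb
  have hσa : (σ a : ℕ) = r := by simp [ha]
  have hσb : (σ b : ℕ) = r + 1 := by simp [hb]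
  have hτa : (τ a : ℕ) = r + 1 := by rw [hτv, if_pos hσa]
  have hτb : (τ b : ℕ) = r := by rw [hτv, hσb]; simp
  have hab : a ≠ b := fun e => by rw [e, hσb] at hσa; omega
  rcases lt_or_gt_of_ne hab with hlt | hlt
  · exact edge_nrm hm hq (α := ⟨(a, b), hlt⟩) (hwall _ (Or.inl ⟨hσa, hσb⟩)) (lperm_injective τ)
      (lperm_lt.2 (Fin.lt_def.2 (by simp only; omega)))
      (lperm_lt.2 (Fin.lt_def.2 (by simp only; omega))) ho2 ho1 hQ hc
  · exact (edge_nrm hm hq (α := ⟨(b, a), hlt⟩) (hwall _ (Or.inr ⟨hσb, hσa⟩)) (lperm_injective σ)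
      (lperm_lt.2 (Fin.lt_def.2 (by simp only; omega)))
      (lperm_lt.2 (Fin.lt_def.2 (by simp only; omega))) ho1 ho2 hQ hc).symm

lemma kv_decr : kv m (lperm (1 : Equiv.Perm (Fin (n + 1)))) = kfull n m := by
  rw [kv, kfull]
  exact Finset.sum_congr rfl fun α _ => by rw [if_pos (lperm_lt.2 α.2)]

lemma normFactor_eq (x : Fin (n + 1) → ℂ) : normFactor h m x = ∏ α : PosRoot n, nrm1 h m α 1 x := by
  rw [normFactor]
  refine Finset.prod_congr rfl fun α _ => ?_
  rw [nrm1, mult_eq]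
  refine Finset.prod_congr rfl fun s _ => ?_
  rw [pair_root, zeta_sub, zeta_sub, zeta_smul, zeta_smul, ← zeta_root]
  congr 1
  push_cast
  ring

lemma nrm_of_lt {ℓ : Fin (n + 1) → ℝ} (hℓ : ∀ i j, i < j → ℓ j < ℓ i) (x : Fin (n + 1) → ℂ) :
    nrm h m ℓ x = normFactor h m x := by
  rw [normFactor_eq, nrm]
  exact Finset.prod_congr rfl fun α _ => by rw [sg, if_pos (hℓ _ _ α.2)]

lemma kv_of_lt {ℓ : Fin (n + 1) → ℝ} (hℓ : ∀ i j, i < j → ℓ j < ℓ i) : kv m ℓ = kfull n m := by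
  rw [kv, kfull]
  exact Finset.sum_congr rfl fun α _ => by rw [if_pos (hℓ _ _ α.2)]

/-- No normalizing factor vanishes at `x`. -/
def NrmNeZero (h : ℂ) (m : ℕ) (x : Fin (n + 1) → ℂ) : Prop :=
  ∀ (α : PosRoot n) (e : ℤ), e = 1 ∨ e = -1 → nrm1 h m α e x ≠ 0

lemma sg_eq (ℓ : Fin (n + 1) → ℝ) (i j : Fin (n + 1)) : sg ℓ i j = 1 ∨ sg ℓ i j = -1 := by
  rw [sg]; split_ifs <;> simp

lemma NrmNeZero.nrm {x : Fin (n + 1) → ℂ} (hx : NrmNeZero h m x) (ℓ : Fin (n + 1) → ℝ) :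
    nrm h m ℓ x ≠ 0 :=
  Finset.prod_ne_zero_iff.2 fun α _ => hx α _ (sg_eq _ _ _)

lemma NrmNeZero.normFactor {x : Fin (n + 1) → ℂ} (hx : NrmNeZero h m x) : normFactor h m x ≠ 0 := by
  rw [normFactor_eq]
  exact Finset.prod_ne_zero_iff.2 fun α _ => hx α _ (Or.inl rfl)

/-- Adjacent transpositions generate the symmetric group, so the relation propagates from the
chamber of the identity by crossing one wall at a time. -/
lemma chamber_perm (hm : 1 ≤ m) (hq : NotRoot h) {x : Fin (n + 1) → ℂ} (hx : NrmNeZero h m x)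
    {c : (Fin (n + 1) → ℤ) →₀ ℂ} (hQ : c ∈ QIs h m x) (hc : c.support ⊆ zon (kmul n m 1))
    (σ : Equiv.Perm (Fin (n + 1))) :
    c (kv m (lperm σ)) * normFactor h m x = c (kfull n m) * nrm h m (lperm σ) x := by
  refine Submonoid.induction_of_closure_eq_top_left (Equiv.Perm.mclosure_swap_castSucc_succ n) σ
    ?_ ?_
  · rw [kv_decr, nrm_of_lt fun i j hij => lperm_lt.2 hij]
  · rintro _ ⟨r, rfl⟩ τ ih
    have h1 := adjacent_nrm hm hq τ r hQ hc
    refine mul_left_cancel₀ (hx.nrm (lperm τ)) ?_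
    linear_combination normFactor h m x * h1 +
      nrm h m (lperm (Equiv.swap r.castSucc r.succ * τ)) x * ih

lemma exists_perm {ℓ : Fin (n + 1) → ℝ} (hℓ : Function.Injective ℓ) :
    ∃ σ : Equiv.Perm (Fin (n + 1)), ∀ i j, lperm σ j < lperm σ i ↔ ℓ j < ℓ i := by
  set τ := Tuple.sort (-ℓ) with hτ
  have hmono : StrictMono ((-ℓ) ∘ τ) := (Tuple.monotone_sort (-ℓ)).strictMono_of_injective
    ((neg_injective.comp hℓ).comp τ.injective)
  refine ⟨τ.symm, fun i j => ?_⟩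
  rw [lperm_lt, ← hmono.lt_iff_lt]
  simp

/-- All extreme coefficients are determined by one of them. -/
theorem chamber (hm : 1 ≤ m) (hq : NotRoot h) {x : Fin (n + 1) → ℂ} (hx : NrmNeZero h m x)
    {c : (Fin (n + 1) → ℤ) →₀ ℂ} (hQ : c ∈ QIs h m x) (hc : c.support ⊆ zon (kmul n m 1))
    {ℓ : Fin (n + 1) → ℝ} (hℓ : Function.Injective ℓ) :
    c (kv m ℓ) * normFactor h m x = c (kfull n m) * nrm h m ℓ x := by
  obtain ⟨σ, hσ⟩ := exists_perm hℓ
  have h1 : kv m ℓ = kv m (lperm σ) := by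
    rw [kv, kv]
    exact Finset.sum_congr rfl fun α _ => by simp only [hσ]
  have h2 : nrm h m ℓ x = nrm h m (lperm σ) x := by
    rw [nrm, nrm]
    exact Finset.prod_congr rfl fun α _ => by simp only [sg, hσ]
  rw [h1, h2]
  exact chamber_perm hm hq hx hQ hc σ

lemma qpow_mul_nrm1 (α : PosRoot n) (e : ℤ) (x : Fin (n + 1) → ℂ) :
    qpow h (e * (zeta m α.1.1 x - zeta m α.1.2 x)) ^ mlt m α.1.1 α.1.2 * nrm1 h m α e x =
      ∏ s ∈ Finset.Icc 1 (mlt m α.1.1 α.1.2),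
        (qpow h (s * ((nsq m α.1.1 + nsq m α.1.2) / 2)) -
          qpow h (-(s * ((nsq m α.1.1 + nsq m α.1.2) / 2))) * mono h m (e • sroot α) x) := by
  rw [nrm1]
  have : mlt m α.1.1 α.1.2 = (Finset.Icc 1 (mlt m α.1.1 α.1.2)).card := by simp
  rw [this, ← Finset.prod_const, ← this, ← Finset.prod_mul_distrib]
  refine Finset.prod_congr rfl fun s _ => ?_
  have h2 : mono h m (e • sroot α) x = qpow h (e * (2 * (zeta m α.1.1 x - zeta m α.1.2 x))) := by
    rw [qpow_int_mul, ← mono_sroot, mono_eq, mono_eq, ← qpow_int_mul]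
    congr 1
    rw [pair_lat, pair_lat]
    simp only [Pi.smul_apply, smul_eq_mul, Int.cast_mul, Finset.mul_sum]
    exact Finset.sum_congr rfl fun i _ => by ring
  rw [h2, qnum, mul_sub, ← qpow_add, ← qpow_add, ← qpow_add]
  congr 2 <;> ring

lemma isPoly_nrm1 (α : PosRoot n) {e : ℤ} : IsPoly h m fun x : Fin (n + 1) → ℂ =>
    qpow h (e * (zeta m α.1.1 x - zeta m α.1.2 x)) ^ mlt m α.1.1 α.1.2 * nrm1 h m α e x := by
  simp only [qpow_mul_nrm1]
  simpa only [Finset.prod_fn] using isPoly_prod (Finset.Icc 1 (mlt m α.1.1 α.1.2)) (fun s x =>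
    qpow h (s * ((nsq m α.1.1 + nsq m α.1.2) / 2)) -
      qpow h (-(s * ((nsq m α.1.1 + nsq m α.1.2) / 2))) * mono h m (e • sroot α) x)
    fun s _ => (isPoly_const h m _).sub ((isPoly_mono _).const_mul _)
lemma nrm1_ne_zero (hm : 1 ≤ m) (h0 : h ≠ 0) (α : PosRoot n) {e : ℤ} (he : e = 1 ∨ e = -1) :
    (nrm1 h m α e : (Fin (n + 1) → ℂ) → ℂ) ≠ 0 := by
  have hne : α.1.1 ≠ α.1.2 := ne_of_lt α.2
  have hd : ∀ s : ℕ, (fun x : Fin (n + 1) → ℂ => qnum h (s * ((nsq m α.1.1 + nsq m α.1.2) / 2) -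
      e * (zeta m α.1.1 x - zeta m α.1.2 x))) ≠ 0 := by
    intro s hh
    have h1 := congrFun hh (pt m (Pi.single α.1.1
      (e * (s * ((nsq m α.1.1 + nsq m α.1.2) / 2) - 1 / (2 * h)))))
    simp only [zeta_pt hm, Pi.single_eq_same, Pi.single_eq_of_ne hne.symm, sub_zero,
      Pi.zero_apply] at h1
    refine qnum_half h0 ?_
    rw [← h1]
    congr 1
    rcases he with rfl | rfl <;> push_cast <;> ring
  have h1 := analytic_prod_ne_zero (Finset.Icc 1 (mlt m α.1.1 α.1.2))
    (fun (s : ℕ) (x : Fin (n + 1) → ℂ) => qnum h (s * ((nsq m α.1.1 + nsq m α.1.2) / 2) -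
      e * (zeta m α.1.1 x - zeta m α.1.2 x))) (fun s _ => AnalyticOnNhd.qnum
        (analyticOnNhd_const.sub (analyticOnNhd_const.mul
          ((analytic_zeta _).sub (analytic_zeta _))))) fun s _ => hd s
  convert h1 using 1
  funext x
  rw [nrm1, Finset.prod_apply]

lemma generically_nrmNeZero (hm : 1 ≤ m) (h0 : h ≠ 0) :
    Generically h m (NrmNeZero h m : (Fin (n + 1) → ℂ) → Prop) := by
  have key : ∀ e : ℤ, e = 1 ∨ e = -1 → Generically h m fun x : Fin (n + 1) → ℂ =>
      ∀ α ∈ (Finset.univ : Finset (PosRoot n)), nrm1 h m α e x ≠ 0 := fun e he =>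
    generically_ball _ _ fun α _ => generically_of_ne_zero (isPoly_nrm1 α)
      (fun x => pow_ne_zero _ (qpow_ne_zero _)) (nrm1_ne_zero hm h0 α he)
  refine ((key 1 (Or.inl rfl)).and (key (-1) (Or.inr rfl))).mono fun x hx α e he => ?_
  rcases he with rfl | rfl
  · exact hx.1 α (Finset.mem_univ _)
  · exact hx.2 α (Finset.mem_univ _)

/-! ### Multiplication and shifts of coefficient vectors -/

/-- Coefficients of a product. -/
def conv (c d : (Fin (n + 1) → ℤ) →₀ ℂ) : (Fin (n + 1) → ℤ) →₀ ℂ :=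
  ∑ p ∈ c.support, ∑ p' ∈ d.support, Finsupp.single (p + p') (c p * d p')

lemma ev_conv (c d : (Fin (n + 1) → ℤ) →₀ ℂ) (z : Fin (n + 1) → ℂ) :
    ev h m (conv c d) z = ev h m c z * ev h m d z := by
  rw [conv, ev_apply c, ev_apply d, Finset.sum_mul_sum]
  simp only [map_sum, Finset.sum_apply, ev_single, mono_add]
  exact Finset.sum_congr rfl fun p _ => Finset.sum_congr rfl fun p' _ => by ring

lemma conv_support {c d : (Fin (n + 1) → ℤ) →₀ ℂ} {S : Finset (Fin (n + 1) → ℤ)}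
    (hd : d.support ⊆ S) : (conv c d).support ⊆ Finset.image₂ (· + ·) c.support S := by
  have : conv c d ∈ Finsupp.supported ℂ ℂ
      ((Finset.image₂ (· + ·) c.support S : Finset (Fin (n + 1) → ℤ)) : Set _) :=
    Submodule.sum_mem _ fun p hp => Submodule.sum_mem _ fun p' hp' =>
      Finsupp.single_mem_supported _ _
        (Finset.mem_coe.2 (Finset.mem_image₂_of_mem hp (hd hp')))
  exact_mod_cast (Finsupp.mem_supported _ _).1 this

lemma TQ.mul {f F : (Fin (n + 1) → ℂ) → ℂ} {y : Fin (n + 1) → ℂ} (hf : TQ h m 0 f)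
    (hF : TQ h m y F) : TQ h m y fun z => f z * F z := by
  intro i j hij s hs1 hs z hz
  have h1 := hf i j hij s hs1 hs z hz
  have h2 := hF i j hij s hs1 hs z hz
  simp only [zeta, Pi.zero_apply, mul_zero, qpow_zero, one_pow, one_mul] at h1
  dsimp only
  rw [h1]
  linear_combination f (z + (s : ℂ) • eps m j) * h2

/-- Multiplication by a quasi-invariant. -/
def mulQ {cf : (Fin (n + 1) → ℤ) →₀ ℂ} (hf : TQ h m 0 (ev h m cf)) {x : Fin (n + 1) → ℂ}
    (c : QIs h m x) : QIs h m x :=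
  ⟨conv cf c, by
    rw [mem_QIs, show ev h m (conv cf (c : (Fin (n + 1) → ℤ) →₀ ℂ)) =
      fun z => ev h m cf z * ev h m (c : (Fin (n + 1) → ℤ) →₀ ℂ) z from funext (ev_conv _ _)]
    exact hf.mul c.2⟩

/-- Translation of exponents. -/
def sh (y : Fin (n + 1) → ℤ) (c : (Fin (n + 1) → ℤ) →₀ ℂ) : (Fin (n + 1) → ℤ) →₀ ℂ :=
  Finsupp.equivMapDomain (Equiv.addRight y) c

lemma sh_apply (y p : Fin (n + 1) → ℤ) (c : (Fin (n + 1) → ℤ) →₀ ℂ) :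
    sh y c p = c (p - y) := by
  rw [sh, Finsupp.equivMapDomain_apply, Equiv.addRight_symm_apply, sub_eq_add_neg]

lemma sh_support {y : Fin (n + 1) → ℤ} {c : (Fin (n + 1) → ℤ) →₀ ℂ}
    {S : Finset (Fin (n + 1) → ℤ)} (hc : c.support ⊆ S) {p : Fin (n + 1) → ℤ}
    (hp : p ∈ (sh y c).support) : p - y ∈ S := by
  rw [Finsupp.mem_support_iff, sh_apply, ← Finsupp.mem_support_iff] at hp
  exact hc hp

lemma ev_sh (y : Fin (n + 1) → ℤ) (c : (Fin (n + 1) → ℤ) →₀ ℂ) (z : Fin (n + 1) → ℂ) :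
    ev h m (sh y c) z = mono h m y z * ev h m c z := by
  rw [sh, Finsupp.equivMapDomain_eq_mapDomain]
  induction c using Finsupp.induction_linear with
  | zero => simp
  | add c d hc hd =>
    rw [Finsupp.mapDomain_add, map_add, map_add, Pi.add_apply, Pi.add_apply, hc, hd, mul_add]
  | single p a =>
    rw [Finsupp.mapDomain_single, ev_single, ev_single, Equiv.coe_addRight, mono_add]
    ring

lemma mono_smul_eps (y : Fin (n + 1) → ℤ) (i : Fin (n + 1)) (s : ℕ) :
    mono h m y ((s : ℂ) • eps m i) = qpow h (2 * (y i * nsq m i)) ^ s := by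
  rw [mono_eq, pair_lat, ← qpow_nat_mul]
  congr 1
  have : ∀ k, (y k : ℂ) * zeta m k ((s : ℂ) • eps m i) =
      if k = i then (y i : ℂ) * (s * nsq m i) else 0 := by
    intro k
    rw [zeta_smul, zeta_eps]
    split_ifs with hk
    · rw [hk]
    · ring
  rw [Finset.sum_congr rfl fun k _ => this k, Finset.sum_ite_eq' Finset.univ i fun _ =>
    (y i : ℂ) * (s * nsq m i), if_pos (Finset.mem_univ _)]
  ring

lemma qpow_zeta_add_lat (x : Fin (n + 1) → ℂ) (y : Fin (n + 1) → ℤ) (i : Fin (n + 1)) :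
    qpow h (2 * zeta m i (x + cvec (lat m y) - cvec (rho n m))) =
      qpow h (2 * zeta m i (x - cvec (rho n m))) * qpow h (2 * (y i * nsq m i)) := by
  rw [← qpow_add, zeta_sub, zeta_sub, zeta_add, zeta_lat]
  congr 1
  ring

/-- Translation of quasi-invariants. -/
def shQ (y : Fin (n + 1) → ℤ) {x : Fin (n + 1) → ℂ} (c : QIs h m (x + cvec (lat m y))) :
    QIs h m x :=
  ⟨sh y c, by
    rw [mem_QIs]
    intro i j hij s hs1 hs z hz
    have h1 := mem_QIs.1 c.2 i j hij s hs1 hs z hz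
    rw [qpow_zeta_add_lat, qpow_zeta_add_lat] at h1
    rw [ev_sh, ev_sh, mono_shift, mono_shift, mono_smul_eps, mono_smul_eps]
    linear_combination mono h m y z * h1⟩

lemma shQ_coe (y : Fin (n + 1) → ℤ) {x : Fin (n + 1) → ℂ} (c : QIs h m (x + cvec (lat m y))) :
    (shQ y c : (Fin (n + 1) → ℤ) →₀ ℂ) = sh y c := rfl

lemma opE_eq_of_tD (hm : 1 ≤ m) (hq : NotRoot h) {x : Fin (n + 1) → ℂ} {c d : QIs h m x}
    (H : ∀ z, OffPoles h m z →
      tD h m (x - cvec (rho n m)) (ev h m (c : (Fin (n + 1) → ℤ) →₀ ℂ)) z =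
        ev h m (d : (Fin (n + 1) → ℤ) →₀ ℂ) z) : opE hm hq x c = d :=
  Subtype.ext (ev_ext hm hq.ne_zero fun z hz => by rw [← opE_spec hm hq x c z hz, H z hz])

/-- Translating exponents by `y` while changing the twist from `x + lat y` to `x` leaves the
function `q^{2(x-ρ,z)} ∑ c_p q^{2(lat p,z)}` unchanged up to a constant factor. Thus eigenvectors at
`x + lat y` become eigenvectors at `x`. -/
lemma opE_shQ (hm : 1 ≤ m) (hq : NotRoot h) (y : Fin (n + 1) → ℤ) {x : Fin (n + 1) → ℂ}
    (c : QIs h m (x + cvec (lat m y))) : opE hm hq x (shQ y c) = shQ y (opE hm hq _ c) := by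
  refine opE_eq_of_tD hm hq fun z hz => ?_
  rw [shQ_coe, shQ_coe, ev_sh, ← opE_spec hm hq _ c z hz, tD, tD, Finset.mul_sum]
  refine Finset.sum_congr rfl fun i _ => ?_
  have := mono_smul_eps (h := h) (m := m) y i 1
  rw [Nat.cast_one, one_smul, pow_one] at this
  rw [ev_sh, mono_shift, this, qpow_zeta_add_lat]
  ring

lemma shQ_smul (y : Fin (n + 1) → ℤ) {x : Fin (n + 1) → ℂ} (a : ℂ)
    (c : QIs h m (x + cvec (lat m y))) : shQ y (a • c) = a • shQ y c := by
  refine Subtype.ext (Finsupp.ext fun p => ?_)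
  rw [shQ_coe, sh_apply, Submodule.coe_smul, Submodule.coe_smul, Finsupp.smul_apply,
    Finsupp.smul_apply, shQ_coe, sh_apply]

/-! ### Expansion of products -/

/-- The Lagrange basis polynomials sum to `1`. When the full product of the factors `X - v i` kills
`w`, this is the decomposition of `w` into eigenvectors. -/
lemma lagrange_decomposition {V ι : Type*} [AddCommMonoid V] [Module ℂ V] [DecidableEq ι]
    (T : Module.End ℂ V) (s : Finset ι) (hs : s.Nonempty) (v : ι → ℂ) (hv : Set.InjOn v s) (w : V) :
    ∑ i ∈ s, (∏ j ∈ s.erase i, (v i - v j))⁻¹ •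
      Polynomial.aeval T (∏ j ∈ s.erase i, (Polynomial.X - Polynomial.C (v j))) w = w := by
  have h1 := congrArg (fun P => Polynomial.aeval T P w) (Lagrange.sum_basis hv hs)
  simp only [map_sum, map_one, LinearMap.sum_apply, Module.End.one_apply] at h1
  refine Eq.trans ?_ h1
  refine Finset.sum_congr rfl fun i _ => ?_
  have h2 : Lagrange.basis s v i = Polynomial.C (∏ j ∈ s.erase i, (v i - v j))⁻¹ *
      ∏ j ∈ s.erase i, (Polynomial.X - Polynomial.C (v j)) := by
    simp only [Lagrange.basis, Lagrange.basisDivisor, Finset.prod_mul_distrib]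
    rw [← Finset.prod_inv_distrib, map_prod]
  rw [h2, map_mul, Module.End.mul_apply, Polynomial.aeval_C, Module.algebraMap_end_apply]

/-- An eigenvector is determined by one extreme coefficient. -/
lemma eigen_eq_zero (hm : 1 ≤ m) (hq : NotRoot h) {x : Fin (n + 1) → ℂ}
    {S : Finset (Fin (n + 1) → ℤ)} (hx : Res h m (tset m S) x) {c : QIs h m x}
    (hc : (c : (Fin (n + 1) → ℤ) →₀ ℂ).support ⊆ S) {y : Fin (n + 1) → ℤ} (hy : y ∈ tset m S)
    (hE : opE hm hq x c = orbitSum h m (x + cvec (lat m y)) • c)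
    (h0 : (c : (Fin (n + 1) → ℤ) →₀ ℂ) (y + kfull n m) = 0) : c = 0 := by
  by_contra hne
  obtain ⟨y', hy1, hy2⟩ := eigen_top hm hq hx hc hne hE
  obtain ⟨ℓ, hℓ, hd⟩ := genDir_decr (n := n)
  have hy' : y' ∈ tset m S := by
    have := sub_kv_mem_tset (m := m) (hc (hy2 ℓ hℓ).1) ℓ
    rwa [add_sub_cancel_right] at this
  have := (hy2 ℓ hℓ).1
  rw [kv_of_lt hd, ← hx y hy y' hy' hy1] at this
  exact (Finsupp.mem_support_iff.1 this) h0

/-- Generic eigenspaces are one-dimensional: subtracting the multiple of `d` that removes the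
extreme coefficient leaves a vector to which `eigen_eq_zero` applies. -/
lemma eigen_eq_smul (hm : 1 ≤ m) (hq : NotRoot h) {x : Fin (n + 1) → ℂ}
    {S : Finset (Fin (n + 1) → ℤ)} (hx : Res h m (tset m S) x) {c d : QIs h m x}
    (hc : (c : (Fin (n + 1) → ℤ) →₀ ℂ).support ⊆ S)
    (hd : (d : (Fin (n + 1) → ℤ) →₀ ℂ).support ⊆ S) {y : Fin (n + 1) → ℤ} (hy : y ∈ tset m S)
    (hcE : opE hm hq x c = orbitSum h m (x + cvec (lat m y)) • c)
    (hdE : opE hm hq x d = orbitSum h m (x + cvec (lat m y)) • d)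
    (h0 : (d : (Fin (n + 1) → ℤ) →₀ ℂ) (y + kfull n m) ≠ 0) :
    c = ((c : (Fin (n + 1) → ℤ) →₀ ℂ) (y + kfull n m) /
      (d : (Fin (n + 1) → ℤ) →₀ ℂ) (y + kfull n m)) • d := by
  set lam := (c : (Fin (n + 1) → ℤ) →₀ ℂ) (y + kfull n m) /
      (d : (Fin (n + 1) → ℤ) →₀ ℂ) (y + kfull n m) with hlam
  have happ : ∀ p, ((c + (-lam) • d : QIs h m x) : (Fin (n + 1) → ℤ) →₀ ℂ) p =
      (c : (Fin (n + 1) → ℤ) →₀ ℂ) p - lam * (d : (Fin (n + 1) → ℤ) →₀ ℂ) p := by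
    intro p
    rw [Submodule.coe_add, Submodule.coe_smul, Finsupp.add_apply, Finsupp.smul_apply, smul_eq_mul]
    ring
  have h1 : c + (-lam) • d = 0 := by
    refine eigen_eq_zero hm hq hx (fun p hp => ?_) hy ?_ ?_
    · by_contra hpS
      rw [Finsupp.mem_support_iff, happ, Finsupp.notMem_support_iff.1 fun hh => hpS (hc hh),
        Finsupp.notMem_support_iff.1 fun hh => hpS (hd hh), mul_zero, sub_zero] at hp
      exact hp rfl
    · rw [map_add, map_smul, hcE, hdE, smul_add, smul_comm]
    · rw [happ, hlam, div_mul_cancel₀ _ h0, sub_self]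
  refine Subtype.ext (Finsupp.ext fun p => ?_)
  have h2 := happ p
  rw [h1, ZeroMemClass.coe_zero, Finsupp.zero_apply] at h2
  rw [Submodule.coe_smul, Finsupp.smul_apply, smul_eq_mul]
  linear_combination -h2

/-- A polynomial family of eigenvectors supported in the polytope. -/
structure EigFam (hm : 1 ≤ m) (hq : NotRoot h) (φ : ∀ x : Fin (n + 1) → ℂ, QIs h m x) : Prop where
  poly : PolyFam h m φ
  supp : ∀ x, (φ x : (Fin (n + 1) → ℤ) →₀ ℂ).support ⊆ zon (kmul n m 1)
  eigen : ∀ x, opE hm hq x (φ x) = orbitSum h m x • φ x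
  ne : (fun x => (φ x : (Fin (n + 1) → ℤ) →₀ ℂ) (kfull n m)) ≠ 0

lemma EigFam.coeff {hm : 1 ≤ m} {hq : NotRoot h} {φ : ∀ x : Fin (n + 1) → ℂ, QIs h m x}
    (hφ : EigFam hm hq φ) (p : Fin (n + 1) → ℤ) :
    IsPoly h m fun x => (φ x : (Fin (n + 1) → ℤ) →₀ ℂ) p :=
  hφ.poly.coeff hm hq.ne_zero hφ.supp p

lemma polyFam_mulQ {cf : (Fin (n + 1) → ℤ) →₀ ℂ} (hf : TQ h m 0 (ev h m cf))
    {φ : ∀ x : Fin (n + 1) → ℂ, QIs h m x} (hφ : PolyFam h m φ) :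
    PolyFam h m fun x => mulQ hf (φ x) := by
  intro z hz
  have : (fun x => ev h m (mulQ hf (φ x) : (Fin (n + 1) → ℤ) →₀ ℂ) z) =
      fun x => ev h m cf z * ev h m (φ x : (Fin (n + 1) → ℤ) →₀ ℂ) z :=
    funext fun x => ev_conv _ _ _
  rw [this]
  exact (hφ z hz).const_mul _

lemma isPoly_shift_ne_zero {f : (Fin (n + 1) → ℂ) → ℂ} (hf : f ≠ 0) (v : Fin (n + 1) → ℂ) :
    (fun x => f (x + v)) ≠ 0 := by
  intro hh
  apply hf
  funext x
  have := congrFun hh (x - v)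
  simpa using this

/-- The product of a quasi-invariant with `φ x` is again a quasi-invariant vector at `x` and
decomposes into eigenvectors. The component with eigenvalue `𝔪(x + y)` is proportional to the
translate of `φ (x + y)`, which has the same eigenvalue. -/
theorem expansion (hm : 1 ≤ m) (hq : NotRoot h) {φ : ∀ x : Fin (n + 1) → ℂ, QIs h m x}
    (hφ : EigFam hm hq φ) {cf : (Fin (n + 1) → ℤ) →₀ ℂ} (hf : TQ h m 0 (ev h m cf)) :
    ∃ (Y : Finset (Fin (n + 1) → ℤ)) (N D : (Fin (n + 1) → ℤ) → (Fin (n + 1) → ℂ) → ℂ),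
      (∀ y ∈ Y, IsPoly h m (N y) ∧ IsPoly h m (D y) ∧ D y ≠ 0) ∧
      Generically h m fun x => (∀ y ∈ Y, D y x ≠ 0) ∧
        conv cf (φ x : (Fin (n + 1) → ℤ) →₀ ℂ) =
          ∑ y ∈ Y, (N y x / D y x) • sh y (φ (x + cvec (lat m y)) : (Fin (n + 1) → ℤ) →₀ ℂ) := by
  classical
  -- The exponents of an arbitrary factor are enclosed in a box, which is cut out by linear
  -- inequalities and hence preserved by the operator.
  obtain ⟨B, hB⟩ := exists_box (Finset.image₂ (· + ·) cf.support (zon (kmul n m 1)))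
  set S := box n B with hS
  -- The point `0` is inserted only to make the set of interpolation nodes nonempty.
  set Y : Finset (Fin (n + 1) → ℤ) := insert 0 (tset m S) with hY
  set S1 : Finset (Fin (n + 1) → ℤ) := S ∪ Finset.image₂ (· + ·) Y (zon (kmul n m 1)) with hS1
  have hsupp : ∀ x, mulQ hf (φ x) ∈ QIsupp h m x S := fun x =>
    mem_QIsupp.2 ((conv_support (hφ.supp x)).trans hB)
  set W : (Fin (n + 1) → ℤ) → ∀ x : Fin (n + 1) → ℂ, QIs h m x := fun y x =>
    Polynomial.aeval (opE hm hq x) (orbPoly h m x (Y.erase y)) (mulQ hf (φ x)) with hW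
  have hWS : ∀ y x, W y x ∈ QIsupp h m x S := fun y x =>
    aeval_mem_QIsupp hm hq (sep_box B) _ (hsupp x)
  set Δ : (Fin (n + 1) → ℤ) → (Fin (n + 1) → ℂ) → ℂ := fun y => ∏ y' ∈ Y.erase y, fun x =>
    (orbitSum h m (x + cvec (lat m y)) - orbitSum h m (x + cvec (lat m y'))) with hΔ
  set g : (Fin (n + 1) → ℂ) → ℂ :=
    fun x => (φ x : (Fin (n + 1) → ℤ) →₀ ℂ) (kfull n m) with hg
  have hΔp : ∀ y, IsPoly h m (Δ y) := fun y => isPoly_prod _ _ fun y' _ =>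
    (isPoly_orbitSum_shift y).sub (isPoly_orbitSum_shift y')
  have hΔ0 : ∀ y, Δ y ≠ 0 := fun y => analytic_prod_ne_zero _ _
    (fun y' _ => ((isPoly_orbitSum_shift y).sub (isPoly_orbitSum_shift y')).analytic)
    fun y' hy' => orbitSum_shift_sub_ne_zero hm hq (Finset.ne_of_mem_erase hy').symm
  have hgp : ∀ y, IsPoly h m fun x => g (x + cvec (lat m y)) := fun y =>
    (hφ.coeff (kfull n m)).shift _
  have hg0 : ∀ y, (fun x => g (x + cvec (lat m y))) ≠ 0 := fun y =>
    isPoly_shift_ne_zero hφ.ne _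
  have hD0 : ∀ y, (Δ y * fun x => g (x + cvec (lat m y))) ≠ 0 := fun y =>
    analytic_mul_ne_zero (hΔp y).analytic (hgp y).analytic (hΔ0 y) (hg0 y)
  refine ⟨Y, fun y x => (W y x : (Fin (n + 1) → ℤ) →₀ ℂ) (y + kfull n m),
    fun y => Δ y * fun x => g (x + cvec (lat m y)), fun y _ => ⟨?_, (hΔp y).mul (hgp y), hD0 y⟩, ?_⟩
  · refine PolyFam.coeff hm hq.ne_zero (S := S) ?_ (fun x => mem_QIsupp.1 (hWS y x)) _
    exact PolyFam.aeval hm hq (polyFam_mulQ hf hφ.poly) _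
  have hgen1 : Generically h m fun x => ∀ y ∈ Y, (Δ y * fun x => g (x + cvec (lat m y))) x ≠ 0 :=
    generically_ball _ _ fun y _ => ⟨_, (hΔp y).mul (hgp y), hD0 y, fun x hx => hx⟩
  refine ((generically_res hm hq (insert 0 (tset m S1))).and
    ((generically_res hm hq Y).and hgen1)).mono
    fun x ⟨hx1', hx2, hx3⟩ => ⟨hx3, ?_⟩
  have hx1 : Res h m (tset m S1) x := fun p hp p' hp' => hx1' p (Finset.mem_insert_of_mem hp) p'
    (Finset.mem_insert_of_mem hp')
  have hkill := orbPoly_kill hm hq (sep_box B) (x := x) (Y := Y)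
    (fun p hp p' hp' => hx2 p (Finset.mem_insert_of_mem hp) p' (Finset.mem_insert_of_mem hp'))
    (fun y hy => Finset.mem_insert_of_mem (by
      obtain ⟨ℓ, hℓ⟩ := exists_genDir (n := n)
      have := sub_kv_mem_tset (m := m) (hy ℓ hℓ) ℓ
      rwa [add_sub_cancel_right] at this)) (hsupp x)
  -- Restoring the omitted factor gives the full polynomial, which kills the product; so `W y x` is
  -- an eigenvector or zero.
  have hWE : ∀ y ∈ Y, opE hm hq x (W y x) = orbitSum h m (x + cvec (lat m y)) • W y x := by
    intro y hy
    have h1 := aeval_X_sub_C_mul (opE hm hq x) (orbitSum h m (x + cvec (lat m y)))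
      (orbPoly h m x (Y.erase y)) (mulQ hf (φ x))
    rw [← orbPoly_insert x (Finset.notMem_erase y Y), Finset.insert_erase hy, hkill,
      zero_add] at h1
    exact h1.symm
  have hWeq : ∀ y ∈ Y, W y x = ((W y x : (Fin (n + 1) → ℤ) →₀ ℂ) (y + kfull n m) /
      g (x + cvec (lat m y))) • shQ y (φ (x + cvec (lat m y))) := by
    intro y hy
    have hgy : g (x + cvec (lat m y)) ≠ 0 := (mul_ne_zero_iff.1 (hx3 y hy)).2
    have hcoef : (shQ y (φ (x + cvec (lat m y))) : (Fin (n + 1) → ℤ) →₀ ℂ) (y + kfull n m) =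
        g (x + cvec (lat m y)) := by
      rw [shQ_coe, sh_apply, add_sub_cancel_left]
    have hshS : (shQ y (φ (x + cvec (lat m y))) : (Fin (n + 1) → ℤ) →₀ ℂ).support ⊆ S1 := by
      intro p hp
      have := sh_support (hφ.supp _) hp
      rw [← add_sub_cancel y p]
      exact Finset.mem_union_right _ (Finset.mem_image₂_of_mem hy this)
    have hyt : y ∈ tset m S1 := by
      have h1 : y + kv m (0 : Fin (n + 1) → ℝ) ∈ S1 :=
        Finset.mem_union_right _ (Finset.mem_image₂_of_mem hy (kv_mem_zon _))
      have := sub_kv_mem_tset (m := m) h1 0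
      rwa [add_sub_cancel_right] at this
    have h1 := eigen_eq_smul hm hq hx1 (c := W y x) (d := shQ y (φ (x + cvec (lat m y))))
      ((mem_QIsupp.1 (hWS y x)).trans Finset.subset_union_left) hshS hyt (hWE y hy)
      (by rw [opE_shQ, hφ.eigen, shQ_smul]) (by rw [hcoef]; exact hgy)
    rwa [hcoef] at h1
  have hlag := lagrange_decomposition (opE hm hq x) Y ⟨0, Finset.mem_insert_self _ _⟩
    (fun y => orbitSum h m (x + cvec (lat m y))) (fun p hp p' hp' hpp => hx2 p hp p' hp' hpp)
    (mulQ hf (φ x))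
  have hcoe := congrArg (QIs h m x).subtype hlag
  rw [map_sum] at hcoe
  simp only [map_smul, Submodule.subtype_apply] at hcoe
  change _ = conv cf (φ x : (Fin (n + 1) → ℤ) →₀ ℂ) at hcoe
  rw [← hcoe]
  refine Finset.sum_congr rfl fun y hy => ?_
  change (∏ y' ∈ Y.erase y, _)⁻¹ • (W y x : (Fin (n + 1) → ℤ) →₀ ℂ) = _
  have h2 := congrArg (QIs h m x).subtype (hWeq y hy)
  simp only [map_smul, Submodule.subtype_apply, shQ_coe] at h2
  refine (congrArg _ h2).trans ?_
  rw [smul_smul]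
  congr 1
  simp only [hΔ, Pi.mul_apply, Finset.prod_apply]
  rw [inv_mul_eq_div, div_div, mul_comm]

/-! ### The dual difference equation -/

/-- Only the exponentials with index `i` or `j` are affected. If both are among the first `n`, the
condition is symmetric; otherwise `s = 1` and it reduces to `wt_mul_qnum`. -/
lemma tq_orbitSum (hm : 1 ≤ m) (hq : NotRoot h) :
    TQ h m (0 : Fin (n + 1) → ℂ) (ev h m (orbCoef h m 0)) := by
  intro i j hij s hs1 hs z hz
  have hev : ∀ w : Fin (n + 1) → ℂ, ev h m (orbCoef h m 0) w = orbitSum h m w := by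
    intro w
    rw [ev_orbCoef, lat_zero, cvec_zero, add_zero]
  simp only [zeta, Pi.zero_apply, mul_zero, qpow_zero, one_pow, one_mul]
  rw [hev, hev, orbitSum_eq, orbitSum_eq, ← Finset.add_sum_erase _ _ (Finset.mem_univ i),
    ← Finset.add_sum_erase _ _ (Finset.mem_erase.2 ⟨hij.ne', Finset.mem_univ j⟩),
    ← Finset.add_sum_erase (a := i) Finset.univ _ (Finset.mem_univ i),
    ← Finset.add_sum_erase (a := j) (Finset.univ.erase i) (fun k => wt h m k *
      qpow h (2 * zeta m k (z + (s : ℂ) • eps m j))) (Finset.mem_erase.2 ⟨hij.ne', Finset.mem_univ j⟩)]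
  have hrest : ∑ k ∈ (Finset.univ.erase i).erase j, wt h m k *
      qpow h (2 * zeta m k (z + (s : ℂ) • eps m i)) = ∑ k ∈ (Finset.univ.erase i).erase j,
      wt h m k * qpow h (2 * zeta m k (z + (s : ℂ) • eps m j)) := by
    refine Finset.sum_congr rfl fun k hk => ?_
    rw [Finset.mem_erase, Finset.mem_erase] at hk
    rw [zeta_shift_of_ne hk.2.1, zeta_shift_of_ne hk.1]
  rw [hrest, zeta_shift_self, zeta_shift_self, zeta_shift_of_ne hij.ne, zeta_shift_of_ne hij.ne', hz]
  have hi : i ≠ Fin.last n := (hij.trans_le (Fin.le_last _)).ne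
  by_cases hj : j = Fin.last n
  · subst hj
    rw [mlt_last] at hs
    obtain rfl : s = 1 := by omega
    have h1 := wt_mul_qnum hm hq hij
    rw [mlt_last, nsq_of_ne hi, nsq_last, qnum, qnum] at h1
    rw [nsq_of_ne hi, nsq_last, off, nsq_of_ne hi, nsq_last]
    have e1 : 2 * (zeta m (Fin.last n) z + ((m : ℂ) - (1 : ℕ)) / 2 + ((1 : ℕ) : ℂ) * (1 : ℕ)) =
      2 * zeta m (Fin.last n) z + m + ((1 : ℕ) : ℂ) * (1 : ℕ) := by push_cast; ring
    have e2 : 2 * (zeta m (Fin.last n) z + ((m : ℂ) - (1 : ℕ)) / 2) =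
      2 * zeta m (Fin.last n) z + m + -(((1 : ℕ) : ℂ) * (1 : ℕ)) := by push_cast; ring
    have e3 : 2 * (zeta m (Fin.last n) z + ((1 : ℕ) : ℂ) * m) =
      2 * zeta m (Fin.last n) z + m + ((1 : ℕ) : ℂ) * m := by push_cast; ring
    have e4 : qpow h (2 * zeta m (Fin.last n) z) =
      qpow h (2 * zeta m (Fin.last n) z + m) * qpow h (-(((1 : ℕ) : ℂ) * m)) := by
        rw [← qpow_add]; congr 1; push_cast; ring
    rw [e1, e2, e3, e4, qpow_add _ (_ + _), qpow_add _ (_ + _), qpow_add _ (_ + _)]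
    linear_combination qpow h (2 * zeta m (Fin.last n) z + m) * h1
  · rw [wt, wt, if_neg hi, if_neg hj, nsq_of_ne hi, nsq_of_ne hj, off, nsq_of_ne hi, nsq_of_ne hj]
    simp only [sub_self, zero_div, add_zero]
    ring

/-! ### Normalizing factors under a shift by a basis vector. -/

lemma prod_posRoot (F : Fin (n + 1) → Fin (n + 1) → ℂ) :
    ∏ α : PosRoot n, F α.1.1 α.1.2 = ∏ a, ∏ b, if a < b then F a b else 1 := by
  rw [← Finset.prod_product', Finset.univ_product_univ, ← Finset.prod_filter]
  exact (Finset.prod_subtype _ (by simp) fun x : Fin (n + 1) × Fin (n + 1) => F x.1 x.2).symm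

lemma prod_posRoot_single (i : Fin (n + 1)) (f : Fin (n + 1) → ℂ) :
    ∏ α : PosRoot n, (if α.1.1 = i then f α.1.2 else if α.1.2 = i then f α.1.1 else 1) =
      ∏ j ∈ Finset.univ.erase i, f j := by
  rw [prod_posRoot fun a b => if a = i then f b else if b = i then f a else 1,
    ← Finset.mul_prod_erase _ _ (Finset.mem_univ i)]
  have h1 : ∏ a ∈ Finset.univ.erase i, ∏ b, (if a < b then
      (if a = i then f b else if b = i then f a else 1) else 1) =
      ∏ a ∈ Finset.univ.erase i, if a < i then f a else 1 := by
    refine Finset.prod_congr rfl fun a ha => ?_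
    have hai := Finset.ne_of_mem_erase ha
    rw [Finset.prod_eq_single i]
    · simp [hai]
    · intro b _ hb; simp [hai, hb]
    · simp
  rw [h1, ← Finset.mul_prod_erase (a := i) Finset.univ (fun b => if i < b then
    (if i = i then f b else if b = i then f i else 1) else 1) (Finset.mem_univ i),
    if_neg (lt_irrefl i), one_mul, ← Finset.prod_mul_distrib]
  refine Finset.prod_congr rfl fun j hj => ?_
  rcases lt_or_gt_of_ne (Finset.ne_of_mem_erase hj) with hh | hh
  · simp [hh, hh.not_gt]
  · simp [hh, hh.not_gt]

lemma prod_Icc_shift (f : ℕ → ℂ) (M : ℕ) :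
    f 0 * ∏ s ∈ Finset.Icc 1 M, f s = f M * ∏ s ∈ Finset.Icc 1 M, f (s - 1) := by
  induction M with
  | zero => simp
  | succ M ih =>
    rw [Finset.prod_Icc_succ_top (by omega), Finset.prod_Icc_succ_top (by omega), ← mul_assoc, ih,
      Nat.add_sub_cancel]
    ring

/-- A shift by `ε_i` moves `ζ_i` by `nsq i`. Among the first `n` indices this is one step of the
product, which telescopes to the quotient of its end factors; if one index is last there is a single
factor. -/
lemma pair_factor (i j : Fin (n + 1)) {x : Fin (n + 1) → ℂ}
    (hx : qnum h (zeta m i x - zeta m j x - off m i j) ≠ 0) :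
    ∏ s ∈ Finset.Icc 1 (mlt m i j),
      qnum h (s * ((nsq m i + nsq m j) / 2) - (zeta m i x - zeta m j x)) =
    phi h m i j x * ∏ s ∈ Finset.Icc 1 (mlt m i j),
      qnum h (s * ((nsq m i + nsq m j) / 2) - (zeta m i x - zeta m j x + nsq m i)) := by
  rw [phi, div_mul_eq_mul_div, eq_div_iff hx]
  set D := zeta m i x - zeta m j x with hD
  by_cases hl : i = Fin.last n ∨ j = Fin.last n
  · have hM : mlt m i j = 1 := if_pos hl
    rw [hM]
    simp only [Finset.Icc_self, Finset.prod_singleton, off, Nat.cast_one, one_mul]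
    have e1 : ((nsq m i + nsq m j) / 2 : ℂ) - D = -(D - (nsq m j - nsq m i) / 2 - nsq m i) := by ring
    have e2 : ((nsq m i + nsq m j) / 2 : ℂ) - (D + nsq m i) = -(D - (nsq m j - nsq m i) / 2) := by
      ring
    rw [e1, e2, qnum_neg, qnum_neg]
    ring
  · rw [not_or] at hl
    rw [mlt_of_ne hl.1 hl.2, nsq_of_ne hl.1, nsq_of_ne hl.2, off, nsq_of_ne hl.1, nsq_of_ne hl.2]
    have h1 := prod_Icc_shift (fun s => qnum h ((s : ℂ) - D)) m
    have e1 : ∏ s ∈ Finset.Icc 1 m, qnum h (s * ((((1 : ℕ) : ℂ) + (1 : ℕ)) / 2) - D) =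
        ∏ s ∈ Finset.Icc 1 m, qnum h ((s : ℂ) - D) :=
      Finset.prod_congr rfl fun s _ => by congr 1; push_cast; ring
    have e2 : ∏ s ∈ Finset.Icc 1 m, qnum h (s * ((((1 : ℕ) : ℂ) + (1 : ℕ)) / 2) - (D + (1 : ℕ))) =
        ∏ s ∈ Finset.Icc 1 m, qnum h (((s - 1 : ℕ) : ℂ) - D) :=
      Finset.prod_congr rfl fun s hs => by
        rw [Nat.cast_sub (Finset.mem_Icc.1 hs).1]; congr 1; push_cast; ring
    have e3 : D - (((1 : ℕ) : ℂ) - (1 : ℕ)) / 2 = -(((0 : ℕ) : ℂ) - D) := by push_cast; ring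
    have e4 : D - (((1 : ℕ) : ℂ) - (1 : ℕ)) / 2 - (m : ℂ) * (1 : ℕ) = -((m : ℂ) - D) := by
      push_cast; ring
    rw [e1, e2, e4, e3, qnum_neg, qnum_neg]
    linear_combination -h1

/-- When `i` comes first in the direction `ℓ`, every root at `i` enters `nrm` oriented away from
`i`, so the shift produces exactly the factors `phi i j`. Here the coefficients of the operator
reappear as functions of `x`. -/
lemma wt_mul_nrm {ℓ : Fin (n + 1) → ℝ} {i : Fin (n + 1)} (hℓ : ∀ j, j ≠ i → ℓ j < ℓ i)
    {x : Fin (n + 1) → ℂ} (hx : OffPoles h m x) :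
    wt h m i * nrm h m ℓ x = aco h m i x * nrm h m ℓ (x + eps m i) := by
  rw [aco, mul_assoc, ← prod_posRoot_single i fun j => phi h m i j x, nrm, nrm,
    ← Finset.prod_mul_distrib]
  congr 1
  refine Finset.prod_congr rfl fun α _ => ?_
  have hne : α.1.1 ≠ α.1.2 := ne_of_lt α.2
  have hz : ∀ k, zeta m k (x + eps m i) = zeta m k x + if k = i then (nsq m i : ℂ) else 0 := by
    intro k
    have := zeta_shift (m := m) k i x 1
    rw [one_smul, one_mul] at this
    rw [this]
    split_ifs with hk
    · rw [hk]
    · rfl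
  rw [nrm1, nrm1]
  by_cases h1 : α.1.1 = i
  · have h2 : α.1.2 ≠ i := fun e => hne (h1.trans e.symm)
    rw [if_pos h1, sg, if_pos (h1 ▸ hℓ _ h2)]
    rw [h1] at hne ⊢
    simp only [hz, if_true, if_neg h2, Int.cast_one, one_mul, add_zero]
    rw [pair_factor i α.1.2 ((offPoles_iff _).1 hx _ _ hne)]
    congr 1
    refine Finset.prod_congr rfl fun s _ => ?_
    congr 1; ring
  · rw [if_neg h1]
    by_cases h2 : α.1.2 = i
    · rw [if_pos h2, sg, if_neg (h2 ▸ (hℓ _ h1).not_gt)]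
      rw [h2] at hne ⊢
      simp only [hz, if_true, if_neg h1, add_zero]
      have h3 := pair_factor i α.1.1 ((offPoles_iff _).1 hx _ _ hne.symm)
      rw [mlt_comm] at h3
      refine (Finset.prod_congr rfl fun s _ => ?_).trans
        (h3.trans (congrArg _ (Finset.prod_congr rfl fun s _ => ?_)))
      · congr 1; push_cast; ring
      · congr 1; push_cast; ring
    · rw [if_neg h2, one_mul]
      simp only [hz, if_neg h1, if_neg h2, add_zero]

lemma exists_genDir_first (i : Fin (n + 1)) :
    ∃ ℓ : Fin (n + 1) → ℝ, GenDir ℓ ∧ ∀ j, j ≠ i → ℓ j < ℓ i := by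
  have h1 : IsOpen {ℓ : Fin (n + 1) → ℝ | ∀ j, j ≠ i → ℓ j < ℓ i} := by
    simp only [Set.ofPred_forall]
    exact isOpen_iInter_of_finite fun j => isOpen_iInter_of_finite fun _ =>
      isOpen_lt (continuous_apply _) (continuous_apply _)
  obtain ⟨ℓ, hℓ1, hℓ2⟩ := dense_genDir.inter_open_nonempty _ h1 ⟨Pi.single i 1, fun j hj => by
    simp [hj]⟩
  exact ⟨ℓ, hℓ2, hℓ1⟩

/-- Lattice points of the standard simplex. -/
lemma eq_single_of_dot {y : Fin (n + 1) → ℤ}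
    (hy : ∀ ℓ, GenDir ℓ → ∃ i, dot y ℓ ≤ ℓ i) : ∃ i, y = Pi.single i 1 := by
  have hall : ∀ ℓ : Fin (n + 1) → ℝ, ∃ i, dot y ℓ ≤ ℓ i := by
    have hc : IsClosed {ℓ : Fin (n + 1) → ℝ | ∃ i, dot y ℓ ≤ ℓ i} := by
      rw [show {ℓ : Fin (n + 1) → ℝ | ∃ i, dot y ℓ ≤ ℓ i} = ⋃ i, {ℓ | dot y ℓ ≤ ℓ i} by
        ext; simp]
      exact isClosed_iUnion_of_finite fun i => isClosed_le (continuous_dot y) (continuous_apply i)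
    have : (Set.univ : Set (Fin (n + 1) → ℝ)) ⊆ {ℓ | ∃ i, dot y ℓ ≤ ℓ i} := by
      rw [← dense_genDir.closure_eq]
      exact closure_minimal hy hc
    exact fun ℓ => this (Set.mem_univ ℓ)
  -- The directions `1` and `-1` give coordinate sum `1`, and the directions `-e_j` give nonnegative
  -- coordinates; integrality leaves only unit vectors.
  obtain ⟨_, h1⟩ := hall fun _ => 1
  obtain ⟨_, h2⟩ := hall fun _ => -1
  simp only [dot, mul_one, mul_neg, Finset.sum_neg_distrib] at h1 h2
  have hsum : ∑ i, y i = 1 := by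
    have : (∑ i, (y i : ℝ)) = 1 := by linarith
    exact_mod_cast this
  obtain ⟨i, -, hi⟩ : ∃ i ∈ Finset.univ, 0 < y i := by
    by_contra! hh
    have := Finset.sum_nonpos hh
    omega
  have hj : ∀ j ∈ Finset.univ.erase i, 0 ≤ y j := by
    intro j _
    obtain ⟨k, hk⟩ := hall (Pi.single j (-1))
    rw [dot_single] at hk
    have : (Pi.single j (-1) : Fin (n + 1) → ℝ) k ≤ 0 := by
      rw [Pi.single_apply]; split_ifs <;> norm_num
    have : (0 : ℝ) ≤ y j := by linarith
    exact_mod_cast this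
  rw [← Finset.add_sum_erase _ _ (Finset.mem_univ i)] at hsum
  have h3 := Finset.sum_nonneg hj
  have h4 := (Finset.sum_eq_zero_iff_of_nonneg hj).1 (by omega)
  refine ⟨i, funext fun j => ?_⟩
  by_cases hji : j = i
  · subst hji
    rw [Pi.single_eq_same]
    omega
  · rw [Pi.single_eq_of_ne hji, h4 j (Finset.mem_erase.2 ⟨hji, Finset.mem_univ _⟩)]

lemma conv_orbCoef_apply (c : (Fin (n + 1) → ℤ) →₀ ℂ) (hm : 1 ≤ m) (h0 : h ≠ 0) (p : Fin (n + 1) → ℤ) :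
    conv (orbCoef h m 0) c p = ∑ i, wt h m i * c (p - Pi.single i 1) := by
  have h1 : conv (orbCoef h m 0) c = ∑ i, wt h m i • sh (Pi.single i 1) c := by
    refine ev_injective hm h0 (funext fun z => ?_)
    rw [ev_conv, ev_orbCoef, lat_zero, cvec_zero, add_zero, orbitSum_eq, map_sum, Finset.sum_apply,
      Finset.sum_mul]
    refine Finset.sum_congr rfl fun i _ => ?_
    rw [map_smul, Pi.smul_apply, ev_sh, mono_single, smul_eq_mul]
    ring
  rw [h1, Finsupp.finsetSum_apply]
  exact Finset.sum_congr rfl fun i _ => by rw [Finsupp.smul_apply, sh_apply, smul_eq_mul]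

lemma apply_eq_zero_of_dot {c : (Fin (n + 1) → ℤ) →₀ ℂ} {M : PosRoot n → ℕ}
    (hc : c.support ⊆ zon M) {p : Fin (n + 1) → ℤ} {ℓ : Fin (n + 1) → ℝ}
    (hp : zsupp M ℓ < dot p ℓ) : c p = 0 :=
  Finsupp.notMem_support_iff.1 fun hh => (dot_le_zsupp (hc hh) ℓ).not_gt hp

lemma dot_e (i : Fin (n + 1)) (ℓ : Fin (n + 1) → ℝ) : dot (Pi.single i 1) ℓ = ℓ i := by
  simp [dot, Pi.single_apply]

/-- Extreme coefficients of sums of translates. -/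
lemma sum_sh_top {Y : Finset (Fin (n + 1) → ℤ)} {d : (Fin (n + 1) → ℤ) → ℂ}
    {c : (Fin (n + 1) → ℤ) → (Fin (n + 1) → ℤ) →₀ ℂ} (hc : ∀ y, (c y).support ⊆ zon (kmul n m 1))
    {ℓ : Fin (n + 1) → ℝ} (hℓ : GenDir ℓ) {y0 : Fin (n + 1) → ℤ} (hy0 : y0 ∈ Y)
    (hmax : ∀ y ∈ Y, d y ≠ 0 → dot y ℓ ≤ dot y0 ℓ) :
    (∑ y ∈ Y, d y • sh y (c y)) (y0 + kv m ℓ) = d y0 * c y0 (kv m ℓ) := by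
  rw [Finsupp.finsetSum_apply, Finset.sum_eq_single y0]
  · rw [Finsupp.smul_apply, sh_apply, add_sub_cancel_left, smul_eq_mul]
  · intro y hy hne
    by_cases hd : d y = 0
    · rw [hd, zero_smul, Finsupp.zero_apply]
    rw [Finsupp.smul_apply, sh_apply, smul_eq_mul, apply_eq_zero_of_dot (hc y) (ℓ := ℓ), mul_zero]
    rw [dot_sub, dot_add, dot_kv]
    have := lt_of_le_of_ne (hmax y hy hd) fun e => hne (hℓ.inj e)
    linarith
  · exact fun hh => absurd hy0 hh

/-- The extreme coefficients of `φ x` do not vanish. -/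
lemma EigFam.generically_ne {hm : 1 ≤ m} {hq : NotRoot h} {φ : ∀ x : Fin (n + 1) → ℂ, QIs h m x}
    (hφ : EigFam hm hq φ) : Generically h m fun x => ∀ ℓ : Fin (n + 1) → ℝ,
      Function.Injective ℓ → (φ x : (Fin (n + 1) → ℤ) →₀ ℂ) (kv m ℓ) ≠ 0 := by
  refine ((generically_nrmNeZero hm hq.ne_zero).and ⟨_, hφ.coeff (kfull n m), hφ.ne,
    fun x hx => hx⟩).mono fun x ⟨hx1, hx2⟩ ℓ hℓ hh => ?_
  have h1 := chamber hm hq hx1 (φ x).2 (hφ.supp x) hℓ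
  rw [hh, zero_mul] at h1
  exact mul_ne_zero hx2 (hx1.nrm ℓ) h1.symm

/-- In each separating direction the extreme shift `y0` contributes the exponent `y0 + kv ℓ`, which
must occur in `𝔪 · φ x`, whose exponents are those of `φ x` plus a basis vector. So all shifts lie
in the simplex of the basis vectors. -/
theorem orbitSum_expansion (hm : 1 ≤ m) (hq : NotRoot h) {φ : ∀ x : Fin (n + 1) → ℂ, QIs h m x}
    (hφ : EigFam hm hq φ) : Generically h m fun x => ∃ d : Fin (n + 1) → ℂ,
      conv (orbCoef h m 0) (φ x : (Fin (n + 1) → ℤ) →₀ ℂ) =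
        ∑ i, d i • sh (Pi.single i 1) (φ (x + eps m i) : (Fin (n + 1) → ℤ) →₀ ℂ) := by
  classical
  obtain ⟨Y, N, D, -, hgen⟩ := expansion hm hq hφ (tq_orbitSum hm hq)
  refine (hgen.and (generically_ball Y (fun y x => ∀ ℓ : Fin (n + 1) → ℝ, Function.Injective ℓ →
    (φ (x + cvec (lat m y)) : (Fin (n + 1) → ℤ) →₀ ℂ) (kv m ℓ) ≠ 0)
    fun y _ => hφ.generically_ne.shift (cvec (lat m y)))).mono fun x ⟨⟨_, hx1⟩, hx2⟩ => ?_
  set d : (Fin (n + 1) → ℤ) → ℂ := fun y => N y x / D y x with hd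
  have hsimp : ∀ y ∈ Y, d y ≠ 0 → ∃ i, y = Pi.single i 1 := by
    intro y hy hdy
    refine eq_single_of_dot fun ℓ hℓ => ?_
    obtain ⟨y0, hy0, hmax⟩ := Finset.exists_max_image (Y.filter fun y => d y ≠ 0)
      (fun y => dot y ℓ) ⟨y, Finset.mem_filter.2 ⟨hy, hdy⟩⟩
    rw [Finset.mem_filter] at hy0
    have h1 := sum_sh_top (m := m) (c := fun y => (φ (x + cvec (lat m y))).1) (d := d)
      (fun y => hφ.supp _) hℓ hy0.1 fun y' hy' hd' => hmax y' (Finset.mem_filter.2 ⟨hy', hd'⟩)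
    rw [← hx1, conv_orbCoef_apply _ hm hq.ne_zero] at h1
    have h2 : ∃ i, wt h m i * (φ x : (Fin (n + 1) → ℤ) →₀ ℂ) (y0 + kv m ℓ - Pi.single i 1) ≠ 0 := by
      by_contra! hh
      rw [Finset.sum_eq_zero fun i _ => hh i] at h1
      exact mul_ne_zero hy0.2 (hx2 y0 hy0.1 ℓ hℓ.injective) h1.symm
    obtain ⟨i, hi⟩ := h2
    have h3 := dot_le_zsupp (hφ.supp x (Finsupp.mem_support_iff.2 (mul_ne_zero_iff.1 hi).2)) ℓ
    rw [dot_sub, dot_add, dot_kv, dot_e] at h3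
    have h4 := hmax y (Finset.mem_filter.2 ⟨hy, hdy⟩)
    exact ⟨i, by linarith⟩
  have heps : ∀ i : Fin (n + 1), x + cvec (lat m (Pi.single i 1)) = x + eps m i := fun i => by
    rw [lat_single, cvec_basisVec]
  have hinj : Function.Injective fun i : Fin (n + 1) => (Pi.single i 1 : Fin (n + 1) → ℤ) := by
    intro i j hij
    by_contra hne
    have := congrFun hij i
    simp [hne] at this
  refine ⟨fun i => if Pi.single i 1 ∈ Y then d (Pi.single i 1) else 0, ?_⟩
  rw [hx1, ← Finset.sum_filter_ne_zero]
  have h5 : ∀ y ∈ Y.filter fun y => d y • sh y (φ (x + cvec (lat m y)) :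
      (Fin (n + 1) → ℤ) →₀ ℂ) ≠ 0, y ∈ Finset.univ.image fun i : Fin (n + 1) =>
        (Pi.single i 1 : Fin (n + 1) → ℤ) := by
    intro y hy
    rw [Finset.mem_filter] at hy
    obtain ⟨i, rfl⟩ := hsimp y hy.1 fun hh => hy.2 (by rw [hh, zero_smul])
    exact Finset.mem_image_of_mem _ (Finset.mem_univ _)
  have h6 : ∑ i, (if Pi.single i 1 ∈ Y then d (Pi.single i 1) else 0) •
      sh (Pi.single i 1) (φ (x + eps m i) : (Fin (n + 1) → ℤ) →₀ ℂ) =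
      ∑ y ∈ Finset.univ.image fun i : Fin (n + 1) => (Pi.single i 1 : Fin (n + 1) → ℤ),
        (if y ∈ Y then d y else 0) • sh y (φ (x + cvec (lat m y)) : (Fin (n + 1) → ℤ) →₀ ℂ) := by
    rw [Finset.sum_image hinj.injOn]
    exact Finset.sum_congr rfl fun i _ => by rw [heps]
  rw [h6]
  refine Finset.sum_subset_zero_on_sdiff h5 (fun y hy => ?_) fun y hy => ?_
  · rw [Finset.mem_sdiff, Finset.mem_filter, not_and, not_not] at hy
    split_ifs with hyY
    · exact hy.2 hyY
    · rw [zero_smul]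
  · rw [if_pos (Finset.mem_filter.1 hy).1]

lemma generically_offPoles (hm : 1 ≤ m) (h0 : h ≠ 0) :
    Generically h m fun x : Fin (n + 1) → ℂ => OffPoles h m x := by
  refine (generically_ball (Finset.univ : Finset (PosRoot n))
    (fun e x => lin h m e.1.1 e.1.2 x ≠ 0) fun e _ => ⟨_, isPoly_lin _ _,
      lin_ne_zero_fun hm h0 e.2.ne, fun x hx => hx⟩).mono fun x hx => ?_
  exact (offPoles_iff_lt _).2 fun e => (lin_ne_zero_iff _ _ _).1 (hx e (Finset.mem_univ _))

/-- In a direction where `i` is first, the coefficient at `e_i + kv ℓ` receives one term on each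
side, which determines `d i`. The relations `chamber` at `x` and at `x + ε_i`, together with
`wt_mul_nrm`, turn the ratio of vertex coefficients into `aco i x`. -/
theorem dual_equation_coeff (hm : 1 ≤ m) (hq : NotRoot h)
    {φ : ∀ x : Fin (n + 1) → ℂ, QIs h m x} (hφ : EigFam hm hq φ) : Generically h m fun x =>
      (normFactor h m x / (φ x).1 (kfull n m)) • conv (orbCoef h m 0) (φ x).1 =
        ∑ i, (aco h m i x * (normFactor h m (x + eps m i) / (φ (x + eps m i)).1 (kfull n m))) •
          sh (Pi.single i 1) (φ (x + eps m i)).1 := by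
  have hg := hφ.generically_ne.and (generically_nrmNeZero (n := n) hm hq.ne_zero)
  have hoff := generically_offPoles (n := n) (h := h) hm hq.ne_zero
  refine ((orbitSum_expansion hm hq hφ).and (hg.and (hoff.and (generically_ball Finset.univ _
    fun i _ => hg.shift (eps m i))))).mono fun x ⟨⟨d, hd⟩, ⟨hx1, hx2⟩, hx3, hx4⟩ => ?_
  rw [hd, Finset.smul_sum]
  refine Finset.sum_congr rfl fun i _ => ?_
  rw [smul_smul]
  congr 1
  obtain ⟨ℓ, hℓ, hfirst⟩ := exists_genDir_first i
  obtain ⟨hx5, hx6⟩ := hx4 i (Finset.mem_univ _)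
  have hkf : kv m (lperm (1 : Equiv.Perm (Fin (n + 1)))) = kfull n m := kv_decr
  have hinj1 := lperm_injective (1 : Equiv.Perm (Fin (n + 1)))
  have g1 : (φ x).1 (kfull n m) ≠ 0 := hkf ▸ hx1 _ hinj1
  have g2 : (φ (x + eps m i)).1 (kfull n m) ≠ 0 := hkf ▸ hx5 _ hinj1
  have e1 := congrArg (fun c => c (Pi.single i 1 + kv m ℓ)) hd
  rw [conv_orbCoef_apply _ hm hq.ne_zero, Finset.sum_eq_single i, add_sub_cancel_left,
    Finsupp.finsetSum_apply, Finset.sum_eq_single i, Finsupp.smul_apply, sh_apply,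
    add_sub_cancel_left, smul_eq_mul] at e1
  rotate_left
  · intro j _ hj
    rw [Finsupp.smul_apply, sh_apply, smul_eq_mul, apply_eq_zero_of_dot (hφ.supp _) (ℓ := ℓ),
      mul_zero]
    rw [dot_sub, dot_add, dot_kv, dot_e, dot_e]
    linarith [hfirst j hj]
  · simp
  · intro j _ hj
    rw [apply_eq_zero_of_dot (hφ.supp _) (ℓ := ℓ), mul_zero]
    rw [dot_sub, dot_add, dot_kv, dot_e, dot_e]
    linarith [hfirst j hj]
  · simp
  have c1 := chamber hm hq hx2 (φ x).2 (hφ.supp x) hℓ.injective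
  have c2 := chamber hm hq hx6 (φ (x + eps m i)).2 (hφ.supp _) hℓ.injective
  have w := wt_mul_nrm hfirst hx3
  have n1 := hx2.normFactor
  have n2 := hx6.normFactor
  have n3 := hx6.nrm ℓ
  rw [← mul_div_assoc, div_mul_eq_mul_div, div_eq_div_iff g1 g2]
  refine mul_right_cancel₀ n3 ?_
  linear_combination d i * normFactor h m x * (-c2) - e1 * normFactor h m x *
    normFactor h m (x + eps m i) + wt h m i * normFactor h m (x + eps m i) * c1 +
    normFactor h m (x + eps m i) * (φ x).1 (kfull n m) * w

/-- The renormalized eigenfunction. -/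
def renorm (φ : ∀ x : Fin (n + 1) → ℂ, QIs h m x) (x z : Fin (n + 1) → ℂ) : ℂ :=
  normFactor h m x / (φ x).1 (kfull n m) * tw h (x - cvec (rho n m)) (ev h m (φ x).1) z

theorem dual_equation (hm : 1 ≤ m) (hq : NotRoot h)
    {φ : ∀ x : Fin (n + 1) → ℂ, QIs h m x} (hφ : EigFam hm hq φ) : Generically h m fun x => ∀ z,
      ∑ i, aco h m i x * renorm φ (x + eps m i) z = orbitSum h m z * renorm φ x z := by
  refine (dual_equation_coeff hm hq hφ).mono fun x hx z => ?_
  have h1 := congrArg (fun c => ev h m c z) hx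
  simp only [map_smul, map_sum, Pi.smul_apply, Finset.sum_apply, smul_eq_mul, ev_conv, ev_sh,
    mono_single, ev_orbCoef, lat_zero, cvec_zero, add_zero] at h1
  have h2 : orbitSum h m z * renorm φ x z = qpow h (2 * pair (x - cvec (rho n m)) z) *
      (normFactor h m x / (φ x).1 (kfull n m) * (orbitSum h m z * ev h m (φ x).1 z)) := by
    rw [renorm, tw]; ring
  rw [h2, h1, Finset.mul_sum]
  refine Finset.sum_congr rfl fun i _ => ?_
  have h3 : qpow h (2 * pair (x + eps m i - cvec (rho n m)) z) =
      qpow h (2 * pair (x - cvec (rho n m)) z) * qpow h (2 * zeta m i z) := by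
    rw [← qpow_add, add_sub_right_comm, pair_add, pair_comm (eps m i), pair_eps, mul_add]
  rw [renorm, tw, h3]
  ring

lemma psiQ_zero_ne (hm : 1 ≤ m) (hq : NotRoot h) {x : Fin (n + 1) → ℂ}
    (hx : Res h m (zon (kmul n m 1)) x) : (psiQ hm hq x).1 0 ≠ 0 := by
  rw [psiQ_zero hm hq x, shiftSet_eq hm, Finset.prod_image (lat_injective hm).injOn]
  refine Finset.prod_ne_zero_iff.2 fun y hy => ?_
  rw [Finset.mem_erase] at hy
  refine sub_ne_zero.2 fun e => hy.1 (hx _ hy.2 _ (zero_mem_zon _) ?_)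
  rw [lat_zero, cvec_zero, add_zero, e]

/-- If the top coefficient vanished identically, the eigenvector would vanish for generic `x` by
`eigen_eq_zero`, whereas its constant coefficient is generically nonzero. -/
lemma eigFam_psiQ (hm : 1 ≤ m) (hq : NotRoot h) : EigFam hm hq (psiQ (n := n) hm hq) where
  poly := polyFam_psiQ hm hq
  supp := psiQ_support hm hq
  eigen := opE_psiQ hm hq
  ne := by
    intro hh
    obtain ⟨x, hx1, hx2⟩ := ((generically_res (n := n) hm hq (tset m (zon (kmul n m 1)))).and
      (generically_res hm hq (zon (kmul n m 1)))).exists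
    have h1 : psiQ hm hq x = 0 := eigen_eq_zero hm hq hx1 (psiQ_support hm hq x)
      (zero_mem_tset le_rfl) (by rw [lat_zero, cvec_zero, add_zero, opE_psiQ])
      (by rw [zero_add]; exact congrFun hh x)
    exact psiQ_zero_ne hm hq hx2 (by rw [h1, ZeroMemClass.coe_zero, Finsupp.zero_apply])

/-! ### Bispectral symmetry -/

/-- The normalizing factor, multiplied by `q^{2(ρ,x)}`: a polynomial. -/
def pnorm (h : ℂ) (m : ℕ) (x : Fin (n + 1) → ℂ) : ℂ :=
  qpow h (2 * pair (cvec (rho n m)) x) * normFactor h m x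

lemma pnorm_eq (x : Fin (n + 1) → ℂ) : pnorm h m x =
    ∏ α : PosRoot n, ∏ s ∈ Finset.Icc 1 (mlt m α.1.1 α.1.2),
      (qpow h (s * ((nsq m α.1.1 + nsq m α.1.2) / 2)) -
        qpow h (-(s * ((nsq m α.1.1 + nsq m α.1.2) / 2))) * mono h m (sroot α) x) := by
  rw [pnorm, normFactor_eq, two_mul_pair_rho, qpow_sum, ← Finset.prod_mul_distrib]
  refine Finset.prod_congr rfl fun α _ => ?_
  have := qpow_mul_nrm1 (h := h) (m := m) α 1 x
  rw [one_zsmul, Int.cast_one, one_mul] at this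
  rw [← this, qpow_nat_mul]

lemma isPoly_pnorm : IsPoly h m (pnorm h m : (Fin (n + 1) → ℂ) → ℂ) := by
  have h1 : (pnorm h m : (Fin (n + 1) → ℂ) → ℂ) = ∏ α : PosRoot n,
      ∏ s ∈ Finset.Icc 1 (mlt m α.1.1 α.1.2), fun x =>
      (qpow h (s * ((nsq m α.1.1 + nsq m α.1.2) / 2)) -
        qpow h (-(s * ((nsq m α.1.1 + nsq m α.1.2) / 2))) * mono h m (sroot α) x) := by
    funext x
    rw [pnorm_eq, Finset.prod_apply]
    exact Finset.prod_congr rfl fun α _ => by rw [Finset.prod_apply]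
  rw [h1]
  exact isPoly_prod _ _ fun α _ => isPoly_prod _ _ fun s _ =>
    (isPoly_const h m _).sub ((isPoly_mono _).const_mul _)

lemma mono_pt_zero (hm : 1 ≤ m) (p : Fin (n + 1) → ℤ) :
    mono h m p (pt m (0 : Fin (n + 1) → ℂ)) = 1 := by
  simp [mono, zeta_pt hm, qpow_zero]

/-- Along a decreasing direction each factor `A - B q^{2(α,x)}` contributes the nonzero number `-B`.
This is the diagonal entry that later fixes the symmetry constant. -/
lemma pnorm_top (hm : 1 ≤ m) (h0 : h ≠ 0) {c : (Fin (n + 1) → ℤ) →₀ ℂ}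
    (hc : c.support ⊆ zon (kmul n m 1)) (hcp : ev h m c = pnorm h m) : c (kfull n m) ≠ 0 := by
  obtain ⟨ℓ, hℓ, hd⟩ := genDir_decr (n := n)
  have hdot : dot (kfull n m) ℓ = ∑ α : PosRoot n, (mlt m α.1.1 α.1.2 : ℝ) * dot (sroot α) ℓ := by
    rw [kfull, dot_sum]
    exact Finset.sum_congr rfl fun α _ => by rw [dot_zsmul]; norm_cast
  have h1 := tendsto_ev_gen hm h0 c 0 hℓ (kfull n m) fun p hp => by
    rw [← kv_of_lt hd, dot_kv]
    exact dot_le_zsupp (hc hp) ℓ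
  rw [mono_pt_zero hm, mul_one, hcp] at h1
  have h2 : Tendsto (fun t : ℝ => pnorm h m (ray h m 0 ℓ t) *
      (Real.exp (2 * t * (-dot (kfull n m) ℓ)) : ℝ)) atTop
      (𝓝 (∏ α : PosRoot n, ∏ s ∈ Finset.Icc 1 (mlt m α.1.1 α.1.2),
        -qpow h (-(s * ((nsq m α.1.1 + nsq m α.1.2) / 2))))) := by
    have h3 : ∀ t : ℝ, pnorm h m (ray h m 0 ℓ t) *
        (Real.exp (2 * t * (-dot (kfull n m) ℓ)) : ℝ) =
        ∏ α : PosRoot n, ∏ s ∈ Finset.Icc 1 (mlt m α.1.1 α.1.2),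
          (qpow h (s * ((nsq m α.1.1 + nsq m α.1.2) / 2)) *
            (Real.exp (2 * t * (-dot (sroot α) ℓ)) : ℝ) -
              qpow h (-(s * ((nsq m α.1.1 + nsq m α.1.2) / 2)))) := by
      intro t
      have h4 : ((Real.exp (2 * t * (-dot (kfull n m) ℓ)) : ℝ) : ℂ) = ∏ α : PosRoot n,
          ∏ s ∈ Finset.Icc 1 (mlt m α.1.1 α.1.2), ((Real.exp (2 * t * (-dot (sroot α) ℓ)) : ℝ) : ℂ) := by
        simp only [Finset.prod_const, Nat.card_Icc, Nat.add_sub_cancel]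
        rw [hdot, ← Finset.sum_neg_distrib, Finset.mul_sum, Real.exp_sum, Complex.ofReal_prod]
        refine Finset.prod_congr rfl fun α _ => ?_
        rw [← Complex.ofReal_pow, ← Real.exp_nat_mul]
        congr 2
        ring
      rw [pnorm_eq, h4, ← Finset.prod_mul_distrib]
      refine Finset.prod_congr rfl fun α _ => ?_
      rw [← Finset.prod_mul_distrib]
      refine Finset.prod_congr rfl fun s _ => ?_
      have h5 : ((Real.exp (2 * t * dot (sroot α) ℓ) : ℝ) : ℂ) *
          (Real.exp (2 * t * (-dot (sroot α) ℓ)) : ℝ) = 1 := by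
        rw [← Complex.ofReal_mul, ← Real.exp_add]
        simp
      rw [mono_ray hm h0, mono_pt_zero hm, one_mul]
      linear_combination (-qpow h (-(s * ((nsq m α.1.1 + nsq m α.1.2) / 2)))) * h5
    simp only [h3]
    refine tendsto_finsetProd _ fun α _ => tendsto_finsetProd _ fun s _ => ?_
    have h6 := (tendsto_exp_neg (b := -dot (sroot α) ℓ) (by
      rw [dot_sroot]; linarith [hd _ _ α.2])).const_mul
      (qpow h (s * ((nsq m α.1.1 + nsq m α.1.2) / 2)))
    simpa using h6.sub_const (qpow h (-(s * ((nsq m α.1.1 + nsq m α.1.2) / 2))))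
  rw [tendsto_nhds_unique h1 h2]
  exact Finset.prod_ne_zero_iff.2 fun α _ => Finset.prod_ne_zero_iff.2 fun s _ =>
    neg_ne_zero.2 (qpow_ne_zero _)

/-- Leading exponents of eigenfunctions that are quotients of polynomials. -/
lemma quotient_top (hm : 1 ≤ m) (h0 : h ≠ 0) {z : Fin (n + 1) → ℂ} {E : ℂ}
    {N b : (Fin (n + 1) → ℤ) →₀ ℂ} {ℓ : Fin (n + 1) → ℝ} (hℓ : GenDir ℓ)
    {p0 β0 : Fin (n + 1) → ℤ} (hp0 : N p0 ≠ 0) (hN : ∀ p ∈ N.support, dot p ℓ ≤ dot p0 ℓ)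
    (hβ0 : b β0 ≠ 0) (hb : ∀ p ∈ b.support, dot p ℓ ≤ dot β0 ℓ)
    (heq : Generically h m fun x => tD h m (z - cvec (rho n m))
      (fun x => ev h m N x / ev h m b x) x = E * (ev h m N x / ev h m b x)) :
    orbitSum h m (z + cvec (lat m (p0 - β0 - kv m ℓ))) = E := by
  set p := p0 - β0 with hp
  set F : (Fin (n + 1) → ℂ) → ℂ := fun x => ev h m N x / ev h m b x with hF
  have hlim : ∀ w : Fin (n + 1) → ℂ, Tendsto (fun t : ℝ => F (ray h m w ℓ t) *
      (Real.exp (2 * t * (-dot p ℓ)) : ℝ)) atTop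
      (𝓝 (N p0 / b β0 * mono h m p (pt m w))) := by
    intro w
    have h1 := (tendsto_ev_gen hm h0 N w hℓ p0 hN).div (tendsto_ev_gen hm h0 b w hℓ β0 hb)
      (mul_ne_zero hβ0 (mono_ne_zero _ _))
    have h2 : mono h m p0 (pt m w) = mono h m p (pt m w) * mono h m β0 (pt m w) := by
      rw [← mono_add, hp, sub_add_cancel]
    rw [h2, ← mul_assoc, mul_div_mul_right _ _ (mono_ne_zero _ _), mul_div_right_comm] at h1
    refine h1.congr fun t => ?_
    have h3 : ((Real.exp (2 * t * (-dot p0 ℓ)) : ℝ) : ℂ) =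
        (Real.exp (2 * t * (-dot p ℓ)) : ℝ) * (Real.exp (2 * t * (-dot β0 ℓ)) : ℝ) := by
      rw [← Complex.ofReal_mul, ← Real.exp_add, hp, dot_sub]
      congr 2; ring
    have h4 : ((Real.exp (2 * t * (-dot β0 ℓ)) : ℝ) : ℂ) ≠ 0 := by
      exact_mod_cast (Real.exp_pos _).ne'
    rw [Pi.div_apply, h3, ← mul_assoc, mul_div_mul_right _ _ h4, hF, mul_div_right_comm]
  -- `F` is only a quotient, so the asymptotics of the operator are applied to the monomial with
  -- exponent `p = p0 - β0`; the rescaled difference between `F` and its leading monomial tends to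
  -- zero.
  have hmono := tendsto_tD hm h0 z (Finsupp.single p 1) hℓ p fun p' hp' => by
    rw [Finset.mem_singleton.1 (Finsupp.support_single_subset hp')]
  rw [Finsupp.single_eq_same, mul_one] at hmono
  have hF0 := hlim 0
  rw [mono_pt_zero hm, mul_one] at hF0
  have hdiff : Tendsto (fun t : ℝ => tD h m (z - cvec (rho n m)) F (ray h m 0 ℓ t) *
      (Real.exp (2 * t * (-dot p ℓ)) : ℝ) - N p0 / b β0 *
      (tD h m (z - cvec (rho n m)) (ev h m (Finsupp.single p 1)) (ray h m 0 ℓ t) *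
        (Real.exp (2 * t * (-dot p ℓ)) : ℝ))) atTop (𝓝 0) := by
    have hterm : ∀ i : Fin (n + 1), Tendsto (fun t : ℝ => aco h m i (ray h m 0 ℓ t) *
        (qpow h (2 * zeta m i (z - cvec (rho n m))) * (F (ray h m 0 ℓ t + eps m i) *
          (Real.exp (2 * t * (-dot p ℓ)) : ℝ) - N p0 / b β0 *
          (ev h m (Finsupp.single p 1) (ray h m 0 ℓ t + eps m i) *
          (Real.exp (2 * t * (-dot p ℓ)) : ℝ))))) atTop (𝓝 0) := by
      intro i
      have h1 := hlim (0 + Pi.single i (nsq m i : ℂ))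
      have h2 := (tendsto_ev_gen hm h0 (Finsupp.single p (1 : ℂ)) (0 + Pi.single i (nsq m i : ℂ)) hℓ
        p fun p' hp' => by
          rw [Finset.mem_singleton.1 (Finsupp.support_single_subset hp')]).const_mul (N p0 / b β0)
      simp only [← ray_add_eps hm] at h1 h2
      rw [Finsupp.single_eq_same, one_mul] at h2
      have h3 := (tendsto_aco_ray (h := h) hm h0 0 hℓ.injective i).mul ((h1.sub h2).const_mul
        (qpow h (2 * zeta m i (z - cvec (rho n m)))))
      simpa using h3
    have := tendsto_finsetSum Finset.univ fun i _ => hterm i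
    rw [Finset.sum_const_zero] at this
    refine this.congr fun t => ?_
    rw [tD, tD, Finset.sum_mul, Finset.sum_mul, Finset.mul_sum, ← Finset.sum_sub_distrib]
    exact Finset.sum_congr rfl fun i _ => by ring
  have h5 := hdiff.add (hmono.const_mul (N p0 / b β0))
  simp only [sub_add_cancel, zero_add] at h5
  have h6 := hF0.const_mul E
  obtain ⟨g, hg, hg0, hgx⟩ := heq
  have h7 := tendsto_nhds_unique (h5.congr' ?_) h6
  · have h8 : N p0 / b β0 ≠ 0 := div_ne_zero hp0 hβ0
    rw [mul_comm] at h7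
    exact mul_right_cancel₀ h8 h7
  · filter_upwards [eventually_ne_zero hm h0 hg hg0 0 hℓ] with t ht
    rw [hgx _ ht, mul_assoc]

/-- With eigenvalue `𝔪(z)` the top exponent of a nonzero numerator can only be `β0 + kv ℓ`, because
the shifted values of `𝔪` at `z` are distinct. -/
lemma quotient_eigen_eq_zero (hm : 1 ≤ m) (h0 : h ≠ 0) {z : Fin (n + 1) → ℂ}
    {N b : (Fin (n + 1) → ℤ) →₀ ℂ} {ℓ : Fin (n + 1) → ℝ} (hℓ : GenDir ℓ)
    {β0 : Fin (n + 1) → ℤ} (hβ0 : b β0 ≠ 0) (hb : ∀ p ∈ b.support, dot p ℓ ≤ dot β0 ℓ)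
    {S : Finset (Fin (n + 1) → ℤ)} (hS : N.support ⊆ S)
    (hz : Res h m (insert 0 (S.image fun p => p - β0 - kv m ℓ)) z)
    (heq : Generically h m fun x => tD h m (z - cvec (rho n m))
      (fun x => ev h m N x / ev h m b x) x = orbitSum h m z * (ev h m N x / ev h m b x))
    (hN : N (β0 + kv m ℓ) = 0) : N = 0 := by
  by_contra hne
  obtain ⟨p0, hp0, hmax⟩ := exists_top hne ℓ
  have h1 := quotient_top hm h0 hℓ (Finsupp.mem_support_iff.1 hp0) hmax hβ0 hb heq
  have h2 := hz _ (Finset.mem_insert_of_mem (Finset.mem_image_of_mem _ (hS hp0))) 0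
    (Finset.mem_insert_self _ _) (by rw [h1, lat_zero, cvec_zero, add_zero])
  have h3 : p0 = β0 + kv m ℓ := by rw [← sub_eq_zero, ← h2]; abel
  exact Finsupp.mem_support_iff.1 hp0 (h3 ▸ hN)

/-- The roles of the variables are exchanged: up to a factor depending on `z` alone, the
eigenfunction is a twist by `z - ρ` of a quotient of polynomials in `x`. -/
lemma renorm_eq (φ : ∀ x : Fin (n + 1) → ℂ, QIs h m x) (x z : Fin (n + 1) → ℂ) :
    renorm φ x z = qpow h (-(2 * pair (cvec (rho n m)) z)) * tw h (z - cvec (rho n m))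
      (fun x => pnorm h m x * ev h m (φ x).1 z / (φ x).1 (kfull n m)) x := by
  have h1 : qpow h (2 * pair (x - cvec (rho n m)) z) = qpow h (-(2 * pair (cvec (rho n m)) z)) *
      (qpow h (2 * pair (z - cvec (rho n m)) x) * qpow h (2 * pair (cvec (rho n m)) x)) := by
    rw [← qpow_add, ← qpow_add]
    congr 1
    have e1 : pair x z = pair (x - cvec (rho n m)) z + pair (cvec (rho n m)) z := by
      rw [← pair_add, sub_add_cancel]
    have e2 : pair z x = pair (z - cvec (rho n m)) x + pair (cvec (rho n m)) x := by
      rw [← pair_add, sub_add_cancel]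
    rw [pair_comm z x] at e2
    linear_combination -2 * e1 + 2 * e2
  rw [renorm, tw, tw, h1, pnorm]
  ring

lemma tD_sub_smul (y x : Fin (n + 1) → ℂ) (F G : (Fin (n + 1) → ℂ) → ℂ) (a : ℂ) :
    tD h m y (fun x => F x - a * G x) x = tD h m y F x - a * tD h m y G x := by
  rw [tD, tD, tD, Finset.mul_sum, ← Finset.sum_sub_distrib]
  exact Finset.sum_congr rfl fun i _ => by ring

/-- For fixed generic `z`, both sides divided by the coefficient `(φ x)_{kfull}` are, after the
twist by `z - ρ`, eigenfunctions in `x` with eigenvalue `𝔪(z)`: one by `dual_equation`, the other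
because `φ z` is an eigenvector. Uniqueness given the leading coefficient yields the factor. -/
theorem exists_proportional (hm : 1 ≤ m) (hq : NotRoot h)
    {φ : ∀ x : Fin (n + 1) → ℂ, QIs h m x} (hφ : EigFam hm hq φ) :
    Generically h m fun z => ∃ Λ : ℂ, ∀ x, pnorm h m x * ev h m (φ x).1 z =
      (φ x).1 (kfull n m) * (Λ * ev h m (φ z).1 x) := by
  classical
  obtain ⟨cb, hcb⟩ := (isPoly_iff _).1 (hφ.coeff (kfull n m))
  have hcb' : ∀ x, (φ x).1 (kfull n m) = ev h m cb x := fun x => congrFun hcb x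
  have hcb0 : cb ≠ 0 := fun hh => hφ.ne (by rw [hcb, hh, map_zero])
  have hg : ∀ p, ∃ g, (fun x => pnorm h m x * (φ x).1 p) = ev h m g := fun p =>
    (isPoly_iff _).1 (isPoly_pnorm.mul (hφ.coeff p))
  choose g hg using hg
  obtain ⟨ℓ, hℓ, hd⟩ := genDir_decr (n := n)
  obtain ⟨β0, hβ0, hb⟩ := exists_top hcb0 ℓ
  rw [Finsupp.mem_support_iff] at hβ0
  set Z := zon (kmul n m 1) with hZ
  set G : (Fin (n + 1) → ℂ) → (Fin (n + 1) → ℤ) →₀ ℂ := fun z => ∑ p ∈ Z, mono h m p z • g p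
    with hG
  have hGev : ∀ z x, ev h m (G z) x = pnorm h m x * ev h m (φ x).1 z := by
    intro z x
    rw [hG, map_sum, Finset.sum_apply, ev_apply_of_subset (hφ.supp x), Finset.mul_sum]
    refine Finset.sum_congr rfl fun p _ => ?_
    rw [map_smul, Pi.smul_apply, ← hg, smul_eq_mul]
    ring
  set S := (Z.biUnion fun p => (g p).support) ∪ Finset.image₂ (· + ·) cb.support Z with hS
  have hGS : ∀ z, (G z).support ⊆ S := by
    intro z p hp
    obtain ⟨p', hp', hpp⟩ := Finset.mem_biUnion.1 (Finsupp.support_finsetSum hp)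
    exact Finset.mem_union_left _ (Finset.mem_biUnion.2 ⟨p', hp', Finsupp.support_smul hpp⟩)
  have hbne : Generically h m fun x : Fin (n + 1) → ℂ => ev h m cb x ≠ 0 :=
    ⟨_, isPoly_ev cb, hcb ▸ hφ.ne, fun x hx => hx⟩
  refine ((generically_res hm hq (insert 0 (S.image fun p => p - β0 - kv m ℓ))).and hbne).mono
    fun z ⟨hz, hbz⟩ => ?_
  -- `φ z` is written over the same denominator as `G z`, so that a combination of the two is again
  -- a quotient of the same kind.
  set N := conv cb (φ z).1 with hN
  have hNev : ∀ x, ev h m N x = ev h m cb x * ev h m (φ z).1 x := fun x => ev_conv _ _ _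
  have hNS : N.support ⊆ S := (conv_support (hφ.supp z)).trans Finset.subset_union_right
  have hφz : (φ z).1 ≠ 0 := fun hh => hbz (by rw [← hcb', hh, Finsupp.zero_apply])
  have hN0 : N ≠ 0 := by
    intro hh
    have h1 := analytic_mul_ne_zero (isPoly_ev cb).analytic
      (isPoly_ev (h := h) (m := m) (φ z).1).analytic (hcb ▸ hφ.ne)
      fun h2 => hφz (ev_injective hm hq.ne_zero (h2.trans (map_zero _).symm))
    refine h1 (funext fun x => ?_)
    rw [Pi.mul_apply, ← hNev, hh, map_zero]
  have heqN : Generically h m fun x => tD h m (z - cvec (rho n m))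
      (fun x => ev h m N x / ev h m cb x) x = orbitSum h m z * (ev h m N x / ev h m cb x) := by
    refine ((generically_offPoles hm hq.ne_zero).and (hbne.and (generically_ball Finset.univ _
      fun i _ => hbne.shift (eps m i)))).mono fun x ⟨hx1, hx2, hx3⟩ => ?_
    have h1 := opE_spec hm hq z (φ z) x hx1
    rw [hφ.eigen z, Submodule.coe_smul, map_smul, Pi.smul_apply, smul_eq_mul] at h1
    rw [hNev, mul_div_cancel_left₀ _ hx2, ← h1, tD, tD]
    refine Finset.sum_congr rfl fun i _ => ?_
    rw [hNev, mul_div_cancel_left₀ _ (hx3 i (Finset.mem_univ _))]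
  have heqG : Generically h m fun x => tD h m (z - cvec (rho n m))
      (fun x => ev h m (G z) x / ev h m cb x) x =
        orbitSum h m z * (ev h m (G z) x / ev h m cb x) := by
    refine (dual_equation hm hq hφ).mono fun x hx => ?_
    have h1 := hx z
    have h2 : (fun x => renorm φ x z) = fun x => qpow h (-(2 * pair (cvec (rho n m)) z)) *
        tw h (z - cvec (rho n m)) (fun x => ev h m (G z) x / ev h m cb x) x := by
      funext x
      rw [renorm_eq]
      simp only [hGev, hcb']
    have h3 : ∀ x, renorm φ x z = _ := fun x => congrFun h2 x
    simp only [h3, mul_left_comm (aco h m _ _), ← Finset.mul_sum, ← opD_apply, opD_tw] at h1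
    rw [tw, tw] at h1
    have h4 := mul_ne_zero (qpow_ne_zero (h := h) (-(2 * pair (cvec (rho n m)) z)))
      (qpow_ne_zero (h := h) (2 * pair (z - cvec (rho n m)) x))
    refine mul_left_cancel₀ h4 ?_
    linear_combination h1
  have hNt : N (β0 + kv m ℓ) ≠ 0 := fun hh =>
    hN0 (quotient_eigen_eq_zero hm hq.ne_zero hℓ hβ0 hb hNS hz heqN hh)
  set Λ := G z (β0 + kv m ℓ) / N (β0 + kv m ℓ) with hΛ
  have hzero : G z - Λ • N = 0 := by
    refine quotient_eigen_eq_zero (S := S) hm hq.ne_zero hℓ hβ0 hb ?_ hz ?_ ?_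
    · exact Finsupp.support_sub.trans (Finset.union_subset (hGS z)
        (Finsupp.support_smul.trans hNS))
    · refine (heqN.and heqG).mono fun x ⟨h1, h2⟩ => ?_
      have h3 : (fun x => ev h m (G z - Λ • N) x / ev h m cb x) = fun x =>
          ev h m (G z) x / ev h m cb x - Λ * (ev h m N x / ev h m cb x) := by
        funext x
        rw [map_sub, map_smul, Pi.sub_apply, Pi.smul_apply, smul_eq_mul]
        ring
      rw [h3, tD_sub_smul, h1, h2, congrFun h3 x]
      ring
    · rw [Finsupp.sub_apply, Finsupp.smul_apply, smul_eq_mul, hΛ, div_mul_cancel₀ _ hNt, sub_self]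
  refine ⟨Λ, fun x => ?_⟩
  rw [hcb', ← hGev, sub_eq_zero.1 hzero, map_smul, Pi.smul_apply, hNev, smul_eq_mul]
  ring

/-- The Laurent polynomial with exponents in `Z` and prescribed coefficients. -/
def coefOn (Z : Finset (Fin (n + 1) → ℤ)) (f : (Fin (n + 1) → ℤ) → ℂ) : (Fin (n + 1) → ℤ) →₀ ℂ :=
  ∑ p ∈ Z, Finsupp.single p (f p)

lemma coefOn_apply (Z : Finset (Fin (n + 1) → ℤ)) (f : (Fin (n + 1) → ℤ) → ℂ)
    (p : Fin (n + 1) → ℤ) : coefOn Z f p = if p ∈ Z then f p else 0 := by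
  classical
  rw [coefOn, Finsupp.finsetSum_apply]
  simp only [Finsupp.single_apply]
  rw [Finset.sum_ite_eq']

lemma coefOn_support (Z : Finset (Fin (n + 1) → ℤ)) (f : (Fin (n + 1) → ℤ) → ℂ) :
    (coefOn Z f).support ⊆ Z := by
  intro p hp
  by_contra hh
  rw [Finsupp.mem_support_iff, coefOn_apply, if_neg hh] at hp
  exact hp rfl

lemma ev_coefOn (Z : Finset (Fin (n + 1) → ℤ)) (f : (Fin (n + 1) → ℤ) → ℂ)
    (z : Fin (n + 1) → ℂ) : ev h m (coefOn Z f) z = ∑ p ∈ Z, f p * mono h m p z := by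
  rw [coefOn, map_sum, Finset.sum_apply]
  exact Finset.sum_congr rfl fun p _ => ev_single _ _ _

lemma kfull_mem_zon : kfull n m ∈ zon (kmul n m 1) := by
  obtain ⟨ℓ, -, hd⟩ := genDir_decr (n := n)
  exact kv_of_lt (m := m) hd ▸ kv_mem_zon ℓ

lemma pnorm_ne_zero (hm : 1 ≤ m) (h0 : h ≠ 0) : (pnorm h m : (Fin (n + 1) → ℂ) → ℂ) ≠ 0 := by
  obtain ⟨x, hx⟩ := (generically_nrmNeZero (n := n) hm h0).exists
  exact fun hh => mul_ne_zero (qpow_ne_zero _) hx.normFactor (congrFun hh x)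

/-- The normalized eigenfunction is a finite bilinear kernel `∑ K p p' q^{2(p,z)} q^{2(p',x)}`.
Proportionality says that the transposed kernel describes the same function up to a factor depending
on one variable; this factor has to be shown to be `1`. -/
theorem exists_kernel (hm : 1 ≤ m) (hq : NotRoot h)
    {φ : ∀ x : Fin (n + 1) → ℂ, QIs h m x} (hφ : EigFam hm hq φ) :
    ∃ K : (Fin (n + 1) → ℤ) → (Fin (n + 1) → ℤ) → ℂ,
      (∀ p ∈ zon (kmul n m 1), ∀ p' ∈ zon (kmul n m 1), K p p' = K p' p) ∧
      (∀ x, pnorm h m x • (φ x).1 = (φ x).1 (kfull n m) • coefOn (zon (kmul n m 1))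
        fun p => ev h m (coefOn (zon (kmul n m 1)) (K p)) x) ∧
      ev h m (coefOn (zon (kmul n m 1)) (K (kfull n m))) = pnorm h m := by
  classical
  set Z := zon (kmul n m 1) with hZ
  set b : (Fin (n + 1) → ℂ) → ℂ := fun x => (φ x).1 (kfull n m) with hbdef
  have hbP : IsPoly h m b := hφ.coeff _
  have hb0 : b ≠ 0 := hφ.ne
  have hbgen : Generically h m fun x => b x ≠ 0 := ⟨b, hbP, hb0, fun x hx => hx⟩
  have huP : IsPoly h m (pnorm h m : (Fin (n + 1) → ℂ) → ℂ) := isPoly_pnorm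
  -- Coefficients in `x` are recovered from values at points with `b x ≠ 0`, so `K` is defined
  -- before it is known that the quotient by `b` is a polynomial in `x`.
  choose w hwX hw using fun p' => exists_coeff_functional hm hq.ne_zero Z hbgen.dense p'
  set K : (Fin (n + 1) → ℤ) → (Fin (n + 1) → ℤ) → ℂ := fun p p' =>
    ∑ x ∈ (w p').support, w p' x * (pnorm h m x * (φ x).1 p / b x) with hK
  set C : (Fin (n + 1) → ℤ) → (Fin (n + 1) → ℂ) → ℂ := fun p => ev h m (coefOn Z (K p)) with hC
  set Cs : (Fin (n + 1) → ℤ) → (Fin (n + 1) → ℂ) → ℂ := fun p' =>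
    ev h m (coefOn Z fun p => K p p') with hCs
  have hkf : kfull n m ∈ Z := kfull_mem_zon
  -- values of the transposed kernel
  have hgen : Generically h m fun z => ∃ Λ : ℂ, (∀ p', p' ∈ Z → Cs p' z = Λ * (φ z).1 p') ∧
      ∀ x, b x ≠ 0 → pnorm h m x * ev h m (φ x).1 z / b x = Λ * ev h m (φ z).1 x := by
    refine (exists_proportional hm hq hφ).mono fun z ⟨Λ, hΛ⟩ => ?_
    have h1 : ∀ x, b x ≠ 0 → pnorm h m x * ev h m (φ x).1 z / b x = Λ * ev h m (φ z).1 x := by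
      intro x hx
      rw [hΛ, mul_div_cancel_left₀ _ hx]
    refine ⟨Λ, fun p' _ => ?_, h1⟩
    simp only [hCs]
    rw [ev_coefOn, ← hw p' (φ z).1 (hφ.supp z), Finset.mul_sum]
    simp only [hK, Finset.sum_mul]
    rw [Finset.sum_comm]
    refine Finset.sum_congr rfl fun x hx => ?_
    rw [mul_left_comm, ← h1 x (hwX p' x hx), ev_apply_of_subset (hφ.supp x), Finset.mul_sum,
      Finset.sum_div, Finset.mul_sum]
    exact Finset.sum_congr rfl fun p _ => by ring
  have hB : ∀ x z, ev h m (coefOn Z fun p => C p x) z = ev h m (coefOn Z fun p' => Cs p' z) x := by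
    intro x z
    simp only [hC, hCs, ev_coefOn, Finset.sum_mul]
    rw [Finset.sum_comm]
    exact Finset.sum_congr rfl fun p _ => Finset.sum_congr rfl fun p' _ => by ring
  have hrow : ∀ x, b x ≠ 0 → (pnorm h m x / b x) • (φ x).1 = coefOn Z fun p => C p x := by
    intro x hx
    refine ev_injective hm hq.ne_zero (hgen.ext (isPoly_ev _).continuous (isPoly_ev _).continuous
      fun z ⟨Λ, h1, h2⟩ => ?_)
    rw [hB, ev_coefOn, map_smul, Pi.smul_apply, smul_eq_mul, div_mul_eq_mul_div, h2 x hx,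
      ev_apply_of_subset (hφ.supp z), Finset.mul_sum]
    exact Finset.sum_congr rfl fun p hp => by rw [h1 p hp]; ring
  have hCP : ∀ p, IsPoly h m (C p) := fun p => isPoly_ev _
  have hCsP : ∀ p, IsPoly h m (Cs p) := fun p => isPoly_ev _
  have hrow' : ∀ p ∈ Z, (fun x => pnorm h m x * (φ x).1 p) = fun x => b x * C p x := by
    intro p hp
    refine hbgen.ext (huP.mul (hφ.coeff p)).continuous (hbP.mul (hCP p)).continuous fun x hx => ?_
    have h1 := DFunLike.congr_fun (hrow x hx) p
    rw [coefOn_apply, if_pos hp, Finsupp.smul_apply, smul_eq_mul, div_mul_eq_mul_div,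
      div_eq_iff hx] at h1
    rw [h1, mul_comm]
  have hu : C (kfull n m) = pnorm h m := by
    refine hbgen.ext (hCP _).continuous huP.continuous fun x hx => ?_
    have := congrFun (hrow' _ hkf) x
    refine mul_left_cancel₀ hx ?_
    rw [← this, mul_comm]
  have ha : ∀ p ∈ Z, (fun z => pnorm h m z * Cs p z) = fun z => Cs (kfull n m) z * C p z := by
    intro p hp
    refine hgen.ext (huP.mul (hCsP p)).continuous ((hCsP _).mul (hCP p)).continuous
      fun z ⟨Λ, h1, _⟩ => ?_
    have h2 := congrFun (hrow' p hp) z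
    rw [h1 p hp, h1 _ hkf, mul_left_comm, h2, mul_assoc]
  have hb' : ∀ x z, pnorm h m z * ev h m (coefOn Z fun p => C p x) z =
      Cs (kfull n m) z * ev h m (coefOn Z fun p => C p z) x := by
    intro x z
    rw [hB, ev_coefOn, ev_coefOn, Finset.mul_sum, Finset.mul_sum]
    refine Finset.sum_congr rfl fun p hp => ?_
    rw [← mul_assoc, congrFun (ha p hp) z, mul_assoc]
  obtain ⟨x0, hx0⟩ := Function.ne_iff.1 (pnorm_ne_zero (n := n) hm hq.ne_zero)
  rw [Pi.zero_apply] at hx0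
  -- The proportionality `hb'` is applied to `(x0, z)` and to `(z, x0)`; their product cancels the
  -- kernel value wherever it is nonzero, and this is dense in `z`.
  have hv : ∀ z, pnorm h m x0 * pnorm h m z = Cs (kfull n m) x0 * Cs (kfull n m) z := by
    have h1 : ev h m (coefOn Z fun p => C p x0) ≠ 0 := by
      intro hh
      have h2 := ev_injective hm hq.ne_zero (hh.trans (map_zero (ev h m)).symm)
      have h3 := DFunLike.congr_fun h2 (kfull n m)
      rw [coefOn_apply, if_pos hkf, hu, Finsupp.zero_apply] at h3
      exact hx0 h3
    have h2 := eq_of_mul_eq_zero (isPoly_ev (h := h) (m := m) (coefOn Z fun p => C p x0)).analytic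
      h1 (g := fun z => pnorm h m x0 * pnorm h m z - Cs (kfull n m) x0 * Cs (kfull n m) z)
      ((continuous_const.mul huP.continuous).sub (continuous_const.mul (hCsP _).continuous))
      fun z => ?_
    · exact fun z => sub_eq_zero.1 (congrFun h2 z)
    · intro hz
      refine mul_left_cancel₀ hz ?_
      have e1 := hb' x0 z
      have e2 := hb' z x0
      linear_combination pnorm h m x0 * e1 + Cs (kfull n m) z * e2
  -- Up to the two constants, the Laurent polynomials compared in `hv` have the same coefficient at
  -- `kfull`, namely the diagonal entry `K kfull kfull`. It is nonzero by `pnorm_top`, so the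
  -- constants agree.
  have hv2 : pnorm h m x0 = Cs (kfull n m) x0 := by
    have h1 : pnorm h m x0 • coefOn Z (K (kfull n m)) =
        Cs (kfull n m) x0 • coefOn Z fun p => K p (kfull n m) := by
      refine ev_injective hm hq.ne_zero (funext fun z => ?_)
      have h2 := hv z
      rw [← hu] at h2 ⊢
      simpa only [map_smul, Pi.smul_apply, smul_eq_mul] using h2
    have h3 := DFunLike.congr_fun h1 (kfull n m)
    rw [Finsupp.smul_apply, Finsupp.smul_apply, coefOn_apply, coefOn_apply, if_pos hkf,
      smul_eq_mul, smul_eq_mul] at h3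
    have h4 := pnorm_top hm hq.ne_zero (coefOn_support Z (K (kfull n m))) hu
    rw [coefOn_apply, if_pos hkf] at h4
    exact mul_right_cancel₀ h4 h3
  have hsymm : ∀ p ∈ Z, Cs p = C p := by
    intro p hp
    have h1 : (fun z => Cs p z - C p z) = 0 := by
      refine eq_of_mul_eq_zero huP.analytic (pnorm_ne_zero hm hq.ne_zero)
        ((hCsP p).continuous.sub (hCP p).continuous) fun z hz => ?_
      have h2 := congrFun (ha p hp) z
      have h3 := hv z
      rw [← hv2] at h3
      have h4 := mul_left_cancel₀ hx0 h3
      rw [← h4] at h2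
      rw [mul_left_cancel₀ hz h2, sub_self]
    exact funext fun z => sub_eq_zero.1 (congrFun h1 z)
  refine ⟨K, fun p hp p' hp' => ?_, fun x => ?_, hu⟩
  · have h1 := DFunLike.congr_fun (ev_injective hm hq.ne_zero (hsymm p' hp')) p
    rwa [coefOn_apply, coefOn_apply, if_pos hp, if_pos hp] at h1
  · refine Finsupp.ext fun p => ?_
    rw [Finsupp.smul_apply, Finsupp.smul_apply, coefOn_apply, smul_eq_mul, smul_eq_mul]
    split_ifs with hp
    · exact congrFun (hrow' p hp) x
    · rw [Finsupp.notMem_support_iff.1 fun hh => hp (hφ.supp x hh), mul_zero, mul_zero]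

/-! ### The normalized Baker–Akhiezer function -/

/-- The kernel defines coefficients that are Laurent polynomials in `x`, with no division. For
generic `x` they are multiples of `φ x`, and quasi-invariance and the eigenvalue equation extend to
all `x` by density. -/
theorem exists_symmetric_family (hm : 1 ≤ m) (hq : NotRoot h)
    {φ : ∀ x : Fin (n + 1) → ℂ, QIs h m x} (hφ : EigFam hm hq φ) :
    ∃ φ' : ∀ x : Fin (n + 1) → ℂ, QIs h m x, EigFam hm hq φ' ∧
      (∀ x, (φ' x).1 (kfull n m) = pnorm h m x) ∧
      (∀ x z, ev h m (φ' x).1 z = ev h m (φ' z).1 x) ∧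
      ∀ x, pnorm h m x • (φ x).1 = (φ x).1 (kfull n m) • (φ' x).1 := by
  obtain ⟨K, hK1, hK2, hK3⟩ := exists_kernel hm hq hφ
  set Z := zon (kmul n m 1) with hZ
  set C : (Fin (n + 1) → ℂ) → (Fin (n + 1) → ℤ) →₀ ℂ := fun x =>
    coefOn Z fun p => ev h m (coefOn Z (K p)) x with hC
  have hsymm : ∀ x z, ev h m (C x) z = ev h m (C z) x := by
    intro x z
    simp only [hC, ev_coefOn, Finset.sum_mul]
    rw [Finset.sum_comm]
    refine Finset.sum_congr rfl fun p hp => Finset.sum_congr rfl fun p' hp' => ?_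
    rw [hK1 p' hp' p hp]
    ring
  have hpoly : ∀ z, IsPoly h m fun x => ev h m (C x) z := by
    intro z
    simp only [fun x => hsymm x z]
    exact isPoly_ev _
  have hgen : Generically h m fun x => ∃ a : ℂ, C x = a • (φ x).1 := by
    refine ⟨_, hφ.coeff (kfull n m), hφ.ne, fun x hx => ⟨pnorm h m x / (φ x).1 (kfull n m), ?_⟩⟩
    rw [div_eq_inv_mul, mul_smul, hK2, smul_smul, inv_mul_cancel₀ hx, one_smul]
  have hmem : ∀ x, C x ∈ QIs h m x := by
    intro x
    rw [mem_QIs]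
    intro i j hij s hs1 hs z hz
    have h1 : ∀ k : Fin (n + 1), IsPoly h m fun x : Fin (n + 1) → ℂ =>
        qpow h (2 * zeta m k (x - cvec (rho n m))) ^ s := fun k => by
      have := isPoly_prod (Finset.range s) (fun _ (x : Fin (n + 1) → ℂ) =>
        qpow h (2 * zeta m k (x - cvec (rho n m)))) fun _ _ => isPoly_qpow_zeta_sub k _
      rwa [Finset.prod_const, Finset.card_range] at this
    refine congrFun (hgen.ext ((h1 i).mul (hpoly _)).continuous
      ((h1 j).mul (hpoly _)).continuous fun x ⟨a, ha⟩ => ?_) x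
    have h2 : C x ∈ QIs h m x := ha ▸ Submodule.smul_mem _ a (φ x).2
    exact mem_QIs.1 h2 i j hij s hs1 hs z hz
  have hkf : kfull n m ∈ Z := kfull_mem_zon
  have htop : ∀ x, C x (kfull n m) = pnorm h m x := by
    intro x
    rw [hC, coefOn_apply, if_pos hkf, hK3]
  have hfam : PolyFam h m fun x => (⟨C x, hmem x⟩ : QIs h m x) := fun z _ => hpoly z
  refine ⟨fun x => ⟨C x, hmem x⟩, ⟨hfam, fun x => coefOn_support _ _, fun x => ?_, ?_⟩, htop,
    hsymm, fun x => hK2 x⟩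
  · refine (hfam.opE hm hq).ext hm hq.ne_zero (hfam.smul isPoly_orbitSum)
      (hgen.mono fun x ⟨a, ha⟩ => ?_) x
    have h1 : (⟨C x, hmem x⟩ : QIs h m x) = a • φ x := Subtype.ext ha
    rw [h1, map_smul, hφ.eigen, smul_comm]
  · simp only [htop]
    exact pnorm_ne_zero hm hq.ne_zero

/-- Coefficients of the function `q^{-2(ρ,z)} ∑ c_p q^{2(lat p, z)}`. -/
def toBA (m : ℕ) (c : (Fin (n + 1) → ℤ) →₀ ℂ) : (Fin (n + 1) → ℝ) →₀ ℂ :=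
  Finsupp.mapDomain (fun p => lat m p - rho n m) c

lemma lat_sub_rho_injective (hm : 1 ≤ m) :
    Function.Injective fun p : Fin (n + 1) → ℤ => lat m p - rho n m := fun _ _ hpp =>
  lat_injective hm (sub_left_injective hpp)

lemma toBA_apply (hm : 1 ≤ m) (c : (Fin (n + 1) → ℤ) →₀ ℂ) (p : Fin (n + 1) → ℤ) :
    toBA m c (lat m p - rho n m) = c p :=
  Finsupp.mapDomain_apply (lat_sub_rho_injective hm) _ _

lemma rho_eq : rho n m = lat m (kfull n m) - rho n m := by
  rw [lat_kfull, two_smul, add_sub_cancel_right]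

lemma cvec_sub (μ ν : Fin (n + 1) → ℝ) : cvec (μ - ν) = cvec μ - cvec ν := by
  funext i; simp [cvec]

lemma pair_sub (x y z : Fin (n + 1) → ℂ) : pair (x - y) z = pair x z - pair y z :=
  eq_sub_of_add_eq (by rw [← pair_add, sub_add_cancel])

lemma expSum_toBA (c : (Fin (n + 1) → ℤ) →₀ ℂ) (x z : Fin (n + 1) → ℂ) :
    qpow h (2 * pair x z) * expSum h (toBA m c) z =
      tw h (x - cvec (rho n m)) (ev h m c) z := by
  have h1 : expSum h (toBA m c) z =
      c.sum fun p a => a * qpow h (2 * pair (cvec (lat m p - rho n m)) z) :=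
    Finsupp.sum_mapDomain_index (by simp) (by intros; ring)
  rw [h1, tw, ev_apply, Finsupp.sum, Finset.mul_sum, Finset.mul_sum]
  refine Finset.sum_congr rfl fun p _ => ?_
  rw [mono_eq, cvec_sub, pair_sub, pair_sub, mul_sub, mul_sub, qpow_sub, qpow_sub]
  ring

lemma mem_polytope {p : Fin (n + 1) → ℤ} (hp : p ∈ zon (kmul n m 1)) :
    lat m p - rho n m ∈ polytope n m ∧ lat m p - rho n m - rho n m ∈ weightLattice n m := by
  constructor
  · obtain ⟨l, hl, rfl⟩ := mem_zon.1 hp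
    refine ⟨fun α => l α, fun α => ⟨by positivity, ?_⟩, ?_⟩
    · have := hl α
      rw [kmul, one_mul, ← mult_eq] at this
      show (l α : ℝ) ≤ mult m α
      exact_mod_cast this
    · rw [lat_sum, sub_eq_neg_add]
      congr 1
      exact Finset.sum_congr rfl fun α _ => by rw [lat_zsmul, lat_sroot, Int.cast_natCast]
  · rw [mem_weightLattice]
    refine ⟨p - kfull n m, ?_⟩
    rw [lat_sub, lat_kfull, two_smul, sub_sub]

/-- The parameters in the polytope are real. They still bound every `dot p ℓ` by the support
function, and `mem_zon_of_dot` then supplies integral parameters. -/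
lemma exists_mem_zon (hm : 1 ≤ m) {ν : Fin (n + 1) → ℝ} (hν : ν ∈ polytope n m)
    (hν' : ν - rho n m ∈ weightLattice n m) :
    ∃ p ∈ zon (kmul n m 1), lat m p - rho n m = ν := by
  obtain ⟨p', hp'⟩ := (mem_weightLattice _).1 hν'
  have hν2 : lat m (p' + kfull n m) - rho n m = ν := by
    rw [lat_add, ← hp', lat_kfull, two_smul]; abel
  refine ⟨p' + kfull n m, mem_zon_of_dot fun ℓ => ?_, hν2⟩
  set p := p' + kfull n m
  obtain ⟨l, hl, hlν⟩ := hν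
  have h1 : lat m p = ∑ α, l α • lat m (sroot α) := by
    rw [← hν2] at hlν
    simp only [lat_sroot]
    rw [sub_eq_neg_add] at hlν
    exact add_left_cancel hlν
  have h2 : ∀ i, (p i : ℝ) = ∑ α, l α * sroot α i := by
    intro i
    have h3 := congrFun h1 i
    simp only [lat, Finset.sum_apply, Pi.smul_apply, smul_eq_mul, ← mul_assoc,
      ← Finset.sum_mul] at h3
    exact mul_right_cancel₀ (kap_ne_zero hm i) h3
  have h4 : dot p ℓ = ∑ α, l α * dot (sroot α) ℓ := by
    simp only [dot, h2, Finset.sum_mul, Finset.mul_sum, mul_assoc]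
    rw [Finset.sum_comm]
  rw [h4, zsupp]
  refine Finset.sum_le_sum fun α _ => ?_
  rw [dot_sroot, kmul, one_mul, ← mult_eq]
  exact (mul_le_mul_of_nonneg_left (le_max_left _ _) (hl α).1).trans
    (mul_le_mul_of_nonneg_right (hl α).2 (le_max_right _ _))

lemma isBA_toBA (hm : 1 ≤ m) {φ : ∀ x : Fin (n + 1) → ℂ, QIs h m x}
    (hφ : ∀ x, (φ x).1.support ⊆ zon (kmul n m 1)) :
    IsBA h m (fun x => toBA m (φ x).1)
      fun x z => tw h (x - cvec (rho n m)) (ev h m (φ x).1) z where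
  expansion x z := (expSum_toBA _ _ _).symm
  support_subset x ν hν := by
    classical
    obtain ⟨p, hp, rfl⟩ := Finset.mem_image.1 (Finsupp.mapDomain_support hν)
    exact mem_polytope (hφ x hp)
  quasiInvariant x := (quasiInvariant_tw_iff hm (isPoly_ev _) _).2 (mem_QIs.1 (φ x).2)

/-- On the zonotope only `y = 0` is admissible, so `orbPoly_kill` with a single root makes every
quasi-invariant vector supported there an eigenvector; the extreme coefficient then decides. -/
lemma eq_zero_of_coeff_eq_zero (hm : 1 ≤ m) (hq : NotRoot h) {x : Fin (n + 1) → ℂ}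
    (hx : Res h m (tset m (zon (kmul n m 1))) x) {c : QIs h m x}
    (hc : c.1.support ⊆ zon (kmul n m 1)) (hc0 : c.1 (kfull n m) = 0) : c = 0 := by
  have h1 := orbPoly_kill hm hq (sep_zon _) hx (Y := {0})
    (fun y hy => Finset.mem_singleton.2 (eq_zero_of_add_kv hy)) (mem_QIsupp.2 hc)
  have h2 := aeval_X_sub_C_mul (opE hm hq x) (orbitSum h m (x + cvec (lat m 0))) 1 c
  have h3 : orbPoly h m x {0} =
      (Polynomial.X - Polynomial.C (orbitSum h m (x + cvec (lat m 0)))) * 1 := by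
    rw [orbPoly, Finset.prod_singleton, mul_one]
  rw [← h3, h1, zero_add, map_one, Module.End.one_apply] at h2
  exact eigen_eq_zero hm hq hx hc (zero_mem_tset le_rfl) h2.symm (by rwa [zero_add])

/-- The difference of two normalized functions has zero coefficient at `ρ`, the point `kfull` of the
zonotope, so `eq_zero_of_coeff_eq_zero` applies. -/
theorem normalized_unique (hm : 1 ≤ m) (hq : NotRoot h) {C C' ψ ψ'}
    (hψ : IsNormalizedBA (n := n) h m C ψ) (hψ' : IsNormalizedBA h m C' ψ') :
    Generically h m fun x => ∀ z, ψ x z = ψ' x z := by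
  classical
  refine (generically_res hm hq (tset m (zon (kmul n m 1)))).mono fun x hx z => ?_
  have key : ∀ C ψ, IsNormalizedBA (n := n) h m C ψ → ∃ d : QIs h m x,
      d.1.support ⊆ zon (kmul n m 1) ∧ d.1 (kfull n m) = normFactor h m x ∧
      ψ x z = tw h (x - cvec (rho n m)) (ev h m d.1) z := by
    intro C ψ hψ
    set d := Finsupp.comapDomain (fun p => lat m p - rho n m) (C x)
      (lat_sub_rho_injective hm).injOn
    have hd : ∀ p, d p = C x (lat m p - rho n m) := fun p => Finsupp.comapDomain_apply _ _ _ _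
    have h1 : toBA m d = C x := by
      refine Finsupp.mapDomain_comapDomain _ (lat_sub_rho_injective hm) _ fun ν hν => ?_
      obtain ⟨h1, h2⟩ := hψ.1.support_subset x ν hν
      obtain ⟨p, -, rfl⟩ := exists_mem_zon hm h1 h2
      exact ⟨p, rfl⟩
    have h2 : ∀ z, ψ x z = tw h (x - cvec (rho n m)) (ev h m d) z := fun z => by
      rw [hψ.1.expansion, ← h1, expSum_toBA]
    have h3 : d ∈ QIs h m x := by
      rw [mem_QIs, ← quasiInvariant_tw_iff hm (isPoly_ev _), ← funext h2]
      exact hψ.1.quasiInvariant x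
    refine ⟨⟨d, h3⟩, fun p hp => ?_, ?_, h2 z⟩
    · rw [Finsupp.mem_support_iff, hd, ← Finsupp.mem_support_iff] at hp
      obtain ⟨h4, h5⟩ := hψ.1.support_subset x _ hp
      obtain ⟨p', hp', h6⟩ := exists_mem_zon hm h4 h5
      exact lat_sub_rho_injective hm h6 ▸ hp'
    · rw [hd, ← rho_eq, hψ.2]
  obtain ⟨d, hd1, hd2, hd3⟩ := key C ψ hψ
  obtain ⟨d', hd1', hd2', hd3'⟩ := key C' ψ' hψ'
  have h1 : d + (-1 : ℂ) • d' = 0 := by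
    refine eq_zero_of_coeff_eq_zero hm hq hx ?_ ?_
    · rw [Submodule.coe_add, Submodule.coe_smul]
      exact Finsupp.support_add.trans (Finset.union_subset hd1 (Finsupp.support_smul.trans hd1'))
    · rw [Submodule.coe_add, Submodule.coe_smul, Finsupp.add_apply, Finsupp.smul_apply, hd2, hd2',
        neg_one_smul, add_neg_cancel]
  have h2 : d.1 = d'.1 := by
    have := congrArg Subtype.val h1
    rw [Submodule.coe_add, Submodule.coe_smul, neg_one_smul, ZeroMemClass.coe_zero,
      ← sub_eq_add_neg] at this
    exact sub_eq_zero.1 this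
  rw [hd3, hd3', h2]

/-! ### Lattice difference operators -/

/-- The operator `∑_y d_y(x) T^y`, without restrictions on the coefficients. -/
def latOp (m : ℕ) (d : (Fin (n + 1) → ℤ) →₀ ((Fin (n + 1) → ℂ) → ℂ))
    (F : (Fin (n + 1) → ℂ) → ℂ) (x : Fin (n + 1) → ℂ) : ℂ :=
  d.sum fun y a => a x * F (x + cvec (lat m y))

lemma latOp_add (d d' : (Fin (n + 1) → ℤ) →₀ ((Fin (n + 1) → ℂ) → ℂ))
    (F : (Fin (n + 1) → ℂ) → ℂ) (x : Fin (n + 1) → ℂ) :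
    latOp m (d + d') F x = latOp m d F x + latOp m d' F x := by
  classical
  exact Finsupp.sum_add_index' (by simp) (by intros; rw [Pi.add_apply, add_mul])

lemma latOp_single (y : Fin (n + 1) → ℤ) (a : (Fin (n + 1) → ℂ) → ℂ)
    (F : (Fin (n + 1) → ℂ) → ℂ) (x : Fin (n + 1) → ℂ) :
    latOp m (Finsupp.single y a) F x = a x * F (x + cvec (lat m y)) :=
  Finsupp.sum_single_index (by simp)

lemma latOp_zero (F : (Fin (n + 1) → ℂ) → ℂ) (x : Fin (n + 1) → ℂ) :
    latOp m (0 : (Fin (n + 1) → ℤ) →₀ ((Fin (n + 1) → ℂ) → ℂ)) F x = 0 := Finsupp.sum_zero_index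

lemma latOp_sum {ι : Type*} (s : Finset ι)
    (d : ι → (Fin (n + 1) → ℤ) →₀ ((Fin (n + 1) → ℂ) → ℂ))
    (F : (Fin (n + 1) → ℂ) → ℂ) (x : Fin (n + 1) → ℂ) :
    latOp m (∑ i ∈ s, d i) F x = ∑ i ∈ s, latOp m (d i) F x := by
  classical
  induction s using Finset.induction_on with
  | empty => rw [Finset.sum_empty, Finset.sum_empty, latOp_zero]
  | insert i s hi ih => rw [Finset.sum_insert hi, Finset.sum_insert hi, latOp_add, ih]

lemma latOp_sub (d d' : (Fin (n + 1) → ℤ) →₀ ((Fin (n + 1) → ℂ) → ℂ))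
    (F : (Fin (n + 1) → ℂ) → ℂ) (x : Fin (n + 1) → ℂ) :
    latOp m (d - d') F x = latOp m d F x - latOp m d' F x :=
  eq_sub_of_add_eq (by rw [← latOp_add, sub_add_cancel])

lemma exists_latOp_comp (d d' : (Fin (n + 1) → ℤ) →₀ ((Fin (n + 1) → ℂ) → ℂ)) :
    ∃ e, ∀ F x, latOp m e F x = latOp m d (latOp m d' F) x := by
  refine ⟨∑ y ∈ d.support, ∑ y' ∈ d'.support, Finsupp.single (y + y')
    fun x => d y x * d' y' (x + cvec (lat m y)), fun F x => ?_⟩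
  rw [latOp_sum]
  simp only [latOp_sum, latOp_single]
  rw [latOp, Finsupp.sum]
  refine Finset.sum_congr rfl fun y _ => ?_
  rw [latOp, Finsupp.sum, Finset.mul_sum]
  refine Finset.sum_congr rfl fun y' _ => ?_
  rw [lat_add, cvec_add, ← add_assoc, mul_assoc]

lemma sum_mapDomain_lat (c : (Fin (n + 1) → ℤ) →₀ ((Fin (n + 1) → ℂ) → ℂ))
    (F : (Fin (n + 1) → ℂ) → ℂ) (x : Fin (n + 1) → ℂ) :
    ((Finsupp.mapDomain (lat m) c).sum fun ν d => d x * F (x + cvec ν)) = latOp m c F x :=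
  Finsupp.sum_mapDomain_index (by simp) (by intros; rw [Pi.add_apply, add_mul])

lemma DiffOp.exists_latOp (hm : 1 ≤ m) (D : DiffOp n h m) :
    ∃ d : (Fin (n + 1) → ℤ) →₀ ((Fin (n + 1) → ℂ) → ℂ), D.act = latOp m d := by
  refine ⟨Finsupp.comapDomain (lat m) D.coeff (lat_injective hm).injOn, ?_⟩
  have h1 : Finsupp.mapDomain (lat m)
      (Finsupp.comapDomain (lat m) D.coeff (lat_injective hm).injOn) = D.coeff := by
    refine Finsupp.mapDomain_comapDomain _ (lat_injective hm) _ fun ν hν => ?_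
    obtain ⟨p, rfl⟩ := (mem_weightLattice _).1 (D.mem_lattice ν hν)
    exact ⟨p, rfl⟩
  funext F x
  rw [← sum_mapDomain_lat, h1]
  rfl

/-- The difference operator with given coefficients. -/
lemma exists_diffOp (hm : 1 ≤ m) (Y : Finset (Fin (n + 1) → ℤ))
    (d : (Fin (n + 1) → ℤ) → (Fin (n + 1) → ℂ) → ℂ) (hd : ∀ y ∈ Y, IsRationalFun h m (d y)) :
    ∃ D : DiffOp n h m, ∀ F x, D.act F x = ∑ y ∈ Y, d y x * F (x + cvec (lat m y)) := by
  classical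
  set c : (Fin (n + 1) → ℤ) →₀ ((Fin (n + 1) → ℂ) → ℂ) := ∑ y ∈ Y, Finsupp.single y (d y) with hc
  have hcY : ∀ y, c y = if y ∈ Y then d y else 0 := by
    intro y
    rw [hc, Finsupp.finsetSum_apply]
    simp only [Finsupp.single_apply]
    rw [Finset.sum_ite_eq']
  have hsupp : ∀ ν ∈ (Finsupp.mapDomain (lat m) c).support, ∃ y ∈ Y, ν = lat m y := by
    intro ν hν
    obtain ⟨y, hy, rfl⟩ := Finset.mem_image.1 (Finsupp.mapDomain_support hν)
    refine ⟨y, ?_, rfl⟩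
    by_contra hh
    rw [Finsupp.mem_support_iff, hcY, if_neg hh] at hy
    exact hy rfl
  refine ⟨⟨Finsupp.mapDomain (lat m) c, fun ν hν => ?_, fun ν hν => ?_⟩, fun F x => ?_⟩
  · obtain ⟨y, -, rfl⟩ := hsupp ν hν
    exact (mem_weightLattice _).2 ⟨y, rfl⟩
  · obtain ⟨y, hy, rfl⟩ := hsupp ν hν
    rw [Finsupp.mapDomain_apply (lat_injective hm), hcY, if_pos hy]
    exact hd y hy
  · refine (sum_mapDomain_lat c F x).trans ?_
    rw [hc, latOp_sum]
    exact Finset.sum_congr rfl fun y _ => latOp_single _ _ _ _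

/-- The eigenfunction `q^{-2(ρ,x)} q^{2(x - ρ, z)} ∑_p φ_p(x) q^{2(lat p, z)}`. -/
def bispec (φ : ∀ x : Fin (n + 1) → ℂ, QIs h m x) (x z : Fin (n + 1) → ℂ) : ℂ :=
  tw h (x - cvec (rho n m)) (ev h m (qpow h (-(2 * pair (cvec (rho n m)) x)) • φ x).1) z

lemma bispec_eq (φ : ∀ x : Fin (n + 1) → ℂ, QIs h m x) (x z : Fin (n + 1) → ℂ) :
    bispec φ x z = qpow h (-(2 * pair (cvec (rho n m)) x)) *
      (qpow h (2 * pair (x - cvec (rho n m)) z) * ev h m (φ x).1 z) := by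
  rw [bispec, Submodule.coe_smul, map_smul, tw, Pi.smul_apply, smul_eq_mul]
  ring

lemma bispec_shift (φ : ∀ x : Fin (n + 1) → ℂ, QIs h m x) (y : Fin (n + 1) → ℤ)
    (x z : Fin (n + 1) → ℂ) : bispec φ (x + cvec (lat m y)) z =
      qpow h (-(2 * pair (cvec (rho n m)) (cvec (lat m y)))) *
      (qpow h (-(2 * pair (cvec (rho n m)) x)) * (qpow h (2 * pair (x - cvec (rho n m)) z) *
        ev h m (sh y (φ (x + cvec (lat m y))).1) z)) := by
  rw [bispec_eq, ev_sh, add_sub_right_comm, pair_add, pair_add_right, mono_eq, mul_add, mul_add,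
    neg_add, qpow_add, qpow_add]
  ring

/-- Only the zero operator annihilates the eigenfunction. -/
theorem latOp_eq_zero {hm : 1 ≤ m} {hq : NotRoot h} {φ : ∀ x : Fin (n + 1) → ℂ, QIs h m x}
    (hφ : EigFam hm hq φ) {d : (Fin (n + 1) → ℤ) →₀ ((Fin (n + 1) → ℂ) → ℂ)}
    (hd : Generically h m fun x => ∀ z, latOp m d (fun y => bispec φ y z) x = 0) :
    Generically h m fun x => ∀ F, latOp m d F x = 0 := by
  classical
  refine (hd.and (generically_ball d.support (fun y x => ∀ ℓ : Fin (n + 1) → ℝ,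
    Function.Injective ℓ → (φ (x + cvec (lat m y))).1 (kv m ℓ) ≠ 0)
    fun y _ => hφ.generically_ne.shift (cvec (lat m y)))).mono fun x ⟨h1, h2⟩ => ?_
  suffices hall : ∀ y ∈ d.support, d y x = 0 by
    intro F
    exact Finset.sum_eq_zero fun y hy => mul_eq_zero_of_left (hall y hy) _
  set u : (Fin (n + 1) → ℤ) → ℂ := fun y =>
    qpow h (-(2 * pair (cvec (rho n m)) (cvec (lat m y)))) * d y x with hu
  have hu0 : ∀ y, u y = 0 ↔ d y x = 0 := fun y =>
    mul_eq_zero_iff_left (qpow_ne_zero _)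
  have h3 : ∑ y ∈ d.support, u y • sh y (φ (x + cvec (lat m y))).1 = 0 := by
    refine ev_injective hm hq.ne_zero (funext fun z => ?_)
    have h4 := h1 z
    rw [latOp, Finsupp.sum] at h4
    have h5 := mul_ne_zero (qpow_ne_zero (h := h) (-(2 * pair (cvec (rho n m)) x)))
      (qpow_ne_zero (h := h) (2 * pair (x - cvec (rho n m)) z))
    rw [map_zero, Pi.zero_apply, map_sum, Finset.sum_apply]
    refine mul_left_cancel₀ h5 ?_
    rw [mul_zero, ← h4, Finset.mul_sum]
    refine Finset.sum_congr rfl fun y _ => ?_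
    rw [bispec_shift, map_smul, Pi.smul_apply, smul_eq_mul, hu]
    ring
  -- Among the shifts with nonzero coefficient, the one extreme in a separating direction is the
  -- only contributor at its own vertex, and the vertex coefficients are generically nonzero.
  by_contra! hne
  obtain ⟨y1, hy1, hy1'⟩ := hne
  obtain ⟨ℓ, hℓ⟩ := exists_genDir (n := n)
  obtain ⟨y0, hy0, hmax⟩ := Finset.exists_max_image (d.support.filter fun y => u y ≠ 0)
    (fun y => dot y ℓ) ⟨y1, Finset.mem_filter.2 ⟨hy1, mt (hu0 y1).1 hy1'⟩⟩
  rw [Finset.mem_filter] at hy0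
  have h4 := sum_sh_top (m := m) (c := fun y => (φ (x + cvec (lat m y))).1) (d := u)
    (fun y => hφ.supp _) hℓ hy0.1 fun y' hy' hd' => hmax y' (Finset.mem_filter.2 ⟨hy', hd'⟩)
  rw [h3, Finsupp.zero_apply] at h4
  exact mul_ne_zero hy0.2 (h2 y0 hy0.1 ℓ hℓ.injective) h4.symm

theorem opEq_of_eigen {hm : 1 ≤ m} {hq : NotRoot h} {φ : ∀ x : Fin (n + 1) → ℂ, QIs h m x}
    (hφ : EigFam hm hq φ) {d d' : (Fin (n + 1) → ℤ) →₀ ((Fin (n + 1) → ℂ) → ℂ)}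
    {f : (Fin (n + 1) → ℂ) → ℂ}
    (hd : Generically h m fun x => ∀ z, latOp m d (fun y => bispec φ y z) x = f z * bispec φ x z)
    (hd' : Generically h m fun x => ∀ z,
      latOp m d' (fun y => bispec φ y z) x = f z * bispec φ x z) :
    OpEq h m (latOp m d) (latOp m d') := by
  refine (latOp_eq_zero hφ (d := d - d') ((hd.and hd').mono fun x ⟨h1, h2⟩ z => ?_)).mono
    fun x hx F => ?_
  · rw [latOp_sub, h1, h2, sub_self]
  · rw [← sub_eq_zero, ← latOp_sub, hx]

lemma latOp_comp_eigen {φ : ∀ x : Fin (n + 1) → ℂ, QIs h m x}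
    {d d' : (Fin (n + 1) → ℤ) →₀ ((Fin (n + 1) → ℂ) → ℂ)} {f f' : (Fin (n + 1) → ℂ) → ℂ}
    (hd : Generically h m fun x => ∀ z, latOp m d (fun y => bispec φ y z) x = f z * bispec φ x z)
    (hd' : Generically h m fun x => ∀ z,
      latOp m d' (fun y => bispec φ y z) x = f' z * bispec φ x z) :
    Generically h m fun x => ∀ z,
      latOp m d (latOp m d' fun y => bispec φ y z) x = f z * f' z * bispec φ x z := by
  -- The inner eigenvalue relation holds for generic `x` only and is needed at the finitely many
  -- translates `x + lat y` used by the outer operator.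
  refine (hd.and (generically_ball d.support (fun y x => ∀ z, latOp m d' (fun y => bispec φ y z)
    (x + cvec (lat m y)) = f' z * bispec φ (x + cvec (lat m y)) z) fun y _ =>
      hd'.shift (cvec (lat m y)))).mono fun x ⟨h1, h2⟩ z => ?_
  have h3 := h1 z
  rw [latOp, Finsupp.sum] at h3 ⊢
  rw [mul_right_comm, ← h3, Finset.sum_mul]
  refine Finset.sum_congr rfl fun y hy => ?_
  rw [h2 y hy]
  ring

/-- Both compositions multiply the eigenfunction by `f f'`, and an operator is determined by its
action on the eigenfunction. -/
theorem opEq_comm {hm : 1 ≤ m} {hq : NotRoot h} {φ : ∀ x : Fin (n + 1) → ℂ, QIs h m x}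
    (hφ : EigFam hm hq φ) {d d' : (Fin (n + 1) → ℤ) →₀ ((Fin (n + 1) → ℂ) → ℂ)}
    {f f' : (Fin (n + 1) → ℂ) → ℂ}
    (hd : Generically h m fun x => ∀ z, latOp m d (fun y => bispec φ y z) x = f z * bispec φ x z)
    (hd' : Generically h m fun x => ∀ z,
      latOp m d' (fun y => bispec φ y z) x = f' z * bispec φ x z) :
    OpEq h m (fun F => latOp m d (latOp m d' F)) (fun F => latOp m d' (latOp m d F)) := by
  obtain ⟨e, he⟩ := exists_latOp_comp (m := m) d d'
  obtain ⟨e', he'⟩ := exists_latOp_comp (m := m) d' d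
  have h1 := opEq_of_eigen hφ (d := e) (d' := e') (f := fun z => f z * f' z)
    (by simpa only [he] using latOp_comp_eigen hd hd')
    (by simpa only [he', mul_comm (f _)] using latOp_comp_eigen hd' hd)
  exact h1.mono fun x hx F => (he F x).symm.trans ((hx F).trans (he' F x))

/-- The decomposition in `expansion` is the required equation: the translate of `φ (x + y)` is the
eigenfunction at `x + y`, up to the common factor and the constant `q^{2(ρ,y)}`, which goes into the
coefficients. -/
theorem exists_diffOp_eigen {hm : 1 ≤ m} {hq : NotRoot h}
    {φ : ∀ x : Fin (n + 1) → ℂ, QIs h m x} (hφ : EigFam hm hq φ) {f : (Fin (n + 1) → ℂ) → ℂ}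
    (hf : f ∈ quasiInvariants n h m) : ∃ D : DiffOp n h m, IsEigen D (bispec φ) f := by
  obtain ⟨hfP, hfQ⟩ := hf
  obtain ⟨cf, rfl⟩ := (isPoly_iff f).1 hfP
  have hfT : TQ h m 0 (ev h m cf) := (quasiInvariant_tw_iff hm hfP 0).1 (by rwa [tw_zero])
  obtain ⟨Y, N, D, hND, hgen⟩ := expansion hm hq hφ hfT
  obtain ⟨A, hA⟩ := exists_diffOp (h := h) hm Y (fun y x =>
    qpow h (2 * pair (cvec (rho n m)) (cvec (lat m y))) * N y x / D y x) fun y hy =>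
      ⟨_, D y, (hND y hy).1.const_mul _, (hND y hy).2.1, (hND y hy).2.2, fun x _ => rfl⟩
  refine ⟨A, hgen.mono fun x ⟨_, hx⟩ z => ?_⟩
  have h1 : ev h m cf z * ev h m (φ x).1 z =
      ∑ y ∈ Y, N y x / D y x * ev h m (sh y (φ (x + cvec (lat m y))).1) z := by
    rw [← ev_conv, hx, map_sum, Finset.sum_apply]
    exact Finset.sum_congr rfl fun y _ => by rw [map_smul, Pi.smul_apply, smul_eq_mul]
  rw [hA, bispec_eq, mul_left_comm, mul_left_comm (ev h m cf z), h1, Finset.mul_sum,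
    Finset.mul_sum]
  refine Finset.sum_congr rfl fun y _ => ?_
  rw [bispec_shift]
  have h2 : qpow h (2 * pair (cvec (rho n m)) (cvec (lat m y))) *
      qpow h (-(2 * pair (cvec (rho n m)) (cvec (lat m y)))) = 1 := by
    rw [← qpow_add, add_neg_cancel, qpow_zero]
  linear_combination (N y x / D y x * (qpow h (-(2 * pair (cvec (rho n m)) x)) *
    (qpow h (2 * pair (x - cvec (rho n m)) z) * ev h m (sh y (φ (x + cvec (lat m y))).1) z))) * h2

lemma exists_latOp_opD : ∃ d : (Fin (n + 1) → ℤ) →₀ ((Fin (n + 1) → ℂ) → ℂ),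
    ∀ F x, opD n h m F x = latOp m d F x := by
  refine ⟨∑ i, Finsupp.single (Pi.single i 1) (aco h m i), fun F x => ?_⟩
  rw [latOp_sum, opD_apply]
  exact Finset.sum_congr rfl fun i _ => by rw [latOp_single, lat_single, cvec_basisVec]

theorem opD_bispec {hm : 1 ≤ m} {hq : NotRoot h} {φ : ∀ x : Fin (n + 1) → ℂ, QIs h m x}
    (hφ : EigFam hm hq φ) (htop : ∀ x, (φ x).1 (kfull n m) = pnorm h m x) :
    Generically h m fun x => ∀ z,
      opD n h m (fun y => bispec φ y z) x = orbitSum h m z * bispec φ x z := by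
  have hne : Generically h m fun x : Fin (n + 1) → ℂ => pnorm h m x ≠ 0 :=
    ⟨_, isPoly_pnorm, pnorm_ne_zero hm hq.ne_zero, fun x hx => hx⟩
  -- Where `pnorm` is nonzero, the renormalization by the quotient of `normFactor` and the top
  -- coefficient is just multiplication by `q^{-2(ρ,x)}`.
  have key : ∀ x z, pnorm h m x ≠ 0 → renorm φ x z = bispec φ x z := by
    intro x z hx
    have h2 : normFactor h m x = qpow h (-(2 * pair (cvec (rho n m)) x)) * pnorm h m x := by
      rw [pnorm, ← mul_assoc, ← qpow_add, neg_add_cancel, qpow_zero, one_mul]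
    rw [renorm, htop, h2, mul_div_assoc, div_self hx, mul_one, bispec_eq, tw]
  refine ((dual_equation hm hq hφ).and (hne.and (generically_ball Finset.univ _
    fun i _ => hne.shift (eps m i)))).mono fun x ⟨h1, h2, h3⟩ z => ?_
  rw [opD_apply, ← key x z h2, ← h1 z]
  exact Finset.sum_congr rfl fun i hi => by rw [key _ z (h3 i hi)]

theorem orbitSum_mem (hm : 1 ≤ m) (hq : NotRoot h) :
    orbitSum h m ∈ quasiInvariants n h m := by
  refine ⟨isPoly_orbitSum, ?_⟩
  have h1 := tq_orbitSum (n := n) hm hq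
  have h2 : ev h m (orbCoef h m 0) = (orbitSum h m : (Fin (n + 1) → ℂ) → ℂ) := by
    funext z
    rw [ev_orbCoef, lat_zero, cvec_zero, add_zero]
  rw [h2, ← quasiInvariant_tw_iff hm isPoly_orbitSum, tw_zero] at h1
  exact h1

end DeformedMR

end

theorem mainTheorem11 (n m : ℕ) (hm : 1 ≤ m) (h : ℂ)
    (hq : ∀ k : ℕ, 1 ≤ k → Complex.exp h ^ k ≠ 1) :
    -- the operator preserves the ring of quasi-invariants
    (∀ f ∈ quasiInvariants n h m, ∃ g ∈ quasiInvariants n h m,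
      ∀ z, OffPoles h m z → opD n h m f z = g z) ∧
    -- the product formula gives a BA function
    (∃ c ψ, IsBA h m c ψ ∧
      (∀ x z, (∀ μ ∈ weightLattice n m, OffPoles h m (z + cvec μ)) →
        ψ x z = berestProduct n h m x z) ∧
      (∀ x, c x (-rho n m) =
        ∏ ν ∈ shiftSet n m, (orbitSum h m x - orbitSum h m (x + cvec ν))) ∧
      (∃ x, c x (-rho n m) ≠ 0) ∧
      (∀ x z, OffPoles h m z → opD n h m (ψ x) z = orbitSum h m x * ψ x z) ∧
      -- its renormalization is the normalized BA function
      ∃ C Ψ, IsNormalizedBA h m C Ψ ∧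
        (∀ C' Ψ', IsNormalizedBA h m C' Ψ' → Generically h m fun x => ∀ z, Ψ' x z = Ψ x z) ∧
        (∀ x z, c x (rho n m) * Ψ x z = normFactor h m x * ψ x z) ∧
        -- symmetry
        (∀ x z, Ψ x z = Ψ z x) ∧
        -- algebraic integrability
        ∃ D : quasiInvariants n h m → DiffOp n h m,
          (∀ f, IsEigen (D f) Ψ (f : (Fin (n + 1) → ℂ) → ℂ)) ∧
          (∀ (f : quasiInvariants n h m) (E : DiffOp n h m),
            IsEigen E Ψ (f : (Fin (n + 1) → ℂ) → ℂ) → OpEq h m E.act (D f).act) ∧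
          (∀ f g, OpEq h m (fun F => (D f).act ((D g).act F))
            (fun F => (D g).act ((D f).act F))) ∧
          ∃ hmem : orbitSum h m ∈ quasiInvariants n h m,
            OpEq h m (D ⟨orbitSum h m, hmem⟩).act (opD n h m)) := by
  have hn : NotRoot h := hq
  -- The eigenvectors of the product formula are replaced by the symmetric polynomial family with
  -- top coefficient `pnorm`; the factor `q^{-2(ρ,x)}` in `bispec` then gives the prescribed
  -- normalization.
  obtain ⟨φ, hφ, htop, hsymm, hprop⟩ :=
    exists_symmetric_family hm hn (eigFam_psiQ (n := n) hm hn)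
  have hnorm : ∀ x : Fin (n + 1) → ℂ,
      qpow h (-(2 * pair (cvec (rho n m)) x)) * pnorm h m x = normFactor h m x := fun x => by
    rw [pnorm, ← mul_assoc, ← qpow_add, neg_add_cancel, qpow_zero, one_mul]
  have hΨ : IsNormalizedBA h m
      (fun x => toBA m (qpow h (-(2 * pair (cvec (rho n m)) x)) • φ x).1) (bispec φ) := by
    refine ⟨isBA_toBA hm (φ := fun x => qpow h (-(2 * pair (cvec (rho n m)) x)) • φ x)
      fun x => Finsupp.support_smul.trans (hφ.supp x), fun x => ?_⟩
    have h1 := toBA_apply hm (qpow h (-(2 * pair (cvec (rho n m)) x)) • φ x).1 (kfull n m)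
    rw [← rho_eq] at h1
    rw [h1, Submodule.coe_smul, Finsupp.smul_apply, htop, smul_eq_mul, hnorm]
  refine ⟨fun f hf => ?_, fun x => toBA m (psiQ hm hn x).1,
    fun x z => tw h (x - cvec (rho n m)) (ev h m (psiQ hm hn x).1) z,
    isBA_toBA hm (psiQ_support hm hn), fun x z hz => ?_, fun x => ?_, ?_, fun x z hz => ?_,
    _, bispec φ, hΨ, fun C' Ψ' hΨ' => normalized_unique hm hn hΨ' hΨ, fun x z => ?_,
    fun x z => ?_, ?_⟩
  · obtain ⟨hfP, hfQ⟩ := hf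
    have hT : TQ h m 0 f := (quasiInvariant_tw_iff hm hfP 0).1 (by rwa [tw_zero])
    obtain ⟨g, hg, hfg⟩ := exists_isPoly_tD hm hn hfP hT
    have hgT := TQ_of_tD hm hn hT hg hfg
    refine ⟨g, ⟨hg, ?_⟩, fun z hz => ?_⟩
    · have := (quasiInvariant_tw_iff hm hg 0).2 hgT
      rwa [tw_zero] at this
    · have := opD_tw (h := h) (m := m) 0 f z
      rw [tw_zero, tw_zero] at this
      rw [this, hfg z hz]
  · exact (berestProduct_eq hm hn x (regular_iff.2 hz)).symm
  · have h1 := toBA_apply hm (psiQ hm hn x).1 0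
    rw [lat_zero, zero_sub] at h1
    rw [h1, psiQ_zero]
  · obtain ⟨x, hx⟩ := (generically_res (n := n) hm hn (zon (kmul n m 1))).exists
    refine ⟨x, ?_⟩
    have h1 := toBA_apply hm (psiQ hm hn x).1 0
    rw [lat_zero, zero_sub] at h1
    rw [h1]
    exact psiQ_zero_ne hm hn hx
  · beta_reduce
    rw [opD_tw, tw, opE_spec hm hn x _ z hz, opE_psiQ, Submodule.coe_smul, map_smul, tw,
      Pi.smul_apply, smul_eq_mul, mul_left_comm]
  · have h1 := toBA_apply hm (psiQ hm hn x).1 (kfull n m)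
    rw [← rho_eq] at h1
    have h2 := congrArg (fun c => ev h m c z) (hprop x)
    simp only [map_smul, Pi.smul_apply, smul_eq_mul] at h2
    beta_reduce
    rw [h1, bispec_eq, tw, ← hnorm]
    linear_combination -qpow h (-(2 * pair (cvec (rho n m)) x)) *
      qpow h (2 * pair (x - cvec (rho n m)) z) * h2
  -- The kernel is symmetric, and so is the total exponent `2(x,z) - 2(ρ,z) - 2(ρ,x)` of the
  -- prefactor.
  · rw [bispec_eq, bispec_eq, hsymm x z, ← mul_assoc, ← mul_assoc, ← qpow_add, ← qpow_add,
      pair_sub, pair_sub, pair_comm x z]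
    congr 2
    ring
  · choose D hD using fun f : quasiInvariants n h m => exists_diffOp_eigen hφ f.2
    choose d hd using fun E : DiffOp n h m => E.exists_latOp hm
    have heig : ∀ (E : DiffOp n h m) f, IsEigen E (bispec φ) f → Generically h m fun x => ∀ z,
        latOp m (d E) (fun y => bispec φ y z) x = f z * bispec φ x z := fun E f hE => by
      rwa [IsEigen, hd] at hE
    obtain ⟨e, he⟩ := exists_latOp_opD (n := n) (h := h) (m := m)
    have hop : ⇑(opD n h m) = latOp m e := funext fun F => funext fun x => he F x
    refine ⟨D, hD, fun f E hE => ?_, fun f g => ?_, orbitSum_mem hm hn, ?_⟩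
    · rw [hd, hd]
      exact opEq_of_eigen hφ (heig _ _ hE) (heig _ _ (hD f))
    · rw [hd, hd]
      exact opEq_comm hφ (heig _ _ (hD f)) (heig _ _ (hD g))
    · rw [hd, hop]
      refine opEq_of_eigen hφ (heig _ _ (hD _)) ?_
      have := opD_bispec hφ htop
      rwa [hop] at this
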